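/- Let $M$ be a compact connected smooth manifold of real dimension $2n\ge 2$ with a bi-Hermitian structure $(g,I_+,I_-)$: $g$ is a Riemannian metric and $I_\pm$ are complex structures orthogonal for $g$. Let $\omega_\pm(X,Y)=g(I_\pm X,Y)$. Assume that $g$ is Gauduchon with respect to both $I_+$ and $I_-$, i.e. $dd^c_\pm(\omega_\pm^{n-1})=0$, and that $\mathrm{vol}_g=\frac1{n!}\omega_+^n=\frac1{n!}\omega_-^n$. Let $V$ be a smooth complex vector bundle on $M$ with holomorphic structures $\bar\partial_+$ and $\bar\partial_-$ with respect to $I_+$ and $I_-$, and let $\alpha\in(0,1)$. For a Hermitian metric on $V$ with Chern curvatures $F_\pm$, put $\deg_\pm(V)=\frac{\sqrt{-1}}{2\pi}\int_M\mathrm{tr}(F_\pm)\wedge\omega_\pm^{n-1}$; the degree $\deg_\pm$ of a coherent subsheaf of $(V,\bar\partial_\pm)$ is that of its determinant line bundle. A coherent subsheaf of rank $r$ of $(V,\bar\partial_+,\bar\partial_-)$ is a pair $\mathcal F=(\mathcal F_+,\mathcal F_-)$ of coherent subsheaves of $(V,\bar\partial_\pm)$ for which there are analytic subsets $S_\pm$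 of $(M,I_\pm)$ of codimension at least $2$ such that $\mathcal F_\pm$ is locally free of rank $r$ on $M\setminus S_\pm$, and $\mathcal F_+$ and $\mathcal F_-$ coincide on $M\setminus(S_+\cup S_-)$, in the sense that they generate the same $C^\infty$-submodule of the sheaf of smooth sections of $V$. It is proper if $0<r<\mathrm{rk}\,V$. The bundle $(V,\bar\partial_+,\bar\partial_-)$ is $\alpha$-stable if every proper coherent subsheaf satisfies $$\alpha\frac{\deg_+(\mathcal F_+)}{r}+(1-\alpha)\frac{\deg_-(\mathcal F_-)}{r}<\alpha\frac{\deg_+(V)}{\mathrm{rk}\,V}+(1-\alpha)\frac{\deg_-(V)}{\mathrm{rk}\,V}.$$ Lemma 3.7. If $(V,\bar\partial_+,\bar\partial_-)$ is $\alpha$-stable, then it is simple: every smooth global endomorphism $\Phi$ of $V$ with $\bar\partial_+\Phi=0$ and $\bar\partial_-\Phi=0$ is of the form $\Phi=c\,\mathrm{Id}_V$ for some $c\in\mathbb C$. -/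

import Mathlib

open Bundle Filter MeasureTheory Topology
open scoped Manifold ContDiff ExteriorAlgebra

noncomputable section

namespace BiHermitian

/-! ### Multilinear algebra and calculus in a complex coordinate space -/

/-- The wedge product `η₀ ∧ ⋯ ∧ η₍ₖ₋₁₎` of `k` two-forms, evaluated on `2k` vectors:
`2⁻ᵏ ∑_σ sgn(σ) ∏ⱼ ηⱼ(v_{σ(2j)}, v_{σ(2j+1)})`. (`finProdFinEquiv (j, i) = 2 * j + i`.) -/
def wedgeTwoForms {T : Type*} {k : ℕ} (η : Fin k → T → T → ℂ) (v : Fin (k * 2) → T) : ℂ :=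
  (1 / 2 : ℂ) ^ k * ∑ σ : Equiv.Perm (Fin (k * 2)),
    (((Equiv.Perm.sign σ : ℤˣ) : ℤ) : ℂ) *
      ∏ j : Fin k, η j (v (σ (finProdFinEquiv (j, 0)))) (v (σ (finProdFinEquiv (j, 1))))

/-- Exterior derivative of a `k`-form on `ℂⁿ` (real differentiation), evaluated on constant
vectors: `dβ(v₀, …, vₖ) = ∑ᵢ (-1)ⁱ D_{vᵢ}(β(v₀, …, v̂ᵢ, …, vₖ))`. -/
def extD {n k : ℕ} (β : (Fin n → ℂ) → (Fin k → Fin n → ℂ) → ℂ) (z : Fin n → ℂ)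
    (v : Fin (k + 1) → Fin n → ℂ) : ℂ :=
  ∑ i : Fin (k + 1), (-1 : ℂ) ^ (i : ℕ) * fderiv ℝ (fun w => β w (i.removeNth v)) z (v i)

/-- `d dᶜ β`, up to sign, for a form `β` of type `(p, p)` on an open subset of `ℂⁿ`. Here
`dᶜ = √-1 (∂̄ - ∂)`; on forms of type `(p, p)` one has `(dᶜβ)(u, …) = -(dβ)(√-1 u, …)`. -/
def ddc {n k : ℕ} (β : (Fin n → ℂ) → (Fin k → Fin n → ℂ) → ℂ) (z : Fin n → ℂ)
    (v : Fin (k + 2) → Fin n → ℂ) : ℂ :=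
  extD (fun w u => extD β w (fun j => Complex.I • u j)) z v

/-- `(∂f)(v)` for a real differentiable `f : ℂⁿ → ℂ`. -/
def delC {n : ℕ} (f : (Fin n → ℂ) → ℂ) (z v : Fin n → ℂ) : ℂ :=
  (1 / 2) * (fderiv ℝ f z v - Complex.I * fderiv ℝ f z (Complex.I • v))

/-- `(∂̄f)(v)` for a real differentiable `f : ℂⁿ → ℂ`. -/
def delbarC {n : ℕ} (f : (Fin n → ℂ) → ℂ) (z v : Fin n → ℂ) : ℂ :=
  (1 / 2) * (fderiv ℝ f z v + Complex.I * fderiv ℝ f z (Complex.I • v))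

/-- Connection form `θ = ∂H · H⁻¹` of the Chern connection, in a holomorphic frame `e` with Gram
matrix `H a b = h(e_a, e_b)` (linear in `e_a`); thus `∇ e_a = ∑_c θ_{ac} e_c`. -/
def chernForm {n r : ℕ} (H : (Fin n → ℂ) → Matrix (Fin r) (Fin r) ℂ) (z v : Fin n → ℂ) :
    Matrix (Fin r) (Fin r) ℂ :=
  (Matrix.of fun a b => delC (fun w => H w a b) z v) * (H z)⁻¹

/-- Curvature `F = ∂̄θ` of the Chern connection in a holomorphic frame with Gram matrix `H`. -/
def chernCurvature {n r : ℕ} (H : (Fin n → ℂ) → Matrix (Fin r) (Fin r) ℂ) (z v w : Fin n → ℂ) :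
    Matrix (Fin r) (Fin r) ℂ :=
  Matrix.of fun a b =>
    delbarC (fun u => chernForm H u w a b) z v - delbarC (fun u => chernForm H u v a b) z w

/-! ### Complex structures and bi-Hermitian manifolds -/

/-- Tangent space of a smooth manifold of real dimension `2n`. -/
abbrev Tan (n : ℕ) {M : Type*} [TopologicalSpace M]
    [ChartedSpace (EuclideanSpace ℝ (Fin (2 * n))) M] (x : M) : Type :=
  TangentSpace (𝓡 (2 * n)) x

section Manifold

variable {n : ℕ} {M : Type*} [TopologicalSpace M]
  [ChartedSpace (EuclideanSpace ℝ (Fin (2 * n))) M]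

/-- The differential at `x` of a map to `ℂⁿ`. -/
def diffCn {n : ℕ} {M : Type*} [TopologicalSpace M]
    [ChartedSpace (EuclideanSpace ℝ (Fin (2 * n))) M] (φ : M → Fin n → ℂ) (x : M) (v : Tan n x) :
    Fin n → ℂ :=
  mfderiv (𝓡 (2 * n)) 𝓘(ℝ, Fin n → ℂ) φ x v

/-- The differential at `x` of a complex-valued function. -/
def diffC {n : ℕ} {M : Type*} [TopologicalSpace M]
    [ChartedSpace (EuclideanSpace ℝ (Fin (2 * n))) M] (f : M → ℂ) (x : M) (v : Tan n x) : ℂ :=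
  mfderiv (𝓡 (2 * n)) 𝓘(ℝ, ℂ) f x v

/-- `φ` is a holomorphic coordinate chart for the field `J` of endomorphisms of the tangent
bundle: a diffeomorphism between open subsets of `M` and `ℂⁿ` with `dφ ∘ J = √-1 dφ`. -/
structure IsHolChart (J : ∀ x : M, Tan n x →L[ℝ] Tan n x)
    (φ : OpenPartialHomeomorph M (Fin n → ℂ)) : Prop where
  smooth : ContMDiffOn (𝓡 (2 * n)) 𝓘(ℝ, Fin n → ℂ) ∞ φ φ.source
  smooth_symm : ContMDiffOn 𝓘(ℝ, Fin n → ℂ) (𝓡 (2 * n)) ∞ φ.symm φ.target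
  holomorphic : ∀ x ∈ φ.source, ∀ v : Tan n x,
    diffCn φ x (J x v) = Complex.I • diffCn φ x v

variable (n M) in
/-- A complex structure on the smooth manifold `M`: a field of endomorphisms of the tangent bundle
with square `-1` admitting local holomorphic coordinates (in particular it is smooth). -/
structure ComplexStructure where
  J : ∀ x : M, Tan n x →L[ℝ] Tan n x
  sq : ∀ x v, J x (J x v) = -v
  integrable : ∀ x, ∃ φ : OpenPartialHomeomorph M (Fin n → ℂ), x ∈ φ.source ∧ IsHolChart J φ

/-- `(∂̄f)(v)` at `x`, with respect to the complex structure `I`. -/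
def dbar (I : ComplexStructure n M) (f : M → ℂ) (x : M) (v : Tan n x) : ℂ :=
  (1 / 2) * (diffC f x v + Complex.I * diffC f x (I.J x v))

/-- `f` is smooth on a neighbourhood of `x`. -/
def SmoothFunNear (n : ℕ) {M : Type*} [TopologicalSpace M]
    [ChartedSpace (EuclideanSpace ℝ (Fin (2 * n))) M] (f : M → ℂ) (x : M) : Prop :=
  ∀ᶠ y in 𝓝 x, ContMDiffAt (𝓡 (2 * n)) 𝓘(ℝ, ℂ) ∞ f y

/-- `f` is `I`-holomorphic on a neighbourhood of `x`. -/
def HolFunNear (I : ComplexStructure n M) (f : M → ℂ) (x : M) : Prop :=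
  ∀ᶠ y in 𝓝 x, ContMDiffAt (𝓡 (2 * n)) 𝓘(ℝ, ℂ) ∞ f y ∧ ∀ v, dbar I f y v = 0

/-- `S` is an analytic subset of `(M, I)`: near every point of `M` it is the common zero set of
finitely many holomorphic functions. -/
def IsAnalyticSubset (I : ComplexStructure n M) (S : Set M) : Prop :=
  ∀ x, ∃ (k : ℕ) (f : Fin k → M → ℂ), (∀ i, HolFunNear I (f i) x) ∧
    ∀ᶠ y in 𝓝 x, y ∈ S ↔ ∀ i, f i y = 0

/-- The analytic subset `S` of `(M, I)` has complex codimension at least `p` (the empty set has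
codimension at least any `p`): at every regular point, i.e. wherever `S` is given in
some holomorphic chart as `z₁ = ⋯ = z_k = 0`, its codimension `k` is at least `p`. -/
def HasCodimAtLeast (I : ComplexStructure n M) (S : Set M) (p : ℕ) : Prop :=
  ∀ (φ : OpenPartialHomeomorph M (Fin n → ℂ)) (k : ℕ), IsHolChart I.J φ → k ≤ n →
    (S ∩ φ.source).Nonempty →
    (∀ y ∈ φ.source, y ∈ S ↔ ∀ i : Fin n, (i : ℕ) < k → φ y i = 0) → p ≤ k

variable [IsManifold (𝓡 (2 * n)) ∞ M]

variable (n M) in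
/-- Smooth Riemannian metrics on `M`. -/
abbrev RiemMetric :=
  ContMDiffRiemannianMetric (𝓡 (2 * n)) ∞ (EuclideanSpace ℝ (Fin (2 * n)))
    (fun x : M => Tan n x)

/-- The metric `g` is Hermitian with respect to `I`. -/
def IsHermitianFor (g : RiemMetric n M) (I : ComplexStructure n M) : Prop :=
  ∀ (x : M) (v w : Tan n x), g.inner x (I.J x v) (I.J x w) = g.inner x v w

/-- The fundamental form `ω(v, w) = g(Iv, w)`. -/
def fundForm (g : RiemMetric n M) (I : ComplexStructure n M) (x : M) (v w : Tan n x) : ℂ :=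
  ((g.inner x (I.J x v) w : ℝ) : ℂ)

/-- The power `ωᵏ` of the fundamental form. -/
def fundFormPow (g : RiemMetric n M) (I : ComplexStructure n M) (k : ℕ) (x : M)
    (v : Fin (k * 2) → Tan n x) : ℂ :=
  wedgeTwoForms (fun _ : Fin k => fundForm g I x) v

/-- The metric `g` is Gauduchon with respect to `I`: `d dᶜ ωⁿ⁻¹ = 0`, written in holomorphic
charts (`ωⁿ⁻¹` is pulled back to an open subset of `ℂⁿ` by the inverse of the chart). -/
def IsGauduchon (g : RiemMetric n M) (I : ComplexStructure n M) : Prop :=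
  ∀ φ : OpenPartialHomeomorph M (Fin n → ℂ), IsHolChart I.J φ → ∀ z ∈ φ.target,
    ∀ v : Fin ((n - 1) * 2 + 2) → Fin n → ℂ,
      ddc (fun w (u : Fin ((n - 1) * 2) → Fin n → ℂ) =>
        fundFormPow g I (n - 1) (φ.symm w)
          (fun j => mfderiv 𝓘(ℝ, Fin n → ℂ) (𝓡 (2 * n)) φ.symm w (u j))) z v = 0

/-- The density `√det(g_{ab})` of the Riemannian volume in the inverse chart of `ψ`. -/
def volDensity (g : RiemMetric n M)
    (ψ : OpenPartialHomeomorph M (EuclideanSpace ℝ (Fin (2 * n))))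
    (z : EuclideanSpace ℝ (Fin (2 * n))) : ℝ :=
  Real.sqrt (Matrix.det (Matrix.of fun a b : Fin (2 * n) =>
    g.inner (ψ.symm z)
      (mfderiv (𝓡 (2 * n)) (𝓡 (2 * n)) ψ.symm z (EuclideanSpace.single a (1 : ℝ)))
      (mfderiv (𝓡 (2 * n)) (𝓡 (2 * n)) ψ.symm z (EuclideanSpace.single b (1 : ℝ)))))

/-- The Riemannian volume measure `vol_g`: the least measure on `M` that dominates, for every
smooth chart, the measure `√det(g_{ab}) dx` carried by the domain of the chart (it then coincides
with it there). -/
def riemVolume (g : RiemMetric n M) [MeasurableSpace M] : Measure M :=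
  ⨆ ψ ∈ IsManifold.maximalAtlas (𝓡 (2 * n)) ∞ M,
    ((volume.restrict ψ.target).withDensity
      (fun z => ENNReal.ofReal (volDensity g ψ z))).map ψ.symm

/-- `c = ∫_M R ∧ ωⁿ⁻¹` for a two-form `R`: writing `R ∧ ωⁿ⁻¹ = ρ ωⁿ/n!`, where `ωⁿ/n!` is the
volume form, `c` is the integral of `ρ` against `vol_g`. -/
def HasWedgeIntegral (g : RiemMetric n M) [MeasurableSpace M] (I : ComplexStructure n M)
    (R : ∀ x : M, Tan n x → Tan n x → ℂ) (c : ℂ) : Prop :=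
  ∃ ρ : M → ℂ,
    (∀ (x : M) (v : Fin ((n - 1 + 1) * 2) → Tan n x),
      wedgeTwoForms (Fin.cons (R x) fun _ : Fin (n - 1) => fundForm g I x) v =
        ρ x * ((n.factorial : ℂ)⁻¹ * fundFormPow g I (n - 1 + 1) x v)) ∧
    Integrable ρ (riemVolume g) ∧ c = ∫ x, ρ x ∂(riemVolume g)

end Manifold

/-! ### Holomorphic structures on a complex vector bundle -/

section Bundle

variable {n : ℕ} {M : Type*} [TopologicalSpace M]
  [ChartedSpace (EuclideanSpace ℝ (Fin (2 * n))) M]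
  (F : Type*) [NormedAddCommGroup F] [NormedSpace ℂ F]
  {V : M → Type*} [∀ x, AddCommGroup (V x)] [∀ x, Module ℂ (V x)]
  [TopologicalSpace (TotalSpace F V)] [∀ x, TopologicalSpace (V x)] [FiberBundle F V]

/-- The section `s` of `V` is smooth at `x`. -/
def SmoothSecAt (n : ℕ) {M : Type*} [TopologicalSpace M]
    [ChartedSpace (EuclideanSpace ℝ (Fin (2 * n))) M]
    (F : Type*) [NormedAddCommGroup F] [NormedSpace ℂ F]
    {V : M → Type*} [TopologicalSpace (TotalSpace F V)] [∀ x, TopologicalSpace (V x)]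
    [FiberBundle F V] (s : ∀ x, V x) (x : M) : Prop :=
  ContMDiffAt (𝓡 (2 * n)) ((𝓡 (2 * n)).prod 𝓘(ℝ, F)) ∞ (fun y => TotalSpace.mk' F y (s y)) x

/-- The section `s` of `V` is smooth on a neighbourhood of `x`. -/
def SmoothSecNear (n : ℕ) {M : Type*} [TopologicalSpace M]
    [ChartedSpace (EuclideanSpace ℝ (Fin (2 * n))) M]
    (F : Type*) [NormedAddCommGroup F] [NormedSpace ℂ F]
    {V : M → Type*} [TopologicalSpace (TotalSpace F V)] [∀ x, TopologicalSpace (V x)]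
    [FiberBundle F V] (s : ∀ x, V x) (x : M) : Prop :=
  ∀ᶠ y in 𝓝 x, SmoothSecAt n F s y

/-- An `I`-holomorphic structure on the complex vector bundle `V`: a first order operator
`∂̄ : C^∞(V) → C^∞(V ⊗ T^{0,1}M)` satisfying the Leibniz rule, for which `V` is locally spanned by
frames of holomorphic (`∂̄`-closed) sections. The operator is local by the Leibniz rule, so it acts
on sections near a point; a section is represented by a global function of which only the germ
matters, and the value on sections that are not smooth near the point is never used. -/
structure HolStructure (I : ComplexStructure n M) (V : M → Type*)
    [∀ x, AddCommGroup (V x)] [∀ x, Module ℂ (V x)]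
    [TopologicalSpace (TotalSpace F V)] [∀ x, TopologicalSpace (V x)] [FiberBundle F V] where
  op : (∀ x, V x) → ∀ x : M, Tan n x →ₗ[ℝ] V x
  type_zero_one : ∀ (s : ∀ x, V x) (x : M), SmoothSecNear n F s x →
    ∀ v, op s x (I.J x v) = -(Complex.I • op s x v)
  add : ∀ (s t : ∀ x, V x) (x : M), SmoothSecNear n F s x → SmoothSecNear n F t x →
    ∀ v, op (fun y => s y + t y) x v = op s x v + op t x v
  leibniz : ∀ (f : M → ℂ) (s : ∀ x, V x) (x : M), SmoothFunNear n f x → SmoothSecNear n F s x →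
    ∀ v, op (fun y => f y • s y) x v = dbar I f x v • s x + f x • op s x v
  integrable : ∀ x : M, ∃ e : Fin (Module.finrank ℂ F) → ∀ y, V y,
    ∀ᶠ y in 𝓝 x, (∀ i, SmoothSecAt n F (e i) y ∧ op (e i) y = 0) ∧
      LinearIndependent ℂ (fun i => e i y) ∧ Submodule.span ℂ (Set.range fun i => e i y) = ⊤

variable {F}

/-- The section `s` is holomorphic on a neighbourhood of `x`. -/
def HolSecNear {I : ComplexStructure n M} (D : HolStructure F I V) (s : ∀ x, V x) (x : M) : Prop :=
  ∀ᶠ y in 𝓝 x, SmoothSecAt n F s y ∧ D.op s y = 0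

/-- `e` is a holomorphic frame of `(V, D)` on a neighbourhood of `x`. -/
def IsHolFrameNear {I : ComplexStructure n M} (D : HolStructure F I V)
    (e : Fin (Module.finrank ℂ F) → ∀ y, V y) (x : M) : Prop :=
  (∀ i, HolSecNear D (e i) x) ∧ ∀ᶠ y in 𝓝 x,
    LinearIndependent ℂ (fun i => e i y) ∧ Submodule.span ℂ (Set.range fun i => e i y) = ⊤

/-- `Φ` is a smooth global endomorphism of the complex vector bundle `V`. -/
def IsSmoothEnd (n : ℕ) {M : Type*} [TopologicalSpace M]
    [ChartedSpace (EuclideanSpace ℝ (Fin (2 * n))) M]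
    (F : Type*) [NormedAddCommGroup F] [NormedSpace ℂ F]
    {V : M → Type*} [∀ x, AddCommGroup (V x)] [∀ x, Module ℂ (V x)]
    [TopologicalSpace (TotalSpace F V)] [∀ x, TopologicalSpace (V x)]
    [FiberBundle F V] (Φ : ∀ x, V x →ₗ[ℂ] V x) : Prop :=
  ∀ (s : ∀ x, V x) (x : M), SmoothSecNear n F s x → SmoothSecNear n F (fun y => Φ y (s y)) x

/-- `∂̄Φ = 0`, for the operator induced by `∂̄` on endomorphisms:
`(∂̄Φ)(s) = ∂̄(Φ s) - Φ(∂̄ s)`. -/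
def IsHolEnd {I : ComplexStructure n M} (D : HolStructure F I V) (Φ : ∀ x, V x →ₗ[ℂ] V x) : Prop :=
  ∀ (s : ∀ x, V x) (x : M), SmoothSecNear n F s x →
    ∀ v, D.op (fun y => Φ y (s y)) x v - Φ x (D.op s x v) = 0

/-- The bundle `V` with the two holomorphic structures `D₁` and `D₂` is simple: the only smooth
endomorphisms killed by both operators are the constant multiples of the identity. -/
def IsSimple {I₁ I₂ : ComplexStructure n M} (D₁ : HolStructure F I₁ V) (D₂ : HolStructure F I₂ V) :
    Prop :=
  ∀ Φ : ∀ x, V x →ₗ[ℂ] V x, IsSmoothEnd n F Φ → IsHolEnd D₁ Φ → IsHolEnd D₂ Φ →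
    ∃ c : ℂ, ∀ x, Φ x = c • LinearMap.id

/-! ### Degree of a holomorphic bundle -/

/-- A smooth Hermitian metric on the complex vector bundle `V`, linear in the first variable. -/
structure HermMetric (n : ℕ) {M : Type*} [TopologicalSpace M]
    [ChartedSpace (EuclideanSpace ℝ (Fin (2 * n))) M]
    (F : Type*) [NormedAddCommGroup F] [NormedSpace ℂ F]
    (V : M → Type*) [∀ x, AddCommGroup (V x)] [∀ x, Module ℂ (V x)]
    [TopologicalSpace (TotalSpace F V)] [∀ x, TopologicalSpace (V x)] [FiberBundle F V] where
  h : ∀ x, V x → V x → ℂ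
  add_left : ∀ x u v w, h x (u + v) w = h x u w + h x v w
  smul_left : ∀ x (c : ℂ) u w, h x (c • u) w = c * h x u w
  conj_symm : ∀ x u w, h x w u = starRingEnd ℂ (h x u w)
  pos : ∀ x u, u ≠ 0 → 0 < (h x u u).re
  smooth : ∀ (s t : ∀ x, V x) (x : M), SmoothSecNear n F s x → SmoothSecNear n F t x →
    SmoothFunNear n (fun y => h y (s y) (t y)) x

/-- The two-form `R` is `tr F`, the trace of the curvature of the Chern connection of the
holomorphic bundle `(V, D)` with the Hermitian metric `h`; expressed in all holomorphic charts and
holomorphic frames. -/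
def IsTraceCurvature {I : ComplexStructure n M} (D : HolStructure F I V) (h : HermMetric n F V)
    (R : ∀ x : M, Tan n x → Tan n x → ℂ) : Prop :=
  ∀ (φ : OpenPartialHomeomorph M (Fin n → ℂ)) (e : Fin (Module.finrank ℂ F) → ∀ y, V y) (x : M),
    IsHolChart I.J φ → x ∈ φ.source → IsHolFrameNear D e x → ∀ v w : Tan n x,
      R x v w = (chernCurvature
        (fun z => Matrix.of fun a b => h.h (φ.symm z) (e a (φ.symm z)) (e b (φ.symm z))) (φ x)
        (diffCn φ x v)
        (diffCn φ x w)).trace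

/-- `d` is the degree of the holomorphic vector bundle `(V, D)` on `(M, I)` with respect to `g`:
`d = (√-1 / 2π) ∫_M tr(F) ∧ ωⁿ⁻¹` for the Chern curvature `F` of a Hermitian metric. -/
def IsBundleDegree [IsManifold (𝓡 (2 * n)) ∞ M] [MeasurableSpace M] (g : RiemMetric n M)
    {I : ComplexStructure n M} (D : HolStructure F I V) (d : ℝ) : Prop :=
  ∃ (h : HermMetric n F V) (R : ∀ x : M, Tan n x → Tan n x → ℂ) (c : ℂ),
    IsTraceCurvature D h R ∧ HasWedgeIntegral g I R c ∧
      (d : ℂ) = Complex.I / (2 * (Real.pi : ℂ)) * c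

/-! ### Coherent subsheaves and their degrees -/

/-- A family of stalks `G x` (sets of germs at `x`, represented by global functions) is generated
over the holomorphic functions by `s₁, …, s_k` near `x`. -/
def GeneratedNear (I : ComplexStructure n M) (G : M → Set (∀ y, V y)) {k : ℕ}
    (s : Fin k → ∀ y, V y) (x : M) : Prop :=
  ∀ᶠ z in 𝓝 x, ∀ t : ∀ y, V y, t ∈ G z ↔
    ∃ f : Fin k → M → ℂ, (∀ i, HolFunNear I (f i) z) ∧
      ∀ᶠ w in 𝓝 z, t w = ∑ i, f i w • s i w

/-- A coherent subsheaf of the sheaf of holomorphic sections of `(V, D)`, given by its stalks: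
`t ∈ stalk x` says that the germ of `t` at `x` belongs to the stalk at `x`. A subsheaf of a locally
free sheaf of finite rank is coherent if and only if it is locally generated by finitely many
sections; a family of stalks that is locally generated in this way is a subsheaf. -/
structure CoherentSubsheaf {I : ComplexStructure n M} (D : HolStructure F I V) where
  stalk : M → Set (∀ y, V y)
  locally_generated : ∀ x, ∃ (k : ℕ) (s : Fin k → ∀ y, V y),
    (∀ i, HolSecNear D (s i) x) ∧ GeneratedNear I stalk s x

variable {I : ComplexStructure n M} {D : HolStructure F I V}

/-- `e₁, …, e_r` is a frame of the sheaf `G` near `x`: they freely generate its stalks near `x`. -/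
def CoherentSubsheaf.IsFrameNear (G : CoherentSubsheaf D) {r : ℕ} (e : Fin r → ∀ y, V y) (x : M) :
    Prop :=
  GeneratedNear I G.stalk e x ∧
    ∀ᶠ z in 𝓝 x, ∀ f : Fin r → M → ℂ, (∀ i, HolFunNear I (f i) z) →
      (∀ᶠ w in 𝓝 z, ∑ i, f i w • e i w = 0) → ∀ i, ∀ᶠ w in 𝓝 z, f i w = 0

/-- The restriction of `G` to the complement of `S` is locally free of rank `r`. -/
def CoherentSubsheaf.IsLocallyFreeOff (G : CoherentSubsheaf D) (S : Set M) (r : ℕ) : Prop :=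
  ∀ x, x ∉ S → ∃ e : Fin r → ∀ y, V y, G.IsFrameNear e x

/-- The section `t` of `V` lies, near `x`, in the `C^∞`-submodule generated by `G`. -/
def CoherentSubsheaf.InSmoothSpan (G : CoherentSubsheaf D) (x : M) (t : ∀ y, V y) : Prop :=
  ∃ (k : ℕ) (s : Fin k → ∀ y, V y) (f : Fin k → M → ℂ),
    (∀ i, s i ∈ G.stalk x ∧ SmoothFunNear n (f i) x) ∧ ∀ᶠ w in 𝓝 x, t w = ∑ i, f i w • s i w

/-- Let `G` be locally free of rank `r` off the analytic subset `S` of codimension at least two.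
This is a Hermitian metric on the determinant line bundle `det G = (Λ^r G)**`, the unique
holomorphic line bundle on `M` that restricts to `Λ^r G` off `S`. It is given by an open cover
`(U x)`, where `x` runs through `M`; by local generators `σ x` of `det G` over `U x`, that is, by
sections which locally off `S` are of the form `e₁ ∧ ⋯ ∧ e_r` for a frame `e` of `G`;
and by the square norms `N x : U x → (0, ∞)` of `σ x`, with the transition law of square norms. -/
structure DetMetric (G : CoherentSubsheaf D) (r : ℕ) (S : Set M) where
  U : M → Set M
  isOpen : ∀ x, IsOpen (U x)
  mem : ∀ x, x ∈ U x
  σ : M → ∀ y, ⋀[ℂ]^r (V y)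
  generates : ∀ x, ∀ y ∈ U x, y ∉ S → ∃ e : Fin r → ∀ z, V z, G.IsFrameNear e y ∧
    ∀ᶠ z in 𝓝 y, σ x z = exteriorPower.ιMulti ℂ r (fun i => e i z)
  N : M → M → ℝ
  smooth : ∀ x, ∀ y ∈ U x, ContMDiffAt (𝓡 (2 * n)) 𝓘(ℝ, ℝ) ∞ (N x) y
  pos : ∀ x, ∀ y ∈ U x, 0 < N x y
  transition : ∀ x x' y, y ∈ U x → y ∈ U x' → y ∉ S → ∀ f : M → ℂ, HolFunNear I f y →
    (∀ᶠ z in 𝓝 y, σ x z = f z • σ x' z) → N x y = ‖f y‖ ^ 2 * N x' y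

/-- The two-form `R` is the curvature of the Chern connection of `det G` with the given metric. -/
def DetMetric.IsCurvature {G : CoherentSubsheaf D} {r : ℕ} {S : Set M} (h : DetMetric G r S)
    (R : ∀ x : M, Tan n x → Tan n x → ℂ) : Prop :=
  ∀ (φ : OpenPartialHomeomorph M (Fin n → ℂ)) (x y : M),
    IsHolChart I.J φ → y ∈ φ.source → y ∈ h.U x → ∀ v w : Tan n y,
      R y v w = (chernCurvature
        (fun z => Matrix.of fun _ _ : Fin 1 => ((h.N x (φ.symm z) : ℝ) : ℂ)) (φ y)
        (diffCn φ y v)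
        (diffCn φ y w)).trace

/-- `d` is the degree of the coherent subsheaf `G` of rank `r`, that is, the degree
`(√-1 / 2π) ∫_M F ∧ ωⁿ⁻¹` of its determinant line bundle `det G`. -/
def CoherentSubsheaf.IsDegree [IsManifold (𝓡 (2 * n)) ∞ M] [MeasurableSpace M] (g : RiemMetric n M)
    (G : CoherentSubsheaf D) (r : ℕ) (d : ℝ) : Prop :=
  ∃ (S : Set M) (h : DetMetric G r S) (R : ∀ x : M, Tan n x → Tan n x → ℂ) (c : ℂ),
    IsAnalyticSubset I S ∧ HasCodimAtLeast I S 2 ∧ G.IsLocallyFreeOff S r ∧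
      h.IsCurvature R ∧ HasWedgeIntegral g I R c ∧
      (d : ℂ) = Complex.I / (2 * (Real.pi : ℂ)) * c

/-! ### Stability -/

variable {I₁ I₂ : ComplexStructure n M} {D₁ : HolStructure F I₁ V} {D₂ : HolStructure F I₂ V}

/-- The pair `(G₁, G₂)` is a coherent subsheaf of rank `r` of `(V, D₁, D₂)`: there are analytic
subsets `S₁` of `(M, I₁)` and `S₂` of `(M, I₂)` of codimension at least two such that `Gᵢ` is
locally free of rank `r` off `Sᵢ`, and off `S₁ ∪ S₂` the two sheaves coincide, that is, they
have the same underlying smooth bundle: they generate the same `C^∞`-submodule of the sheaf of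
smooth sections of `V`. -/
def IsCoherentPair (G₁ : CoherentSubsheaf D₁) (G₂ : CoherentSubsheaf D₂) (r : ℕ) : Prop :=
  ∃ S₁ S₂ : Set M, IsAnalyticSubset I₁ S₁ ∧ IsAnalyticSubset I₂ S₂ ∧
    HasCodimAtLeast I₁ S₁ 2 ∧ HasCodimAtLeast I₂ S₂ 2 ∧
    G₁.IsLocallyFreeOff S₁ r ∧ G₂.IsLocallyFreeOff S₂ r ∧
    ∀ x, x ∉ S₁ ∪ S₂ → ∀ t : ∀ y, V y, G₁.InSmoothSpan x t ↔ G₂.InSmoothSpan x t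

/-- `α`-stability of `(V, D₁, D₂)` with respect to the metric `g`: `μ_α(G) < μ_α(V)` for every
proper coherent subsheaf `G = (G₁, G₂)`, where proper means `0 < rk G < rk V`. -/
def IsAlphaStable [IsManifold (𝓡 (2 * n)) ∞ M] [MeasurableSpace M] (g : RiemMetric n M) (α : ℝ)
    (D₁ : HolStructure F I₁ V) (D₂ : HolStructure F I₂ V) : Prop :=
  ∀ (G₁ : CoherentSubsheaf D₁) (G₂ : CoherentSubsheaf D₂) (r : ℕ), IsCoherentPair G₁ G₂ r →
    0 < r → r < Module.finrank ℂ F →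
    ∀ d₁ d₂ e₁ e₂ : ℝ, G₁.IsDegree g r d₁ → G₂.IsDegree g r d₂ →
      IsBundleDegree g D₁ e₁ → IsBundleDegree g D₂ e₂ →
      α * (d₁ / r) + (1 - α) * (d₂ / r) <
        α * (e₁ / Module.finrank ℂ F) + (1 - α) * (e₂ / Module.finrank ℂ F)

end Bundle

end BiHermitian

end

open BiHermitian

open Bundle Filter MeasureTheory Topology
open scoped Manifold ContDiff ExteriorAlgebra

noncomputable section

namespace BiHermitian

set_option linter.unusedSectionVars false

/-! ### Holomorphic functions of several variables -/


section SeveralVariables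

open Metric Set

/-! Let `c` be an eigenvalue of `Φ` on one fibre and `Ψ = Φ - c`. Then `det Ψ` is a holomorphic
function on a compact connected manifold, hence constant, hence zero. Suppose `Ψ ≠ 0`. Its maximal
rank `r`, attained on a dense set, satisfies `0 < r < rk V`. The image and the kernel of `Ψ` are
formed for both holomorphic structures. As smooth objects they depend on `Ψ` alone, so each gives a
coherent pair, of rank `r` and of rank `s = rk V - r`. For each structure the degrees of image and
kernel add up to the degree of `V`. Hence the two strict slope inequalities, weighted by `r` and
`s`, sum to `μ(V) < μ(V)` (`not_isAlphaStable`).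

The work lies in showing that image and kernel are locally free off a set of codimension two and
that degrees add. Both rest on one local object, the annihilating form (`IsAnnForm`). The minors of
`Ψ` in `r` fixed rows define a holomorphic alternating `r`-form on `V` that kills `ker Ψ`. Dividing
it by the greatest common divisor of its values gives a form `η` that is unique up to a holomorphic
unit (`IsAnnForm.exists_unit`) and whose zero set has codimension at least two. Off this set,
contraction with `η` completes `r` frame vectors by sections of the kernel
(`IsAnnForm.exists_isAdapted`). The kernel sheaf is taken to be the one generated by such
contractions: it is finitely generated by construction, and off the zero set it is the full kernel.

The form also trivializes the determinants. In a frame `w, k` with `k` in the kernel, the condition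
`η(w) = 1` singles out a generator of `det im`, and `det(w, k) = 1` then singles out one of `det
ker`. A metric on `det im` comes from a partition of unity. On `det ker` one takes the metric that
`V` induces on its determinant, divided by the former. Their curvatures then add up pointwise to the
trace of the curvature of `V` (`exists_detMetrics`, `exists_degrees`).

The common divisor comes from `exists_primitive_factorization`. In a polydisc where `f i₀` has a
constant number of zeros in the last variable, the polynomials `a` for which all `a * f i / f i₀`
are holomorphic on a slice form an ideal of `ℂ[X]`. Off the zeros of a minor, the coefficients of
its monic generator are bounded holomorphic functions of the slice, and they extend by Riemann's
theorem. Primitivity is expressed by meromorphic germs, which avoids unique factorization. It gives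
codimension two because a hypersurface in the common zero set would be a common divisor. -/

theorem exists_closedBall_prod_sphere_subset {W : Type*} [NormedAddCommGroup W] {Ω : Set (W × ℂ)} (hΩ : IsOpen Ω) {w₀ : W} {c : ℂ}
    {r : ℝ} (h : ∀ ζ ∈ sphere c r, (w₀, ζ) ∈ Ω) :
    ∃ ε > 0, closedBall w₀ ε ×ˢ sphere c r ⊆ Ω := by
  obtain ⟨u, v, hu, -, hwu, hsv, huv⟩ := generalized_tube_lemma (isCompact_singleton (x := w₀))
    (isCompact_sphere c r) hΩ (by rintro ⟨w, ζ⟩ ⟨hw, hζ⟩; obtain rfl : w = w₀ := hw; exact h ζ hζ)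
  obtain ⟨ε, hε, hb⟩ := nhds_basis_closedBall.mem_iff.1 (hu.mem_nhds (hwu rfl))
  exact ⟨ε, hε, (prod_mono hb hsv).trans huv⟩

variable {E W : Type*} [NormedAddCommGroup E] [NormedSpace ℂ E] [FiniteDimensional ℂ E]
  [NormedAddCommGroup W] [NormedSpace ℂ W] [FiniteDimensional ℂ W]

theorem continuousAt_circleIntegral {f : W × ℂ → ℂ} {Ω : Set (W × ℂ)} (hΩ : IsOpen Ω)
    (hf : ContinuousOn f Ω) {w₀ : W} {c : ℂ} {r : ℝ} (hr : 0 ≤ r)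
    (h : ∀ ζ ∈ sphere c r, (w₀, ζ) ∈ Ω) :
    ContinuousAt (fun w => ∮ ζ in C(c, r), f (w, ζ)) w₀ := by
  have : ProperSpace W := FiniteDimensional.proper ℂ W
  obtain ⟨ε, hε, hsub⟩ := exists_closedBall_prod_sphere_subset hΩ h
  have hcomp : IsCompact (closedBall w₀ ε ×ˢ sphere c r) :=
    (isCompact_closedBall _ _).prod (isCompact_sphere _ _)
  obtain ⟨M, hM⟩ := hcomp.exists_bound_of_continuousOn (hf.mono hsub)
  have hcont : ∀ w ∈ closedBall w₀ ε,
      Continuous fun θ : ℝ => deriv (circleMap c r) θ • f (w, circleMap c r θ) := by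
    intro w hw
    have h1 : Continuous fun θ : ℝ => f (w, circleMap c r θ) := by
      refine hf.comp_continuous (by fun_prop) fun θ => hsub ⟨hw, circleMap_mem_sphere c hr θ⟩
    simp only [deriv_circleMap]
    exact (((continuous_circleMap 0 r).mul continuous_const).smul h1)
  have hev : ∀ᶠ w in 𝓝 w₀, w ∈ closedBall w₀ ε := closedBall_mem_nhds w₀ hε
  refine intervalIntegral.continuousAt_of_dominated_interval (bound := fun _ => |r| * M) ?_ ?_ ?_ ?_
  · filter_upwards [hev] with w hw using (hcont w hw).aestronglyMeasurable
  · filter_upwards [hev] with w hw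
    refine ae_of_all _ fun θ _ => ?_
    rw [norm_smul]
    gcongr
    · simp [deriv_circleMap]
    · exact hM _ ⟨hw, circleMap_mem_sphere c hr θ⟩
  · exact intervalIntegrable_const
  · refine ae_of_all _ fun θ _ => ?_
    have : ContinuousAt f (w₀, circleMap c r θ) :=
      hf.continuousAt (hΩ.mem_nhds (h _ (circleMap_mem_sphere c hr θ)))
    have h2 : ContinuousAt (fun w : W => f (w, circleMap c r θ)) w₀ :=
      ContinuousAt.comp (f := fun w : W => (w, circleMap c r θ)) this (by fun_prop)
    exact h2.const_smul (deriv (circleMap c r) θ)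

/-- Cauchy's formula for directional derivatives, locally uniformly in the base point. -/
theorem exists_fderiv_apply_eq_circleIntegral {f : E → ℂ} {U : Set E} (hU : IsOpen U)
    (hf : DifferentiableOn ℂ f U) (v : E) {z₀ : E} (hz₀ : z₀ ∈ U) :
    ∃ r > 0, (∀ ζ ∈ closedBall (0 : ℂ) r, z₀ + ζ • v ∈ U) ∧ ∀ᶠ z in 𝓝 z₀, fderiv ℂ f z v =
      (2 * Real.pi * Complex.I : ℂ)⁻¹ • ∮ ζ in C(0, r), (ζ ^ 2)⁻¹ • f (z + ζ • v) := by
  -- One radius has to serve all base points near `z₀`. The summand `1` in `‖v‖ + 1` keeps the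
  -- inclusion strict even for `v = 0`.
  have hev : ∀ᶠ p : E × ℝ in 𝓝 (z₀, 0), ball p.1 (p.2 * (‖v‖ + 1)) ⊆ U := by
    obtain ⟨ε, hε, hb⟩ := Metric.isOpen_iff.1 hU z₀ hz₀
    have h1 : ∀ᶠ p : E × ℝ in 𝓝 (z₀, 0), dist p.1 z₀ + p.2 * (‖v‖ + 1) < ε := by
      have : ContinuousAt (fun p : E × ℝ => dist p.1 z₀ + p.2 * (‖v‖ + 1)) (z₀, 0) := by fun_prop
      exact this.eventually_lt continuousAt_const (by simpa using hε)
    filter_upwards [h1] with p hp y hy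
    refine hb ?_
    rw [mem_ball] at *
    linarith [dist_triangle y p.1 z₀]
  rw [nhds_prod_eq, eventually_prod_iff] at hev
  obtain ⟨pa, hpa, pb, hpb, hab⟩ := hev
  obtain ⟨r, hr, hrp⟩ : ∃ r > 0, pb r := by
    obtain ⟨δ, hδ, h⟩ := Metric.eventually_nhds_iff.1 hpb
    exact ⟨δ / 2, by positivity, h (by simp [abs_of_pos hδ]; linarith)⟩
  have hin : ∀ z, pa z → ∀ ζ ∈ closedBall (0 : ℂ) r, z + ζ • v ∈ U := by
    intro z hz ζ hζ
    refine hab hz hrp ?_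
    rw [mem_ball, dist_eq_norm, add_sub_cancel_left, norm_smul]
    rw [mem_closedBall_zero_iff] at hζ
    nlinarith [norm_nonneg v, norm_nonneg ζ]
  refine ⟨r, hr, fun ζ hζ => hin z₀ hpa.self_of_nhds ζ hζ, ?_⟩
  · filter_upwards [hpa] with z hz
    have hd : DifferentiableOn ℂ (fun ζ : ℂ => f (z + ζ • v)) {ζ : ℂ | z + ζ • v ∈ U} :=
      hf.comp (t := U) (by fun_prop) fun ζ hζ => hζ
    have := Complex.two_pi_I_inv_smul_circleIntegral_sub_sq_inv_smul_of_differentiable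
      (U := {ζ : ℂ | z + ζ • v ∈ U}) (f := fun ζ : ℂ => f (z + ζ • v))
      (hU.preimage (show Continuous fun ζ : ℂ => z + ζ • v by fun_prop)) (c := 0) (R := r) (w₀ := 0)
      (fun ζ hζ => hin z hz ζ hζ) hd (mem_ball_self hr)
    simp only [sub_zero] at this
    rw [this]
    have h0 : z ∈ U := by simpa using hin z hz 0 (by simp [hr.le])
    have h1 : HasFDerivAt f (fderiv ℂ f z) (z + (0 : ℂ) • v) := by
      simpa using (hf.differentiableAt (hU.mem_nhds h0)).hasFDerivAt
    have h2 : HasDerivAt (fun ζ : ℂ => z + ζ • v) v 0 := by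
      simpa using ((hasDerivAt_id (0 : ℂ)).smul_const v).const_add z
    exact (h1.comp_hasDerivAt (0 : ℂ) h2).deriv.symm

theorem isOpen_setOf_add_smul_mem {U : Set E} (hU : IsOpen U) (v : E) :
    IsOpen {p : E × ℂ | p.1 + p.2 • v ∈ U ∧ p.2 ≠ 0} :=
  (hU.preimage (f := fun p : E × ℂ => p.1 + p.2 • v) (by fun_prop)).inter
    (isOpen_ne_fun continuous_snd continuous_const)

/-- Cauchy's formula expresses the derivative as a circle integral of `f`, which is continuous in
the base point. This continuity supplies the local bound needed for differentiating under the
integral sign in `differentiableAt_circleIntegral`. -/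
theorem continuousOn_fderiv_of_differentiableOn {f : E → ℂ} {U : Set E} (hU : IsOpen U)
    (hf : DifferentiableOn ℂ f U) : ContinuousOn (fderiv ℂ f) U := by
  rw [continuousOn_clm_apply]
  intro v z₀ hz₀
  obtain ⟨r, hr, hin, key⟩ := exists_fderiv_apply_eq_circleIntegral hU hf v hz₀
  refine ContinuousAt.continuousWithinAt (ContinuousAt.congr ?_ (key.mono fun z hz => hz.symm))
  refine ContinuousAt.const_smul (M := ℂ) (g := fun z => ∮ ζ in C(0, r), (ζ ^ 2)⁻¹ • f (z + ζ • v)) ?_ _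
  refine continuousAt_circleIntegral (f := fun p : E × ℂ => (p.2 ^ 2)⁻¹ • f (p.1 + p.2 • v))
    (isOpen_setOf_add_smul_mem hU v) ?_ hr.le ?_
  · have A : ContinuousOn (fun p : E × ℂ => (p.2 ^ 2)⁻¹) {p | p.1 + p.2 • v ∈ U ∧ p.2 ≠ 0} :=
      ContinuousOn.inv₀ (by fun_prop) fun p hp => pow_ne_zero 2 hp.2
    exact A.smul (hf.continuousOn.comp (by fun_prop) fun p hp => hp.1)
  · intro ζ hζ
    exact ⟨hin ζ (sphere_subset_closedBall hζ), ne_of_mem_sphere hζ hr.ne'⟩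

theorem differentiableAt_circleIntegral {f : W × ℂ → ℂ} {Ω : Set (W × ℂ)} (hΩ : IsOpen Ω)
    (hf : DifferentiableOn ℂ f Ω) {w₀ : W} {c : ℂ} {r : ℝ} (hr : 0 ≤ r)
    (h : ∀ ζ ∈ sphere c r, (w₀, ζ) ∈ Ω) :
    DifferentiableAt ℂ (fun w => ∮ ζ in C(c, r), f (w, ζ)) w₀ := by
  have : ProperSpace W := FiniteDimensional.proper ℂ W
  obtain ⟨ε, hε, hsub⟩ := exists_closedBall_prod_sphere_subset hΩ h
  have hcomp : IsCompact (closedBall w₀ ε ×ˢ sphere c r) :=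
    (isCompact_closedBall _ _).prod (isCompact_sphere _ _)
  have hfd := continuousOn_fderiv_of_differentiableOn hΩ hf
  obtain ⟨M, hM⟩ := hcomp.exists_bound_of_continuousOn (hfd.mono hsub)
  have hcont : ∀ w ∈ closedBall w₀ ε,
      Continuous fun θ : ℝ => deriv (circleMap c r) θ • f (w, circleMap c r θ) := by
    intro w hw
    have h1 : Continuous fun θ : ℝ => f (w, circleMap c r θ) := by
      refine hf.continuousOn.comp_continuous (by fun_prop)
        fun θ => hsub ⟨hw, circleMap_mem_sphere c hr θ⟩
    simp only [deriv_circleMap]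
    exact (((continuous_circleMap 0 r).mul continuous_const).smul h1)
  have hev : closedBall w₀ ε ∈ 𝓝 w₀ := closedBall_mem_nhds w₀ hε
  refine (intervalIntegral.hasFDerivAt_integral_of_dominated_of_fderiv_le (𝕜 := ℂ)
    (F' := fun w θ => deriv (circleMap c r) θ •
      (fderiv ℂ f (w, circleMap c r θ)).comp (ContinuousLinearMap.inl ℂ W ℂ))
    (bound := fun _ => |r| * (M * ‖ContinuousLinearMap.inl ℂ W ℂ‖))
    hev ?_ ?_ ?_ ?_ ?_ ?_).differentiableAt
  · filter_upwards [hev] with w hw using (hcont w hw).aestronglyMeasurable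
  · exact (hcont w₀ (mem_closedBall_self hε.le)).intervalIntegrable _ _
  · refine Continuous.aestronglyMeasurable ?_
    have h1 : Continuous fun θ : ℝ => fderiv ℂ f (w₀, circleMap c r θ) := by
      refine hfd.comp_continuous (by fun_prop) fun θ => h _ (circleMap_mem_sphere c hr θ)
    simp only [deriv_circleMap]
    exact ((continuous_circleMap 0 r).mul continuous_const).smul (h1.clm_comp continuous_const)
  · refine ae_of_all _ fun θ _ w hw => ?_
    rw [norm_smul]
    gcongr
    · simp [deriv_circleMap]
    · refine (ContinuousLinearMap.opNorm_comp_le _ _).trans ?_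
      gcongr
      exact hM _ ⟨hw, circleMap_mem_sphere c hr θ⟩
  · exact intervalIntegrable_const
  · refine ae_of_all _ fun θ _ w hw => ?_
    have hd : HasFDerivAt f (fderiv ℂ f (w, circleMap c r θ)) (w, circleMap c r θ) :=
      (hf.differentiableAt (hΩ.mem_nhds (hsub ⟨hw, circleMap_mem_sphere c hr θ⟩))).hasFDerivAt
    exact (hd.comp (f := fun w : W => (w, circleMap c r θ)) w
      (hasFDerivAt_prodMk_left w _)).const_smul (deriv (circleMap c r) θ)

/-- Cauchy's formula again, now with a holomorphic dependence on the base point. Iterating this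
turns complex differentiability into smoothness. -/
theorem differentiableOn_fderiv_apply {f : E → ℂ} {U : Set E} (hU : IsOpen U)
    (hf : DifferentiableOn ℂ f U) (v : E) : DifferentiableOn ℂ (fun z => fderiv ℂ f z v) U := by
  intro z₀ hz₀
  obtain ⟨r, hr, hin, key⟩ := exists_fderiv_apply_eq_circleIntegral hU hf v hz₀
  refine DifferentiableAt.differentiableWithinAt (DifferentiableAt.congr_of_eventuallyEq ?_ key)
  refine DifferentiableAt.const_smul (R := ℂ)
    (f := fun z => ∮ ζ in C(0, r), (ζ ^ 2)⁻¹ • f (z + ζ • v)) ?_ _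
  refine differentiableAt_circleIntegral (f := fun p : E × ℂ => (p.2 ^ 2)⁻¹ • f (p.1 + p.2 • v))
    (isOpen_setOf_add_smul_mem hU v) ?_ hr.le ?_
  · have A : DifferentiableOn ℂ (fun p : E × ℂ => (p.2 ^ 2)⁻¹) {p | p.1 + p.2 • v ∈ U ∧ p.2 ≠ 0} :=
      fun p hp => (show DifferentiableAt ℂ (fun p : E × ℂ => (p.2 ^ 2)⁻¹) p from
        DifferentiableAt.inv (by fun_prop) (pow_ne_zero 2 hp.2)).differentiableWithinAt
    exact A.smul (hf.comp (by fun_prop) fun p hp => hp.1)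
  · intro ζ hζ
    exact ⟨hin ζ (sphere_subset_closedBall hζ), ne_of_mem_sphere hζ hr.ne'⟩

theorem contDiffOn_of_differentiableOn {f : E → ℂ} {U : Set E} (hU : IsOpen U)
    (hf : DifferentiableOn ℂ f U) : ContDiffOn ℂ ∞ f U := by
  rw [contDiffOn_infty]
  intro k
  induction k generalizing f with
  | zero => exact contDiffOn_zero.2 hf.continuousOn
  | succ k ih =>
    rw [Nat.cast_succ, contDiffOn_succ_iff_fderiv_of_isOpen hU]
    refine ⟨hf, by simp, contDiffOn_clm_apply.2 fun v => ih (differentiableOn_fderiv_apply hU hf v)⟩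

theorem eq_of_frequently_eq {X Y : Type*} [TopologicalSpace X] [TopologicalSpace Y] [T2Space Y]
    {u v : X → Y} {y : X} (hu : ContinuousAt u y) (hv : ContinuousAt v y)
    (h : ∃ᶠ z in 𝓝 y, u z = v z) : u y = v y := by
  by_contra hne
  have : ∀ᶠ z in 𝓝 y, (u z, v z) ∈ {p : Y × Y | p.1 ≠ p.2} :=
    (hu.prodMk hv).eventually ((isOpen_ne_fun continuous_fst continuous_snd).mem_nhds hne)
  exact h (this.mono fun z hz => hz)

/-- Identity theorem on convex open sets. -/
theorem eqOn_zero_of_eventually_eq_zero {f : E → ℂ} {U : Set E} (hU : IsOpen U) (hc : Convex ℝ U)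
    (hf : DifferentiableOn ℂ f U) {p : E} (hp : p ∈ U) (h0 : ∀ᶠ z in 𝓝 p, f z = 0) :
    ∀ q ∈ U, f q = 0 := by
  intro q hq
  -- The one-variable identity theorem is applied on the complex line through `p` and `q`, whose
  -- trace on `U` is convex, hence connected.
  let ℓ : ℂ → E := fun s => p + s • (q - p)
  have hℓ : Continuous ℓ := by fun_prop
  have hT : IsOpen (ℓ ⁻¹' U) := hU.preimage hℓ
  have hcT : Convex ℝ (ℓ ⁻¹' U) := by
    intro s hs t ht a b ha hb hab
    have := hc hs ht ha hb hab
    have e : ℓ (a • s + b • t) = a • ℓ s + b • ℓ t := by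
      obtain rfl : b = 1 - a := by linarith
      simp only [ℓ, ← Complex.coe_smul]
      push_cast
      module
    show ℓ _ ∈ U
    rw [e]; exact this
  have han : AnalyticOnNhd ℂ (fun s => f (ℓ s)) (ℓ ⁻¹' U) :=
    (hf.comp (t := U) (s := ℓ ⁻¹' U) (f := ℓ) (by fun_prop) fun s hs => hs).analyticOnNhd hT
  have h0' : (fun s => f (ℓ s)) =ᶠ[𝓝 0] 0 := by
    have : Tendsto ℓ (𝓝 0) (𝓝 p) := by simpa [ℓ] using hℓ.tendsto 0
    exact this.eventually h0
  have := han.eqOn_zero_of_preconnected_of_eventuallyEq_zero hcT.isPreconnected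
    (by simpa [ℓ] using hp) h0'
  simpa [ℓ] using this (show (1 : ℂ) ∈ ℓ ⁻¹' U by simpa [ℓ] using hq)

theorem frequently_ne_zero_of_ne_zero {f : E → ℂ} {U : Set E} (hU : IsOpen U) (hc : Convex ℝ U)
    (hf : DifferentiableOn ℂ f U) {q : E} (hq : q ∈ U) (hfq : f q ≠ 0) {p : E} (hp : p ∈ U) :
    ∃ᶠ z in 𝓝 p, f z ≠ 0 := by
  intro h
  exact hfq (eqOn_zero_of_eventually_eq_zero hU hc hf hp (h.mono fun z hz => not_not.1 hz) q hq)

/-- Removable singularities in one variable: by `hD0` the zeros of `D` are isolated, and `u` is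
bounded near each of them. Unlike `D` itself, the extension has no bad points, so Cauchy's formula
applies to it on slices. -/
theorem exists_differentiableOn_extension_of_bounded {T : Set ℂ} (hT : IsOpen T) {D u : ℂ → ℂ}
    (hD : ContinuousOn D T) (hD0 : ∀ s ∈ T, ∀ᶠ s' in 𝓝[≠] s, D s' ≠ 0)
    (hu : ∀ s ∈ T, D s ≠ 0 → DifferentiableAt ℂ u s) {M : ℝ}
    (hM : ∀ s ∈ T, D s ≠ 0 → ‖u s‖ ≤ M) :
    ∃ v : ℂ → ℂ, DifferentiableOn ℂ v T ∧ ∀ s ∈ T, D s ≠ 0 → v s = u s := by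
  classical
  refine ⟨fun s => if D s = 0 then limUnder (𝓝[≠] s) u else u s, fun s hs => ?_, fun s hs h => by
    simp [h]⟩
  refine DifferentiableAt.differentiableWithinAt ?_
  by_cases h : D s = 0
  · obtain ⟨N, hN, hNo, hsN⟩ := _root_.mem_nhds_iff.1 (inter_mem (hT.mem_nhds hs)
      (eventually_nhdsWithin_iff.1 (hD0 s hs)))
    have h1 := Complex.differentiableOn_update_limUnder_of_bddAbove (f := u)
      (hNo.mem_nhds hsN)
      (fun t ht => (hu t (hN ht.1).1 ((hN ht.1).2 ht.2)).differentiableWithinAt)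
      ⟨M, by rintro _ ⟨t, ht, rfl⟩; exact hM t (hN ht.1).1 ((hN ht.1).2 ht.2)⟩
    refine (h1.differentiableAt (hNo.mem_nhds hsN)).congr_of_eventuallyEq ?_
    filter_upwards [hNo.mem_nhds hsN] with t ht
    by_cases hts : t = s
    · subst hts; simp [h]
    · simp [hts, show D t ≠ 0 from (hN ht).2 hts]
  · refine (hu s hs h).congr_of_eventuallyEq ?_
    filter_upwards [(hD.continuousAt (hT.mem_nhds hs)).eventually_ne h] with t ht
    simp [ht]

/-- On the complex line from `p` to `q` the function `δ` has isolated zeros, so it vanishes nowhere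
on a small circle around `p`. The extension at `w` is the Cauchy integral of `c` over the translate
of this circle to `w`. It is holomorphic in `w`, and it agrees with `c` because on each good slice
`c` extends across the isolated zeros of `δ`. -/
theorem exists_riemann_extension_near {B : Set W} (hB : IsOpen B) (hc : Convex ℝ B)
    {δ c : W → ℂ} (hδ : DifferentiableOn ℂ δ B) {q : W} (hq : q ∈ B) (hδq : δ q ≠ 0)
    (hcd : ∀ w ∈ B, δ w ≠ 0 → DifferentiableAt ℂ c w) {M : ℝ}
    (hM : ∀ w ∈ B, δ w ≠ 0 → ‖c w‖ ≤ M) {p : W} (hp : p ∈ B) :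
    ∃ c' : W → ℂ, ∀ᶠ w in 𝓝 p, DifferentiableAt ℂ c' w ∧ (δ w ≠ 0 → c' w = c w) := by
  have : ProperSpace W := FiniteDimensional.proper ℂ W
  set v := q - p with hv
  have hℓ : Continuous fun x : W × ℂ => x.1 + x.2 • v := by fun_prop
  have hΩ : IsOpen {x : W × ℂ | x.1 + x.2 • v ∈ B ∧ δ (x.1 + x.2 • v) ≠ 0} := by
    have h1 := hδ.continuousOn.isOpen_inter_preimage hB isOpen_ne (t := {y : ℂ | y ≠ 0})
    exact h1.preimage hℓ
  -- The slice through `w` in direction `q - p` meets a point where `δ` is nonzero: `w` itself in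
  -- the first case, and `q` if `w = p`.
  have hslice : ∀ w ∈ B, δ w ≠ 0 ∨ w = p →
      ∀ s : ℂ, w + s • v ∈ B → ∀ᶠ s' in 𝓝[≠] s, δ (w + s' • v) ≠ 0 := by
    intro w hw hw' s hs
    have hT : IsOpen ((fun s : ℂ => w + s • v) ⁻¹' B) := hB.preimage (by fun_prop)
    have hcT : Convex ℝ ((fun s : ℂ => w + s • v) ⁻¹' B) := by
      intro s hs t ht a b ha hb hab
      have := hc hs ht ha hb hab
      have e : w + (a • s + b • t) • v = a • (w + s • v) + b • (w + t • v) := by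
        obtain rfl : b = 1 - a := by linarith
        simp only [← Complex.coe_smul]
        push_cast
        module
      show w + _ ∈ B
      rw [e]; exact this
    have hd : DifferentiableOn ℂ (fun s : ℂ => δ (w + s • v))
        ((fun s : ℂ => w + s • v) ⁻¹' B) := hδ.comp (t := B) (by fun_prop) fun s hs => hs
    refine ((hd.analyticAt (hT.mem_nhds hs)).eventually_eq_zero_or_eventually_ne_zero).resolve_left
      fun h0 => ?_
    have hz := eqOn_zero_of_eventually_eq_zero hT hcT hd hs h0
    rcases hw' with h | rfl
    · exact h (by simpa using hz 0 (by simpa using hw))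
    · exact hδq (by simpa [hv] using hz 1 (by simpa [hv] using hq))
  obtain ⟨r, hr, hsph⟩ : ∃ r > 0, ∀ ζ ∈ closedBall (0 : ℂ) r, p + ζ • v ∈ B ∧
      (ζ ≠ 0 → δ (p + ζ • v) ≠ 0) := by
    have h1 : ∀ᶠ ζ : ℂ in 𝓝 0, p + ζ • v ∈ B := by
      have : Tendsto (fun ζ : ℂ => p + ζ • v) (𝓝 0) (𝓝 p) := by
        simpa using (show Continuous fun ζ : ℂ => p + ζ • v by fun_prop).tendsto 0
      exact this.eventually (hB.mem_nhds hp)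
    have h2 := eventually_nhdsWithin_iff.1 (hslice p hp (Or.inr rfl) 0 (by simpa using hp))
    obtain ⟨r, hr, hb⟩ := nhds_basis_closedBall.mem_iff.1 (h1.and h2)
    exact ⟨r, hr, fun ζ hζ => hb hζ⟩
  have hdf : DifferentiableOn ℂ (fun x : W × ℂ => (x.2 - 0)⁻¹ • c (x.1 + x.2 • v))
      ({x : W × ℂ | x.1 + x.2 • v ∈ B ∧ δ (x.1 + x.2 • v) ≠ 0} ∩ {x | x.2 ≠ 0}) := by
    intro x hx
    have h1 : DifferentiableAt ℂ (fun x : W × ℂ => (x.2 - 0)⁻¹) x :=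
      DifferentiableAt.inv (by fun_prop) (by simpa using hx.2)
    exact (h1.smul ((hcd _ hx.1.1 hx.1.2).comp (f := fun x : W × ℂ => x.1 + x.2 • v) x
      (by fun_prop))).differentiableWithinAt
  have hΩ' := hΩ.inter
    (isOpen_ne_fun continuous_snd continuous_const : IsOpen {x : W × ℂ | x.2 ≠ 0})
  have hp' : ∀ ζ ∈ sphere (0 : ℂ) r, (p, ζ) ∈ {x : W × ℂ | x.1 + x.2 • v ∈ B ∧
      δ (x.1 + x.2 • v) ≠ 0} ∩ {x | x.2 ≠ 0} := fun ζ hζ =>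
    ⟨⟨(hsph ζ (sphere_subset_closedBall hζ)).1, (hsph ζ (sphere_subset_closedBall hζ)).2
      (ne_of_mem_sphere hζ hr.ne')⟩, ne_of_mem_sphere hζ hr.ne'⟩
  obtain ⟨ε, hε, hsub⟩ := exists_closedBall_prod_sphere_subset hΩ' hp'
  obtain ⟨ε', hε', hsub'⟩ : ∃ ε' > 0, ∀ w ∈ ball p ε', ∀ ζ ∈ closedBall (0 : ℂ) r,
      w + ζ • v ∈ B := by
    obtain ⟨u, t, hu, -, hwu, hst, hut⟩ := generalized_tube_lemma (isCompact_singleton (x := p))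
      (isCompact_closedBall (0 : ℂ) r) (hB.preimage hℓ) (by
        rintro ⟨w, ζ⟩ ⟨hw, hζ⟩
        obtain rfl : w = p := hw
        exact (hsph ζ hζ).1)
    obtain ⟨ε, hε, hb⟩ := nhds_basis_ball.mem_iff.1 (hu.mem_nhds (hwu rfl))
    exact ⟨ε, hε, fun w hw ζ hζ => hut (show (w, ζ) ∈ u ×ˢ t from ⟨hb hw, hst hζ⟩)⟩
  refine ⟨fun w => (2 * Real.pi * Complex.I : ℂ)⁻¹ •
    ∮ ζ in C(0, r), (ζ - 0)⁻¹ • c (w + ζ • v), ?_⟩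
  filter_upwards [ball_mem_nhds p hε, ball_mem_nhds p hε', hB.mem_nhds hp] with w hw hw' hwB
  refine ⟨?_, fun hδw => ?_⟩
  · refine DifferentiableAt.const_smul (R := ℂ)
      (f := fun w => ∮ ζ in C(0, r), (ζ - 0)⁻¹ • c (w + ζ • v)) ?_ _
    exact differentiableAt_circleIntegral hΩ' hdf hr.le
      fun ζ hζ => hsub ⟨ball_subset_closedBall hw, hζ⟩
  · have hT : IsOpen ((fun s : ℂ => w + s • v) ⁻¹' B) := hB.preimage (by fun_prop)
    obtain ⟨û, hû, hûe⟩ := exists_differentiableOn_extension_of_bounded hT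
      (D := fun s => δ (w + s • v)) (u := fun s => c (w + s • v))
      (hδ.continuousOn.comp (by fun_prop) fun s hs => hs)
      (fun s hs => hslice w hwB (Or.inl hδw) s hs)
      (fun s hs h => (hcd _ hs h).comp (f := fun s : ℂ => w + s • v) s (by fun_prop))
      (fun s hs h => hM _ hs h)
    have hcb : closedBall (0 : ℂ) r ⊆ (fun s : ℂ => w + s • v) ⁻¹' B := fun ζ hζ => hsub' w hw' ζ hζ
    have h1 := (hû.mono hcb).circleIntegral_sub_inv_smul (mem_ball_self hr)
    have h2 : (∮ ζ in C(0, r), (ζ - 0)⁻¹ • c (w + ζ • v)) =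
        ∮ ζ in C(0, r), (ζ - 0)⁻¹ • û ζ := by
      refine circleIntegral.integral_congr hr.le fun ζ hζ => ?_
      have := hsub (show (w, ζ) ∈ _ from ⟨ball_subset_closedBall hw, hζ⟩)
      rw [hûe ζ this.1.1 this.1.2]
    rw [h2, h1, hûe 0 (by simpa using hwB) (by simpa using hδw), smul_smul,
      inv_mul_cancel₀ Complex.two_pi_I_ne_zero]
    simp

/-- Riemann's extension theorem across the zero set of a holomorphic function. -/
theorem exists_riemann_extension {B : Set W} (hB : IsOpen B) (hc : Convex ℝ B)
    {δ c : W → ℂ} (hδ : DifferentiableOn ℂ δ B) {q : W} (hq : q ∈ B) (hδq : δ q ≠ 0)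
    (hcd : ∀ w ∈ B, δ w ≠ 0 → DifferentiableAt ℂ c w) {M : ℝ}
    (hM : ∀ w ∈ B, δ w ≠ 0 → ‖c w‖ ≤ M) :
    ∃ c' : W → ℂ, DifferentiableOn ℂ c' B ∧ ∀ w ∈ B, δ w ≠ 0 → c' w = c w := by
  choose! c' hc' using fun p (hp : p ∈ B) =>
    exists_riemann_extension_near hB hc hδ hq hδq hcd hM hp
  refine ⟨fun w => c' w w, fun p hp => ?_, fun w hw h => (hc' w hw).self_of_nhds.2 h⟩
  refine DifferentiableAt.differentiableWithinAt
    ((hc' p hp).self_of_nhds.1.congr_of_eventuallyEq ?_)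
  filter_upwards [hc' p hp, (hc' p hp).eventually_nhds, hB.mem_nhds hp] with w hw hw' hwB
  refine eq_of_frequently_eq (hc' w hwB).self_of_nhds.1.continuousAt hw.1.continuousAt ?_
  -- The local extensions agree with `c` where `δ ≠ 0`, which is a dense set, so they agree with
  -- each other and glue.
  refine ((frequently_ne_zero_of_ne_zero hB hc hδ hq hδq hwB).and_eventually
    (hw'.and (hc' w hwB))).mono fun z hz => ?_
  rw [hz.2.1.2 hz.1, hz.2.2.2 hz.1]

end SeveralVariables

/-! ### Divisibility of holomorphic functions on a disc by polynomials -/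

section Disc

open Metric Set Polynomial

theorem finite_zeros_of_ne_zero_annulus {R ρ : ℝ} (hρ : 0 < ρ) (hρR : ρ < R) {f : ℂ → ℂ}
    (hf : DifferentiableOn ℂ f (ball 0 R)) (hne : ∀ t ∈ ball (0 : ℂ) R, ρ ≤ ‖t‖ → f t ≠ 0) :
    {t ∈ ball (0 : ℂ) R | f t = 0}.Finite := by
  by_contra hinf
  have hsub : {t ∈ ball (0 : ℂ) R | f t = 0} ⊆ closedBall 0 ρ := by
    intro t ht
    by_contra h
    exact hne t ht.1 (by simpa using (not_le.1 (fun h' => h (by simpa using h'))).le) ht.2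
  obtain ⟨x, hx, hacc⟩ := Set.Infinite.exists_accPt_of_subset_isCompact hinf
    (isCompact_closedBall _ _) hsub
  have hxR : x ∈ ball (0 : ℂ) R := closedBall_subset_ball hρR hx
  have hfr : ∃ᶠ z in 𝓝[≠] x, f z = 0 := by
    rw [accPt_iff_frequently_nhdsNE] at hacc
    exact hacc.mono fun z hz => hz.2
  have h0 := (hf.analyticOnNhd isOpen_ball).eqOn_zero_of_preconnected_of_frequently_eq_zero
    (convex_ball _ _).isPreconnected hxR hfr
  have hρm : (ρ : ℂ) ∈ ball (0 : ℂ) R := by simpa [abs_of_pos hρ] using hρR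
  exact hne ρ hρm (by simp [abs_of_pos hρ]) (h0 hρm)

/-- A holomorphic function on a disc which does not vanish near the boundary is the product of a
monic polynomial with a function without zeros; the degree of the polynomial is the number of
zeros. -/
theorem exists_polynomial_mul_unit {R ρ ρ₁ : ℝ} (hρ : 0 < ρ) (hρ₁ : ρ < ρ₁) (hρR : ρ₁ < R)
    {f : ℂ → ℂ}
    (hf : DifferentiableOn ℂ f (ball 0 R)) (hne : ∀ t ∈ ball (0 : ℂ) R, ρ ≤ ‖t‖ → f t ≠ 0) :
    ∃ (s : Multiset ℂ) (u : ℂ → ℂ), (∀ a ∈ s, ‖a‖ < ρ) ∧ DifferentiableOn ℂ u (ball 0 R) ∧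
      (∀ t ∈ ball (0 : ℂ) R, u t ≠ 0) ∧
      (∀ t ∈ ball (0 : ℂ) R, f t = (s.map fun a => X - C a).prod.eval t * u t) ∧
      (∮ ζ in C(0, ρ₁), deriv f ζ / f ζ) = 2 * Real.pi * Complex.I * Multiset.card s := by
  have hρ₁0 : 0 < ρ₁ := hρ.trans hρ₁
  -- Induction on the number of distinct zeros. Each step divides out one zero with its full
  -- multiplicity `m`, so that the quotient `f₁` has exactly one zero less, and its logarithmic
  -- derivative differs by `m / (ζ - w)`.
  generalize hn : {t ∈ ball (0 : ℂ) R | f t = 0}.ncard = n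
  induction n generalizing f with
  | zero =>
    rw [Set.ncard_eq_zero (finite_zeros_of_ne_zero_annulus hρ (hρ₁.trans hρR) hf hne)] at hn
    have hnz : ∀ t ∈ ball (0 : ℂ) R, f t ≠ 0 := fun t ht h => by
      have : t ∈ {t ∈ ball (0 : ℂ) R | f t = 0} := ⟨ht, h⟩
      rw [hn] at this; exact this
    refine ⟨0, f, by simp, hf, hnz, by simp, ?_⟩
    have hd : DifferentiableOn ℂ (fun ζ => deriv f ζ / f ζ) (ball 0 R) :=
      (hf.deriv isOpen_ball).div hf hnz
    have := (hd.mono (closedBall_subset_ball hρR)).diffContOnCl_ball Subset.rfl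
    simpa using this.circleIntegral_eq_zero hρ₁0.le
  | succ n ih =>
    have hfin := finite_zeros_of_ne_zero_annulus hρ (hρ₁.trans hρR) hf hne
    obtain ⟨w, hw⟩ := (Set.ncard_pos hfin).1 (hn ▸ Nat.succ_pos n)
    have hwρ : ‖w‖ < ρ := not_le.1 fun h => hne w hw.1 h hw.2
    have hfw : AnalyticAt ℂ f w := hf.analyticAt (isOpen_ball.mem_nhds hw.1)
    obtain ⟨m, g, hg, hgw, hfg⟩ := hfw.exists_eventuallyEq_pow_smul_nonzero_iff.2 (by
      intro h0
      have := eqOn_zero_of_eventually_eq_zero isOpen_ball (convex_ball _ _) hf hw.1 h0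
      have hρm : (ρ : ℂ) ∈ ball (0 : ℂ) R := by simpa [abs_of_pos hρ] using hρ₁.trans hρR
      exact hne ρ hρm (by simp [abs_of_pos hρ]) (this _ hρm))
    set f₁ : ℂ → ℂ := Function.update (fun t => f t / (t - w) ^ m) w (g w) with hf₁
    have hev : f₁ =ᶠ[𝓝 w] g := by
      filter_upwards [hfg] with t ht
      by_cases htw : t = w
      · subst htw; simp [hf₁]
      · simp only [hf₁, Function.update_of_ne htw]
        rw [ht, smul_eq_mul, mul_div_cancel_left₀]
        exact pow_ne_zero _ (sub_ne_zero.2 htw)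
    have hmul : ∀ t ∈ ball (0 : ℂ) R, f t = (t - w) ^ m * f₁ t := by
      intro t ht
      by_cases htw : t = w
      · subst htw; simpa [hf₁] using hfg.self_of_nhds
      · simp only [hf₁, Function.update_of_ne htw]
        field_simp [sub_ne_zero.2 htw]
    have hd₁ : DifferentiableOn ℂ f₁ (ball 0 R) := by
      intro t ht
      by_cases htw : t = w
      · subst htw
        exact (hg.differentiableAt.congr_of_eventuallyEq hev).differentiableWithinAt
      · have h1 : DifferentiableAt ℂ (fun t => f t / (t - w) ^ m) t :=
          (hf.differentiableAt (isOpen_ball.mem_nhds ht)).div (by fun_prop)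
            (pow_ne_zero _ (sub_ne_zero.2 htw))
        refine (h1.congr_of_eventuallyEq ?_).differentiableWithinAt
        filter_upwards [isOpen_ne.mem_nhds htw] with y hy
        simp only [hf₁, Function.update_of_ne hy]
    have hf₁w : f₁ w ≠ 0 := by simpa [hf₁] using hgw
    have hm : m ≠ 0 := by
      rintro rfl
      exact hf₁w (by simpa [hw.2] using (hmul w hw.1).symm)
    have hne₁ : ∀ t ∈ ball (0 : ℂ) R, ρ ≤ ‖t‖ → f₁ t ≠ 0 := fun t ht htρ h0 =>
      hne t ht htρ (by rw [hmul t ht, h0, mul_zero])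
    have hzeros : {t ∈ ball (0 : ℂ) R | f₁ t = 0} = {t ∈ ball (0 : ℂ) R | f t = 0} \ {w} := by
      ext t
      constructor
      · rintro ⟨ht, h0⟩
        exact ⟨⟨ht, by rw [hmul t ht, h0, mul_zero]⟩, by rintro rfl; exact hf₁w h0⟩
      · rintro ⟨⟨ht, h0⟩, htw⟩
        rw [hmul t ht, mul_eq_zero] at h0
        exact ⟨ht, h0.resolve_left (pow_ne_zero _ (sub_ne_zero.2 htw))⟩
    obtain ⟨s, u, hs, hu, hu0, hfu, hint⟩ := ih hd₁ hne₁ (by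
      rw [hzeros, Set.ncard_sdiff_singleton_of_mem hw, hn]; rfl)
    refine ⟨Multiset.replicate m w + s, u, ?_, hu, hu0, ?_, ?_⟩
    · intro a ha
      rcases Multiset.mem_add.1 ha with h | h
      · rwa [Multiset.eq_of_mem_replicate h]
      · exact hs a h
    · intro t ht
      rw [hmul t ht, hfu t ht]
      simp [eval_mul, mul_assoc]
    · have hsph : ∀ ζ ∈ sphere (0 : ℂ) ρ₁, deriv f ζ / f ζ =
          (m : ℂ) * (ζ - w)⁻¹ + deriv f₁ ζ / f₁ ζ := by
        intro ζ hζ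
        have hζn : ‖ζ‖ = ρ₁ := by simpa using hζ
        have hζR : ζ ∈ ball (0 : ℂ) R := by simpa [hζn] using hρR
        have hζw : ζ - w ≠ 0 := by
          intro h; rw [sub_eq_zero.1 h] at hζn; linarith
        have hf1 := hne₁ ζ hζR (by rw [hζn]; exact hρ₁.le)
        have h1 : f =ᶠ[𝓝 ζ] fun t => (t - w) ^ m * f₁ t := by
          filter_upwards [isOpen_ball.mem_nhds hζR] with t ht using hmul t ht
        have h2 : HasDerivAt (fun t => (t - w) ^ m * f₁ t)
            ((m * (ζ - w) ^ (m - 1) * 1) * f₁ ζ + (ζ - w) ^ m * deriv f₁ ζ) ζ :=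
          (((hasDerivAt_id ζ).sub_const w).pow m).mul
            (hd₁.differentiableAt (isOpen_ball.mem_nhds hζR)).hasDerivAt
        rw [h1.deriv_eq, h2.deriv, h1.eq_of_nhds]
        obtain ⟨k, rfl⟩ := Nat.exists_eq_succ_of_ne_zero hm
        simp only [Nat.succ_sub_one, pow_succ]
        field_simp
      rw [circleIntegral.integral_congr hρ₁0.le hsph, circleIntegral.integral_add, hint,
        circleIntegral.integral_const_mul, circleIntegral.integral_sub_inv_of_mem_ball]
      · simp only [Multiset.card_add, Multiset.card_replicate]; push_cast; ring
      · simpa using hwρ.trans hρ₁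
      · refine ContinuousOn.circleIntegrable hρ₁0.le ?_
        refine continuousOn_const.mul (ContinuousOn.inv₀ (by fun_prop) fun ζ hζ h => ?_)
        have hζn : ‖ζ‖ = ρ₁ := by simpa using hζ
        rw [sub_eq_zero.1 h] at hζn; linarith
      · refine ContinuousOn.circleIntegrable hρ₁0.le ?_
        have hsub : sphere (0 : ℂ) ρ₁ ⊆ ball 0 R :=
          sphere_subset_closedBall.trans (closedBall_subset_ball hρR)
        exact ((hd₁.deriv isOpen_ball).continuousOn.mono hsub).div (hd₁.continuousOn.mono hsub)
          fun ζ hζ => hne₁ ζ (hsub hζ) (by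
            have hζn : ‖ζ‖ = ρ₁ := by simpa using hζ
            rw [hζn]; exact hρ₁.le)

theorem eval_prod_X_sub_C_ne_zero {s : Multiset ℂ} {ρ : ℝ} (hs : ∀ a ∈ s, ‖a‖ < ρ) {t : ℂ}
    (ht : ρ ≤ ‖t‖) : (s.map fun a => X - C a).prod.eval t ≠ 0 := by
  rw [eval_multiset_prod, Multiset.map_map]
  refine Multiset.prod_ne_zero fun h => ?_
  obtain ⟨a, ha, h0⟩ := Multiset.mem_map.1 h
  simp only [Function.comp_apply, eval_sub, eval_X, eval_C, sub_eq_zero] at h0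
  exact absurd (h0 ▸ hs a ha) (not_lt.2 ht)

theorem circleIntegral_sum_const_mul {κ : Type*} (s : Finset κ) (c : κ → ℂ) {F : κ → ℂ → ℂ} {r : ℝ}
    (hF : ∀ j, CircleIntegrable (F j) 0 r) :
    (∮ ζ in C(0, r), ∑ j ∈ s, c j * F j ζ) = ∑ j ∈ s, c j * ∮ ζ in C(0, r), F j ζ := by
  rw [circleIntegral.integral_fun_sum (f := fun j ζ => c j * F j ζ)
    fun j _ => (hF j).const_smul (a := c j)]
  simp_rw [circleIntegral.integral_const_mul]

/-- Write `P = (X - a) P'`. Combining the moments of `φ / P` with the coefficients of `P'` gives the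
integral of `φ / (ζ - a)`, that is, `2πi φ(a)`. So `φ` vanishes at `a`, and `φ / (X - a)` has
vanishing moments against `P'`. The number of moments needed is the degree of `P`. -/
theorem exists_mul_of_moments_eq_zero {R ρ₁ : ℝ} (hρ₁ : 0 < ρ₁) (hρR : ρ₁ < R) (s : Multiset ℂ)
    (hs : ∀ a ∈ s, ‖a‖ < ρ₁) {φ : ℂ → ℂ} (hφ : DifferentiableOn ℂ φ (ball 0 R))
    (hm : ∀ l < Multiset.card s,
      (∮ ζ in C(0, ρ₁), ζ ^ l * φ ζ / (s.map fun a => X - C a).prod.eval ζ) = 0) :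
    ∃ ψ : ℂ → ℂ, DifferentiableOn ℂ ψ (ball 0 R) ∧
      ∀ t ∈ ball (0 : ℂ) R, φ t = (s.map fun a => X - C a).prod.eval t * ψ t := by
  induction s using Multiset.induction generalizing φ with
  | empty => exact ⟨φ, hφ, by simp⟩
  | cons a s ih =>
    have hs' : ∀ b ∈ s, ‖b‖ < ρ₁ := fun b hb => hs b (Multiset.mem_cons_of_mem hb)
    have haρ : ‖a‖ < ρ₁ := hs a (Multiset.mem_cons_self a s)
    have haR : a ∈ ball (0 : ℂ) R := by simpa using haρ.trans hρR
    set P' : ℂ[X] := (s.map fun a => X - C a).prod with hP'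
    have hPe : ∀ t, ((a ::ₘ s).map fun a => X - C a).prod.eval t = (t - a) * P'.eval t := by
      intro t; simp [hP']
    have hsn : ∀ ζ ∈ sphere (0 : ℂ) ρ₁, ρ₁ ≤ ‖ζ‖ := fun ζ hζ => by
      rw [mem_sphere_zero_iff_norm.1 hζ]
    have hsub : sphere (0 : ℂ) ρ₁ ⊆ ball 0 R :=
      sphere_subset_closedBall.trans (closedBall_subset_ball hρR)
    have hint : ∀ l : ℕ, CircleIntegrable (fun ζ => ζ ^ l * φ ζ /
        ((a ::ₘ s).map fun a => X - C a).prod.eval ζ) 0 ρ₁ := fun l =>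
      ContinuousOn.circleIntegrable hρ₁.le
        (((continuousOn_id.pow l).mul (hφ.continuousOn.mono hsub)).div
          (Polynomial.continuousOn _) fun ζ hζ => eval_prod_X_sub_C_ne_zero hs (hsn ζ hζ))
    have hdeg : P'.natDegree = Multiset.card s := by
      rw [hP', natDegree_multiset_prod_X_sub_C_eq_card]
    have hφa : φ a = 0 := by
      have h1 := (hφ.mono (closedBall_subset_ball hρR)).circleIntegral_sub_inv_smul
        (show a ∈ ball (0 : ℂ) ρ₁ by simpa using haρ)
      have h2 : (∮ ζ in C(0, ρ₁), (ζ - a)⁻¹ • φ ζ) =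
          ∮ ζ in C(0, ρ₁), ∑ l ∈ Finset.range (P'.natDegree + 1), P'.coeff l *
            (ζ ^ l * φ ζ / ((a ::ₘ s).map fun a => X - C a).prod.eval ζ) := by
        refine circleIntegral.integral_congr hρ₁.le fun ζ hζ => ?_
        have hP0 : P'.eval ζ ≠ 0 := eval_prod_X_sub_C_ne_zero hs' (hsn ζ hζ)
        simp only [mul_div_assoc, ← mul_assoc]
        rw [← Finset.sum_mul, ← eval_eq_sum_range, hPe, smul_eq_mul]
        have hζa : ζ - a ≠ 0 := fun h => by
          have := hsn ζ hζ; rw [sub_eq_zero.1 h] at this; linarith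
        field_simp
      rw [h2, circleIntegral_sum_const_mul _ _ hint, Finset.sum_eq_zero fun l hl => ?_] at h1
      · exact ((smul_eq_zero.1 h1.symm).resolve_left Complex.two_pi_I_ne_zero)
      · rw [hm l, mul_zero]
        rw [Finset.mem_range, hdeg] at hl
        simpa using hl
    have hds : DifferentiableOn ℂ (dslope φ a) (ball 0 R) :=
      (Complex.differentiableOn_dslope (isOpen_ball.mem_nhds haR)).2 hφ
    have hφe : ∀ t, φ t = (t - a) * dslope φ a t := fun t => by
      have := sub_smul_dslope φ a t
      rw [hφa, sub_zero, smul_eq_mul] at this; exact this.symm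
    obtain ⟨ψ, hψ, hψe⟩ := ih hs' hds (fun l hl => by
      refine Eq.trans ?_ (hm l (by simpa using hl.trans (Nat.lt_succ_self _)))
      refine circleIntegral.integral_congr hρ₁.le fun ζ hζ => ?_
      have hP0 : P'.eval ζ ≠ 0 := eval_prod_X_sub_C_ne_zero hs' (hsn ζ hζ)
      have hζa : ζ - a ≠ 0 := fun h => by
        have := hsn ζ hζ; rw [sub_eq_zero.1 h] at this; linarith
      rw [hPe, hφe ζ]
      field_simp)
    exact ⟨ψ, hψ, fun t ht => by rw [hPe, hφe t, hψe t ht, mul_assoc]⟩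

/-- Cancels the factor `t - w`. If `w` lies outside the disc, it is a unit there; otherwise `hw`
makes `k` divisible by it. -/
theorem exists_eq_mul_of_sub_mul_eq {R : ℝ} {f g k : ℂ → ℂ} {w : ℂ}
    (hf : DifferentiableOn ℂ f (ball 0 R)) (hg : DifferentiableOn ℂ g (ball 0 R))
    (hk : DifferentiableOn ℂ k (ball 0 R))
    (he : ∀ t ∈ ball (0 : ℂ) R, (t - w) * f t = g t * k t)
    (hw : w ∈ ball (0 : ℂ) R → k w = 0) :
    ∃ h : ℂ → ℂ, DifferentiableOn ℂ h (ball 0 R) ∧ ∀ t ∈ ball (0 : ℂ) R, f t = g t * h t := by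
  by_cases hwR : w ∈ ball (0 : ℂ) R
  · have hN : ball (0 : ℂ) R ∈ 𝓝 w := isOpen_ball.mem_nhds hwR
    have hds : DifferentiableOn ℂ (dslope k w) (ball 0 R) :=
      (Complex.differentiableOn_dslope hN).2 hk
    have key : ∀ t ∈ ball (0 : ℂ) R, t ≠ w → f t = g t * dslope k w t := by
      intro t ht htw
      have h2 := sub_smul_dslope k w t
      rw [hw hwR, sub_zero, smul_eq_mul] at h2
      refine mul_left_cancel₀ (sub_ne_zero.2 htw) ?_
      rw [he t ht, ← h2, mul_left_comm]
    refine ⟨dslope k w, hds, fun t ht => ?_⟩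
    by_cases htw : t = w
    · rw [htw]
      have d1 : ContinuousAt f w := (hf.differentiableAt hN).continuousAt
      have d2 : ContinuousAt g w := (hg.differentiableAt hN).continuousAt
      have d3 : ContinuousAt (dslope k w) w := (hds.differentiableAt hN).continuousAt
      refine eq_of_frequently_eq d1 (d2.mul d3) ?_
      have h1 : ∀ᶠ z in 𝓝[≠] w, z ∈ ball (0 : ℂ) R := eventually_nhdsWithin_of_eventually_nhds hN
      have h2 : ∀ᶠ z in 𝓝[≠] w, z ≠ w := self_mem_nhdsWithin
      exact ((h1.and h2).frequently.filter_mono nhdsWithin_le_nhds).mono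
        fun z hz => key z hz.1 hz.2
    · exact key t ht htw
  · have hne : ∀ t ∈ ball (0 : ℂ) R, t - w ≠ 0 := fun t ht h0 => hwR (sub_eq_zero.1 h0 ▸ ht)
    refine ⟨fun t => k t / (t - w), hk.div (by fun_prop) hne, fun t ht => ?_⟩
    rw [← mul_div_assoc, ← he t ht, mul_div_cancel_left₀ _ (hne t ht)]

/-- The ideal of all polynomials `a` such that all `a * φ i / φ₀` are holomorphic on the disc. -/
def denomIdeal {ι : Type*} (R : ℝ) (φ : ι → ℂ → ℂ) (φ₀ : ℂ → ℂ) : Ideal ℂ[X] where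
  carrier := {a | ∀ i, ∃ h : ℂ → ℂ, DifferentiableOn ℂ h (ball 0 R) ∧
    ∀ t ∈ ball (0 : ℂ) R, a.eval t * φ i t = φ₀ t * h t}
  zero_mem' := fun i => ⟨0, differentiableOn_const 0, by simp⟩
  add_mem' := by
    intro a b ha hb i
    obtain ⟨h, hh, he⟩ := ha i
    obtain ⟨k, hk, ke⟩ := hb i
    exact ⟨h + k, hh.add hk, fun t ht => by
      rw [eval_add, add_mul, he t ht, ke t ht, Pi.add_apply, mul_add]⟩
  smul_mem' := by
    intro c a ha i
    obtain ⟨h, hh, he⟩ := ha i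
    refine ⟨fun t => c.eval t * h t, c.differentiable.differentiableOn.mul hh, fun t ht => ?_⟩
    rw [smul_eq_mul, eval_mul, mul_assoc, he t ht]; ring

/-! ### Minimal denominators of families of quotients on a disc -/

section denomIdeal

variable {ι : Type*} {R ρ ρ₁ : ℝ} {φ : ι → ℂ → ℂ} {φ₀ : ℂ → ℂ}

theorem mem_denomIdeal {a : ℂ[X]} : a ∈ denomIdeal R φ φ₀ ↔
    ∀ i, ∃ h : ℂ → ℂ, DifferentiableOn ℂ h (ball 0 R) ∧
      ∀ t ∈ ball (0 : ℂ) R, a.eval t * φ i t = φ₀ t * h t := Iff.rfl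

theorem mem_denomIdeal_of_X_sub_C_mul (hφ : ∀ i, DifferentiableOn ℂ (φ i) (ball 0 R))
    (hφ₀ : DifferentiableOn ℂ φ₀ (ball 0 R)) {a : ℂ[X]} {w : ℂ}
    (h : ∀ i, ∃ h : ℂ → ℂ, DifferentiableOn ℂ h (ball 0 R) ∧
      (∀ t ∈ ball (0 : ℂ) R, ((X - C w) * a).eval t * φ i t = φ₀ t * h t) ∧
      (w ∈ ball (0 : ℂ) R → h w = 0)) : a ∈ denomIdeal R φ φ₀ := by
  rw [mem_denomIdeal]
  intro i
  obtain ⟨k, hk, he, hw⟩ := h i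
  have he' : ∀ t ∈ ball (0 : ℂ) R, (t - w) * (a.eval t * φ i t) = φ₀ t * k t := fun t ht => by
    rw [← he t ht, eval_mul, eval_sub, eval_X, eval_C, mul_assoc]
  exact exists_eq_mul_of_sub_mul_eq (a.differentiable.differentiableOn.mul (hφ i)) hφ₀ hk he' hw

/-- The monic generator of `denomIdeal`. -/
def denom (R : ℝ) (φ : ι → ℂ → ℂ) (φ₀ : ℂ → ℂ) : ℂ[X] :=
  normalize (Submodule.IsPrincipal.generator (denomIdeal R φ φ₀))

theorem denom_dvd_iff {a : ℂ[X]} : denom R φ φ₀ ∣ a ↔ a ∈ denomIdeal R φ φ₀ := by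
  rw [denom, normalize_dvd_iff, ← Submodule.IsPrincipal.mem_iff_generator_dvd]

theorem denom_mem : denom R φ φ₀ ∈ denomIdeal R φ φ₀ := denom_dvd_iff.1 dvd_rfl

theorem monic_denom {a : ℂ[X]} (ha : a ≠ 0) (h : a ∈ denomIdeal R φ φ₀) :
    (denom R φ φ₀).Monic :=
  Polynomial.monic_normalize fun h0 => ha (by
    rw [Submodule.IsPrincipal.mem_iff_generator_dvd, h0, zero_dvd_iff] at h
    exact h)

theorem denom_not_mem_of_X_sub_C_mul {a b : ℂ[X]} (ha : a ≠ 0) (h : a ∈ denomIdeal R φ φ₀) {w : ℂ}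
    (hb : denom R φ φ₀ = (X - C w) * b) : b ∉ denomIdeal R φ φ₀ := by
  intro hmem
  have hm := monic_denom ha h
  have hb0 : b ≠ 0 := by rintro rfl; rw [mul_zero] at hb; exact hm.ne_zero hb
  have := natDegree_le_of_dvd (denom_dvd_iff.2 hmem) hb0
  rw [hb, natDegree_mul (X_sub_C_ne_zero w) hb0, natDegree_X_sub_C] at this
  omega

/-- At a root `w` that is outside the disc or at which `φ₀` does not vanish, the factor `X - w`
could be cancelled from the denominator, against the minimality of its degree. -/
theorem norm_lt_of_denom_isRoot (hφ : ∀ i, DifferentiableOn ℂ (φ i) (ball 0 R))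
    (hφ₀ : DifferentiableOn ℂ φ₀ (ball 0 R)) (hne : ∀ t ∈ ball (0 : ℂ) R, ρ ≤ ‖t‖ → φ₀ t ≠ 0)
    {a : ℂ[X]} (ha : a ≠ 0) (h : a ∈ denomIdeal R φ φ₀) {w : ℂ}
    (hw : (denom R φ φ₀).IsRoot w) : ‖w‖ < ρ := by
  by_contra hρ
  rw [not_lt] at hρ
  obtain ⟨b, hb⟩ := dvd_iff_isRoot.2 hw
  refine denom_not_mem_of_X_sub_C_mul ha h hb (mem_denomIdeal_of_X_sub_C_mul hφ hφ₀ (w := w)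
    fun i => ?_)
  obtain ⟨k, hk, ke⟩ := denom_mem (R := R) (φ := φ) (φ₀ := φ₀) i
  rw [hb] at ke
  refine ⟨k, hk, ke, fun hwR => ?_⟩
  have := ke w hwR
  simp only [eval_mul, eval_sub, eval_X, eval_C, sub_self, zero_mul] at this
  exact (mul_eq_zero.1 this.symm).resolve_left (hne w hwR hρ)

/-- If all numerators vanished at a root of the denominator, a linear factor would cancel throughout
and the denominator would not be minimal. -/
theorem exists_ne_zero_of_denom_isRoot (hφ : ∀ i, DifferentiableOn ℂ (φ i) (ball 0 R))
    (hφ₀ : DifferentiableOn ℂ φ₀ (ball 0 R))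
    {a : ℂ[X]} (ha : a ≠ 0) (h : a ∈ denomIdeal R φ φ₀) {w : ℂ}
    (hw : (denom R φ φ₀).IsRoot w) {q : ι → ℂ → ℂ}
    (hq : ∀ i, DifferentiableOn ℂ (q i) (ball 0 R))
    (hqe : ∀ i, ∀ t ∈ ball (0 : ℂ) R, (denom R φ φ₀).eval t * φ i t = φ₀ t * q i t) :
    ∃ i, q i w ≠ 0 := by
  by_contra! h0
  obtain ⟨b, hb⟩ := dvd_iff_isRoot.2 hw
  refine denom_not_mem_of_X_sub_C_mul ha h hb (mem_denomIdeal_of_X_sub_C_mul hφ hφ₀ (w := w)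
    fun i => ⟨q i, hq i, ?_, fun _ => h0 i⟩)
  rw [← hb]; exact hqe i

variable (hρ : 0 < ρ) (hρ₁ : ρ < ρ₁) (hρR : ρ₁ < R)
  (hφ : ∀ i, DifferentiableOn ℂ (φ i) (ball 0 R))
  (hφ₀ : DifferentiableOn ℂ φ₀ (ball 0 R)) (hne : ∀ t ∈ ball (0 : ℂ) R, ρ ≤ ‖t‖ → φ₀ t ≠ 0)

include hρ hρ₁ hρR hφ hφ₀ hne

theorem circleIntegral_mul_div_eq_sum (a : ℂ[X]) {D : ℕ} (hD : a.natDegree ≤ D) (i : ι) (l : ℕ) :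
    (∮ ζ in C(0, ρ₁), ζ ^ l * (a.eval ζ * φ i ζ) / φ₀ ζ) =
      ∑ j ∈ Finset.range (D + 1), a.coeff j * ∮ ζ in C(0, ρ₁), ζ ^ (l + j) * φ i ζ / φ₀ ζ := by
  have hρ₁0 : 0 < ρ₁ := hρ.trans hρ₁
  have hsub : sphere (0 : ℂ) ρ₁ ⊆ ball 0 R :=
    sphere_subset_closedBall.trans (closedBall_subset_ball hρR)
  have hint : ∀ k : ℕ, CircleIntegrable (fun ζ => ζ ^ k * φ i ζ / φ₀ ζ) 0 ρ₁ := fun k =>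
    ContinuousOn.circleIntegrable hρ₁0.le
      (((continuousOn_id.pow k).mul ((hφ i).continuousOn.mono hsub)).div
        (hφ₀.continuousOn.mono hsub) fun ζ hζ => hne ζ (hsub hζ) (by
          rw [mem_sphere_zero_iff_norm.1 hζ]; exact hρ₁.le))
  rw [← circleIntegral_sum_const_mul _ _ fun j => hint (l + j)]
  refine circleIntegral.integral_congr hρ₁0.le fun ζ hζ => ?_
  rw [eval_eq_sum_range' (Nat.lt_succ_of_le hD), Finset.sum_mul, Finset.mul_sum, Finset.sum_div]
  refine Finset.sum_congr rfl fun j _ => ?_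
  rw [pow_add]; ring

/-- Since `φ₀` and a polynomial of degree `D` differ by a unit, holomorphy of `a * φ i / φ₀` amounts
to the vanishing of its first `D` moments. This is a finite linear system for the coefficients of
`a`, and its matrix consists of circle integrals, which vary holomorphically with parameters. -/
theorem mem_denomIdeal_iff_moments {D : ℕ} {s : Multiset ℂ} {u : ℂ → ℂ}
    (hs : ∀ a ∈ s, ‖a‖ < ρ) (hu : DifferentiableOn ℂ u (ball 0 R))
    (hu0 : ∀ t ∈ ball (0 : ℂ) R, u t ≠ 0)
    (hfu : ∀ t ∈ ball (0 : ℂ) R, φ₀ t = (s.map fun a => X - C a).prod.eval t * u t)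
    (hcard : Multiset.card s = D) {a : ℂ[X]} (hD : a.natDegree ≤ D) :
    a ∈ denomIdeal R φ φ₀ ↔ ∀ i, ∀ l < D, ∑ j ∈ Finset.range (D + 1),
      a.coeff j * (∮ ζ in C(0, ρ₁), ζ ^ (l + j) * φ i ζ / φ₀ ζ) = 0 := by
  have hρ₁0 : 0 < ρ₁ := hρ.trans hρ₁
  have hsub : sphere (0 : ℂ) ρ₁ ⊆ ball 0 R :=
    sphere_subset_closedBall.trans (closedBall_subset_ball hρR)
  have hneS : ∀ ζ ∈ sphere (0 : ℂ) ρ₁, φ₀ ζ ≠ 0 := fun ζ hζ => hne ζ (hsub hζ) (by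
    rw [mem_sphere_zero_iff_norm.1 hζ]; exact hρ₁.le)
  simp_rw [← circleIntegral_mul_div_eq_sum hρ hρ₁ hρR hφ hφ₀ hne a hD]
  constructor
  · intro ha i l _
    obtain ⟨h, hh, he⟩ := ha i
    have h1 : (∮ ζ in C(0, ρ₁), ζ ^ l * (a.eval ζ * φ i ζ) / φ₀ ζ) =
        ∮ ζ in C(0, ρ₁), ζ ^ l * h ζ := by
      refine circleIntegral.integral_congr hρ₁0.le fun ζ hζ => ?_
      rw [he ζ (hsub hζ)]
      field_simp [hneS ζ hζ]
    rw [h1]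
    have hd : DifferentiableOn ℂ (fun ζ => ζ ^ l * h ζ) (ball 0 R) :=
      (differentiableOn_id.pow l).mul hh
    exact ((hd.mono (closedBall_subset_ball hρR)).diffContOnCl_ball
      Subset.rfl).circleIntegral_eq_zero hρ₁0.le
  · intro hm i
    obtain ⟨ψ, hψ, hψe⟩ := exists_mul_of_moments_eq_zero hρ₁0 hρR s
      (fun b hb => (hs b hb).trans hρ₁)
      (φ := fun t => a.eval t * φ i t / u t)
      ((a.differentiable.differentiableOn.mul (hφ i)).div hu hu0) (fun l hl => by
        refine Eq.trans ?_ (hm i l (hcard ▸ hl))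
        refine circleIntegral.integral_congr hρ₁0.le fun ζ hζ => ?_
        have h1 := hu0 ζ (hsub hζ)
        have h2 := hneS ζ hζ
        have h3 := hfu ζ (hsub hζ)
        have h4 : (s.map fun a => X - C a).prod.eval ζ ≠ 0 := fun h => h2 (by rw [h3, h, zero_mul])
        rw [h3]
        field_simp)
    refine ⟨ψ, hψ, fun t ht => ?_⟩
    have h1 := hψe t ht
    rw [div_eq_iff (hu0 t ht)] at h1
    rw [h1, hfu t ht]; ring

end denomIdeal

end Disc

/-! ### Minors -/

/-- A matrix with linearly independent columns has a nonvanishing maximal minor. -/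
theorem exists_det_submatrix_ne_zero {m : Type*} {k : ℕ} [Finite m] (A : Matrix m (Fin k) ℂ)
    (hA : ∀ c : Fin k → ℂ, A.mulVec c = 0 → c = 0) :
    ∃ ρ : Fin k → m, (A.submatrix ρ id).det ≠ 0 := by
  classical
  have := Fintype.ofFinite m
  have hrank : A.rank = k := by
    have h1 : Function.Injective A.mulVecLin := (injective_iff_map_eq_zero _).2 hA
    rw [Matrix.rank, LinearMap.finrank_range_of_inj h1, Module.finrank_fin_fun]
  obtain ⟨κ, a, -, hspan, hli⟩ := exists_linearIndependent' (K := ℂ) A.row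
  have htop : Submodule.span ℂ (Set.range A.row) = ⊤ := by
    apply Submodule.eq_top_of_finrank_eq
    rw [← Matrix.rank_eq_finrank_span_row, hrank, Module.finrank_fin_fun]
  let b : Module.Basis κ ℂ (Fin k → ℂ) := Module.Basis.mk hli (by rw [hspan, htop])
  let e : Fin k ≃ κ := (Pi.basisFun ℂ (Fin k)).indexEquiv b
  refine ⟨a ∘ e, ?_⟩
  have h2 : LinearIndependent ℂ (A.submatrix (a ∘ e) id).row := by
    have := hli.comp e e.injective
    exact this
  exact ((Matrix.isUnit_iff_isUnit_det _).1
    (Matrix.linearIndependent_rows_iff_isUnit.1 h2)).ne_zero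

/-! ### Local factorization with a primitive cofactor -/

section Primitive

open Metric Set Polynomial

variable {E W : Type*} [NormedAddCommGroup E] [NormedSpace ℂ E]
  [NormedAddCommGroup W] [NormedSpace ℂ W] [FiniteDimensional ℂ W]

/-- `f` is holomorphic near `z`. -/
def HolAt (f : E → ℂ) (z : E) : Prop := ∀ᶠ w in 𝓝 z, DifferentiableAt ℂ f w

/-- Every meromorphic germ `a / b` at `y` for which all `a / b * q i` are holomorphic is
holomorphic. -/
def IsPrimitiveAt {ι : Type*} (q : ι → E → ℂ) (y : E) : Prop :=
  ∀ a b : E → ℂ, HolAt a y → HolAt b y → (∃ᶠ z in 𝓝 y, b z ≠ 0) →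
    (∀ i, ∃ h, HolAt h y ∧ ∀ᶠ z in 𝓝 y, a z * q i z = b z * h z) →
    ∃ h, HolAt h y ∧ ∀ᶠ z in 𝓝 y, a z = b z * h z

theorem exists_ball_prod_subset {Ω : Set (W × ℂ)} (hΩ : IsOpen Ω) {w₀ : W} {K : Set ℂ}
    (hK : IsCompact K) (h : ∀ ζ ∈ K, (w₀, ζ) ∈ Ω) :
    ∃ ε > 0, ball w₀ ε ×ˢ K ⊆ Ω := by
  obtain ⟨u, v, hu, -, hwu, hsv, huv⟩ := generalized_tube_lemma (isCompact_singleton (x := w₀))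
    hK hΩ (by rintro ⟨w, ζ⟩ ⟨hw, hζ⟩; obtain rfl : w = w₀ := hw; exact h ζ hζ)
  obtain ⟨ε, hε, hb⟩ := nhds_basis_ball.mem_iff.1 (hu.mem_nhds (hwu rfl))
  exact ⟨ε, hε, (Set.prod_mono hb hsv).trans huv⟩

theorem differentiableOn_prod {κ : Type*} {f : κ → E → ℂ} {U : Set E} (s : Finset κ)
    (hf : ∀ i, DifferentiableOn ℂ (f i) U) : DifferentiableOn ℂ (fun w => ∏ i ∈ s, f i w) U := by
  classical
  induction s using Finset.induction_on with
  | empty => simp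
  | insert a s ha ih => simp only [Finset.prod_insert ha]; exact (hf a).mul ih

theorem differentiableOn_det {k : ℕ} {A : E → Matrix (Fin k) (Fin k) ℂ} {U : Set E}
    (hA : ∀ i j, DifferentiableOn ℂ (fun w => A w i j) U) :
    DifferentiableOn ℂ (fun w => (A w).det) U := by
  simp only [Matrix.det_apply']
  exact DifferentiableOn.fun_sum fun σ _ => (differentiableOn_const _).mul
    (differentiableOn_prod _ fun i => hA _ _)

/-- On a suitable product of discs, `f₀` has no zeros near the boundary of the second factor, and
the number of its zeros is constant. -/
theorem exists_polydisc {Ω : Set (W × ℂ)} (hΩ : IsOpen Ω) (h0 : (0, 0) ∈ Ω) {f₀ : W × ℂ → ℂ}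
    (hf : DifferentiableOn ℂ f₀ Ω) (hne : ¬ ∀ᶠ t in 𝓝 (0 : ℂ), f₀ (0, t) = 0) :
    ∃ ε ρ ρ₁ R : ℝ, 0 < ε ∧ 0 < ρ ∧ ρ < ρ₁ ∧ ρ₁ < R ∧ ball 0 ε ×ˢ ball 0 R ⊆ Ω ∧
      (∀ w ∈ ball (0 : W) ε, ∀ t ∈ ball (0 : ℂ) R, ρ ≤ ‖t‖ → f₀ (w, t) ≠ 0) ∧
      ∃ D : ℕ, ∀ w ∈ ball (0 : W) ε, ∃ (s : Multiset ℂ) (u : ℂ → ℂ), (∀ a ∈ s, ‖a‖ < ρ) ∧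
        DifferentiableOn ℂ u (ball 0 R) ∧ (∀ t ∈ ball (0 : ℂ) R, u t ≠ 0) ∧
        (∀ t ∈ ball (0 : ℂ) R, f₀ (w, t) = (s.map fun a => X - C a).prod.eval t * u t) ∧
        Multiset.card s = D := by
  have hslice : Continuous fun t : ℂ => ((0 : W), t) := by fun_prop
  have han : AnalyticAt ℂ (fun t => f₀ (0, t)) 0 := by
    have : DifferentiableOn ℂ (fun t => f₀ (0, t)) ((fun t : ℂ => ((0 : W), t)) ⁻¹' Ω) :=
      hf.comp (by fun_prop) fun t ht => ht
    exact this.analyticAt ((hΩ.preimage hslice).mem_nhds h0)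
  have h1 := eventually_nhdsWithin_iff.1 (han.eventually_eq_zero_or_eventually_ne_zero.resolve_left
    hne)
  have h2 : ∀ᶠ t in 𝓝 (0 : ℂ), ((0 : W), t) ∈ Ω := (hΩ.preimage hslice).mem_nhds h0
  obtain ⟨R, hR, hRb⟩ := nhds_basis_closedBall.mem_iff.1 (h1.and h2)
  set ρ := R / 3 with hρd
  set ρ₁ := 2 * R / 3 with hρ₁d
  have hρ : 0 < ρ := by positivity
  have hρ₁ : ρ < ρ₁ := by rw [hρd, hρ₁d]; linarith
  have hρR : ρ₁ < R := by rw [hρ₁d]; linarith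
  obtain ⟨ε₁, hε₁, hs₁⟩ := exists_ball_prod_subset hΩ (isCompact_closedBall (0 : ℂ) R)
    (fun ζ hζ => (hRb hζ).2)
  have hΩ' : IsOpen (Ω ∩ f₀ ⁻¹' {0}ᶜ) := hf.continuousOn.isOpen_inter_preimage hΩ
    isOpen_compl_singleton
  obtain ⟨ε₂, hε₂, hs₂⟩ := exists_ball_prod_subset hΩ' (w₀ := 0) (K := closedBall (0 : ℂ) R \ ball 0 ρ)
    ((isCompact_closedBall _ _).diff isOpen_ball) (fun ζ hζ => ⟨(hRb hζ.1).2, (hRb hζ.1).1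
      fun h => hζ.2 (by rw [mem_singleton_iff.1 h]; simpa using hρ)⟩)
  have hann : ∀ w ∈ ball (0 : W) ε₂, ∀ t ∈ ball (0 : ℂ) R, ρ ≤ ‖t‖ → f₀ (w, t) ≠ 0 :=
    fun w hw t ht htρ => (hs₂ (show (w, t) ∈ _ from ⟨hw, ball_subset_closedBall ht, by
      simpa using htρ⟩)).2
  set ε₃ := min ε₁ ε₂
  have hΩ₃ : ball (0 : W) ε₃ ×ˢ ball (0 : ℂ) R ⊆ Ω :=
    (Set.prod_mono (ball_subset_ball (min_le_left _ _)) ball_subset_closedBall).trans hs₁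
  have hann₃ : ∀ w ∈ ball (0 : W) ε₃, ∀ t ∈ ball (0 : ℂ) R, ρ ≤ ‖t‖ → f₀ (w, t) ≠ 0 :=
    fun w hw => hann w (ball_subset_ball (min_le_right _ _) hw)
  have hdw : ∀ w ∈ ball (0 : W) ε₃, DifferentiableOn ℂ (fun t => f₀ (w, t)) (ball 0 R) :=
    fun w hw => hf.comp (by fun_prop) fun t ht => hΩ₃ ⟨hw, ht⟩
  choose! s u hs hu hu0 hfu hint using fun w (hw : w ∈ ball (0 : W) ε₃) =>
    exists_polynomial_mul_unit hρ hρ₁ hρR (hdw w hw) (hann₃ w hw)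
  have hderiv : ∀ w ∈ ball (0 : W) ε₃, ∀ ζ ∈ ball (0 : ℂ) R,
      deriv (fun t => f₀ (w, t)) ζ = fderiv ℂ f₀ (w, ζ) (0, 1) := by
    intro w hw ζ hζ
    have h1 : HasFDerivAt f₀ (fderiv ℂ f₀ (w, ζ)) (w, ζ) :=
      (hf.differentiableAt (hΩ.mem_nhds (hΩ₃ ⟨hw, hζ⟩))).hasFDerivAt
    have h2 : HasDerivAt (fun t : ℂ => (w, t)) ((0 : W), (1 : ℂ)) ζ :=
      (hasDerivAt_const ζ w).prodMk (hasDerivAt_id ζ)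
    exact (h1.comp_hasDerivAt ζ h2).deriv
  have hsph : sphere (0 : ℂ) ρ₁ ⊆ ball 0 R :=
    sphere_subset_closedBall.trans (closedBall_subset_ball hρR)
  have hε₃ : 0 < ε₃ := lt_min hε₁ hε₂
  have hcont : ContinuousAt (fun w => ∮ ζ in C(0, ρ₁), (fderiv ℂ f₀ (w, ζ) (0, 1) / f₀ (w, ζ)))
      (0 : W) := by
    refine continuousAt_circleIntegral
      (f := fun p : W × ℂ => fderiv ℂ f₀ p (0, 1) / f₀ p) hΩ' ?_ (hρ.trans hρ₁).le fun ζ hζ => ?_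
    · exact ((differentiableOn_fderiv_apply hΩ hf _).continuousOn.mono inter_subset_left).div
        (hf.continuousOn.mono inter_subset_left) fun p hp => hp.2
    · refine ⟨hΩ₃ ⟨mem_ball_self hε₃, hsph hζ⟩, hann₃ 0 (mem_ball_self hε₃) ζ (hsph hζ) ?_⟩
      rw [mem_sphere_zero_iff_norm.1 hζ]; exact hρ₁.le
  have hn : ∀ w ∈ ball (0 : W) ε₃, (∮ ζ in C(0, ρ₁), (fderiv ℂ f₀ (w, ζ) (0, 1) / f₀ (w, ζ))) =
      2 * Real.pi * Complex.I * Multiset.card (s w) := by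
    intro w hw
    rw [← hint w hw]
    refine circleIntegral.integral_congr (hρ.trans hρ₁).le fun ζ hζ => ?_
    rw [hderiv w hw ζ (hsph hζ)]
  -- The integral is `2πi` times the number of zeros. A variation of less than `2π` forces the two
  -- integers to differ by less than `1`, hence to be equal.
  obtain ⟨ε₄, hε₄, hs₄⟩ := Metric.continuousAt_iff.1 hcont (2 * Real.pi) (by positivity)
  refine ⟨min ε₃ ε₄, ρ, ρ₁, R, lt_min hε₃ hε₄, hρ, hρ₁, hρR,
    (Set.prod_mono (ball_subset_ball (min_le_left _ _)) Subset.rfl).trans hΩ₃,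
    fun w hw => hann₃ w (ball_subset_ball (min_le_left _ _) hw), Multiset.card (s 0),
    fun w hw => ?_⟩
  have hw₃ := ball_subset_ball (min_le_left _ _) hw
  refine ⟨s w, u w, hs w hw₃, hu w hw₃, hu0 w hw₃, hfu w hw₃, ?_⟩
  have := hs₄ (ball_subset_ball (min_le_right _ _) hw)
  rw [hn w hw₃, hn 0 (mem_ball_self hε₃), dist_eq_norm, ← mul_sub, norm_mul] at this
  simp only [norm_mul, Complex.norm_ofNat, Complex.norm_real, Complex.norm_I, mul_one,
    Real.norm_eq_abs, abs_of_pos Real.pi_pos] at this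
  have h3 : ‖((Multiset.card (s w) : ℤ) - (Multiset.card (s 0) : ℤ) : ℂ)‖ < 1 := by
    have hpi : 0 < 2 * Real.pi := by positivity
    have := (mul_lt_iff_lt_one_right hpi).1 this
    simpa using this
  rw [← Int.cast_sub, Complex.norm_intCast] at h3
  have h4 : |(Multiset.card (s w) : ℤ) - (Multiset.card (s 0) : ℤ)| < 1 := by exact_mod_cast h3
  have := Int.abs_lt_one_iff.1 h4
  omega

theorem HolAt.continuousAt {f : E → ℂ} {z : E} (hf : HolAt f z) : ContinuousAt f z :=
  hf.self_of_nhds.continuousAt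

theorem HolAt.mul {f g : E → ℂ} {z : E} (hf : HolAt f z) (hg : HolAt g z) :
    HolAt (fun w => f w * g w) z := by
  filter_upwards [hf, hg] with w h1 h2 using h1.mul h2

theorem DifferentiableOn.holAt {f : E → ℂ} {U : Set E} (hf : DifferentiableOn ℂ f U)
    (hU : IsOpen U) {z : E} (hz : z ∈ U) : HolAt f z := by
  filter_upwards [hU.mem_nhds hz] with w hw using hf.differentiableAt (hU.mem_nhds hw)

theorem eq_of_mul_eq_mul_of_frequently {X : Type*} [TopologicalSpace X] {b u v : X → ℂ} {V : Set X}
    (hV : IsOpen V) (hu : ContinuousOn u V) (hv : ContinuousOn v V)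
    (hb : ∀ z ∈ V, ∃ᶠ y in 𝓝 z, b y ≠ 0) (h : ∀ z ∈ V, b z * u z = b z * v z) :
    ∀ z ∈ V, u z = v z := by
  intro z hz
  refine eq_of_frequently_eq (hu.continuousAt (hV.mem_nhds hz)) (hv.continuousAt (hV.mem_nhds hz))
    (((hb z hz).and_eventually (hV.mem_nhds hz)).mono fun y hy => mul_left_cancel₀ hy.1 (h y hy.2))

theorem frequently_nhds_prod_of_right {X Y : Type*} [TopologicalSpace X] [TopologicalSpace Y]
    {x : X} {y : Y} {p : X × Y → Prop} (h : ∃ᶠ t in 𝓝 y, p (x, t)) : ∃ᶠ z in 𝓝 (x, y), p z :=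
  (show Tendsto (fun t : Y => (x, t)) (𝓝 y) (𝓝 (x, y)) from
    (Continuous.prodMk_right x).tendsto y).frequently h

theorem frequently_nhds_prod_of_left {X Y : Type*} [TopologicalSpace X] [TopologicalSpace Y]
    {x : X} {y : Y} {p : X → Prop} (h : ∃ᶠ t in 𝓝 x, p t) : ∃ᶠ z in 𝓝 (x, y), p z.1 :=
  (show Tendsto (fun t : X => (t, y)) (𝓝 x) (𝓝 (x, y)) from
    (Continuous.prodMk_left y).tendsto x).frequently h

theorem differentiableAt_cauchyKernel {φ : W × ℂ → ℂ} {Ω : Set (W × ℂ)} (hΩ : IsOpen Ω)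
    (hφ : DifferentiableOn ℂ φ Ω) {w : W} {c t : ℂ} {r : ℝ} (hr : 0 < r)
    (h : ∀ ζ ∈ sphere c r, (w, ζ) ∈ Ω) (ht : t ∈ ball c r) :
    DifferentiableAt ℂ (fun p : W × ℂ => (2 * Real.pi * Complex.I : ℂ)⁻¹ •
      ∮ ζ in C(c, r), (ζ - p.2)⁻¹ • φ (p.1, ζ)) (w, t) := by
  refine DifferentiableAt.const_smul (R := ℂ)
    (f := fun p : W × ℂ => ∮ ζ in C(c, r), (ζ - p.2)⁻¹ • φ (p.1, ζ)) ?_ _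
  refine differentiableAt_circleIntegral
    (f := fun x : (W × ℂ) × ℂ => (x.2 - x.1.2)⁻¹ • φ (x.1.1, x.2))
    (Ω := {x : (W × ℂ) × ℂ | (x.1.1, x.2) ∈ Ω} ∩ {x | x.2 - x.1.2 ≠ 0})
    ((hΩ.preimage (by fun_prop)).inter (isOpen_ne_fun (by fun_prop) continuous_const)) ?_ hr.le ?_
  · intro x hx
    have h1 : DifferentiableAt ℂ (fun x : (W × ℂ) × ℂ => (x.2 - x.1.2)⁻¹) x :=
      DifferentiableAt.inv (by fun_prop) hx.2
    have h2 : DifferentiableAt ℂ φ (x.1.1, x.2) := hφ.differentiableAt (hΩ.mem_nhds hx.1)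
    exact (h1.smul (h2.comp (f := fun x : (W × ℂ) × ℂ => (x.1.1, x.2)) x
      (by fun_prop))).differentiableWithinAt
  · intro ζ hζ
    refine ⟨h ζ hζ, fun h0 => ?_⟩
    have h1 : ζ = t := sub_eq_zero.1 h0
    rw [mem_sphere] at hζ; rw [mem_ball, ← h1] at ht
    linarith

theorem differentiableOn_div {f g : E → ℂ} {U : Set E} (hf : DifferentiableOn ℂ f U)
    (hg : DifferentiableOn ℂ g U) (h0 : ∀ z ∈ U, g z ≠ 0) :
    DifferentiableOn ℂ (fun z => f z / g z) U := by
  simp only [div_eq_mul_inv]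
  exact hf.mul (hg.fun_inv h0)

/-- Let `h i = (a / b) * q i`. On a slice with `δ w ≠ 0` some `q i` is nonzero at each point, and
the quotients `h i / q i` glue to a holomorphic function. It is recovered from a circle on which `q
i₀` has no zeros by a Cauchy integral, which is holomorphic also in `w`. The resulting `k` satisfies
`k * q i₀ = h i₀` on a dense set of slices, hence everywhere, and `a = b * k` follows by cancelling
`q i₀`. -/
theorem isPrimitiveAt_of_generic {ι : Type*} [Finite ι] {B : Set W} (hB : IsOpen B)
    (hc : Convex ℝ B) {T : Set ℂ} (hT : IsOpen T) {δ : W → ℂ} (hδ : DifferentiableOn ℂ δ B)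
    {w' : W} (hw' : w' ∈ B) (hδw' : δ w' ≠ 0) {q : ι → W × ℂ → ℂ}
    (hq : ∀ i, DifferentiableOn ℂ (q i) (B ×ˢ T)) (i₀ : ι)
    (hq₀ : ∀ w ∈ B, ∀ t ∈ T, ¬ ∀ᶠ s in 𝓝 t, q i₀ (w, s) = 0)
    (hgen : ∀ w ∈ B, δ w ≠ 0 → ∀ t ∈ T, ∃ i, q i (w, t) ≠ 0) {y : W × ℂ} (hy : y ∈ B ×ˢ T) :
    IsPrimitiveAt q y := by
  intro a b ha hb hb0 H
  choose h hh he using H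
  obtain ⟨w₁, t₁⟩ := y
  have hall : ∀ᶠ z in 𝓝 (w₁, t₁), z ∈ B ×ˢ T ∧ DifferentiableAt ℂ a z ∧ DifferentiableAt ℂ b z ∧
      ∀ i, DifferentiableAt ℂ (h i) z ∧ a z * q i z = b z * h i z := by
    filter_upwards [(hB.prod hT).mem_nhds hy, ha, hb, eventually_all.2 hh, eventually_all.2 he]
      with z h1 h2 h3 h4 h5 using ⟨h1, h2, h3, fun i => ⟨h4 i, h5 i⟩⟩
  obtain ⟨r, hr, hV⟩ := Metric.mem_nhds_iff.1 hall
  rw [← ball_prod_same] at hV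
  set V := ball w₁ r ×ˢ ball t₁ r with hVd
  have hVo : IsOpen V := isOpen_ball.prod isOpen_ball
  have hVc : Convex ℝ V := (convex_ball _ _).prod (convex_ball _ _)
  have hVB : V ⊆ B ×ˢ T := fun z hz => (hV hz).1
  have hyV : (w₁, t₁) ∈ V := ⟨mem_ball_self hr, mem_ball_self hr⟩
  have hbd : DifferentiableOn ℂ b V := fun z hz => (hV hz).2.2.1.differentiableWithinAt
  have had : DifferentiableOn ℂ a V := fun z hz => (hV hz).2.1.differentiableWithinAt
  have hhd : ∀ i, DifferentiableOn ℂ (h i) V := fun i z hz =>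
    ((hV hz).2.2.2 i).1.differentiableWithinAt
  have hqd : ∀ i, DifferentiableOn ℂ (q i) V := fun i => (hq i).mono hVB
  have hbf : ∀ z ∈ V, ∃ᶠ y in 𝓝 z, b y ≠ 0 := by
    obtain ⟨z, hz, hzV⟩ := (hb0.and_eventually (hVo.mem_nhds hyV)).exists
    exact fun p hp => frequently_ne_zero_of_ne_zero hVo hVc hbd hzV hz hp
  -- After multiplication by `b`, both sides become `a * q i * q j`.
  have hcross : ∀ i j, ∀ z ∈ V, h i z * q j z = h j z * q i z := by
    intro i j
    refine eq_of_mul_eq_mul_of_frequently hVo ((hhd i).mul (hqd j)).continuousOn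
      ((hhd j).mul (hqd i)).continuousOn hbf fun z hz => ?_
    linear_combination -(((hV hz).2.2.2 i).2) * q j z + ((hV hz).2.2.2 j).2 * q i z
  have hsl : ∀ w ∈ ball w₁ r, DifferentiableOn ℂ (fun t => q i₀ (w, t)) (ball t₁ r) := fun w hw =>
    (hqd i₀).comp (by fun_prop) fun t ht => ⟨hw, ht⟩
  obtain ⟨r', hr', hr'r, hsph⟩ : ∃ r' > 0, r' < r ∧ ∀ ζ ∈ sphere t₁ r', q i₀ (w₁, ζ) ≠ 0 := by
    have := ((hsl w₁ (mem_ball_self hr)).analyticAt (ball_mem_nhds t₁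
      hr)).eventually_eq_zero_or_eventually_ne_zero.resolve_left (hq₀ w₁ hy.1 t₁ hy.2)
    obtain ⟨s, hs, hsb⟩ := nhds_basis_ball.mem_iff.1 (eventually_nhdsWithin_iff.1 this)
    refine ⟨min r s / 2, by positivity, by linarith [min_le_left r s], fun ζ hζ => hsb ?_ ?_⟩
    · rw [mem_ball, mem_sphere.1 hζ]; linarith [min_le_right r s, lt_min hr hs]
    · exact ne_of_mem_sphere hζ (by positivity)
  have hΩo : IsOpen (V ∩ q i₀ ⁻¹' {0}ᶜ) :=
    (hqd i₀).continuousOn.isOpen_inter_preimage hVo isOpen_compl_singleton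
  have hsphV : ∀ ζ ∈ closedBall t₁ r', ζ ∈ ball t₁ r := fun ζ hζ =>
    closedBall_subset_ball hr'r hζ
  obtain ⟨r'', hr'', hs''⟩ := exists_ball_prod_subset hΩo (w₀ := w₁) (isCompact_sphere t₁ r')
    fun ζ hζ => ⟨⟨mem_ball_self hr, hsphV ζ (sphere_subset_closedBall hζ)⟩, hsph ζ hζ⟩
  have hφ : DifferentiableOn ℂ (fun p => h i₀ p / q i₀ p) (V ∩ q i₀ ⁻¹' {0}ᶜ) :=
    differentiableOn_div ((hhd i₀).mono inter_subset_left) ((hqd i₀).mono inter_subset_left)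
      fun p hp => hp.2
  set k : W × ℂ → ℂ := fun p => (2 * Real.pi * Complex.I : ℂ)⁻¹ •
      ∮ ζ in C(t₁, r'), (ζ - p.2)⁻¹ • (h i₀ (p.1, ζ) / q i₀ (p.1, ζ)) with hk
  set V' := ball w₁ (min r r'') ×ˢ ball t₁ r' with hV'
  have hV'o : IsOpen V' := isOpen_ball.prod isOpen_ball
  have hyV' : (w₁, t₁) ∈ V' := ⟨mem_ball_self (lt_min hr hr''), mem_ball_self hr'⟩
  have hV'V : V' ⊆ V := Set.prod_mono (ball_subset_ball (min_le_left _ _))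
    (ball_subset_ball hr'r.le)
  have hkd : DifferentiableOn ℂ k V' := by
    rintro ⟨w, t⟩ ⟨hw, ht⟩
    refine (differentiableAt_cauchyKernel (φ := fun p => h i₀ p / q i₀ p) hΩo hφ hr'
      (fun ζ hζ => hs'' ⟨ball_subset_ball (min_le_right _ _) hw, hζ⟩) ht).differentiableWithinAt
  have hkey : ∀ w ∈ ball w₁ (min r r''), δ w ≠ 0 → ∀ t ∈ ball t₁ r', k (w, t) * q i₀ (w, t) =
      h i₀ (w, t) := by
    intro w hw hδw t ht
    have hwr : w ∈ ball w₁ r := ball_subset_ball (min_le_left _ _) hw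
    have hwB : w ∈ B := (hVB (show (w, t₁) ∈ V from ⟨hwr, mem_ball_self hr⟩)).1
    have : Nonempty ι := ⟨i₀⟩
    -- The index may jump with `s`. By `hcross` the value of `κ` does not depend on it, so near each
    -- point `κ` is a quotient with a fixed index.
    choose! ix hix using fun (s : ℂ) (hs : s ∈ ball t₁ r) =>
      hgen w hwB hδw s (hVB (show (w, s) ∈ V from ⟨hwr, hs⟩)).2
    set κ : ℂ → ℂ := fun s => h (ix s) (w, s) / q (ix s) (w, s) with hκ
    have hκe : ∀ s ∈ ball t₁ r, ∀ i, κ s * q i (w, s) = h i (w, s) := by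
      intro s hs i
      have h1 := hcross (ix s) i (w, s) ⟨hwr, hs⟩
      have h2 := hix s hs
      simp only [hκ]
      rw [div_mul_eq_mul_div, h1, mul_div_cancel_right₀ _ h2]
    have hκd : DifferentiableOn ℂ κ (ball t₁ r) := by
      intro s hs
      have hsV : V ∈ 𝓝 (w, s) := hVo.mem_nhds ⟨hwr, hs⟩
      have d1 : DifferentiableAt ℂ (fun t => h (ix s) (w, t)) s :=
        ((hhd (ix s)).differentiableAt hsV).comp (f := fun t : ℂ => (w, t)) s (by fun_prop)
      have d2 : DifferentiableAt ℂ (fun t => q (ix s) (w, t)) s :=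
        ((hqd (ix s)).differentiableAt hsV).comp (f := fun t : ℂ => (w, t)) s (by fun_prop)
      refine ((d1.div d2 (hix s hs)).congr_of_eventuallyEq ?_).differentiableWithinAt
      filter_upwards [isOpen_ball.mem_nhds hs, d2.continuousAt.eventually_ne (hix s hs)]
        with t ht ht0
      exact eq_div_of_mul_eq ht0 (hκe t ht (ix s))
    have h1 := (hκd.mono (closedBall_subset_ball hr'r)).circleIntegral_sub_inv_smul ht
    have h2 : (∮ ζ in C(t₁, r'), (ζ - t)⁻¹ • (h i₀ (w, ζ) / q i₀ (w, ζ))) =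
        ∮ ζ in C(t₁, r'), (ζ - t)⁻¹ • κ ζ := by
      refine circleIntegral.integral_congr hr'.le fun ζ hζ => ?_
      have hζ0 := (hs'' (show (w, ζ) ∈ _ from ⟨ball_subset_ball (min_le_right _ _) hw, hζ⟩)).2
      have := hκe ζ (hsphV ζ (sphere_subset_closedBall hζ)) i₀
      rw [← this, mul_div_cancel_right₀ _ hζ0]
    have hkκ : k (w, t) = κ t := by
      simp only [hk]
      rw [h2, h1, smul_smul, inv_mul_cancel₀ Complex.two_pi_I_ne_zero, one_smul]
    rw [hkκ]
    exact hκe t (ball_subset_ball hr'r.le ht) i₀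
  have hkey' : ∀ z ∈ V', k z * q i₀ z = h i₀ z := by
    rintro ⟨w, t⟩ ⟨hw, ht⟩
    have hzV' : V' ∈ 𝓝 (w, t) := hV'o.mem_nhds ⟨hw, ht⟩
    have c1 := ((hkd.mul ((hqd i₀).mono hV'V)).differentiableAt hzV').continuousAt
    have c2 := (((hhd i₀).mono hV'V).differentiableAt hzV').continuousAt
    refine eq_of_frequently_eq c1 c2 ?_
    have hwB : w ∈ B := (hVB (hV'V (show (w, t) ∈ V' from ⟨hw, ht⟩))).1
    refine ((frequently_nhds_prod_of_left (y := t) (frequently_ne_zero_of_ne_zero hB hc hδ hw' hδw'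
      hwB)).and_eventually hzV').mono fun z hz => hkey z.1 hz.2.1 hz.1 z.2 hz.2.2
  clear_value k
  refine ⟨k, DifferentiableOn.holAt hkd hV'o hyV', ?_⟩
  filter_upwards [hV'o.mem_nhds hyV'] with z hz
  refine eq_of_mul_eq_mul_of_frequently (b := q i₀) hV'o (had.mono hV'V).continuousOn
    ((hbd.mono hV'V).mul hkd).continuousOn ?_ ?_ z hz
  · rintro ⟨w, t⟩ hp
    exact frequently_nhds_prod_of_right (not_eventually.1
      (hq₀ w (hVB (hV'V hp)).1 t (hVB (hV'V hp)).2))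
  · intro p hp
    have := ((hV (hV'V hp)).2.2.2 i₀).2
    show q i₀ p * a p = q i₀ p * (b p * k p)
    rw [mul_comm, this, ← hkey' p hp]
    ring

end Primitive

/-! ### Existence of primitive factorizations in several variables -/

section PrimitiveExistence

open Metric Set Polynomial

variable {W : Type*} [NormedAddCommGroup W] [NormedSpace ℂ W] [FiniteDimensional ℂ W]

theorem sum_range_eq_sum_fin {e D : ℕ} (he : e ≤ D) {F : ℕ → ℂ} (hF : ∀ k, e ≤ k → F k = 0) :
    ∑ k ∈ Finset.range (D + 1), F k = ∑ j : Fin e, F j := by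
  rw [Fin.sum_univ_eq_sum_range]
  refine (Finset.sum_subset (fun k hk => ?_) fun k _ hk => hF k ?_).symm
  · simp only [Finset.mem_range] at *; omega
  · simpa using hk

/-- The lower bound depends only on `ρ` and on the degree, so it survives limits of polynomials. It
keeps zeros out of `ρ < ‖t‖` also on slices where only a limit of denominators is available. -/
theorem norm_eval_ge_of_roots {p : ℂ[X]} (hp : p.Monic) {ρ : ℝ} (hr : ∀ w, p.IsRoot w → ‖w‖ < ρ)
    {t : ℂ} (ht : ρ ≤ ‖t‖) : (‖t‖ - ρ) ^ p.natDegree ≤ ‖p.eval t‖ := by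
  have hs := IsAlgClosed.splits p
  rw [hs.eval_eq_prod_roots_of_monic hp, hs.natDegree_eq_card_roots]
  have : ∀ s : Multiset ℂ, (∀ a ∈ s, ‖a‖ < ρ) →
      (‖t‖ - ρ) ^ Multiset.card s ≤ ‖(s.map (t - ·)).prod‖ := by
    intro s
    induction s using Multiset.induction with
    | empty => simp
    | cons a s ih =>
      intro h
      have h1 := ih fun b hb => h b (Multiset.mem_cons_of_mem hb)
      have h2 := h a (Multiset.mem_cons_self a s)
      rw [Multiset.card_cons, pow_succ, Multiset.map_cons, Multiset.prod_cons, norm_mul, mul_comm]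
      have h3 : ‖t‖ - ρ ≤ ‖t - a‖ := by linarith [norm_sub_norm_le t a]
      exact mul_le_mul h3 h1 (pow_nonneg (by linarith) _) (norm_nonneg _)
  exact this _ fun a ha => hr a (isRoot_of_mem_roots ha)

/-- The denominator of a family of quotients `f i / f i₀` depends holomorphically on parameters. -/
theorem exists_holomorphic_denom {ι : Type*} [Finite ι] {f : ι → W × ℂ → ℂ} {i₀ : ι}
    {ε ρ ρ₁ R : ℝ} (hε : 0 < ε) (hρ : 0 < ρ) (hρ₁ : ρ < ρ₁) (hρR : ρ₁ < R)
    (hf : ∀ i, DifferentiableOn ℂ (f i) (ball 0 ε ×ˢ ball 0 R))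
    (hne : ∀ w ∈ ball (0 : W) ε, ∀ t ∈ ball (0 : ℂ) R, ρ ≤ ‖t‖ → f i₀ (w, t) ≠ 0) {D : ℕ}
    (hD : ∀ w ∈ ball (0 : W) ε, ∃ (s : Multiset ℂ) (u : ℂ → ℂ), (∀ a ∈ s, ‖a‖ < ρ) ∧
        DifferentiableOn ℂ u (ball 0 R) ∧ (∀ t ∈ ball (0 : ℂ) R, u t ≠ 0) ∧
        (∀ t ∈ ball (0 : ℂ) R, f i₀ (w, t) = (s.map fun a => X - C a).prod.eval t * u t) ∧
        Multiset.card s = D) :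
    ∃ (e : ℕ) (c : Fin e → W → ℂ) (δ : W → ℂ) (w' : W),
      (∀ j, DifferentiableOn ℂ (c j) (ball 0 ε)) ∧ DifferentiableOn ℂ δ (ball 0 ε) ∧
      w' ∈ ball 0 ε ∧ δ w' ≠ 0 ∧
      ∀ w ∈ ball (0 : W) ε, δ w ≠ 0 →
        (denom R (fun i t => f i (w, t)) fun t => f i₀ (w, t)).natDegree = e ∧
        ∀ t, (denom R (fun i t => f i (w, t)) fun t => f i₀ (w, t)).eval t =
          t ^ e + ∑ j : Fin e, c j w * t ^ (j : ℕ) := by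
  set Ew : W → ℂ[X] := fun w => denom R (fun i t => f i (w, t)) fun t => f i₀ (w, t) with hEw
  set N : W → Ideal ℂ[X] := fun w => denomIdeal R (fun i t => f i (w, t)) fun t => f i₀ (w, t)
    with hN
  have hB0 : (0 : W) ∈ ball (0 : W) ε := mem_ball_self hε
  have hsl : ∀ w ∈ ball (0 : W) ε, ∀ i, DifferentiableOn ℂ (fun t => f i (w, t)) (ball 0 R) :=
    fun w hw i => (hf i).comp (by fun_prop) fun t ht => ⟨hw, ht⟩
  choose! s u hs hu hu0 hfu hcard using hD
  have hPmem : ∀ w ∈ ball (0 : W) ε, ((s w).map fun a => X - C a).prod ∈ N w := by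
    intro w hw i
    refine ⟨fun t => f i (w, t) / u w t, (hsl w hw i).div (hu w hw) (hu0 w hw), fun t ht => ?_⟩
    beta_reduce
    rw [hfu w hw t ht]
    field_simp [hu0 w hw t ht]
  have hPmonic : ∀ w, ((s w).map fun a => X - C a).prod.Monic := fun w =>
    monic_multiset_prod_of_monic _ _ fun a _ => monic_X_sub_C a
  have hPdeg : ∀ w ∈ ball (0 : W) ε, ((s w).map fun a => X - C a).prod.natDegree = D :=
    fun w hw => by rw [natDegree_multiset_prod_X_sub_C_eq_card, hcard w hw]
  have hEmonic : ∀ w ∈ ball (0 : W) ε, (Ew w).Monic := fun w hw =>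
    monic_denom (hPmonic w).ne_zero (hPmem w hw)
  have hEdeg : ∀ w ∈ ball (0 : W) ε, (Ew w).natDegree ≤ D := fun w hw => by
    rw [← hPdeg w hw]
    exact natDegree_le_of_dvd (denom_dvd_iff.2 (hPmem w hw)) (hPmonic w).ne_zero
  set mo : ι → ℕ → W → ℂ := fun i k w => ∮ ζ in C(0, ρ₁), ζ ^ k * f i (w, ζ) / f i₀ (w, ζ) with hmo
  have hmem : ∀ w ∈ ball (0 : W) ε, ∀ a : ℂ[X], a.natDegree ≤ D → (a ∈ N w ↔
      ∀ i, ∀ l < D, ∑ j ∈ Finset.range (D + 1), a.coeff j * mo i (l + j) w = 0) :=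
    fun w hw a ha => mem_denomIdeal_iff_moments hρ hρ₁ hρR (hsl w hw) (hsl w hw i₀) (hne w hw)
      (hs w hw) (hu w hw) (hu0 w hw) (hfu w hw) (hcard w hw) ha
  have hmod : ∀ i k, DifferentiableOn ℂ (mo i k) (ball 0 ε) := by
    intro i k w hw
    have hΩ : IsOpen ((ball (0 : W) ε ×ˢ ball (0 : ℂ) R) ∩ f i₀ ⁻¹' {0}ᶜ) :=
      (hf i₀).continuousOn.isOpen_inter_preimage (isOpen_ball.prod isOpen_ball)
        isOpen_compl_singleton
    refine (differentiableAt_circleIntegral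
      (f := fun p : W × ℂ => p.2 ^ k * f i p / f i₀ p) hΩ ?_ (hρ.trans hρ₁).le
      fun ζ hζ => ?_).differentiableWithinAt
    · exact differentiableOn_div (DifferentiableOn.mul (by fun_prop)
        ((hf i).mono inter_subset_left)) ((hf i₀).mono inter_subset_left) fun p hp => hp.2
    · have hζR : ζ ∈ ball (0 : ℂ) R := closedBall_subset_ball hρR (sphere_subset_closedBall hζ)
      exact ⟨⟨hw, hζR⟩, hne w hw ζ hζR (by rw [mem_sphere_zero_iff_norm.1 hζ]; exact hρ₁.le)⟩
  -- maximal degree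
  obtain ⟨w', hw', hmax⟩ : ∃ w' ∈ ball (0 : W) ε, ∀ w ∈ ball (0 : W) ε,
      (Ew w).natDegree ≤ (Ew w').natDegree := by
    set S : Set ℕ := (fun w => (Ew w).natDegree) '' ball (0 : W) ε
    have hb : BddAbove S := ⟨D, by rintro _ ⟨w, hw, rfl⟩; exact hEdeg w hw⟩
    obtain ⟨w', hw', h⟩ := Nat.sSup_mem (s := S) ⟨_, 0, hB0, rfl⟩ hb
    exact ⟨w', hw', fun w hw => by
      simp only at h
      rw [h]; exact le_csSup hb ⟨w, hw, rfl⟩⟩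
  set e := (Ew w').natDegree with he
  have heD : e ≤ D := hEdeg w' hw'
  set A : W → Matrix (ι × Fin D) (Fin e) ℂ := fun w p j => mo p.1 (p.2 + j) w with hA
  -- A kernel vector would be a polynomial of degree below `e` in the ideal at `w'`, whose generator
  -- has degree `e`. Injectivity gives a maximal minor `δ` that is nonzero at `w'`.
  have hAinj : ∀ c : Fin e → ℂ, (A w').mulVec c = 0 → c = 0 := by
    intro c hc
    set a : ℂ[X] := ∑ j : Fin e, monomial (j : ℕ) (c j) with ha
    have hcoeff : ∀ k (hk : k < e), a.coeff k = c ⟨k, hk⟩ := by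
      intro k hk
      rw [ha, finsetSum_coeff, Finset.sum_eq_single ⟨k, hk⟩]
      · simp
      · intro j _ hj
        rw [coeff_monomial, if_neg]
        rintro rfl; exact hj rfl
      · simp
    have hcoeff0 : ∀ k, e ≤ k → a.coeff k = 0 := by
      intro k hk
      rw [ha, finsetSum_coeff]
      refine Finset.sum_eq_zero fun j _ => ?_
      rw [coeff_monomial, if_neg (by have := j.2; omega)]
    have hdeg : a.degree < e := (degree_lt_iff_coeff_zero a e).2 hcoeff0
    have haN : a ∈ N w' := by
      rw [hmem w' hw' a ((natDegree_le_iff_degree_le.2 hdeg.le).trans heD)]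
      intro i l hl
      rw [sum_range_eq_sum_fin heD fun k hk => by rw [hcoeff0 k hk, zero_mul]]
      have := congrFun hc (i, ⟨l, hl⟩)
      simp only [Matrix.mulVec, dotProduct, hA, Pi.zero_apply] at this
      rw [← this]
      exact Finset.sum_congr rfl fun j _ => by rw [hcoeff j j.2, mul_comm]
    have ha0 : a = 0 := eq_zero_of_dvd_of_degree_lt (denom_dvd_iff.2 haN) (by
      rw [degree_eq_natDegree (hEmonic w' hw').ne_zero]; exact hdeg)
    funext j
    rw [Pi.zero_apply, ← hcoeff j j.2, ha0, coeff_zero]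
  obtain ⟨r, hr⟩ := exists_det_submatrix_ne_zero (A w') hAinj
  set δ : W → ℂ := fun w => ((A w).submatrix r id).det with hδ
  have hδd : DifferentiableOn ℂ δ (ball 0 ε) := differentiableOn_det fun i j => hmod _ _
  have hlin : ∀ w ∈ ball (0 : W) ε, ∀ p : Fin e,
      ∑ j ∈ Finset.range (D + 1), (Ew w).coeff j * mo (r p).1 ((r p).2 + j) w = 0 :=
    fun w hw p => (hmem w hw _ (hEdeg w hw)).1 denom_mem _ _ (r p).2.2
  -- If `δ w ≠ 0`, the system has no nonzero solution of degree below `e`, so the degree of the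
  -- denominator is at least `e`. It is at most `e` by the choice of `w'`.
  have hdege : ∀ w ∈ ball (0 : W) ε, δ w ≠ 0 → (Ew w).natDegree = e := by
    intro w hw hδw
    refine le_antisymm (hmax w hw) (not_lt.1 fun hlt => ?_)
    have h0 : (fun j : Fin e => (Ew w).coeff j) = 0 := by
      refine Matrix.eq_zero_of_mulVec_eq_zero hδw ?_
      funext p
      have := hlin w hw p
      rw [sum_range_eq_sum_fin heD fun k hk => by
        rw [coeff_eq_zero_of_natDegree_lt (hlt.trans_le hk), zero_mul]] at this
      simp only [Matrix.mulVec, dotProduct, Pi.zero_apply, hA]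
      rw [← this]
      exact Finset.sum_congr rfl fun j _ => mul_comm _ _
    have h1 := congrFun h0 ⟨_, hlt⟩
    rw [Pi.zero_apply, (hEmonic w hw).coeff_natDegree] at h1
    exact one_ne_zero h1
  -- The leading coefficient is `1`, so the remaining ones solve an inhomogeneous system with
  -- determinant `δ`. Cramer's rule exhibits them as holomorphic functions of `w`.
  have hsolve : ∀ w ∈ ball (0 : W) ε, δ w ≠ 0 → ∀ j : Fin e, (Ew w).coeff j =
      (((A w).submatrix r id).updateCol j fun p => -mo (r p).1 ((r p).2 + e) w).det / δ w := by
    intro w hw hδw j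
    have h1 : ((A w).submatrix r id).mulVec (fun j : Fin e => (Ew w).coeff j) =
        fun p => -mo (r p).1 ((r p).2 + e) w := by
      funext p
      have := hlin w hw p
      have hsplit : ∑ j ∈ Finset.range (D + 1), (Ew w).coeff j * mo (r p).1 ((r p).2 + j) w =
          ∑ j ∈ Finset.range (e + 1), (Ew w).coeff j * mo (r p).1 ((r p).2 + j) w := by
        refine (Finset.sum_subset (fun k hk => ?_) fun k _ hk => ?_).symm
        · simp only [Finset.mem_range] at *; omega
        · rw [coeff_eq_zero_of_natDegree_lt, zero_mul]
          rw [hdege w hw hδw]; simp only [Finset.mem_range] at hk; omega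
      have hone : (Ew w).coeff e = 1 := by
        rw [← hdege w hw hδw]; exact (hEmonic w hw).coeff_natDegree
      rw [hsplit, Finset.sum_range_succ, hone, one_mul, ← Fin.sum_univ_eq_sum_range
        (fun j => (Ew w).coeff j * mo (r p).1 ((r p).2 + j) w)] at this
      rw [← eq_neg_iff_add_eq_zero] at this
      rw [← this]
      simp only [Matrix.mulVec, dotProduct, Matrix.submatrix_apply, hA]
      exact Finset.sum_congr rfl fun j _ => mul_comm _ _
    rw [← h1, ← Matrix.cramer_apply, Matrix.cramer_eq_adjugate_mulVec, Matrix.mulVec_mulVec,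
      Matrix.adjugate_mul, Matrix.smul_mulVec, Matrix.one_mulVec, Pi.smul_apply, smul_eq_mul,
      mul_div_cancel_left₀ _ hδw]
  have hroot : ∀ w ∈ ball (0 : W) ε, ∀ z, (Ew w).IsRoot z → ‖z‖ < ρ := fun w hw z hz =>
    norm_lt_of_denom_isRoot (hsl w hw) (hsl w hw i₀) (hne w hw) (hPmonic w).ne_zero (hPmem w hw) hz
  have hext : ∀ j : Fin e, ∃ c' : W → ℂ, DifferentiableOn ℂ c' (ball 0 ε) ∧
      ∀ w ∈ ball (0 : W) ε, δ w ≠ 0 → c' w = (Ew w).coeff j := by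
    intro j
    -- The bound comes from the roots: they all have modulus less than `ρ`, and the coefficients are
    -- elementary symmetric functions of them.
    refine exists_riemann_extension isOpen_ball (convex_ball _ _) hδd hw' hr ?_
      (M := ρ ^ (e - j) * e.choose j) fun w hw hδw => ?_
    · intro w hw hδw
      have hO : IsOpen (ball (0 : W) ε ∩ δ ⁻¹' {0}ᶜ) :=
        hδd.continuousOn.isOpen_inter_preimage isOpen_ball isOpen_compl_singleton
      have hd : DifferentiableOn ℂ (fun w => (((A w).submatrix r id).updateCol j
          fun p => -mo (r p).1 ((r p).2 + e) w).det / δ w) (ball (0 : W) ε ∩ δ ⁻¹' {0}ᶜ) := by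
        refine differentiableOn_div (differentiableOn_det fun i k => ?_)
          (hδd.mono inter_subset_left) fun z hz => hz.2
        simp only [Matrix.updateCol_apply]
        split_ifs
        · exact ((hmod _ _).mono inter_subset_left).neg
        · exact (hmod _ _).mono inter_subset_left
      refine (hd.differentiableAt (hO.mem_nhds ⟨hw, hδw⟩)).congr_of_eventuallyEq ?_
      filter_upwards [hO.mem_nhds ⟨hw, hδw⟩] with z hz using hsolve z hz.1 hz.2 j
    · have := coeff_le_of_roots_le (f := RingHom.id ℂ) (B := ρ) (p := Ew w) j (hEmonic w hw)
        (IsAlgClosed.splits _) (by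
          intro z hz
          rw [Polynomial.map_id] at hz
          exact (hroot w hw z (isRoot_of_mem_roots hz)).le)
      rwa [Polynomial.map_id, hdege w hw hδw] at this
  choose c hc hce using hext
  refine ⟨e, c, δ, w', hc, hδd, hw', hr, fun w hw hδw => ⟨hdege w hw hδw, fun t => ?_⟩⟩
  rw [eval_eq_sum_range, hdege w hw hδw, Finset.sum_range_succ, add_comm]
  congr 1
  · rw [← hdege w hw hδw, (hEmonic w hw).coeff_natDegree, one_mul]
  · rw [← Fin.sum_univ_eq_sum_range (fun j => (Ew w).coeff j * t ^ j)]
    exact Finset.sum_congr rfl fun j _ => by rw [hce j w hw hδw]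

theorem not_eventually_zero_of_pow_add_sum (e : ℕ) (c : Fin e → ℂ) (t : ℂ) :
    ¬ ∀ᶠ s in 𝓝 t, s ^ e + ∑ j : Fin e, c j * s ^ (j : ℕ) = 0 := by
  intro h
  set p : ℂ[X] := X ^ e + ∑ j : Fin e, C (c j) * X ^ (j : ℕ) with hp
  have hpe : ∀ s, p.eval s = s ^ e + ∑ j : Fin e, c j * s ^ (j : ℕ) := fun s => by
    simp [hp, eval_finsetSum]
  have hdeg : (∑ j : Fin e, C (c j) * X ^ (j : ℕ)).degree < (e : WithBot ℕ) := by
    exact degree_sum_fin_lt _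
  have hp0 : p ≠ 0 := (monic_X_pow_add (by simpa using hdeg)).ne_zero
  have hfin : {s | p.IsRoot s}.Finite := finite_setOfPred_isRoot hp0
  have h2 : ∀ᶠ s in 𝓝[≠] t, p.IsRoot s := by
    filter_upwards [eventually_nhdsWithin_of_eventually_nhds h] with s hs
    rw [IsRoot, hpe, hs]
  have h3 : ∀ᶠ s in 𝓝[≠] t, ¬ p.IsRoot s := by
    rw [eventually_nhdsWithin_iff]
    have h4 : IsClosed ({s | p.IsRoot s} \ {t}) := (hfin.subset sdiff_subset).isClosed
    filter_upwards [h4.isOpen_compl.mem_nhds (fun h => h.2 rfl : t ∉ {s | p.IsRoot s} \ {t})]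
      with s hs hst hr
    exact hs ⟨hr, hst⟩
  obtain ⟨s, hs, hs'⟩ := (h2.and h3).exists
  exact hs' hs

/-- The common denominator `Q` of the quotients `f i / f i₀` is a monic polynomial in the last
variable with holomorphic coefficients. The common divisor is `g = f i₀ / Q` and the cofactors are
`q i = Q * f i / f i₀`. Both are defined by Cauchy integrals over `‖ζ‖ = ρ₁`, where neither `Q` nor
`f i₀` vanishes; the identities hold on generic slices and extend by density. -/
theorem exists_primitive_factorization_prod {ι : Type*} [Finite ι] {f : ι → W × ℂ → ℂ}
    {Ω : Set (W × ℂ)} (hΩ : IsOpen Ω) (h0 : (0, 0) ∈ Ω) (hf : ∀ i, DifferentiableOn ℂ (f i) Ω)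
    (i₀ : ι) (hne : ¬ ∀ᶠ t in 𝓝 (0 : ℂ), f i₀ (0, t) = 0) :
    ∃ (U : Set (W × ℂ)) (g : W × ℂ → ℂ) (q : ι → W × ℂ → ℂ), IsOpen U ∧ (0, 0) ∈ U ∧
      DifferentiableOn ℂ g U ∧ (∀ i, DifferentiableOn ℂ (q i) U) ∧
      (∀ z ∈ U, ∀ i, f i z = g z * q i z) ∧ ∀ z ∈ U, IsPrimitiveAt q z := by
  obtain ⟨ε, ρ, ρ₁, R, hε, hρ, hρ₁, hρR, hsub, hnz, D, hD⟩ := exists_polydisc hΩ h0 (hf i₀) hne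
  have hfV : ∀ i, DifferentiableOn ℂ (f i) (ball 0 ε ×ˢ ball 0 R) := fun i => (hf i).mono hsub
  obtain ⟨e, c, δ, w', hc, hδ, hw', hδw', hE⟩ :=
    exists_holomorphic_denom hε hρ hρ₁ hρR hfV hnz hD
  set B := ball (0 : W) ε with hB
  have hBo : IsOpen B := isOpen_ball
  have hBc : Convex ℝ B := convex_ball _ _
  have hρ₁0 : 0 < ρ₁ := hρ.trans hρ₁
  have hδf : ∀ w ∈ B, ∃ᶠ z in 𝓝 w, δ z ≠ 0 := fun w hw =>
    frequently_ne_zero_of_ne_zero hBo hBc hδ hw' hδw' hw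
  set Q : W × ℂ → ℂ := fun p => p.2 ^ e + ∑ j : Fin e, c j p.1 * p.2 ^ (j : ℕ) with hQ
  have hQd : DifferentiableOn ℂ Q (B ×ˢ (univ : Set ℂ)) := by
    refine DifferentiableOn.add (by fun_prop) (DifferentiableOn.fun_sum fun j _ => ?_)
    exact ((hc j).comp (by fun_prop) fun p hp => hp.1).mul (by fun_prop)
  have hsl : ∀ w ∈ B, ∀ i, DifferentiableOn ℂ (fun t => f i (w, t)) (ball 0 R) :=
    fun w hw i => (hfV i).comp (by fun_prop) fun t ht => ⟨hw, ht⟩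
  have hPex : ∀ w ∈ B, ∃ P : ℂ[X], P ≠ 0 ∧
      P ∈ denomIdeal R (fun i t => f i (w, t)) (fun t => f i₀ (w, t)) ∧ ∃ u : ℂ → ℂ,
      DifferentiableOn ℂ u (ball 0 R) ∧ ∀ t ∈ ball (0 : ℂ) R, f i₀ (w, t) = P.eval t * u t := by
    intro w hw
    obtain ⟨s, u, -, hu, hu0, hfu, -⟩ := hD w hw
    refine ⟨(s.map fun a => X - C a).prod, (monic_multiset_prod_of_monic _ _ fun a _ =>
      monic_X_sub_C a).ne_zero, fun i => ⟨fun t => f i (w, t) / u t, (hsl w hw i).div hu hu0,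
      fun t ht => ?_⟩, u, hu, hfu⟩
    beta_reduce
    rw [hfu t ht]
    field_simp [hu0 t ht]
  -- On slices with `δ ≠ 0` the polynomial `Q` is the denominator itself and `norm_eval_ge_of_roots`
  -- applies. Such slices accumulate at every `w`, and the bound passes to the limit.
  have hQ0 : ∀ w ∈ B, ∀ t, ρ < ‖t‖ → Q (w, t) ≠ 0 := by
    intro w hw t ht h0
    have hcont : ContinuousAt (fun w => Q (w, t)) w := by
      have : DifferentiableAt ℂ Q (w, t) := hQd.differentiableAt
        ((hBo.prod isOpen_univ).mem_nhds ⟨hw, mem_univ _⟩)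
      exact ContinuousAt.comp (f := fun w : W => (w, t)) this.continuousAt (by fun_prop)
    have hpos : 0 < (‖t‖ - ρ) ^ e := pow_pos (by linarith) _
    have hev : ∀ᶠ z in 𝓝 w, ‖Q (z, t)‖ < (‖t‖ - ρ) ^ e :=
      hcont.norm.eventually_lt continuousAt_const (by simpa [h0] using hpos)
    obtain ⟨z, hδz, hz, hzB⟩ := ((hδf w hw).and_eventually (hev.and (hBo.mem_nhds hw))).exists
    obtain ⟨hdeg, heval⟩ := hE z hzB hδz
    obtain ⟨P, hP0, hPm, -⟩ := hPex z hzB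
    have := norm_eval_ge_of_roots (monic_denom hP0 hPm) (fun x hx => norm_lt_of_denom_isRoot
      (hsl z hzB) (hsl z hzB i₀) (hnz z hzB) hP0 hPm hx) ht.le
    rw [hdeg, heval] at this
    exact absurd hz (not_lt.2 this)
  have hQf : ∀ w ∈ B, ∀ t, ¬ ∀ᶠ s in 𝓝 t, Q (w, s) = 0 := fun w _ t =>
    not_eventually_zero_of_pow_add_sum e (fun j => c j w) t
  have hVo : IsOpen (B ×ˢ ball (0 : ℂ) R) := hBo.prod isOpen_ball
  have hsphR : ∀ ζ ∈ sphere (0 : ℂ) ρ₁, ζ ∈ ball (0 : ℂ) R := fun ζ hζ =>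
    closedBall_subset_ball hρR (sphere_subset_closedBall hζ)
  have hsphn : ∀ ζ ∈ sphere (0 : ℂ) ρ₁, ‖ζ‖ = ρ₁ := fun ζ hζ => mem_sphere_zero_iff_norm.1 hζ
  have hΩ₁ : IsOpen ((B ×ˢ ball (0 : ℂ) R) ∩ Q ⁻¹' {0}ᶜ) :=
    (hQd.mono (Set.prod_mono Subset.rfl (subset_univ _))).continuousOn.isOpen_inter_preimage hVo
      isOpen_compl_singleton
  have hΩ₂ : IsOpen ((B ×ˢ ball (0 : ℂ) R) ∩ f i₀ ⁻¹' {0}ᶜ) :=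
    (hfV i₀).continuousOn.isOpen_inter_preimage hVo isOpen_compl_singleton
  have hQd' : DifferentiableOn ℂ Q (B ×ˢ ball (0 : ℂ) R) :=
    hQd.mono (Set.prod_mono Subset.rfl (subset_univ _))
  have hφ₁ : DifferentiableOn ℂ (fun p => f i₀ p / Q p) ((B ×ˢ ball (0 : ℂ) R) ∩ Q ⁻¹' {0}ᶜ) :=
    differentiableOn_div ((hfV i₀).mono inter_subset_left) (hQd'.mono inter_subset_left)
      fun p hp => hp.2
  have hφ₂ : ∀ i, DifferentiableOn ℂ (fun p => Q p * f i p / f i₀ p)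
      ((B ×ˢ ball (0 : ℂ) R) ∩ f i₀ ⁻¹' {0}ᶜ) := fun i =>
    differentiableOn_div ((hQd'.mul (hfV i)).mono inter_subset_left)
      ((hfV i₀).mono inter_subset_left) fun p hp => hp.2
  set g : W × ℂ → ℂ := fun p => (2 * Real.pi * Complex.I : ℂ)⁻¹ •
      ∮ ζ in C(0, ρ₁), (ζ - p.2)⁻¹ • (f i₀ (p.1, ζ) / Q (p.1, ζ)) with hg
  set q : ι → W × ℂ → ℂ := fun i p => (2 * Real.pi * Complex.I : ℂ)⁻¹ •
      ∮ ζ in C(0, ρ₁), (ζ - p.2)⁻¹ • (Q (p.1, ζ) * f i (p.1, ζ) / f i₀ (p.1, ζ)) with hq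
  set U : Set (W × ℂ) := B ×ˢ ball (0 : ℂ) ρ₁ with hU
  have hUo : IsOpen U := hBo.prod isOpen_ball
  have hUV : U ⊆ B ×ˢ ball (0 : ℂ) R := Set.prod_mono Subset.rfl (ball_subset_ball hρR.le)
  have hgd : DifferentiableOn ℂ g U := by
    rintro ⟨w, t⟩ ⟨hw, ht⟩
    exact (differentiableAt_cauchyKernel (φ := fun p => f i₀ p / Q p) hΩ₁ hφ₁ hρ₁0
      (fun ζ hζ => ⟨⟨hw, hsphR ζ hζ⟩, hQ0 w hw ζ (by rw [hsphn ζ hζ]; exact hρ₁)⟩)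
      ht).differentiableWithinAt
  have hqd : ∀ i, DifferentiableOn ℂ (q i) U := by
    rintro i ⟨w, t⟩ ⟨hw, ht⟩
    exact (differentiableAt_cauchyKernel (φ := fun p => Q p * f i p / f i₀ p) hΩ₂ (hφ₂ i) hρ₁0
      (fun ζ hζ => ⟨⟨hw, hsphR ζ hζ⟩, hnz w hw ζ (hsphR ζ hζ) (by rw [hsphn ζ hζ]; exact hρ₁.le)⟩)
      ht).differentiableWithinAt
  have hslice : ∀ w ∈ B, δ w ≠ 0 → (∀ t ∈ ball (0 : ℂ) ρ₁, f i₀ (w, t) = Q (w, t) * g (w, t)) ∧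
      (∀ i, ∀ t ∈ ball (0 : ℂ) ρ₁, Q (w, t) * f i (w, t) = f i₀ (w, t) * q i (w, t)) ∧
      ∀ t ∈ ball (0 : ℂ) ρ₁, Q (w, t) = 0 → ∃ i, q i (w, t) ≠ 0 := by
    intro w hw hδw
    obtain ⟨hdeg, heval⟩ := hE w hw hδw
    obtain ⟨P, hP0, hPm, u, hu, hfu⟩ := hPex w hw
    have hQe : ∀ t, Q (w, t) =
      (denom R (fun i t => f i (w, t)) fun t => f i₀ (w, t)).eval t := fun t => (heval t).symm
    obtain ⟨b, hb⟩ := denom_dvd_iff.2 hPm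
    have hfac : ∀ t ∈ ball (0 : ℂ) R, f i₀ (w, t) = Q (w, t) * (b.eval t * u t) := by
      intro t ht
      rw [hfu t ht, hQe, hb, eval_mul, mul_assoc]
    choose h hh he using denom_mem (R := R) (φ := fun i t => f i (w, t))
      (φ₀ := fun t => f i₀ (w, t))
    have hqh : ∀ i, ∀ t ∈ ball (0 : ℂ) ρ₁, q i (w, t) = h i t := by
      intro i t ht
      have h1 := ((hh i).mono (closedBall_subset_ball hρR)).circleIntegral_sub_inv_smul ht
      have h2 : (∮ ζ in C(0, ρ₁), (ζ - t)⁻¹ • (Q (w, ζ) * f i (w, ζ) / f i₀ (w, ζ))) =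
          ∮ ζ in C(0, ρ₁), (ζ - t)⁻¹ • h i ζ := by
        refine circleIntegral.integral_congr hρ₁0.le fun ζ hζ => ?_
        have h3 := hnz w hw ζ (hsphR ζ hζ) (by rw [hsphn ζ hζ]; exact hρ₁.le)
        have h4 := he i ζ (hsphR ζ hζ)
        rw [← hQe] at h4
        simp only [h4, mul_div_cancel_left₀ _ h3]
      simp only [hq]
      rw [h2, h1, smul_smul, inv_mul_cancel₀ Complex.two_pi_I_ne_zero, one_smul]
    refine ⟨fun t ht => ?_, fun i t ht => ?_, fun t ht h0 => ?_⟩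
    · have hd : DifferentiableOn ℂ (fun t => b.eval t * u t) (ball 0 R) :=
        b.differentiable.differentiableOn.mul hu
      have h1 := (hd.mono (closedBall_subset_ball hρR)).circleIntegral_sub_inv_smul ht
      have h2 : (∮ ζ in C(0, ρ₁), (ζ - t)⁻¹ • (f i₀ (w, ζ) / Q (w, ζ))) =
          ∮ ζ in C(0, ρ₁), (ζ - t)⁻¹ • (b.eval ζ * u ζ) := by
        refine circleIntegral.integral_congr hρ₁0.le fun ζ hζ => ?_
        have h3 := hQ0 w hw ζ (by rw [hsphn ζ hζ]; exact hρ₁)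
        simp only [hfac ζ (hsphR ζ hζ), mul_div_cancel_left₀ _ h3]
      rw [hfac t (ball_subset_ball hρR.le ht)]
      simp only [hg]
      rw [h2, h1, smul_smul, inv_mul_cancel₀ Complex.two_pi_I_ne_zero, one_smul]
    · rw [hqh i t ht, hQe, he i t (ball_subset_ball hρR.le ht)]
    · obtain ⟨i, hi⟩ := exists_ne_zero_of_denom_isRoot (hsl w hw) (hsl w hw i₀) hP0 hPm
        (w := t) (by rw [IsRoot, ← hQe, h0]) hh he
      exact ⟨i, by rwa [hqh i t ht]⟩
  clear_value g q
  have hfg : ∀ z ∈ U, f i₀ z = Q z * g z := by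
    rintro ⟨w, t⟩ hz
    refine eq_of_frequently_eq (((hfV i₀).mono hUV).differentiableAt
      (hUo.mem_nhds hz)).continuousAt (((hQd'.mono hUV).mul hgd).differentiableAt
      (hUo.mem_nhds hz)).continuousAt ?_
    exact ((frequently_nhds_prod_of_left (y := t) (hδf w hz.1)).and_eventually
      (hUo.mem_nhds hz)).mono fun p hp => (hslice p.1 hp.2.1 hp.1).1 p.2 hp.2.2
  have hQq : ∀ i, ∀ z ∈ U, Q z * f i z = f i₀ z * q i z := by
    rintro i ⟨w, t⟩ hz
    refine eq_of_frequently_eq (((hQd'.mul (hfV i)).mono hUV).differentiableAt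
      (hUo.mem_nhds hz)).continuousAt ((((hfV i₀).mono hUV).mul (hqd i)).differentiableAt
      (hUo.mem_nhds hz)).continuousAt ?_
    exact ((frequently_nhds_prod_of_left (y := t) (hδf w hz.1)).and_eventually
      (hUo.mem_nhds hz)).mono fun p hp => (hslice p.1 hp.2.1 hp.1).2.1 i p.2 hp.2.2
  have hQfr : ∀ z ∈ U, ∃ᶠ y in 𝓝 z, Q y ≠ 0 := by
    rintro ⟨w, t⟩ hz
    exact frequently_nhds_prod_of_right (not_eventually.1 (hQf w hz.1 t))
  have hfq : ∀ i, ∀ z ∈ U, f i z = g z * q i z := fun i =>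
    eq_of_mul_eq_mul_of_frequently hUo ((hfV i).mono hUV).continuousOn
      (hgd.mul (hqd i)).continuousOn hQfr fun z hz => by
        show Q z * f i z = Q z * (g z * q i z)
        rw [hQq i z hz, hfg z hz, mul_assoc]
  have hfi₀ : ∀ w ∈ B, ∀ t ∈ ball (0 : ℂ) R, ¬ ∀ᶠ s in 𝓝 t, f i₀ (w, s) = 0 := by
    intro w hw t ht h
    have hm : (ρ : ℂ) ∈ ball (0 : ℂ) R := by
      simpa [abs_of_pos hρ] using hρ₁.trans hρR
    exact hnz w hw ρ hm (by simp [abs_of_pos hρ])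
      (eqOn_zero_of_eventually_eq_zero isOpen_ball (convex_ball _ _) (hsl w hw i₀) ht h _ hm)
  -- Hence at points where `Q` does not vanish the member `q i₀` is nonzero. At zeros of `Q` on
  -- generic slices, minimality of the denominator provides another nonzero member.
  have hqQ : ∀ z ∈ U, q i₀ z = Q z := by
    refine eq_of_mul_eq_mul_of_frequently (b := f i₀) hUo (hqd i₀).continuousOn
      (hQd'.mono hUV).continuousOn ?_ fun z hz => by rw [← hQq i₀ z hz, mul_comm]
    rintro ⟨w, t⟩ hz
    exact frequently_nhds_prod_of_right (not_eventually.1 (hfi₀ w hz.1 t (hUV hz).2))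
  refine ⟨U, g, q, hUo, ⟨mem_ball_self hε, mem_ball_self hρ₁0⟩, hgd, hqd,
    fun z hz i => hfq i z hz, fun z hz => ?_⟩
  refine isPrimitiveAt_of_generic hBo hBc isOpen_ball hδ hw' hδw' hqd i₀ ?_ ?_ hz
  · intro w hw t ht h
    refine hQf w hw t ?_
    filter_upwards [h, isOpen_ball.mem_nhds ht] with s hs hsb
    rw [← hqQ (w, s) ⟨hw, hsb⟩, hs]
  · intro w hw hδw t ht
    by_cases h0 : Q (w, t) = 0
    · exact (hslice w hw hδw).2.2 t ht h0
    · exact ⟨i₀, by rwa [hqQ (w, t) ⟨hw, ht⟩]⟩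

variable {E : Type*} [NormedAddCommGroup E] [NormedSpace ℂ E] [FiniteDimensional ℂ E]

/-- Locally, a finite family of holomorphic functions is a multiple of a primitive one. -/
theorem exists_primitive_factorization [Nontrivial E] {ι : Type*} [Finite ι] {f : ι → E → ℂ}
    {z₀ : E} (hf : ∀ i, HolAt (f i) z₀) (i₀ : ι) (hne : ∃ᶠ z in 𝓝 z₀, f i₀ z ≠ 0) :
    ∃ (U : Set E) (g : E → ℂ) (q : ι → E → ℂ), IsOpen U ∧ z₀ ∈ U ∧
      DifferentiableOn ℂ g U ∧ (∀ i, DifferentiableOn ℂ (q i) U) ∧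
      (∀ z ∈ U, ∀ i, f i z = g z * q i z) ∧ ∀ z ∈ U, IsPrimitiveAt q z := by
  obtain ⟨r, hr, hΩ⟩ := Metric.mem_nhds_iff.1 (eventually_all.2 hf)
  have hfd : ∀ i, DifferentiableOn ℂ (f i) (ball z₀ r) := fun i z hz =>
    (hΩ hz i).differentiableWithinAt
  -- The last coordinate axis has to be a direction in which `f i₀` does not vanish identically. If
  -- `f i₀ z₀ = 0`, it points to a nearby nonzero of `f i₀`; otherwise any `v ≠ 0` will do.
  obtain ⟨v, hv, hvf⟩ : ∃ v : E, v ≠ 0 ∧ ¬ ∀ᶠ s in 𝓝 (0 : ℂ), f i₀ (z₀ + s • v) = 0 := by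
    by_cases h0 : f i₀ z₀ = 0
    · obtain ⟨z, hz, hzr⟩ := (hne.and_eventually (ball_mem_nhds z₀ hr)).exists
      refine ⟨z - z₀, fun h => hz (by rw [sub_eq_zero.1 h, h0]), fun h => hz ?_⟩
      let ℓ : ℂ → E := fun s => z₀ + s • (z - z₀)
      have hT : IsOpen (ℓ ⁻¹' ball z₀ r) := isOpen_ball.preimage (by fun_prop)
      have hn : ∀ s : ℂ, s ∈ ℓ ⁻¹' ball z₀ r ↔ ‖s‖ * ‖z - z₀‖ < r := fun s => by
        simp [ℓ, norm_smul]
      have hcT : Convex ℝ (ℓ ⁻¹' ball z₀ r) := by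
        intro s hs t ht a b ha hb hab
        rw [hn] at *
        have : ‖a • s + b • t‖ ≤ a * ‖s‖ + b * ‖t‖ := by
          refine (norm_add_le _ _).trans ?_
          rw [norm_smul, norm_smul, Real.norm_of_nonneg ha, Real.norm_of_nonneg hb]
        have h3 : a * (‖s‖ * ‖z - z₀‖) + b * (‖t‖ * ‖z - z₀‖) < r := by
          rcases ha.eq_or_lt with rfl | ha'
          · obtain rfl : b = 1 := by linarith
            linarith
          · nlinarith
        nlinarith [norm_nonneg (z - z₀)]
      have := eqOn_zero_of_eventually_eq_zero hT hcT
        ((hfd i₀).comp (t := ball z₀ r) (f := ℓ) (by fun_prop) fun s hs => hs)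
        (show (0 : ℂ) ∈ _ by rw [hn]; simpa using hr) h 1 (by
          rw [hn]; simpa [dist_eq_norm] using hzr)
      simpa [ℓ] using this
    · obtain ⟨v, hv⟩ := exists_ne (0 : E)
      exact ⟨v, hv, fun h => h0 (by simpa using h.self_of_nhds)⟩
  obtain ⟨ℓ, hℓ⟩ := SeparatingDual.exists_eq_one (R := ℂ) hv
  -- A functional with `ℓ v = 1` splits off the line of `v` as the second factor.
  let L : E ≃L[ℂ] ℓ.ker × ℂ := (ContinuousLinearEquiv.equivOfRightInverse ℓ
    ((ContinuousLinearMap.id ℂ ℂ).smulRight v) (fun t => by simp [hℓ])).trans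
    (ContinuousLinearEquiv.prodComm ℂ _ _)
  have hL : ∀ t : ℂ, L.symm (0, t) = t • v := fun t => by simp [L]
  let T : E → ℓ.ker × ℂ := fun z => L (z - z₀)
  let T' : ℓ.ker × ℂ → E := fun p => z₀ + L.symm p
  have hT : Continuous T := by fun_prop
  have hT' : Continuous T' := by fun_prop
  have hTd : Differentiable ℂ T := by fun_prop
  have hTd' : Differentiable ℂ T' := by fun_prop
  have hTT' : ∀ p, T (T' p) = p := fun p => by simp [T, T']
  have hT'T : ∀ z, T' (T z) = z := fun z => by simp [T, T']
  obtain ⟨U, g, q, hU, h0U, hg, hq, hfq, hprim⟩ := exists_primitive_factorization_prod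
    (f := fun i p => f i (T' p)) (Ω := T' ⁻¹' ball z₀ r) (isOpen_ball.preimage hT')
    (by show T' 0 ∈ ball z₀ r; simpa [T'] using hr) (fun i => (hfd i).comp hTd'.differentiableOn fun p hp => hp) i₀ (by
      have : ∀ t : ℂ, T' (0, t) = z₀ + t • v := fun t => by simp only [T', hL]
      simpa only [this] using hvf)
  have hcompT : ∀ {a : E → ℂ} {y : E}, HolAt a y → HolAt (a ∘ T') (T y) := by
    intro a y ha
    have : Tendsto T' (𝓝 (T y)) (𝓝 y) := by simpa only [hT'T] using hT'.tendsto (T y)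
    filter_upwards [this.eventually ha] with p hp using hp.comp p (hTd' p)
  refine ⟨T ⁻¹' U, g ∘ T, fun i => q i ∘ T, hU.preimage hT, by
    show T z₀ ∈ U
    have : T z₀ = 0 := by simp [T]
    rw [this]; exact h0U,
    hg.comp hTd.differentiableOn fun z hz => hz,
    fun i => (hq i).comp hTd.differentiableOn fun z hz => hz, fun z hz i => ?_, fun y hy => ?_⟩
  · have := hfq (T z) hz i
    rwa [hT'T] at this
  · intro a b ha hb hb0 H
    have t1 : Tendsto T' (𝓝 (T y)) (𝓝 y) := by simpa only [hT'T] using hT'.tendsto (T y)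
    have t2 : Tendsto T (𝓝 y) (𝓝 (T y)) := hT.tendsto y
    obtain ⟨h, hh, he⟩ := hprim (T y) hy (a ∘ T') (b ∘ T') (hcompT ha) (hcompT hb)
      (by
        refine t2.frequently (p := fun p => (b ∘ T') p ≠ 0) ?_
        simpa only [Function.comp_apply, hT'T] using hb0) fun i => by
        obtain ⟨h, hh, he⟩ := H i
        refine ⟨h ∘ T', hcompT hh, ?_⟩
        filter_upwards [t1.eventually he] with p hp
        simpa only [Function.comp_apply, hTT'] using hp
    refine ⟨h ∘ T, ?_, ?_⟩
    · filter_upwards [t2.eventually hh] with z hz using hz.comp z (hTd z)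
    · filter_upwards [t2.eventually he] with z hz
      simpa only [Function.comp_apply, hT'T] using hz

end PrimitiveExistence

/-! ### Holomorphic functions on a complex manifold -/

section HolomorphicFunctions

variable {n : ℕ} {M : Type*} [TopologicalSpace M]
  [ChartedSpace (EuclideanSpace ℝ (Fin (2 * n))) M]

section Chart

variable {J : ∀ x : M, Tan n x →L[ℝ] Tan n x} {φ : OpenPartialHomeomorph M (Fin n → ℂ)}

theorem IsHolChart.contMDiffAt (hφ : IsHolChart J φ) {y : M} (hy : y ∈ φ.source) :
    ContMDiffAt (𝓡 (2 * n)) 𝓘(ℝ, Fin n → ℂ) ∞ φ y :=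
  hφ.smooth.contMDiffAt (φ.open_source.mem_nhds hy)

theorem IsHolChart.contMDiffAt_symm (hφ : IsHolChart J φ) {z : Fin n → ℂ} (hz : z ∈ φ.target) :
    ContMDiffAt 𝓘(ℝ, Fin n → ℂ) (𝓡 (2 * n)) ∞ φ.symm z :=
  hφ.smooth_symm.contMDiffAt (φ.open_target.mem_nhds hz)

theorem IsHolChart.mdifferentiableAt (hφ : IsHolChart J φ) {y : M} (hy : y ∈ φ.source) :
    MDifferentiableAt (𝓡 (2 * n)) 𝓘(ℝ, Fin n → ℂ) φ y :=
  (hφ.contMDiffAt hy).mdifferentiableAt (by simp)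

theorem IsHolChart.mdifferentiableAt_symm (hφ : IsHolChart J φ) {z : Fin n → ℂ}
    (hz : z ∈ φ.target) : MDifferentiableAt 𝓘(ℝ, Fin n → ℂ) (𝓡 (2 * n)) φ.symm z :=
  (hφ.contMDiffAt_symm hz).mdifferentiableAt (by simp)

theorem IsHolChart.contMDiffAt_iff (hφ : IsHolChart J φ) {y : M} (hy : y ∈ φ.source)
    {E : Type*} [NormedAddCommGroup E] [NormedSpace ℝ E] {f : M → E} :
    ContMDiffAt (𝓡 (2 * n)) 𝓘(ℝ, E) ∞ f y ↔ ContDiffAt ℝ ∞ (f ∘ φ.symm) (φ y) := by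
  rw [← contMDiffAt_iff_contDiffAt]
  constructor
  · intro h
    exact ContMDiffAt.comp_of_eq h (hφ.contMDiffAt_symm (φ.map_source hy)) (φ.left_inv hy)
  · intro h
    refine (h.comp y (hφ.contMDiffAt hy)).congr_of_eventuallyEq ?_
    filter_upwards [φ.open_source.mem_nhds hy] with z hz
    simp [φ.left_inv hz]

theorem IsHolChart.fderiv_apply (hφ : IsHolChart J φ) {y : M} (hy : y ∈ φ.source)
    {E : Type*} [NormedAddCommGroup E] [NormedSpace ℝ E] {f : M → E}
    (hf : MDifferentiableAt (𝓡 (2 * n)) 𝓘(ℝ, E) f y) (v : Tan n y) :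
    fderiv ℝ (f ∘ φ.symm) (φ y) (diffCn φ y v) = mfderiv (𝓡 (2 * n)) 𝓘(ℝ, E) f y v := by
  have h1 : MDifferentiableAt 𝓘(ℝ, Fin n → ℂ) 𝓘(ℝ, E) (f ∘ φ.symm) (φ y) :=
    MDifferentiableAt.comp_of_eq (φ y) hf (hφ.mdifferentiableAt_symm (φ.map_source hy))
      (φ.left_inv hy)
  have h2 : f =ᶠ[𝓝 y] (f ∘ φ.symm) ∘ φ := by
    filter_upwards [φ.open_source.mem_nhds hy] with z hz
    simp [φ.left_inv hz]
  rw [h2.mfderiv_eq, mfderiv_comp y h1 (hφ.mdifferentiableAt hy), mfderiv_eq_fderiv]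
  rfl

theorem IsHolChart.diffCn_surjective (hφ : IsHolChart J φ) {y : M} (hy : y ∈ φ.source) :
    Function.Surjective (diffCn φ y) := by
  intro w
  have hz := φ.map_source hy
  have h2 : (φ ∘ φ.symm) =ᶠ[𝓝 (φ y)] id := by
    filter_upwards [φ.open_target.mem_nhds hz] with z hz
    simp [φ.right_inv hz]
  have h3 := mfderiv_comp_of_eq (I := 𝓘(ℝ, Fin n → ℂ)) (I'' := 𝓘(ℝ, Fin n → ℂ))
    (hφ.mdifferentiableAt hy) (hφ.mdifferentiableAt_symm hz) (φ.left_inv hy)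
  rw [h2.mfderiv_eq, mfderiv_id] at h3
  rw [φ.left_inv hy] at h3
  exact ⟨mfderiv 𝓘(ℝ, Fin n → ℂ) (𝓡 (2 * n)) φ.symm (φ y) w, (DFunLike.congr_fun h3 w).symm⟩

end Chart

variable {I : ComplexStructure n M} {φ : OpenPartialHomeomorph M (Fin n → ℂ)}

/-- In a holomorphic chart `∂̄f = 0` says that the real derivative commutes with multiplication by
`√-1`, so it is complex linear. Conversely, complex differentiability near a point implies the
smoothness demanded in `HolFunNear`. -/
theorem holFunNear_iff (hφ : IsHolChart I.J φ) {x : M} (hx : x ∈ φ.source) {f : M → ℂ} :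
    HolFunNear I f x ↔ HolAt (f ∘ φ.symm) (φ x) := by
  have key : ∀ y ∈ φ.source, ∀ v : Tan n y,
      MDifferentiableAt (𝓡 (2 * n)) 𝓘(ℝ, ℂ) f y →
      dbar I f y v = 1 / 2 * (fderiv ℝ (f ∘ φ.symm) (φ y) (diffCn φ y v) +
        Complex.I * fderiv ℝ (f ∘ φ.symm) (φ y) (Complex.I • diffCn φ y v)) := by
    intro y hy v hf
    rw [← hφ.holomorphic y hy, hφ.fderiv_apply hy hf, hφ.fderiv_apply hy hf]
    rfl
  constructor
  · intro h
    have t : Tendsto φ.symm (𝓝 (φ x)) (𝓝 x) := φ.tendsto_symm hx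
    filter_upwards [t.eventually h, t.eventually (φ.open_source.mem_nhds hx),
      φ.open_target.mem_nhds (φ.map_source hx)] with z hz hzs hzt
    have hd := ((hφ.contMDiffAt_iff hzs).1 hz.1).differentiableAt (by simp)
    rw [φ.right_inv hzt] at hd
    refine (differentiableAt_iff_restrictScalars ℝ hd).2 ?_
    have hI : ∀ w, fderiv ℝ (f ∘ φ.symm) z (Complex.I • w) =
        Complex.I * fderiv ℝ (f ∘ φ.symm) z w := by
      intro w
      obtain ⟨v, rfl⟩ := hφ.diffCn_surjective hzs w
      have h1 := key _ hzs v (hz.1.mdifferentiableAt (by simp))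
      rw [hz.2 v, φ.right_inv hzt] at h1
      linear_combination 2 * Complex.I * h1 + (fderiv ℝ (f ∘ φ.symm) z
        (Complex.I • diffCn φ (φ.symm z) v)) * Complex.I_mul_I
    refine ⟨⟨⟨⟨fderiv ℝ (f ∘ φ.symm) z, map_add _⟩, ?_⟩, (fderiv ℝ (f ∘ φ.symm) z).cont⟩, ?_⟩
    · intro c w
      have hc : c • w = c.re • w + c.im • (Complex.I • w) := by
        rw [← Complex.coe_smul, ← Complex.coe_smul, smul_smul, ← add_smul, Complex.re_add_im]
      show fderiv ℝ (f ∘ φ.symm) z (c • w) = c • fderiv ℝ (f ∘ φ.symm) z w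
      rw [hc, map_add, map_smul, map_smul, hI, Complex.real_smul, Complex.real_smul, smul_eq_mul]
      conv_rhs => rw [← Complex.re_add_im c]
      ring
    · ext w; rfl
  · intro h
    obtain ⟨U, hU, hUo, hxU⟩ := eventually_nhds_iff.1 h
    have hcd := contDiffOn_of_differentiableOn hUo
      (fun z hz => (hU z hz).differentiableWithinAt : DifferentiableOn ℂ _ U)
    filter_upwards [φ.open_source.mem_nhds hx,
      (φ.continuousAt hx).preimage_mem_nhds (hUo.mem_nhds hxU)] with y hy hyU
    have hs : ContMDiffAt (𝓡 (2 * n)) 𝓘(ℝ, ℂ) ∞ f y :=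
      (hφ.contMDiffAt_iff hy).2 ((hcd.contDiffAt (hUo.mem_nhds hyU)).restrict_scalars ℝ)
    refine ⟨hs, fun v => ?_⟩
    rw [key y hy v (hs.mdifferentiableAt (by simp)), (hU _ hyU).fderiv_restrictScalars ℝ,
      ContinuousLinearMap.coe_restrictScalars', map_smul, smul_eq_mul, ← mul_assoc,
      Complex.I_mul_I]
    ring

theorem HolFunNear.eventually {f : M → ℂ} {x : M} (hf : HolFunNear I f x) :
    ∀ᶠ y in 𝓝 x, HolFunNear I f y := eventually_eventually_nhds.2 hf

theorem HolFunNear.smoothFunNear {f : M → ℂ} {x : M} (hf : HolFunNear I f x) :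
    SmoothFunNear n f x := hf.mono fun _ h => h.1

theorem HolFunNear.continuousAt {f : M → ℂ} {x : M} (hf : HolFunNear I f x) :
    ContinuousAt f x := hf.self_of_nhds.1.continuousAt

theorem HolFunNear.congr {f f' : M → ℂ} {x : M} (hf : HolFunNear I f x) (h : f' =ᶠ[𝓝 x] f) :
    HolFunNear I f' x := by
  obtain ⟨φ, hx, hφ⟩ := I.integrable x
  rw [holFunNear_iff hφ hx] at hf ⊢
  have t : Tendsto φ.symm (𝓝 (φ x)) (𝓝 x) := φ.tendsto_symm hx
  filter_upwards [hf, (t.eventually h).eventually_nhds] with z hz hz'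
  exact hz.congr_of_eventuallyEq hz'

theorem holFunNear_const (c : ℂ) (x : M) : HolFunNear I (fun _ => c) x := by
  obtain ⟨φ, hx, hφ⟩ := I.integrable x
  exact (holFunNear_iff hφ hx).2 (Eventually.of_forall fun z => differentiableAt_const c)

theorem HolFunNear.add {f g : M → ℂ} {x : M} (hf : HolFunNear I f x) (hg : HolFunNear I g x) :
    HolFunNear I (fun y => f y + g y) x := by
  obtain ⟨φ, hx, hφ⟩ := I.integrable x
  rw [holFunNear_iff hφ hx] at *
  filter_upwards [hf, hg] with z h1 h2 using h1.add h2

theorem HolFunNear.mul {f g : M → ℂ} {x : M} (hf : HolFunNear I f x) (hg : HolFunNear I g x) :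
    HolFunNear I (fun y => f y * g y) x := by
  obtain ⟨φ, hx, hφ⟩ := I.integrable x
  rw [holFunNear_iff hφ hx] at *
  exact HolAt.mul hf hg

theorem HolFunNear.inv {f : M → ℂ} {x : M} (hf : HolFunNear I f x) (h0 : f x ≠ 0) :
    HolFunNear I (fun y => (f y)⁻¹) x := by
  obtain ⟨φ, hx, hφ⟩ := I.integrable x
  rw [holFunNear_iff hφ hx] at *
  have : ∀ᶠ z in 𝓝 (φ x), (f ∘ φ.symm) z ≠ 0 :=
    (HolAt.continuousAt hf).eventually_ne (by simpa [φ.left_inv hx] using h0)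
  filter_upwards [hf, this] with z h1 h2 using h1.inv h2

theorem HolFunNear.neg {f : M → ℂ} {x : M} (hf : HolFunNear I f x) :
    HolFunNear I (fun y => -f y) x := by
  simpa using (holFunNear_const (-1) x).mul hf

theorem HolFunNear.sub {f g : M → ℂ} {x : M} (hf : HolFunNear I f x) (hg : HolFunNear I g x) :
    HolFunNear I (fun y => f y - g y) x := by
  simpa [sub_eq_add_neg] using hf.add hg.neg

theorem HolFunNear.sum {ι : Type*} (s : Finset ι) {f : ι → M → ℂ} {x : M}
    (hf : ∀ i ∈ s, HolFunNear I (f i) x) : HolFunNear I (fun y => ∑ i ∈ s, f i y) x := by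
  classical
  induction s using Finset.induction_on with
  | empty => simpa using holFunNear_const 0 x
  | insert a s ha ih =>
    simp only [Finset.sum_insert ha]
    exact (hf a (by simp)).add (ih fun i hi => hf i (by simp [hi]))

theorem HolFunNear.prod {ι : Type*} (s : Finset ι) {f : ι → M → ℂ} {x : M}
    (hf : ∀ i ∈ s, HolFunNear I (f i) x) : HolFunNear I (fun y => ∏ i ∈ s, f i y) x := by
  classical
  induction s using Finset.induction_on with
  | empty => simpa using holFunNear_const 1 x
  | insert a s ha ih =>
    simp only [Finset.prod_insert ha]
    exact (hf a (by simp)).mul (ih fun i hi => hf i (by simp [hi]))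

theorem HolFunNear.det {ι : Type*} [Fintype ι] [DecidableEq ι] {A : M → Matrix ι ι ℂ} {x : M}
    (hA : ∀ i j, HolFunNear I (fun y => A y i j) x) : HolFunNear I (fun y => (A y).det) x := by
  simp only [Matrix.det_apply']
  exact .sum _ fun σ _ => (holFunNear_const _ x).mul (.prod _ fun i _ => hA _ _)

/-- A holomorphic function that does not vanish identically near `x` does not vanish identically
near any point close to `x`. -/
theorem HolFunNear.eventually_frequently_ne_zero {f : M → ℂ} {x : M} (hf : HolFunNear I f x)
    (h : ∃ᶠ y in 𝓝 x, f y ≠ 0) : ∀ᶠ y in 𝓝 x, ∃ᶠ z in 𝓝 y, f z ≠ 0 := by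
  obtain ⟨φ, hx, hφ⟩ := I.integrable x
  rw [holFunNear_iff hφ hx] at hf
  obtain ⟨ρ, hρ, hb⟩ := Metric.mem_nhds_iff.1 (hf.and (φ.open_target.mem_nhds (φ.map_source hx)))
  have hpre : φ ⁻¹' Metric.ball (φ x) ρ ∈ 𝓝 x :=
    (φ.continuousAt hx).preimage_mem_nhds (Metric.ball_mem_nhds _ hρ)
  obtain ⟨q, hq, hqs, hqb⟩ := (h.and_eventually
    (inter_mem (φ.open_source.mem_nhds hx) hpre)).exists
  filter_upwards [hpre, φ.open_source.mem_nhds hx] with y hy hys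
  have h1 := frequently_ne_zero_of_ne_zero Metric.isOpen_ball (convex_ball _ _)
    (fun z hz => (hb hz).1.differentiableWithinAt) hqb
    (show (f ∘ φ.symm) (φ q) ≠ 0 by simpa [φ.left_inv hqs] using hq) hy
  have t : Tendsto φ.symm (𝓝 (φ y)) (𝓝 y) := φ.tendsto_symm hys
  exact t.frequently h1

/-- Cancellation of a holomorphic factor that does not vanish identically. -/
theorem eventuallyEq_of_mul_eq_mul {b u v : M → ℂ} {x : M} (hb : HolFunNear I b x)
    (hb0 : ∃ᶠ y in 𝓝 x, b y ≠ 0) (hu : HolFunNear I u x) (hv : HolFunNear I v x)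
    (h : ∀ᶠ y in 𝓝 x, b y * u y = b y * v y) : u =ᶠ[𝓝 x] v := by
  filter_upwards [hb.eventually_frequently_ne_zero hb0, hu.eventually, hv.eventually,
    h.eventually_nhds] with y h1 h2 h3 h4
  refine eq_of_frequently_eq h2.continuousAt h3.continuousAt ?_
  exact (h1.and_eventually h4).mono fun z hz => mul_left_cancel₀ hz.1 hz.2

theorem IsHolChart.holFunNear (hφ : IsHolChart I.J φ) {x : M} (hx : x ∈ φ.source) (i : Fin n) :
    HolFunNear I (fun y => φ y i) x := by
  rw [holFunNear_iff hφ hx]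
  filter_upwards [(φ.open_target.mem_nhds (φ.map_source hx))] with z hz
  have : (fun w : Fin n → ℂ => w i) =ᶠ[𝓝 z] (fun y => φ y i) ∘ φ.symm := by
    filter_upwards [φ.open_target.mem_nhds hz] with w hw
    simp [φ.right_inv hw]
  exact (differentiableAt_apply i z).congr_of_eventuallyEq this.symm

theorem IsHolChart.frequently_ne (hφ : IsHolChart I.J φ) {x : M} (hx : x ∈ φ.source) (i : Fin n) :
    ∃ᶠ y in 𝓝 x, φ y i - φ x i ≠ 0 := by
  have t : Tendsto (fun s : ℂ => φ.symm (φ x + Pi.single i s)) (𝓝 0) (𝓝 x) := by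
    have h1 : ContinuousAt (fun s : ℂ => φ x + Pi.single i s) 0 :=
      (continuous_const.add (continuous_single i)).continuousAt
    refine (φ.tendsto_symm hx).comp ?_
    simpa [ContinuousAt] using h1
  have h1 : ∀ᶠ s : ℂ in 𝓝 0, φ x + Pi.single i s ∈ φ.target := by
    have h1 : ContinuousAt (fun s : ℂ => φ x + Pi.single i s) 0 :=
      (continuous_const.add (continuous_single i)).continuousAt
    exact h1.eventually (by simpa using φ.open_target.mem_nhds (φ.map_source hx))
  have h2 : ∃ᶠ s : ℂ in 𝓝 0, s ≠ 0 :=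
    (eventually_mem_nhdsWithin (a := (0 : ℂ)) (s := {0}ᶜ)).frequently.filter_mono
      nhdsWithin_le_nhds
  refine t.frequently ((h2.and_eventually h1).mono fun s hs => ?_)
  rw [φ.right_inv hs.2]
  simpa using hs.1

end HolomorphicFunctions

/-! ### Primitive families, codimension two and the identity theorem on a complex manifold -/

section PrimitiveFamilies

/-- A holomorphic function that vanishes on the hyperplane `z i = 0` is divisible by `z i`. -/
theorem exists_eq_coord_mul {n : ℕ} {f : (Fin n → ℂ) → ℂ} {z₀ : Fin n → ℂ} (hf : HolAt f z₀)
    (i : Fin n) (h0 : ∀ᶠ z in 𝓝 z₀, z i = 0 → f z = 0) :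
    ∃ h, HolAt h z₀ ∧ ∀ᶠ z in 𝓝 z₀, f z = z i * h z := by
  obtain ⟨ρ, hρ, hb⟩ := Metric.mem_nhds_iff.1 (hf.and h0)
  by_cases hz : z₀ i = 0
  swap
  · refine ⟨fun z => f z / z i, ?_, ?_⟩
    · have hne : ∀ᶠ z in 𝓝 z₀, z i ≠ 0 := (continuous_apply i).continuousAt.eventually_ne hz
      filter_upwards [hf, hne] with z h1 h2
      exact h1.mul ((differentiableAt_apply i z).inv h2)
    · filter_upwards [(continuous_apply i).continuousAt.eventually_ne hz] with z h2
      field_simp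
  have hfd : DifferentiableOn ℂ f (Metric.ball z₀ ρ) := fun z hz =>
    (hb hz).1.differentiableWithinAt
  have hcd := contDiffOn_of_differentiableOn Metric.isOpen_ball hfd
  have hcont := (hcd.contDiffAt (Metric.ball_mem_nhds z₀ hρ)).continuousAt_fderiv (by simp)
  obtain ⟨δ, hδ, hδb⟩ := Metric.mem_nhds_iff.1 (inter_mem (Metric.ball_mem_nhds z₀ hρ)
    (hcont.norm.eventually_lt (continuousAt_const (y := ‖fderiv ℂ f z₀‖ + 1)) (by linarith)))
  set B := Metric.ball z₀ δ
  have hfB : DifferentiableOn ℂ f B := hfd.mono fun z hz => (hδb hz).1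
  have hB0 : ∀ z ∈ B, Function.update z i 0 ∈ B := by
    intro z hz
    rw [Metric.mem_ball, dist_pi_lt_iff hδ] at hz ⊢
    intro j
    rcases eq_or_ne j i with rfl | hj
    · simpa [hz] using hδ
    · simpa [hj] using hz j
  -- The mean value inequality between `z` and its projection to the hyperplane, at sup-norm
  -- distance at most `‖z i‖`, bounds the quotient. Riemann's theorem then extends it.
  have hbound : ∀ z ∈ B, z i ≠ 0 → ‖f z / z i‖ ≤ ‖fderiv ℂ f z₀‖ + 1 := by
    intro z hz hzi
    have h1 := (convex_ball z₀ δ).norm_image_sub_le_of_norm_fderiv_le (𝕜 := ℂ)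
      (fun w hw => (hb (hδb hw).1).1) (fun w hw => (hδb hw).2.le) (hB0 z hz) hz
    rw [(hb (hδb (hB0 z hz)).1).2 (by simp), sub_zero] at h1
    have h2 : ‖z - Function.update z i 0‖ ≤ ‖z i‖ := by
      refine (pi_norm_le_iff_of_nonneg (norm_nonneg _)).2 fun j => ?_
      rcases eq_or_ne j i with rfl | hj <;> simp [*]
    rw [norm_div, div_le_iff₀ (norm_pos_iff.2 hzi)]
    exact h1.trans (mul_le_mul_of_nonneg_left h2 (by positivity))
  have hq : Function.update z₀ i (δ / 2 : ℝ) ∈ B := by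
    rw [Metric.mem_ball, dist_pi_lt_iff hδ]
    intro j
    rcases eq_or_ne j i with rfl | hj
    · simp [hz, abs_of_pos hδ, hδ]
    · simpa [hj] using hδ
  obtain ⟨h, hh⟩ := exists_riemann_extension_near Metric.isOpen_ball (convex_ball z₀ δ)
    (δ := fun z => z i) (c := fun z => f z / z i) (by fun_prop) hq
    (by simpa using hδ.ne') (fun z hz hzi => ((hfB.differentiableAt
      (Metric.isOpen_ball.mem_nhds hz)).mul ((differentiableAt_apply i z).inv hzi))) hbound
    (Metric.mem_ball_self hδ)
  refine ⟨h, hh.mono fun z hz => hz.1, ?_⟩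
  filter_upwards [hh, h0] with z h1 h2
  by_cases h3 : z i = 0
  · rw [h2 h3, h3, zero_mul]
  · rw [h1.2 h3, mul_div_cancel₀ _ h3]

variable {n : ℕ} {M : Type*} [TopologicalSpace M]
  [ChartedSpace (EuclideanSpace ℝ (Fin (2 * n))) M] {I : ComplexStructure n M}

/-- Every meromorphic germ `a / b` at `y` for which all `a / b * q i` are holomorphic is
holomorphic. -/
def IsPrimitiveNear {ι : Type*} (I : ComplexStructure n M) (q : ι → M → ℂ) (y : M) : Prop :=
  ∀ a b : M → ℂ, HolFunNear I a y → HolFunNear I b y → (∃ᶠ z in 𝓝 y, b z ≠ 0) →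
    (∀ i, ∃ h, HolFunNear I h y ∧ ∀ᶠ z in 𝓝 y, a z * q i z = b z * h z) →
    ∃ h, HolFunNear I h y ∧ ∀ᶠ z in 𝓝 y, a z = b z * h z

theorem holFunNear_comp_iff {φ : OpenPartialHomeomorph M (Fin n → ℂ)} (hφ : IsHolChart I.J φ)
    {x : M} (hx : x ∈ φ.source) {g : (Fin n → ℂ) → ℂ} :
    HolFunNear I (g ∘ φ) x ↔ HolAt g (φ x) := by
  rw [holFunNear_iff hφ hx]
  have : ∀ᶠ z in 𝓝 (φ x), ((g ∘ φ) ∘ φ.symm) =ᶠ[𝓝 z] g := by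
    refine Eventually.eventually_nhds ?_
    filter_upwards [φ.open_target.mem_nhds (φ.map_source hx)] with z hz
    simp [φ.right_inv hz]
  constructor <;> intro h <;> filter_upwards [h, this] with z h1 h2
  · exact h1.congr_of_eventuallyEq h2.symm
  · exact h1.congr_of_eventuallyEq h2

theorem IsPrimitiveAt.isPrimitiveNear {ι : Type*} {φ : OpenPartialHomeomorph M (Fin n → ℂ)}
    (hφ : IsHolChart I.J φ) {x : M} (hx : x ∈ φ.source) {q : ι → (Fin n → ℂ) → ℂ}
    (hq : IsPrimitiveAt q (φ x)) : IsPrimitiveNear I (fun i => q i ∘ φ) x := by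
  intro a b ha hb hb0 H
  rw [holFunNear_iff hφ hx] at ha hb
  have t := φ.tendsto_symm hx
  have t' := φ.continuousAt hx
  obtain ⟨h, hh, he⟩ := hq _ _ ha hb (by
    refine t'.tendsto.frequently ((hb0.and_eventually (φ.open_source.mem_nhds hx)).mono ?_)
    intro z hz
    simpa [φ.left_inv hz.2] using hz.1) fun i => by
    obtain ⟨h, hh, he⟩ := H i
    refine ⟨h ∘ φ.symm, (holFunNear_iff hφ hx).1 hh, ?_⟩
    filter_upwards [t.eventually he, φ.open_target.mem_nhds (φ.map_source hx)] with z hz hzt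
    simpa [φ.right_inv hzt] using hz
  refine ⟨h ∘ φ, (holFunNear_comp_iff hφ hx).2 hh, ?_⟩
  filter_upwards [t'.eventually he, φ.open_source.mem_nhds hx] with z hz hzs
  simpa [φ.left_inv hzs] using hz

/-- Locally, a finite family of holomorphic functions is a multiple of a primitive one. -/
theorem exists_primitive_factorization_near (hn : 0 < n) {ι : Type*} [Finite ι] {f : ι → M → ℂ}
    {x : M} (hf : ∀ i, HolFunNear I (f i) x) (i₀ : ι) (hne : ∃ᶠ z in 𝓝 x, f i₀ z ≠ 0) :
    ∃ (μ : M → ℂ) (q : ι → M → ℂ), HolFunNear I μ x ∧ (∀ i, HolFunNear I (q i) x) ∧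
      ∀ᶠ y in 𝓝 x, (∀ i, f i y = μ y * q i y) ∧ IsPrimitiveNear I q y := by
  have : Nonempty (Fin n) := ⟨⟨0, hn⟩⟩
  obtain ⟨φ, hx, hφ⟩ := I.integrable x
  obtain ⟨U, g, q, hU, hxU, hg, hq, hfq, hprim⟩ := exists_primitive_factorization
    (fun i => (holFunNear_iff hφ hx).1 (hf i)) i₀ (by
      refine (φ.continuousAt hx).tendsto.frequently ((hne.and_eventually
        (φ.open_source.mem_nhds hx)).mono fun z hz => ?_)
      simpa [φ.left_inv hz.2] using hz.1)
  refine ⟨g ∘ φ, fun i => q i ∘ φ, (holFunNear_comp_iff hφ hx).2 (DifferentiableOn.holAt hg hU hxU),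
    fun i => (holFunNear_comp_iff hφ hx).2 (DifferentiableOn.holAt (hq i) hU hxU), ?_⟩
  filter_upwards [φ.open_source.mem_nhds hx, (φ.continuousAt hx).preimage_mem_nhds
    (hU.mem_nhds hxU)] with y hy hyU
  refine ⟨fun i => ?_, (hprim _ hyU).isPrimitiveNear hφ hy⟩
  simpa [φ.left_inv hy] using hfq _ hyU i

theorem IsPrimitiveNear.congr {ι : Type*} [Finite ι] {q q' : ι → M → ℂ} {y : M}
    (hq : IsPrimitiveNear I q y) (h : ∀ i, q' i =ᶠ[𝓝 y] q i) : IsPrimitiveNear I q' y := by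
  intro a b ha hb hb0 H
  refine hq a b ha hb hb0 fun i => ?_
  obtain ⟨g, hg, he⟩ := H i
  refine ⟨g, hg, ?_⟩
  filter_upwards [he, h i] with z h1 h2
  rw [← h2, h1]

/-- For the zero family every germ `a / b` passes the test, for instance the reciprocal of a
coordinate vanishing at `y`, which is not holomorphic. Such a coordinate exists because `0 < n`. -/
theorem IsPrimitiveNear.exists_frequently_ne_zero (hn : 0 < n) {ι : Type*} [Finite ι]
    {q : ι → M → ℂ} {y : M} (hq : IsPrimitiveNear I q y) : ∃ i, ∃ᶠ z in 𝓝 y, q i z ≠ 0 := by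
  by_contra! H
  obtain ⟨φ, hy, hφ⟩ := I.integrable y
  obtain ⟨h, hh, he⟩ := hq (fun _ => 1) (fun z => φ z ⟨0, hn⟩ - φ y ⟨0, hn⟩)
    (holFunNear_const 1 y) ((hφ.holFunNear hy _).sub (holFunNear_const _ y))
    (hφ.frequently_ne hy _) fun i => ⟨fun _ => 0, holFunNear_const 0 y, by
      filter_upwards [H i] with z hz
      rw [hz, mul_zero, mul_zero]⟩
  simpa using he.self_of_nhds

/-- The members of a primitive family have no common divisor. -/
theorem IsPrimitiveNear.ne_zero_of_eq_mul (hn : 0 < n) {ι : Type*} [Finite ι]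
    {q : ι → M → ℂ} {y : M} (hq : IsPrimitiveNear I q y) {c : M → ℂ} (hc : HolFunNear I c y)
    (h : ∀ i, ∃ h, HolFunNear I h y ∧ ∀ᶠ z in 𝓝 y, q i z = c z * h z) : c y ≠ 0 := by
  obtain ⟨i, hi⟩ := hq.exists_frequently_ne_zero hn
  have hc0 : ∃ᶠ z in 𝓝 y, c z ≠ 0 := by
    obtain ⟨g, -, hg⟩ := h i
    refine (hi.and_eventually hg).mono fun z hz h0 => hz.1 ?_
    rw [hz.2, h0, zero_mul]
  -- Primitivity is tested on the germ `1 / c`: it is holomorphic, so `c` is a unit.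
  obtain ⟨g, -, hg⟩ := hq (fun _ => 1) c (holFunNear_const 1 y) hc hc0 (by simpa using h)
  intro h0
  simpa [h0] using hg.self_of_nhds

/-- A set that is locally the zero locus of a primitive family has codimension at least two. -/
theorem hasCodimAtLeast_two (hn : 0 < n) {S : Set M}
    (hS : ∀ y ∈ S, ∃ (m : ℕ) (q : Fin m → M → ℂ), (∀ i, HolFunNear I (q i) y) ∧
      IsPrimitiveNear I q y ∧ ∀ᶠ z in 𝓝 y, z ∈ S ↔ ∀ i, q i z = 0) :
    HasCodimAtLeast I S 2 := by
  rintro φ k hφ hk ⟨y, hyS, hy⟩ hzero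
  by_contra! hk2
  obtain ⟨m, q, hqh, hq, hqS⟩ := hS y hyS
  set i₀ : Fin n := ⟨0, hn⟩
  refine hq.ne_zero_of_eq_mul hn (c := fun z => φ z i₀ - φ y i₀)
    ((hφ.holFunNear hy i₀).sub (holFunNear_const _ y)) (fun i => ?_) (sub_self _)
  -- In codimension zero all `q i` vanish near `y` and are divisible by anything. In codimension one
  -- they vanish on a coordinate hyperplane and are divisible by its equation. Either way a nonunit
  -- divides a primitive family.
  obtain rfl | rfl : k = 0 ∨ k = 1 := by omega
  · refine ⟨fun _ => 0, holFunNear_const 0 y, ?_⟩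
    filter_upwards [hqS, φ.open_source.mem_nhds hy] with z h1 h2
    rw [mul_zero, h1.1 ((hzero z h2).2 (by simp)) i]
  · have hy0 : φ y i₀ = 0 := (hzero y hy).1 hyS i₀ (by simp [i₀])
    obtain ⟨h, hh, he⟩ := exists_eq_coord_mul ((holFunNear_iff hφ hy).1 (hqh i)) i₀ (by
      filter_upwards [(φ.tendsto_symm hy).eventually hqS, φ.open_target.mem_nhds
        (φ.map_source hy)] with z h1 h2 h3
      refine h1.1 ((hzero _ (φ.map_target h2)).2 fun j hj => ?_) i
      have : j = i₀ := Fin.ext (by simpa [i₀] using hj)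
      rw [φ.right_inv h2, this, h3])
    refine ⟨h ∘ φ, (holFunNear_comp_iff hφ hy).2 hh, ?_⟩
    filter_upwards [(φ.continuousAt hy).eventually he, φ.open_source.mem_nhds hy] with z h1 h2
    simpa [hy0, φ.left_inv h2] using h1

/-- The maximum principle: holomorphic functions on a compact connected manifold are constant. -/
theorem eq_of_forall_holFunNear [CompactSpace M] [ConnectedSpace M] {f : M → ℂ}
    (hf : ∀ x, HolFunNear I f x) (x y : M) : f x = f y := by
  have hc : Continuous f := continuous_iff_continuousAt.2 fun x => (hf x).continuousAt
  obtain ⟨p, -, hp⟩ := isCompact_univ.exists_isMaxOn Set.univ_nonempty hc.norm.continuousOn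
  have hcl : IsClopen {x | f x = f p} := by
    refine ⟨isClosed_eq hc continuous_const, isOpen_iff_mem_nhds.2 fun x hx => ?_⟩
    obtain ⟨φ, hxφ, hφ⟩ := I.integrable x
    have hmax : IsLocalMax (norm ∘ (f ∘ φ.symm)) (φ x) := Eventually.of_forall fun z => by
      have h1 : f x = f p := hx
      simpa [φ.left_inv hxφ, h1] using hp (Set.mem_univ (φ.symm z))
    have h1 := Complex.eventually_eq_of_isLocalMax_norm ((holFunNear_iff hφ hxφ).1 (hf x)) hmax
    filter_upwards [(φ.continuousAt hxφ).eventually h1, φ.open_source.mem_nhds hxφ] with z h2 h3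
    have h4 : f z = f x := by simpa [φ.left_inv h3, φ.left_inv hxφ] using h2
    exact h4.trans hx
  have hu := hcl.eq_univ ⟨p, rfl⟩
  have h1 : ∀ x, f x = f p := fun x => by
    have : x ∈ {x | f x = f p} := hu ▸ Set.mem_univ x
    exact this
  rw [h1 x, h1 y]

/-- A property that holds near `x` as soon as it holds on open sets accumulating at `x` holds
nowhere densely if it fails somewhere. -/
theorem frequently_not_of_exists_not [ConnectedSpace M] {Q : M → Prop}
    (hQ : ∀ x, (∃ᶠ y in 𝓝 x, ∀ᶠ z in 𝓝 y, Q z) → ∀ᶠ y in 𝓝 x, Q y) {p : M} (hp : ¬ Q p) (x : M) :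
    ∃ᶠ y in 𝓝 x, ¬ Q y := by
  have hcl : IsClopen {x | ∀ᶠ y in 𝓝 x, Q y} := by
    refine ⟨isClosed_iff_frequently.2 fun x hx => hQ x hx, isOpen_iff_mem_nhds.2 fun x hx => ?_⟩
    exact eventually_eventually_nhds.2 hx
  intro h
  have hu := hcl.eq_univ ⟨x, by filter_upwards [h] with y hy using not_not.1 hy⟩
  have : p ∈ {x | ∀ᶠ y in 𝓝 x, Q y} := hu ▸ Set.mem_univ p
  exact hp this.self_of_nhds

/-- A holomorphic function that vanishes near points accumulating at `x` vanishes near `x`. -/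
theorem HolFunNear.eventually_eq_zero_of_frequently {f : M → ℂ} {x : M} (hf : HolFunNear I f x)
    (h : ∃ᶠ y in 𝓝 x, ∀ᶠ z in 𝓝 y, f z = 0) : ∀ᶠ y in 𝓝 x, f y = 0 := by
  by_contra H
  obtain ⟨y, h1, h2⟩ := (h.and_eventually (hf.eventually_frequently_ne_zero (not_eventually.1 H))).exists
  exact h2 (by filter_upwards [h1] with z hz using not_not.2 hz)

end PrimitiveFamilies

/-! ### Sections of the vector bundle -/

section Sections

variable {n : ℕ} {M : Type*} [TopologicalSpace M]
  [ChartedSpace (EuclideanSpace ℝ (Fin (2 * n))) M]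

theorem SmoothFunNear.congr {f g : M → ℂ} {x : M} (hf : SmoothFunNear n f x) (h : g =ᶠ[𝓝 x] f) :
    SmoothFunNear n g x := by
  filter_upwards [hf, h.eventually_nhds] with y h1 h2
  exact ContMDiffAt.congr_of_eventuallyEq h1 h2

theorem contMDiffAt_mul {f g : M → ℂ} {x : M} (hf : ContMDiffAt (𝓡 (2 * n)) 𝓘(ℝ, ℂ) ∞ f x)
    (hg : ContMDiffAt (𝓡 (2 * n)) 𝓘(ℝ, ℂ) ∞ g x) :
    ContMDiffAt (𝓡 (2 * n)) 𝓘(ℝ, ℂ) ∞ (fun y => f y * g y) x :=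
  (contDiff_mul.contDiffAt).comp_contMDiffAt (hf.prodMk_space hg)

variable {F : Type*} [NormedAddCommGroup F] [NormedSpace ℂ F] [FiniteDimensional ℂ F]
  {V : M → Type*} [∀ x, AddCommGroup (V x)] [∀ x, Module ℂ (V x)]
  [TopologicalSpace (TotalSpace F V)] [∀ x, TopologicalSpace (V x)] [FiberBundle F V]

/-- The vectors `e i y` form a basis of the fibre at `y`. -/
def IsBasisAt {ι : Type*} (e : ι → ∀ y, V y) (y : M) : Prop :=
  LinearIndependent ℂ (fun i => e i y) ∧ Submodule.span ℂ (Set.range fun i => e i y) = ⊤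

/-- The basis of the fibre at `y` formed by the vectors `e i y`. -/
def IsBasisAt.basis {ι : Type*} {e : ι → ∀ y, V y} {y : M} (h : IsBasisAt e y) :
    Module.Basis ι ℂ (V y) := Module.Basis.mk h.1 h.2.ge

open Classical in
/-- Coefficients of the section `s` in the frame `e`. -/
def secCoeff {ι : Type*} (e : ι → ∀ y, V y) (s : ∀ y, V y) (i : ι) (y : M) : ℂ :=
  if h : IsBasisAt e y then h.basis.repr (s y) i else 0

@[simp]
theorem IsBasisAt.basis_apply {ι : Type*} {e : ι → ∀ y, V y} {y : M} (h : IsBasisAt e y) (i : ι) :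
    h.basis i = e i y := by simp [basis]

theorem IsBasisAt.secCoeff_eq {ι : Type*} {e : ι → ∀ y, V y} {y : M} (h : IsBasisAt e y)
    (s : ∀ y, V y) (i : ι) : secCoeff e s i y = h.basis.repr (s y) i := by simp [secCoeff, h]

theorem IsBasisAt.sum_secCoeff {ι : Type*} [Fintype ι] {e : ι → ∀ y, V y} {y : M}
    (h : IsBasisAt e y) (s : ∀ y, V y) : ∑ i, secCoeff e s i y • e i y = s y := by
  simp_rw [h.secCoeff_eq, ← h.basis_apply]
  exact h.basis.sum_repr _

theorem IsBasisAt.secCoeff_of_eq_sum {ι : Type*} [Fintype ι] {e : ι → ∀ y, V y} {y : M}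
    (h : IsBasisAt e y) {s : ∀ y, V y} {c : ι → ℂ} (hs : s y = ∑ i, c i • e i y) (i : ι) :
    secCoeff e s i y = c i := by
  rw [h.secCoeff_eq, hs]
  simp_rw [← h.basis_apply]
  rw [h.basis.repr_sum_self]

/-! ### Smooth and holomorphic sections in local frames -/

section Smooth

variable [VectorBundle ℂ F V] [VectorBundle ℝ F V] [IsManifold (𝓡 (2 * n)) ∞ M]
  [ContMDiffVectorBundle ∞ F V (𝓡 (2 * n))]

/-- The local trivialization around `x`, as a linear map on the fibres. -/
def trivMap (F : Type*) [NormedAddCommGroup F] [NormedSpace ℂ F] {V : M → Type*}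
    [∀ x, AddCommGroup (V x)] [∀ x, Module ℂ (V x)] [TopologicalSpace (TotalSpace F V)]
    [∀ x, TopologicalSpace (V x)] [FiberBundle F V] [VectorBundle ℂ F V] (x y : M) :
    V y →ₗ[ℂ] F := (trivializationAt F V x).linearMapAt ℂ y

theorem smoothSecAt_iff {s : ∀ y, V y} {x y : M} (hy : y ∈ (trivializationAt F V x).baseSet) :
    SmoothSecAt n F s y ↔ ContMDiffAt (𝓡 (2 * n)) 𝓘(ℝ, F) ∞ (fun z => trivMap F x z (s z)) y := by
  unfold SmoothSecAt
  rw [(trivializationAt F V x).contMDiffAt_section_iff hy]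
  have h : (fun z => trivMap F x z (s z)) =ᶠ[𝓝 y] fun z => (trivializationAt F V x ⟨z, s z⟩).2 := by
    filter_upwards [(trivializationAt F V x).open_baseSet.mem_nhds hy] with z hz
    simp [trivMap, Trivialization.coe_linearMapAt_of_mem _ hz]
  exact ⟨fun H => H.congr_of_eventuallyEq h, fun H => H.congr_of_eventuallyEq h.symm⟩

theorem bijective_trivMap {x y : M} (hy : y ∈ (trivializationAt F V x).baseSet) :
    Function.Bijective (trivMap F x y : V y →ₗ[ℂ] F) := by
  have h : ⇑(trivMap F x y : V y →ₗ[ℂ] F) = (trivializationAt F V x).linearEquivAt ℂ y hy := by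
    ext v
    simp [trivMap, Trivialization.coe_linearMapAt_of_mem _ hy]
  rw [h]
  exact LinearEquiv.bijective _

theorem SmoothSecAt.congr {s t : ∀ y, V y} {x : M} (hs : SmoothSecAt n F s x)
    (h : ∀ᶠ y in 𝓝 x, t y = s y) : SmoothSecAt n F t x :=
  ContMDiffAt.congr_of_eventuallyEq hs (h.mono fun y hy => by simp only [hy])

theorem SmoothSecNear.congr {s t : ∀ y, V y} {x : M} (hs : SmoothSecNear n F s x)
    (h : ∀ᶠ y in 𝓝 x, t y = s y) : SmoothSecNear n F t x := by
  filter_upwards [hs, h.eventually_nhds] with y h1 h2 using h1.congr h2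

theorem SmoothSecAt.sum_smul {ι : Type*} (S : Finset ι) {f : ι → M → ℂ} {s : ι → ∀ y, V y} {x : M}
    (hf : ∀ i ∈ S, ContMDiffAt (𝓡 (2 * n)) 𝓘(ℝ, ℂ) ∞ (f i) x)
    (hs : ∀ i ∈ S, SmoothSecAt n F (s i) x) :
    SmoothSecAt n F (fun y => ∑ i ∈ S, f i y • s i y) x := by
  have hx := mem_baseSet_trivializationAt F V x
  rw [smoothSecAt_iff hx]
  simp only [map_sum, map_smul]
  refine contMDiffAt_finsetSum fun i hi => ?_
  have h1 := (smoothSecAt_iff hx).1 (hs i hi)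
  exact (contDiff_smul (𝕜 := ℝ) (𝕜' := ℂ)).contDiffAt.comp_contMDiffAt ((hf i hi).prodMk_space h1)

theorem SmoothSecNear.sum_smul {ι : Type*} (S : Finset ι) {f : ι → M → ℂ} {s : ι → ∀ y, V y}
    {x : M} (hf : ∀ i ∈ S, SmoothFunNear n (f i) x) (hs : ∀ i ∈ S, SmoothSecNear n F (s i) x) :
    SmoothSecNear n F (fun y => ∑ i ∈ S, f i y • s i y) x := by
  filter_upwards [(Finset.eventually_all S).2 hf, (Finset.eventually_all S).2 hs] with y h1 h2
  exact SmoothSecAt.sum_smul S h1 h2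

/-- In a trivialization the frame becomes a family of isomorphisms `(ι → ℂ) → F`. The coefficients
arise by applying the inverse, and inversion of continuous linear maps is smooth. -/
theorem contMDiffAt_secCoeff {ι : Type*} [Fintype ι] {e : ι → ∀ y, V y} {s : ∀ y, V y} {x : M}
    (he : ∀ i, SmoothSecAt n F (e i) x) (hb : ∀ᶠ y in 𝓝 x, IsBasisAt e y)
    (hs : SmoothSecAt n F s x) (i : ι) :
    ContMDiffAt (𝓡 (2 * n)) 𝓘(ℝ, ℂ) ∞ (secCoeff e s i) x := by
  have hx := mem_baseSet_trivializationAt F V x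
  have : FiniteDimensional ℝ F := FiniteDimensional.complexToReal F
  let A : M → (ι → ℂ) →L[ℝ] F := fun y =>
    ∑ i, ((ContinuousLinearMap.proj i : (ι → ℂ) →L[ℂ] ℂ).smulRight
      (trivMap F x y (e i y))).restrictScalars ℝ
  have hA : ∀ y c, A y c = trivMap F x y (∑ i, c i • e i y) := by
    intro y c
    simp [A, map_sum]
  have hAs : ContMDiffAt (𝓡 (2 * n)) 𝓘(ℝ, (ι → ℂ) →L[ℝ] F) ∞ A x := by
    refine contMDiffAt_finsetSum fun i _ => ?_
    have h1 := (smoothSecAt_iff hx).1 (he i)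
    let L : F →ₗ[ℝ] ((ι → ℂ) →L[ℝ] F) :=
      { toFun := fun u => ((ContinuousLinearMap.proj i : (ι → ℂ) →L[ℂ] ℂ).smulRight
          u).restrictScalars ℝ
        map_add' := fun u v => by ext; simp
        map_smul' := fun c u => by ext w; exact smul_comm (w i) c u }
    exact (LinearMap.toContinuousLinearMap L).contDiff.contDiffAt.comp_contMDiffAt h1
  have hbij : ∀ y, IsBasisAt e y → y ∈ (trivializationAt F V x).baseSet →
      Function.Bijective (A y) := by
    intro y hy hyb
    have h1 : ⇑(A y) = trivMap F x y ∘ (hy.basis.equivFun.symm) := by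
      ext c
      simp [hA, Module.Basis.equivFun_symm_apply]
    rw [h1]
    exact (bijective_trivMap hyb).comp (LinearEquiv.bijective _)
  let A₀ : ∀ y, Function.Bijective (A y) → ((ι → ℂ) ≃L[ℝ] F) := fun y h =>
    (LinearEquiv.ofBijective (A y : (ι → ℂ) →ₗ[ℝ] F) h).toContinuousLinearEquiv
  have hA₀ : ∀ y h, (A₀ y h : (ι → ℂ) →L[ℝ] F) = A y := fun y h => by ext c; rfl
  have hinv : ContMDiffAt (𝓡 (2 * n)) 𝓘(ℝ, F →L[ℝ] (ι → ℂ)) ∞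
      (fun y => ContinuousLinearMap.inverse (A y)) x := by
    have h1 : ContDiffAt ℝ ∞ ContinuousLinearMap.inverse (A x) := by
      rw [← hA₀ x (hbij x hb.self_of_nhds hx)]
      exact contDiffAt_map_inverse _
    exact h1.comp_contMDiffAt hAs
  have hc : ContMDiffAt (𝓡 (2 * n)) 𝓘(ℝ, ι → ℂ) ∞
      (fun y => ContinuousLinearMap.inverse (A y) (trivMap F x y (s y))) x :=
    hinv.clm_apply ((smoothSecAt_iff hx).1 hs)
  refine (((contDiff_apply ℝ ℂ i).contDiffAt).comp_contMDiffAt hc).congr_of_eventuallyEq ?_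
  filter_upwards [hb, (trivializationAt F V x).open_baseSet.mem_nhds hx] with y hy hyb
  have h1 : trivMap F x y (s y) = A₀ y (hbij y hy hyb) (fun i => secCoeff e s i y) := by
    show _ = A y _
    rw [hA, hy.sum_secCoeff]
  rw [Function.comp_apply, h1, ← hA₀ y (hbij y hy hyb), ContinuousLinearMap.inverse_equiv]
  simp

variable {I : ComplexStructure n M} (D : HolStructure F I V)

theorem HolStructure.op_congr {s t : ∀ y, V y} {x : M} (hs : SmoothSecNear n F s x)
    (h : ∀ᶠ y in 𝓝 x, s y = t y) : D.op s x = D.op t x := by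
  classical
  -- Multiplying by this indicator makes the two sections equal everywhere, while its germ at `x` is
  -- `1`. The Leibniz rule thus yields locality of the operator.
  set f : M → ℂ := fun y => if s y = t y then 1 else 0 with hf
  have hf1 : f =ᶠ[𝓝 x] fun _ => 1 := h.mono fun y hy => if_pos hy
  have hfs : SmoothFunNear n f x :=
    ((holFunNear_const 1 x : HolFunNear I _ x).smoothFunNear).congr hf1
  have hft : (fun y => f y • s y) = fun y => f y • t y := by
    ext y
    by_cases hy : s y = t y <;> simp [hf, hy]
  have hd : ∀ v, dbar I f x v = 0 := fun v => by
    have : ∀ w : Tan n x, diffC f x w = 0 := fun w => by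
      unfold diffC
      rw [hf1.mfderiv_eq, mfderiv_const]
      rfl
    simp [dbar, this]
  ext v
  have h1 := D.leibniz f s x hfs hs v
  have h2 := D.leibniz f t x hfs (hs.congr (h.mono fun y hy => hy.symm)) v
  rw [hft, h2, hd, hf1.self_of_nhds] at h1
  simpa using h1.symm

theorem HolStructure.op_sum_smul {ι : Type*} (S : Finset ι) {f : ι → M → ℂ} {s : ι → ∀ y, V y}
    {x : M} (hf : ∀ i ∈ S, SmoothFunNear n (f i) x) (hs : ∀ i ∈ S, SmoothSecNear n F (s i) x)
    (v : Tan n x) : D.op (fun y => ∑ i ∈ S, f i y • s i y) x v =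
      ∑ i ∈ S, (dbar I (f i) x v • s i x + f i x • D.op (s i) x v) := by
  classical
  induction S using Finset.induction_on with
  | empty =>
    have h0 : SmoothSecNear n F (fun y => (0 : V y)) x :=
      SmoothSecNear.sum_smul (V := V) (∅ : Finset ℕ) (f := fun _ _ => 0) (s := fun _ _ => 0)
        (by simp) (by simp)
    have := D.add (fun y => 0) (fun y => 0) x h0 h0 v
    simp only [add_zero] at this
    simpa using this
  | insert a S ha ih =>
    simp only [Finset.sum_insert ha]
    rw [D.add _ _ x, D.leibniz _ _ x (hf a (by simp)) (hs a (by simp)),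
      ih (fun i hi => hf i (by simp [hi])) (fun i hi => hs i (by simp [hi]))]
    · simpa using SmoothSecNear.sum_smul {a} (f := f) (s := s)
        (by simpa using hf a (by simp)) (by simpa using hs a (by simp))
    · exact SmoothSecNear.sum_smul S (fun i hi => hf i (by simp [hi])) fun i hi =>
        hs i (by simp [hi])

variable {D}

theorem HolSecNear.smoothSecNear {s : ∀ y, V y} {x : M} (hs : HolSecNear D s x) :
    SmoothSecNear n F s x := hs.mono fun _ h => h.1

theorem HolSecNear.eventually {s : ∀ y, V y} {x : M} (hs : HolSecNear D s x) :
    ∀ᶠ y in 𝓝 x, HolSecNear D s y := eventually_eventually_nhds.2 hs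

theorem HolSecNear.congr {s t : ∀ y, V y} {x : M} (hs : HolSecNear D s x)
    (h : ∀ᶠ y in 𝓝 x, t y = s y) : HolSecNear D t x := by
  filter_upwards [hs, hs.eventually, h.eventually_nhds] with y h1 h2 h3
  refine ⟨h1.1.congr h3, ?_⟩
  rw [← D.op_congr h2.smoothSecNear (h3.mono fun z hz => hz.symm), h1.2]

theorem HolSecNear.sum_smul {ι : Type*} (S : Finset ι) {f : ι → M → ℂ} {s : ι → ∀ y, V y}
    {x : M} (hf : ∀ i ∈ S, HolFunNear I (f i) x) (hs : ∀ i ∈ S, HolSecNear D (s i) x) :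
    HolSecNear D (fun y => ∑ i ∈ S, f i y • s i y) x := by
  filter_upwards [(Finset.eventually_all S).2 hf, (Finset.eventually_all S).2 hs,
    (Finset.eventually_all S).2 fun i hi => (hf i hi).eventually,
    (Finset.eventually_all S).2 fun i hi => (hs i hi).eventually] with y h1 h2 h3 h4
  refine ⟨SmoothSecAt.sum_smul S (fun i hi => (h1 i hi).1) fun i hi => (h2 i hi).1, ?_⟩
  ext v
  rw [D.op_sum_smul S (fun i hi => (h3 i hi).smoothFunNear) fun i hi => (h4 i hi).smoothSecNear]
  refine Finset.sum_eq_zero fun i hi => ?_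
  rw [(h1 i hi).2, (h2 i hi).2]
  simp

theorem HolSecNear.smul {f : M → ℂ} {s : ∀ y, V y} {x : M} (hf : HolFunNear I f x)
    (hs : HolSecNear D s x) : HolSecNear D (fun y => f y • s y) x := by
  simpa using HolSecNear.sum_smul {()} (f := fun _ => f) (s := fun _ => s) (by simpa) (by simpa)

/-- `e` is a holomorphic frame of `(V, D)` near `x`, indexed by an arbitrary type. -/
def IsHolBasisNear {ι : Type*} (D : HolStructure F I V) (e : ι → ∀ y, V y) (x : M) : Prop :=
  (∀ i, HolSecNear D (e i) x) ∧ ∀ᶠ y in 𝓝 x, IsBasisAt e y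

theorem exists_isHolBasisNear (D : HolStructure F I V) (x : M) :
    ∃ e : Fin (Module.finrank ℂ F) → ∀ y, V y, IsHolBasisNear D e x := by
  obtain ⟨e, he⟩ := D.integrable x
  exact ⟨e, fun i => he.mono fun y hy => hy.1 i, he.mono fun y hy => hy.2⟩

theorem IsHolBasisNear.eventually {ι : Type*} [Finite ι] {e : ι → ∀ y, V y} {x : M}
    (he : IsHolBasisNear D e x) : ∀ᶠ y in 𝓝 x, IsHolBasisNear D e y := by
  filter_upwards [eventually_all.2 fun i => (he.1 i).eventually, he.2.eventually_nhds]
    with y h1 h2 using ⟨h1, h2⟩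

theorem IsHolBasisNear.smoothFunNear_secCoeff {ι : Type*} [Fintype ι] {e : ι → ∀ y, V y} {x : M}
    (he : IsHolBasisNear D e x) {s : ∀ y, V y} (hs : SmoothSecNear n F s x) (i : ι) :
    SmoothFunNear n (secCoeff e s i) x := by
  filter_upwards [he.eventually, hs] with y h1 h2
  exact contMDiffAt_secCoeff (fun i => (h1.1 i).self_of_nhds.1) h1.2 h2 i

/-- By the Leibniz rule `∂̄s = ∑ ∂̄cᵢ ⊗ eᵢ` in a holomorphic frame, and the `eᵢ` are independent. -/
theorem IsHolBasisNear.holFunNear_secCoeff {ι : Type*} [Fintype ι] {e : ι → ∀ y, V y} {x : M}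
    (he : IsHolBasisNear D e x) {s : ∀ y, V y} (hs : HolSecNear D s x) (i : ι) :
    HolFunNear I (secCoeff e s i) x := by
  filter_upwards [he.eventually, hs.eventually] with y h1 h2
  refine ⟨(h1.smoothFunNear_secCoeff h2.smoothSecNear i).self_of_nhds, fun v => ?_⟩
  have h3 := D.op_sum_smul Finset.univ
    (fun i _ => h1.smoothFunNear_secCoeff h2.smoothSecNear i)
    (fun i _ => (h1.1 i).smoothSecNear) v
  have h4 : ∀ᶠ z in 𝓝 y, s z = ∑ i, secCoeff e s i z • e i z :=
    h1.2.mono fun z hz => (hz.sum_secCoeff s).symm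
  rw [← D.op_congr h2.smoothSecNear h4, h2.self_of_nhds.2] at h3
  simp only [(h1.1 _).self_of_nhds.2, LinearMap.zero_apply, smul_zero, add_zero] at h3
  exact Fintype.linearIndependent_iff.1 h1.2.self_of_nhds.1 _ h3.symm i

end Smooth

end Sections

/-! ### Alternating forms that vanish on a subspace -/

section AlternatingForms

variable {W X : Type*} [AddCommGroup W] [Module ℂ W] [AddCommGroup X] [Module ℂ X] {r : ℕ}

/-- The minors of a family of vectors with respect to the first part of a basis. -/
def minorForm {κ : Type*} (b : Module.Basis (Fin r ⊕ κ) ℂ W) : W [⋀^Fin r]→ₗ[ℂ] ℂ :=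
  Matrix.detRowAlternating.compLinearMap (LinearMap.pi fun j => b.coord (Sum.inl j))

theorem minorForm_apply {κ : Type*} (b : Module.Basis (Fin r ⊕ κ) ℂ W) (u : Fin r → W) :
    minorForm b u = (Matrix.of fun i j => b.repr (u i) (Sum.inl j)).det := rfl

/-- An alternating form of degree `r` on a space with basis `b` indexed by `Fin r ⊕ κ` that
vanishes on the second part of the basis is a multiple of a minor. -/
theorem alternatingMap_eq_minorForm {κ : Type*} (b : Module.Basis (Fin r ⊕ κ) ℂ W)
    (f : W [⋀^Fin r]→ₗ[ℂ] X)
    (hf : ∀ C : Fin r → Fin r ⊕ κ, (∃ i j, C i = Sum.inr j) → f (fun i => b (C i)) = 0)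
    (u : Fin r → W) : f u = minorForm b u • f fun i => b (Sum.inl i) := by
  classical
  set x := f fun i => b (Sum.inl i) with hx
  have key : f = (LinearMap.toSpanSingleton ℂ X x).compAlternatingMap (minorForm b) := by
    refine Module.Basis.ext_alternating b fun C hC => ?_
    simp only [LinearMap.compAlternatingMap_apply, LinearMap.toSpanSingleton_apply]
    by_cases h : ∃ i j, C i = Sum.inr j
    · obtain ⟨i, j, hij⟩ := h
      rw [hf C ⟨i, j, hij⟩, minorForm_apply, Matrix.det_eq_zero_of_row_eq_zero i, zero_smul]
      intro l
      simp [hij]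
    · have h1 : ∀ i, ∃ c, C i = Sum.inl c := fun i => by
        rcases hci : C i with c | c
        · exact ⟨c, rfl⟩
        · exact absurd ⟨i, c, hci⟩ h
      choose c hc using h1
      have hcinj : Function.Injective c := fun i i' hii => hC (by rw [hc, hc, hii])
      let σ : Equiv.Perm (Fin r) := Equiv.ofBijective c (Finite.injective_iff_bijective.1 hcinj)
      have h2 : (fun i => b (C i)) = (fun i => b (Sum.inl i)) ∘ σ := by
        funext i; simp [hc, σ]
      rw [h2, AlternatingMap.map_perm, AlternatingMap.map_perm]
      have h3 : minorForm b (fun i => b (Sum.inl i)) = 1 := by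
        rw [minorForm_apply, ← Matrix.det_one (n := Fin r) (R := ℂ)]
        congr 1
        ext i j
        rw [Matrix.of_apply, b.repr_self, Matrix.one_apply, Finsupp.single_apply]
        simp only [Sum.inl.injEq]
      rw [h3, ← hx]
      simp
  conv_lhs => rw [key]
  rfl

/-- A subspace of codimension `r` and a complement, in terms of a basis. -/
theorem exists_basis_of_finrank_quotient [FiniteDimensional ℂ W] (K : Submodule ℂ W)
    (hK : Module.finrank ℂ (W ⧸ K) = r) :
    ∃ b : Module.Basis (Fin r ⊕ Fin (Module.finrank ℂ K)) ℂ W, ∀ j, b (Sum.inr j) ∈ K := by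
  obtain ⟨L, hL⟩ := K.exists_isCompl
  have hLr : Module.finrank ℂ L = r := by
    rw [← hK]; exact (K.quotientEquivOfIsCompl L hL).finrank_eq.symm
  refine ⟨((Module.finBasisOfFinrankEq ℂ L hLr).prod (Module.finBasis ℂ K)).map
    (Submodule.prodEquivOfIsCompl L K hL.symm), fun j => ?_⟩
  simp

/-- Alternating forms of degree `r` on an `r`-dimensional quotient are proportional. -/
theorem alternatingMap_smul_comm [FiniteDimensional ℂ W] (K : Submodule ℂ W)
    (hK : Module.finrank ℂ (W ⧸ K) = r) (f : W [⋀^Fin r]→ₗ[ℂ] ℂ) (g : W [⋀^Fin r]→ₗ[ℂ] X)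
    (hf : ∀ u i, u i ∈ K → f u = 0) (hg : ∀ u i, u i ∈ K → g u = 0) (u w : Fin r → W) :
    f u • g w = f w • g u := by
  obtain ⟨b, hb⟩ := exists_basis_of_finrank_quotient K hK
  have h1 := alternatingMap_eq_minorForm b f fun C ⟨i, j, h⟩ => hf _ i (by rw [h]; exact hb j)
  have h2 := alternatingMap_eq_minorForm b g fun C ⟨i, j, h⟩ => hg _ i (by rw [h]; exact hb j)
  rw [h1 u, h1 w, h2 u, h2 w, smul_smul, smul_smul]
  congr 1
  simp only [smul_eq_mul]
  ring

/-- The linear map sending `v` to the map `w ↦ f w • v`. -/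
def smulRightMap (f : W [⋀^Fin r]→ₗ[ℂ] ℂ) :
    W →ₗ[ℂ] MultilinearMap ℂ (fun _ : Fin r => W) W where
  toFun v := (f : MultilinearMap ℂ (fun _ : Fin r => W) ℂ).smulRight v
  map_add' v v' := by ext w; simp
  map_smul' c v := by ext w; simp [smul_comm c]

/-- Contraction of `r + 1` vectors with a form of degree `r`:
`∑ᵢ (-1)ⁱ f(u₀, …, ûᵢ, …, u_r) uᵢ`. -/
def contraction (f : W [⋀^Fin r]→ₗ[ℂ] ℂ) : MultilinearMap ℂ (fun _ : Fin (r + 1) => W) W :=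
  ∑ i : Fin (r + 1), (-1 : ℂ) ^ (i : ℕ) • (smulRightMap f).uncurryMid i

theorem contraction_apply (f : W [⋀^Fin r]→ₗ[ℂ] ℂ) (u : Fin (r + 1) → W) :
    contraction f u = ∑ i : Fin (r + 1), ((-1 : ℂ) ^ (i : ℕ) * f (i.removeNth u)) • u i := by
  simp [contraction, smulRightMap, smul_smul]

theorem contraction_smul (c : ℂ) (f : W [⋀^Fin r]→ₗ[ℂ] ℂ) (u : Fin (r + 1) → W) :
    contraction (c • f) u = c • contraction f u := by
  simp only [contraction_apply, Finset.smul_sum, smul_smul, AlternatingMap.smul_apply, smul_eq_mul]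
  exact Finset.sum_congr rfl fun i _ => by ring_nf

theorem contraction_cons (f : W [⋀^Fin r]→ₗ[ℂ] ℂ) (v : W) (w : Fin r → W) :
    contraction f (Fin.cons v w) = f w • v + ∑ i : Fin r,
      ((-1 : ℂ) ^ ((i : ℕ) + 1) * f (i.succ.removeNth (Fin.cons v w : Fin (r + 1) → W))) • w i := by
  rw [contraction_apply, Fin.sum_univ_succ]
  simp

theorem contraction_cons_of_mem (f : W [⋀^Fin r]→ₗ[ℂ] ℂ) {v : W}
    (hv : ∀ u i, u i = v → f u = 0) (w : Fin r → W) :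
    contraction f (Fin.cons v w) = f w • v := by
  rw [contraction_cons, add_eq_left]
  refine Finset.sum_eq_zero fun i _ => ?_
  obtain ⟨r, rfl⟩ : ∃ r', r = r' + 1 := ⟨r - 1, by have := i.2; omega⟩
  rw [hv _ 0, mul_zero, zero_smul]
  simp [Fin.removeNth]

/-- Contractions with a form of degree `r` that vanishes on a subspace of codimension `r` lie in
that subspace. -/
theorem contraction_mem [FiniteDimensional ℂ W] (K : Submodule ℂ W)
    (hK : Module.finrank ℂ (W ⧸ K) = r) (f : W [⋀^Fin r]→ₗ[ℂ] ℂ)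
    (hf : ∀ u i, u i ∈ K → f u = 0) (u : Fin (r + 1) → W) : contraction f u ∈ K := by
  obtain ⟨b, hb⟩ := exists_basis_of_finrank_quotient K hK
  have h1 := alternatingMap_eq_minorForm b f fun C ⟨i, j, h⟩ => hf _ i (by rw [h]; exact hb j)
  have hc : ∀ l, b.repr (contraction f u) (Sum.inl l) = 0 := by
    intro l
    -- Up to a constant factor, the coordinate of the contraction along `Sum.inl l` is the Laplace
    -- expansion of a determinant in which the column `l` occurs twice.
    have h2 := Matrix.det_succ_column_zero (R := ℂ) (n := r) (Matrix.of fun i =>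
      (Fin.cons (b.repr (u i) (Sum.inl l)) (fun j : Fin r => b.repr (u i) (Sum.inl j)) :
        Fin (r + 1) → ℂ))
    rw [Matrix.det_zero_of_column_eq (i := 0) (j := l.succ) (Fin.succ_ne_zero l).symm
      (by intro k; simp)] at h2
    rw [contraction_apply, map_sum, Finsupp.finsetSum_apply]
    have h3 : ∀ i : Fin (r + 1), b.repr (((-1 : ℂ) ^ (i : ℕ) * f (i.removeNth u)) • u i) (Sum.inl l) =
        ((-1 : ℂ) ^ (i : ℕ) * b.repr (u i) (Sum.inl l) * minorForm b (i.removeNth u)) *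
          f fun i => b (Sum.inl i) := by
      intro i
      rw [map_smul, Finsupp.smul_apply, h1 (i.removeNth u), smul_eq_mul, smul_eq_mul]
      ring
    simp_rw [h3]
    rw [← Finset.sum_mul]
    convert zero_mul _
    rw [h2]
    refine Finset.sum_congr rfl fun i _ => ?_
    rw [minorForm_apply]
    rfl
  rw [← b.sum_repr (contraction f u), Fintype.sum_sum_type]
  refine K.add_mem (K.sum_mem fun l _ => ?_) (K.sum_mem fun j _ => K.smul_mem _ (hb j))
  rw [hc, zero_smul]
  exact K.zero_mem

end AlternatingForms

/-! ### Holomorphic forms annihilating the kernel of an endomorphism -/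

section AnnihilatingForms

variable {n : ℕ} {M : Type*} [TopologicalSpace M]
  [ChartedSpace (EuclideanSpace ℝ (Fin (2 * n))) M]
  {F : Type*} [NormedAddCommGroup F] [NormedSpace ℂ F] [FiniteDimensional ℂ F]
  {V : M → Type*} [∀ x, AddCommGroup (V x)] [∀ x, Module ℂ (V x)]
  [TopologicalSpace (TotalSpace F V)] [∀ x, TopologicalSpace (V x)] [FiberBundle F V]

theorem IsBasisAt.multilinear_expand {ι : Type*} [Fintype ι] {e : ι → ∀ y, V y} {y : M}
    (h : IsBasisAt e y) {X : Type*} [AddCommGroup X] [Module ℂ X] {m : ℕ}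
    (f : MultilinearMap ℂ (fun _ : Fin m => V y) X) (u : Fin m → ∀ y, V y) :
    f (fun i => u i y) =
      ∑ C : Fin m → ι, (∏ i, secCoeff e (u i) (C i) y) • f fun i => e (C i) y := by
  classical
  conv_lhs => rw [funext fun i => (h.sum_secCoeff (u i)).symm]
  rw [f.map_sum]
  exact Finset.sum_congr rfl fun C _ => f.map_smul_univ _ _

open Classical in
/-- The coordinate functionals of a frame. -/
def frameCoord {ι : Type*} (e : ι → ∀ y, V y) (i : ι) (y : M) : V y →ₗ[ℂ] ℂ :=
  if h : IsBasisAt e y then h.basis.coord i else 0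

theorem frameCoord_apply {ι : Type*} (e : ι → ∀ y, V y) (s : ∀ y, V y) (i : ι) (y : M) :
    frameCoord e i y (s y) = secCoeff e s i y := by
  by_cases h : IsBasisAt e y <;> simp [frameCoord, secCoeff, h]

theorem IsBasisAt.frameCoord_self {ι : Type*} [DecidableEq ι] {e : ι → ∀ y, V y} {y : M}
    (h : IsBasisAt e y) (i j : ι) : frameCoord e i y (e j y) = if j = i then 1 else 0 := by
  have : frameCoord e i y (e j y) = h.basis.repr (h.basis j) i := by
    rw [h.basis_apply]; simp [frameCoord, h]
  rw [this, Module.Basis.repr_self, Finsupp.single_apply]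

theorem IsBasisAt.finiteDimensional {ι : Type*} [Finite ι] {e : ι → ∀ y, V y} {y : M}
    (h : IsBasisAt e y) : FiniteDimensional ℂ (V y) := h.basis.finiteDimensional_of_finite

/-- The minor of vectors of `V y` in the columns `C` of the frame `e`. -/
def frameMinor {ι : Type*} {r : ℕ} (e : ι → ∀ y, V y) (C : Fin r → ι) (y : M) :
    V y [⋀^Fin r]→ₗ[ℂ] ℂ :=
  Matrix.detRowAlternating.compLinearMap (LinearMap.pi fun j => frameCoord e (C j) y)

theorem frameMinor_apply {ι : Type*} {r : ℕ} (e : ι → ∀ y, V y) (C : Fin r → ι) (y : M)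
    (u : Fin r → V y) :
    frameMinor e C y u = (Matrix.of fun i j => frameCoord e (C j) y (u i)).det := rfl

/-- The alternating form with prescribed values on the frame `e`. -/
def formOfValues {ι : Type*} [Fintype ι] {r : ℕ} (e : ι → ∀ y, V y) (q : (Fin r → ι) → M → ℂ)
    (y : M) : V y [⋀^Fin r]→ₗ[ℂ] ℂ :=
  (r.factorial : ℂ)⁻¹ • ∑ C : Fin r → ι, q C y • frameMinor e C y

theorem alternatingMap_sum_apply {W X κ : Type*} [AddCommGroup W] [Module ℂ W] [AddCommGroup X]
    [Module ℂ X] {r : ℕ} (s : Finset κ) (g : κ → W [⋀^Fin r]→ₗ[ℂ] X) (u : Fin r → W) :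
    (∑ C ∈ s, g C) u = ∑ C ∈ s, g C u :=
  map_sum ({ toFun := fun f => f u, map_zero' := rfl, map_add' := fun _ _ => rfl } :
    (W [⋀^Fin r]→ₗ[ℂ] X) →+ X) g s

/-- Only the index tuples `B ∘ σ` contribute. By antisymmetry of `q` each of the `r!` permutations
gives the same term, which the normalizing factor compensates. -/
theorem formOfValues_apply_frame {ι : Type*} [Fintype ι] {r : ℕ} {e : ι → ∀ y, V y}
    {q : (Fin r → ι) → M → ℂ} {y : M} (h : IsBasisAt e y)
    (hq : ∀ (C : Fin r → ι) (σ : Equiv.Perm (Fin r)), q (C ∘ σ) y = (Equiv.Perm.sign σ : ℤ) * q C y)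
    (B : Fin r → ι) : formOfValues e q y (fun i => e (B i) y) = q B y := by
  classical
  have h1 : ∀ C : Fin r → ι, frameMinor e C y (fun i => e (B i) y) =
      ∑ σ : Equiv.Perm (Fin r), if C = B ∘ σ then ((Equiv.Perm.sign σ : ℤ) : ℂ) else 0 := by
    intro C
    rw [frameMinor_apply, Matrix.det_apply']
    refine Finset.sum_congr rfl fun σ _ => ?_
    simp only [Matrix.of_apply, h.frameCoord_self]
    split_ifs with hC
    · simp [hC]
    · obtain ⟨i, hi⟩ := Function.ne_iff.1 hC
      rw [Finset.prod_eq_zero (Finset.mem_univ i), mul_zero]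
      exact if_neg fun h => hi h.symm
  simp only [formOfValues, AlternatingMap.smul_apply, alternatingMap_sum_apply, smul_eq_mul, h1,
    Finset.mul_sum]
  rw [Finset.sum_comm]
  have h2 : ∀ σ : Equiv.Perm (Fin r), (∑ C : Fin r → ι, (r.factorial : ℂ)⁻¹ *
      (q C y * if C = B ∘ σ then ((Equiv.Perm.sign σ : ℤ) : ℂ) else 0)) =
      (r.factorial : ℂ)⁻¹ * q B y := by
    intro σ
    rw [Finset.sum_eq_single (B ∘ σ) (fun C _ hC => by simp [hC]) (by simp), if_pos rfl, hq]
    rcases Int.units_eq_one_or (Equiv.Perm.sign σ) with h | h <;> simp [h]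
  simp_rw [h2]
  rw [Finset.sum_const, Finset.card_univ, Fintype.card_perm, Fintype.card_fin, nsmul_eq_mul,
    mul_inv_cancel_left₀ (by exact_mod_cast r.factorial_ne_zero)]

theorem HolFunNear.frequently_mul_ne_zero {I : ComplexStructure n M} {f g : M → ℂ} {x : M}
    (hf : HolFunNear I f x) (hg : HolFunNear I g x) (hf0 : ∃ᶠ y in 𝓝 x, f y ≠ 0)
    (hg0 : ∃ᶠ y in 𝓝 x, g y ≠ 0) : ∃ᶠ y in 𝓝 x, f y * g y ≠ 0 := by
  intro h
  refine hg0 ?_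
  filter_upwards [eventuallyEq_of_mul_eq_mul hf hf0 hg (holFunNear_const 0 x) (by
    filter_upwards [h] with y hy using by
      simpa using not_not.1 hy)] with y hy using not_not.2 hy

variable [VectorBundle ℂ F V] [VectorBundle ℝ F V] [IsManifold (𝓡 (2 * n)) ∞ M]
  [ContMDiffVectorBundle ∞ F V (𝓡 (2 * n))] {I : ComplexStructure n M}

/-- `η` is a holomorphic form of degree `r` near `x`, without zeros in codimension one, that
annihilates the kernel of `Ψ` at generic points, where `Ψ` has rank `r`. -/
structure IsAnnForm {r : ℕ} (D : HolStructure F I V) (Ψ : ∀ x, V x →ₗ[ℂ] V x)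
    (η : ∀ y, V y [⋀^Fin r]→ₗ[ℂ] ℂ) (x : M) : Prop where
  hol : ∀ᶠ y in 𝓝 x, ∀ u : Fin r → ∀ z, V z, (∀ i, HolSecNear D (u i) y) →
    HolFunNear I (fun z => η z fun i => u i z) y
  ann : ∃ b, HolFunNear I b x ∧ (∃ᶠ z in 𝓝 x, b z ≠ 0) ∧ ∀ᶠ z in 𝓝 x, b z ≠ 0 →
    Module.finrank ℂ (LinearMap.range (Ψ z)) = r ∧ ∀ u i, u i ∈ LinearMap.ker (Ψ z) → η z u = 0
  prim : ∃ e : Fin (Module.finrank ℂ F) → ∀ y, V y, IsHolBasisNear D e x ∧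
    ∀ᶠ y in 𝓝 x, IsPrimitiveNear I (fun C : Fin r → Fin (Module.finrank ℂ F) =>
      fun z => η z fun i => e (C i) z) y

variable {D : HolStructure F I V} {Ψ : ∀ x, V x →ₗ[ℂ] V x} {r : ℕ}

theorem IsAnnForm.eventually {η : ∀ y, V y [⋀^Fin r]→ₗ[ℂ] ℂ} {x : M}
    (h : IsAnnForm D Ψ η x) : ∀ᶠ y in 𝓝 x, IsAnnForm D Ψ η y := by
  obtain ⟨b, hb, hb0, hba⟩ := h.ann
  obtain ⟨e, he, hp⟩ := h.prim
  filter_upwards [h.hol.eventually_nhds, hb.eventually, hb.eventually_frequently_ne_zero hb0,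
    hba.eventually_nhds, he.eventually, hp.eventually_nhds] with y h1 h2 h3 h4 h5 h6
  exact ⟨h1, ⟨b, h2, h3, h4⟩, ⟨e, h5, h6⟩⟩

theorem exists_minor_ne_zero {ι : Type*} [Fintype ι] {e : ι → ∀ y, V y} {y : M}
    (h : IsBasisAt e y) (Ψ : ∀ x, V x →ₗ[ℂ] V x)
    (hr : Module.finrank ℂ (LinearMap.range (Ψ y)) = r) :
    ∃ R C : Fin r → ι, frameMinor e R y (fun i => Ψ y (e (C i) y)) ≠ 0 := by
  have := h.finiteDimensional
  have hs : Submodule.span ℂ (Set.range fun i => Ψ y (e i y)) = LinearMap.range (Ψ y) := by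
    rw [Set.range_comp' (Ψ y), ← Submodule.map_span, h.2, Submodule.map_top]
  obtain ⟨f, hf, hli⟩ : ∃ f : Fin r → V y, (∀ i, f i ∈ Set.range fun i => Ψ y (e i y)) ∧
      LinearIndependent ℂ f := by
    rw [← hr, ← hs]
    obtain ⟨f, hf, -, hli⟩ := Submodule.exists_fun_fin_finrank_span_eq ℂ
      (Set.range fun i => Ψ y (e i y))
    exact ⟨f, hf, hli⟩
  choose C hC using hf
  obtain ⟨R, hR⟩ := exists_det_submatrix_ne_zero
    (Matrix.of fun (i : ι) (j : Fin r) => frameCoord e i y (f j)) fun c hc => by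
      refine funext fun j => Fintype.linearIndependent_iff.1 hli c ?_ j
      refine h.basis.repr.map_eq_zero_iff.1 (Finsupp.ext fun i => ?_)
      have := congrFun hc i
      simp only [Matrix.mulVec, dotProduct, Matrix.of_apply, frameCoord, h, dif_pos,
        Module.Basis.coord_apply, Pi.zero_apply] at this
      simpa [mul_comm] using this
  refine ⟨R, C, ?_⟩
  rw [frameMinor_apply, ← Matrix.det_transpose]
  convert hR using 3
  ext i j
  simp only [Matrix.transpose_apply, Matrix.of_apply, Matrix.submatrix_apply, id, ← hC]

/-- For fixed rows `R`, the minors `f C` are the values on a frame of the form `frameMinor e R ∘ Ψ`,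
which kills `ker Ψ`. The rows are chosen so that this form is not identically zero near `x`. The
primitive part `q` of the family `f` gives `η`; where `f C₀ ≠ 0` the rank is exactly `r`. -/
theorem exists_isAnnForm (hn : 0 < n)
    (hΨ : ∀ s x, HolSecNear D s x → HolSecNear D (fun y => Ψ y (s y)) x)
    (hle : ∀ y, Module.finrank ℂ (LinearMap.range (Ψ y)) ≤ r) {x : M}
    (hr : ∃ᶠ y in 𝓝 x, Module.finrank ℂ (LinearMap.range (Ψ y)) = r) :
    ∃ η : ∀ y, V y [⋀^Fin r]→ₗ[ℂ] ℂ, IsAnnForm D Ψ η x := by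
  classical
  obtain ⟨e, he⟩ := exists_isHolBasisNear D x
  obtain ⟨R, C₀, hRC⟩ : ∃ R C : Fin r → Fin (Module.finrank ℂ F),
      ∃ᶠ y in 𝓝 x, frameMinor e R y (fun i => Ψ y (e (C i) y)) ≠ 0 := by
    by_contra! H
    refine hr ?_
    filter_upwards [eventually_all.2 fun R => eventually_all.2 (H R), he.2] with y h1 h2 h3
    obtain ⟨R, C, h4⟩ := exists_minor_ne_zero h2 Ψ h3
    exact h4 (h1 R C)
  set f : (Fin r → Fin (Module.finrank ℂ F)) → M → ℂ := fun C y =>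
    frameMinor e R y (fun i => Ψ y (e (C i) y)) with hf
  have hfh : ∀ C, HolFunNear I (f C) x := by
    intro C
    simp only [hf, frameMinor_apply]
    refine HolFunNear.det fun i j => ?_
    refine (he.holFunNear_secCoeff (hΨ _ x (he.1 (C i))) (R j)).congr ?_
    exact Eventually.of_forall fun y =>
      frameCoord_apply e (fun y => Ψ y (e (C i) y)) (R j) y
  obtain ⟨μ, q, hμ, hq, hfac⟩ := exists_primitive_factorization_near hn hfh C₀ hRC
  have hμ0 : ∃ᶠ y in 𝓝 x, μ y ≠ 0 := (hRC.and_eventually hfac).mono fun y hy h0 => hy.1 (by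
    show f C₀ y = 0
    rw [hy.2.1 C₀, h0, zero_mul])
  -- The cofactors inherit antisymmetry from the minors once the common factor `μ` is cancelled.
  have halt : ∀ᶠ y in 𝓝 x, ∀ (C : Fin r → Fin (Module.finrank ℂ F)) (σ : Equiv.Perm (Fin r)),
      q (C ∘ σ) y = (Equiv.Perm.sign σ : ℤ) * q C y := by
    refine eventually_all.2 fun C => eventually_all.2 fun σ => ?_
    refine eventuallyEq_of_mul_eq_mul hμ hμ0 (hq _) ((holFunNear_const _ x).mul (hq C)) ?_
    filter_upwards [hfac] with y hy
    rw [mul_left_comm, ← hy.1, ← hy.1]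
    have := (frameMinor e R y).map_perm (fun i => Ψ y (e (C i) y)) σ
    rw [Units.smul_def, zsmul_eq_mul] at this
    exact this
  have hval : ∀ᶠ y in 𝓝 x, ∀ C, formOfValues e q y (fun i => e (C i) y) = q C y := by
    filter_upwards [halt, he.2] with y h1 h2 C using formOfValues_apply_frame h2 h1 C
  refine ⟨formOfValues e q, ?_, ⟨f C₀, hfh C₀, hRC, ?_⟩, ⟨e, he, ?_⟩⟩
  · filter_upwards [he.eventually, eventually_all.2 fun C => (hq C).eventually,
      hval.eventually_nhds] with y h1 h2 h3 u hu
    refine HolFunNear.congr (f := fun z => ∑ C : Fin r → Fin (Module.finrank ℂ F),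
      (∏ i, secCoeff e (u i) (C i) z) * q C z) ?_ ?_
    · exact .sum _ fun C _ => (HolFunNear.prod _ fun i _ => h1.holFunNear_secCoeff (hu i) _).mul
        (h2 C)
    · filter_upwards [h1.2, h3] with z h4 h5
      have := h4.multilinear_expand (formOfValues e q z).toMultilinearMap u
      simp only [AlternatingMap.coe_multilinearMap, h5, smul_eq_mul] at this
      exact this
  · filter_upwards [hfac, hval, he.2] with z h1 h2 h3 hz
    have hμz : μ z ≠ 0 := fun h0 => hz (by
      show f C₀ z = 0
      rw [h1.1, h0, zero_mul])
    have := h3.finiteDimensional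
    constructor
    · refine le_antisymm (hle z) ?_
      have hli : LinearIndependent ℂ fun i => (⟨Ψ z (e (C₀ i) z), LinearMap.mem_range_self _ _⟩ :
          LinearMap.range (Ψ z)) := by
        refine LinearIndependent.of_comp (LinearMap.range (Ψ z)).subtype ?_
        by_contra h
        exact hz ((frameMinor e R z).map_linearDependent _ h)
      simpa using hli.fintype_card_le_finrank
    · have heq : μ z • formOfValues e q z = (frameMinor e R z).compLinearMap (Ψ z) := by
        refine Module.Basis.ext_alternating h3.basis fun B _ => ?_
        simp only [IsBasisAt.basis_apply, AlternatingMap.smul_apply, h2, smul_eq_mul]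
        exact (h1.1 B).symm
      intro u i hu
      have h4 := DFunLike.congr_fun heq u
      have h5 : (frameMinor e R z).compLinearMap (Ψ z) u = 0 :=
        (frameMinor e R z).toMultilinearMap.map_coord_zero i (LinearMap.mem_ker.1 hu)
      rw [h5, AlternatingMap.smul_apply, smul_eq_mul] at h4
      exact (mul_eq_zero.1 h4).resolve_left hμz
  · filter_upwards [hfac, hval.eventually_nhds] with y h1 h2
    exact h1.2.congr fun C => h2.mono fun z hz => hz C

/-- Annihilating forms are unique up to holomorphic units. -/
theorem IsAnnForm.exists_unit (hn : 0 < n) {η η' : ∀ y, V y [⋀^Fin r]→ₗ[ℂ] ℂ} {x : M}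
    (h : IsAnnForm D Ψ η x) (h' : IsAnnForm D Ψ η' x) :
    ∃ k : M → ℂ, HolFunNear I k x ∧ k x ≠ 0 ∧ ∀ᶠ z in 𝓝 x, η' z = k z • η z := by
  have key : ∀ {η η' : ∀ y, V y [⋀^Fin r]→ₗ[ℂ] ℂ}, IsAnnForm D Ψ η x → IsAnnForm D Ψ η' x →
      ∃ k : M → ℂ, HolFunNear I k x ∧ ∀ᶠ z in 𝓝 x, η' z = k z • η z := by
    intro η η' h h'
    obtain ⟨b, hb, hb0, hba⟩ := h.ann
    obtain ⟨b', hb', hb0', hba'⟩ := h'.ann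
    obtain ⟨e, he, hp⟩ := h.prim
    set v : (Fin r → Fin (Module.finrank ℂ F)) → M → ℂ := fun C z => η z fun i => e (C i) z
    set w : (Fin r → Fin (Module.finrank ℂ F)) → M → ℂ := fun C z => η' z fun i => e (C i) z
    have hv : ∀ C, HolFunNear I (v C) x := fun C => h.hol.self_of_nhds _ fun i => he.1 _
    have hw : ∀ C, HolFunNear I (w C) x := fun C => h'.hol.self_of_nhds _ fun i => he.1 _
    -- At generic points both forms live on the quotient by the kernel, which has dimension `r`, so
    -- they are proportional.
    have hcomm : ∀ B C, ∀ᶠ z in 𝓝 x, w B z * v C z = v B z * w C z := by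
      intro B C
      refine eventuallyEq_of_mul_eq_mul (hb.mul hb') (hb.frequently_mul_ne_zero hb' hb0 hb0')
        ((hw B).mul (hv C)) ((hv B).mul (hw C)) ?_
      filter_upwards [hba, hba', he.2] with z h1 h2 h3
      by_cases hz : b z * b' z = 0
      · rw [hz, zero_mul, zero_mul]
      · have hbz := left_ne_zero_of_mul hz
        have := h3.finiteDimensional
        congr 1
        refine (alternatingMap_smul_comm (LinearMap.ker (Ψ z)) ?_ (η' z) (η z)
          (h2 (right_ne_zero_of_mul hz)).2 (h1 hbz).2 _ _).trans ?_
        · rw [(Ψ z).quotKerEquivRange.finrank_eq, (h1 hbz).1]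
        · rw [smul_eq_mul, mul_comm]
    obtain ⟨B, hB⟩ := hp.self_of_nhds.exists_frequently_ne_zero hn
    -- All products of the meromorphic germ `w B / v B` with the values `v C` are the holomorphic
    -- functions `w C`. Primitivity of `v` makes the ratio holomorphic.
    obtain ⟨k, hk, hkB⟩ := hp.self_of_nhds (w B) (v B) (hw B) (hv B) hB
      fun C => ⟨w C, hw C, hcomm B C⟩
    refine ⟨k, hk, ?_⟩
    have h3 : ∀ C, ∀ᶠ z in 𝓝 x, w C z = k z * v C z := fun C => by
      refine eventuallyEq_of_mul_eq_mul (hv B) hB (hw C) (hk.mul (hv C)) ?_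
      filter_upwards [hcomm B C, hkB] with z h1 h2
      rw [← h1, h2]
      ring
    filter_upwards [eventually_all.2 h3, he.2] with z h4 h5
    refine Module.Basis.ext_alternating h5.basis fun C _ => ?_
    simpa using h4 C
  obtain ⟨k, hk, hkz⟩ := key h h'
  obtain ⟨k', hk', hkz'⟩ := key h' h
  refine ⟨k, hk, ?_, hkz⟩
  obtain ⟨e, he, hp⟩ := h.prim
  obtain ⟨B, hB⟩ := hp.self_of_nhds.exists_frequently_ne_zero hn
  -- The ratios in both directions are holomorphic and inverse to each other, so they are units.
  have h1 : (fun z => k' z * k z) =ᶠ[𝓝 x] fun _ => 1 := by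
    refine eventuallyEq_of_mul_eq_mul (h.hol.self_of_nhds _ fun i => he.1 (B i)) hB
      (hk'.mul hk) (holFunNear_const 1 x) ?_
    filter_upwards [hkz, hkz'] with z h1 h2
    have h3 := DFunLike.congr_fun h2 fun i => e (B i) z
    rw [h1, smul_smul, AlternatingMap.smul_apply, smul_eq_mul] at h3
    rw [mul_one, mul_comm, ← h3]
  intro h0
  have := h1.self_of_nhds
  simp [h0] at this

end AnnihilatingForms

/-! ### Frames adapted to the kernel of an endomorphism -/

section Adapted

variable {n : ℕ} {M : Type*} [TopologicalSpace M]
  [ChartedSpace (EuclideanSpace ℝ (Fin (2 * n))) M]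
  {F : Type*} [NormedAddCommGroup F] [NormedSpace ℂ F] [FiniteDimensional ℂ F]
  {V : M → Type*} [∀ x, AddCommGroup (V x)] [∀ x, Module ℂ (V x)]
  [TopologicalSpace (TotalSpace F V)] [∀ x, TopologicalSpace (V x)] [FiberBundle F V]
  [VectorBundle ℂ F V] [VectorBundle ℝ F V] [IsManifold (𝓡 (2 * n)) ∞ M]
  [ContMDiffVectorBundle ∞ F V (𝓡 (2 * n))] {I : ComplexStructure n M}

/-- `w, k` is a holomorphic frame near `y` whose second part lies in the kernel of `Ψ`. -/
def IsAdapted {r s : ℕ} (D : HolStructure F I V) (Ψ : ∀ x, V x →ₗ[ℂ] V x)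
    (w : Fin r → ∀ y, V y) (k : Fin s → ∀ y, V y) (y : M) : Prop :=
  IsHolBasisNear D (Sum.elim w k) y ∧ ∀ᶠ z in 𝓝 y, ∀ j, Ψ z (k j z) = 0

/-- The points without adapted frames. -/
def singSet (D : HolStructure F I V) (Ψ : ∀ x, V x →ₗ[ℂ] V x) (r s : ℕ) : Set M :=
  {y | ¬ ∃ (w : Fin r → ∀ y, V y) (k : Fin s → ∀ y, V y), IsAdapted D Ψ w k y}

variable {D : HolStructure F I V} {Ψ : ∀ x, V x →ₗ[ℂ] V x} {r s : ℕ}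

theorem IsAdapted.eventually {w : Fin r → ∀ y, V y} {k : Fin s → ∀ y, V y} {y : M}
    (h : IsAdapted D Ψ w k y) : ∀ᶠ z in 𝓝 y, IsAdapted D Ψ w k z := by
  filter_upwards [h.1.eventually, h.2.eventually_nhds] with z h1 h2 using ⟨h1, h2⟩

theorem IsAnnForm.eventually_eq_zero {η : ∀ y, V y [⋀^Fin r]→ₗ[ℂ] ℂ} {y : M}
    (h : IsAnnForm D Ψ η y) {w : Fin r → ∀ y, V y} {k : Fin s → ∀ y, V y}
    (ha : IsAdapted D Ψ w k y) : ∀ᶠ z in 𝓝 y, ∀ C : Fin r → Fin r ⊕ Fin s,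
      (∃ i j, C i = Sum.inr j) → η z (fun i => Sum.elim w k (C i) z) = 0 := by
  obtain ⟨b, hb, hb0, hba⟩ := h.ann
  refine eventually_all.2 fun C => ?_
  by_cases hC : ∃ i j, C i = Sum.inr j
  swap
  · exact Eventually.of_forall fun z h => absurd h hC
  obtain ⟨i, j, hij⟩ := hC
  have : (fun z => η z (fun i => Sum.elim w k (C i) z)) =ᶠ[𝓝 y] fun _ => 0 := by
    refine eventuallyEq_of_mul_eq_mul hb hb0 (h.hol.self_of_nhds _ fun i => ha.1.1 _)
      (holFunNear_const 0 y) ?_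
    filter_upwards [hba, ha.2] with z h1 h2
    by_cases hz : b z = 0
    · rw [hz, zero_mul, zero_mul]
    · rw [(h1 hz).2 _ i (by rw [hij]; exact h2 j)]
  exact this.mono fun z hz _ => hz

/-- The values of an annihilating form in an adapted frame. -/
theorem IsAnnForm.eventually_eq_minorForm {η : ∀ y, V y [⋀^Fin r]→ₗ[ℂ] ℂ} {y : M}
    (h : IsAnnForm D Ψ η y) {w : Fin r → ∀ y, V y} {k : Fin s → ∀ y, V y}
    (ha : IsAdapted D Ψ w k y) : ∀ᶠ z in 𝓝 y, ∃ hz : IsBasisAt (Sum.elim w k) z, ∀ u,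
      η z u = minorForm hz.basis u * η z fun i => w i z := by
  filter_upwards [h.eventually_eq_zero ha, ha.1.2] with z h1 h2
  refine ⟨h2, fun u => ?_⟩
  have h3 := alternatingMap_eq_minorForm h2.basis (η z)
    (fun C hC => by simpa using h1 C hC) u
  simpa using h3

/-- In an adapted frame `η` is a minor times `η(w)`, so `η(w)` divides all values of `η` on the
frame `e`. As these form a primitive family, `η(w)` is a unit. -/
theorem IsAnnForm.ne_zero (hn : 0 < n) {η : ∀ y, V y [⋀^Fin r]→ₗ[ℂ] ℂ} {y : M}
    (h : IsAnnForm D Ψ η y) {w : Fin r → ∀ y, V y} {k : Fin s → ∀ y, V y}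
    (ha : IsAdapted D Ψ w k y) : η y (fun i => w i y) ≠ 0 := by
  obtain ⟨e, he, hp⟩ := h.prim
  refine hp.self_of_nhds.ne_zero_of_eq_mul hn (c := fun z => η z fun i => w i z)
    (h.hol.self_of_nhds _ fun i => ha.1.1 (Sum.inl i)) fun C => ?_
  refine ⟨fun z => (Matrix.of fun i j =>
    secCoeff (Sum.elim w k) (e (C i)) (Sum.inl j) z).det, HolFunNear.det fun i j =>
      ha.1.holFunNear_secCoeff (he.1 _) _, ?_⟩
  filter_upwards [h.eventually_eq_minorForm ha] with z ⟨h1, h2⟩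
  rw [h2, mul_comm, minorForm_apply]
  simp only [h1.secCoeff_eq]

/-- Contractions with an annihilating form are holomorphic sections of the kernel. -/
theorem IsAnnForm.contraction_mem_ker
    (hΨ : ∀ s x, HolSecNear D s x → HolSecNear D (fun y => Ψ y (s y)) x)
    {η : ∀ y, V y [⋀^Fin r]→ₗ[ℂ] ℂ} {y : M}
    (h : IsAnnForm D Ψ η y) {u : Fin (r + 1) → ∀ z, V z} (hu : ∀ i, HolSecNear D (u i) y) :
    HolSecNear D (fun z => contraction (η z) fun i => u i z) y ∧
      ∀ᶠ z in 𝓝 y, Ψ z (contraction (η z) fun i => u i z) = 0 := by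
  have h1 : HolSecNear D (fun z => contraction (η z) fun i => u i z) y := by
    simp only [contraction_apply]
    exact HolSecNear.sum_smul _ (fun i _ => (holFunNear_const _ y).mul
      (h.hol.self_of_nhds (i.removeNth u) fun j => hu _)) fun i _ => hu i
  refine ⟨h1, ?_⟩
  obtain ⟨b, hb, hb0, hba⟩ := h.ann
  obtain ⟨e, he⟩ := exists_isHolBasisNear D y
  -- Membership in the kernel is linear algebra where `b ≠ 0`. It extends to the remaining points by
  -- cancelling `b`.
  have h2 : ∀ᶠ z in 𝓝 y, ∀ i, secCoeff e (fun z => Ψ z (contraction (η z) fun i => u i z)) i z = 0 :=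
    eventually_all.2 fun i => by
      refine eventuallyEq_of_mul_eq_mul hb hb0 (he.holFunNear_secCoeff (hΨ _ _ h1) i)
        (holFunNear_const 0 y) ?_
      filter_upwards [hba, he.2] with z h3 h4
      by_cases hz : b z = 0
      · rw [hz, zero_mul, zero_mul]
      · have := h4.finiteDimensional
        have h5 : Ψ z (contraction (η z) fun i => u i z) = 0 :=
          LinearMap.mem_ker.1 (contraction_mem (LinearMap.ker (Ψ z)) (by
            rw [(Ψ z).quotKerEquivRange.finrank_eq, (h3 hz).1]) _ (h3 hz).2 _)
        rw [h4.secCoeff_of_eq_sum (c := fun _ => 0) (by simp [h5]) i]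
  filter_upwards [h2, he.2] with z h3 h4
  rw [← h4.sum_secCoeff fun z => Ψ z (contraction (η z) fun i => u i z)]
  simp [h3]

/-- Where `η(e_C) ≠ 0`, each frame vector `e_l` outside `C` is replaced by the contraction of `e_l,
e_C`. This is `η(e_C) e_l` plus a combination of the `e_C`, so the new family is again a frame, and
the contractions lie in the kernel. -/
theorem IsAnnForm.exists_isAdapted (hrs : r + s = Module.finrank ℂ F)
    (hΨ : ∀ s x, HolSecNear D s x → HolSecNear D (fun y => Ψ y (s y)) x)
    {η : ∀ y, V y [⋀^Fin r]→ₗ[ℂ] ℂ} {y : M} (h : IsAnnForm D Ψ η y)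
    {e : Fin (Module.finrank ℂ F) → ∀ y, V y} (he : IsHolBasisNear D e y)
    {C : Fin r → Fin (Module.finrank ℂ F)} (hC : η y (fun i => e (C i) y) ≠ 0) : y ∉ singSet D Ψ r s := by
  classical
  have hCinj : Function.Injective C := by
    intro i j hij
    by_contra hne
    exact hC ((η y).map_eq_zero_of_eq _ (by simp only [hij]) hne)
  obtain ⟨τ⟩ : Nonempty (Fin s ≃ ((Set.range C)ᶜ : Set (Fin (Module.finrank ℂ F)))) := by
    rw [← Fintype.card_eq, Fintype.card_compl_set, Set.card_range_of_injective hCinj]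
    simp; omega
  set k : Fin s → ∀ y, V y := fun j z => contraction (η z)
    fun i => (Fin.cons (e (τ j)) (fun i => e (C i)) : Fin (r + 1) → ∀ y, V y) i z with hk
  have hk1 := fun j => h.contraction_mem_ker hΨ
    (u := (Fin.cons (e (τ j)) (fun i => e (C i)) : Fin (r + 1) → ∀ y, V y)) (fun i => by
      refine Fin.cases ?_ (fun i => ?_) i
      · exact he.1 _
      · exact he.1 _)
  refine not_not.2 ⟨fun i => e (C i), k, ⟨?_, ?_⟩, eventually_all.2 fun j => (hk1 j).2⟩
  · rintro (i | j)
    · exact he.1 _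
    · exact (hk1 j).1
  · have hCz : ∀ᶠ z in 𝓝 y, η z (fun i => e (C i) z) ≠ 0 :=
      (h.hol.self_of_nhds _ fun i => he.1 _).continuousAt.eventually_ne hC
    filter_upwards [hCz, he.2] with z hz hez
    have hspan : Submodule.span ℂ (Set.range fun i => Sum.elim (fun i => e (C i)) k i z) = ⊤ := by
      rw [eq_top_iff, ← hez.2, Submodule.span_le]
      set P := Submodule.span ℂ (Set.range fun i => Sum.elim (fun i => e (C i)) k i z)
      have h1 : ∀ i, e (C i) z ∈ P := fun i => Submodule.subset_span ⟨Sum.inl i, rfl⟩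
      have h2 : ∀ j, k j z ∈ P := fun j => Submodule.subset_span ⟨Sum.inr j, rfl⟩
      rintro _ ⟨l, rfl⟩
      by_cases hl : l ∈ Set.range C
      · obtain ⟨i, rfl⟩ := hl; exact h1 i
      · obtain ⟨j, hj⟩ := τ.surjective ⟨l, hl⟩
        have h3 := h2 j
        have h4 : (fun i => (Fin.cons (e (τ j)) (fun i => e (C i)) : Fin (r + 1) → ∀ y, V y) i z) =
            Fin.cons (e l z) fun i => e (C i) z := by
          funext i
          refine Fin.cases ?_ (fun i => ?_) i
          · simp [hj]
          · simp
        simp only [hk] at h3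
        rw [h4, contraction_cons] at h3
        have h5 := (P.add_mem_iff_left (P.sum_mem fun i _ => P.smul_mem _ (h1 i))).1 h3
        exact (P.smul_mem_iff hz).1 h5
    refine ⟨?_, hspan⟩
    have := hez.finiteDimensional
    refine linearIndependent_of_top_le_span_of_card_eq_finrank hspan.ge ?_
    rw [Module.finrank_eq_card_basis hez.basis]
    simpa using hrs

/-- The singular set is the zero set of any annihilating form. -/
theorem IsAnnForm.mem_singSet_iff (hn : 0 < n) (hrs : r + s = Module.finrank ℂ F)
    (hΨ : ∀ s x, HolSecNear D s x → HolSecNear D (fun y => Ψ y (s y)) x)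
    {η : ∀ y, V y [⋀^Fin r]→ₗ[ℂ] ℂ} {y : M} (h : IsAnnForm D Ψ η y)
    {e : Fin (Module.finrank ℂ F) → ∀ y, V y} (he : IsHolBasisNear D e y) :
    y ∈ singSet D Ψ r s ↔ ∀ C : Fin r → Fin (Module.finrank ℂ F), η y (fun i => e (C i) y) = 0 := by
  constructor
  · intro hy C
    by_contra hC
    exact h.exists_isAdapted hrs hΨ he hC hy
  · rintro hC ⟨w, k, ha⟩
    refine h.ne_zero hn ha ?_
    have : η y = 0 := Module.Basis.ext_alternating he.2.self_of_nhds.basis fun C _ => by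
      simpa using hC C
    rw [this]; rfl

theorem isAnalyticSubset_singSet (hn : 0 < n) (hrs : r + s = Module.finrank ℂ F)
    (hΨ : ∀ s x, HolSecNear D s x → HolSecNear D (fun y => Ψ y (s y)) x)
    (hη : ∀ x, ∃ η : ∀ y, V y [⋀^Fin r]→ₗ[ℂ] ℂ, IsAnnForm D Ψ η x) :
    IsAnalyticSubset I (singSet D Ψ r s) ∧ HasCodimAtLeast I (singSet D Ψ r s) 2 := by
  have key : ∀ x, ∃ (m : ℕ) (q : Fin m → M → ℂ), (∀ i, HolFunNear I (q i) x) ∧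
      IsPrimitiveNear I q x ∧ ∀ᶠ z in 𝓝 x, z ∈ singSet D Ψ r s ↔ ∀ i, q i z = 0 := by
    intro x
    obtain ⟨η, hηx⟩ := hη x
    obtain ⟨e, he, hp⟩ := hηx.prim
    let τ := Fintype.equivFin (Fin r → Fin (Module.finrank ℂ F))
    refine ⟨_, fun l z => η z fun i => e (τ.symm l i) z,
      fun l => hηx.hol.self_of_nhds _ fun i => he.1 _, ?_, ?_⟩
    · intro a b ha hb hb0 H
      refine hp.self_of_nhds a b ha hb hb0 fun C => ?_
      simpa using H (τ C)
    · filter_upwards [hηx.eventually, he.eventually] with z h1 h2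
      rw [h1.mem_singSet_iff hn hrs hΨ h2]
      exact τ.symm.forall_congr_right.symm
  refine ⟨fun x => ?_, hasCodimAtLeast_two hn fun y _ => key y⟩
  obtain ⟨m, q, h1, -, h2⟩ := key x
  exact ⟨m, q, h1, h2⟩

end Adapted

/-! ### Image and kernel sheaves -/

section Sheaves

variable {n : ℕ} {M : Type*} [TopologicalSpace M]
  [ChartedSpace (EuclideanSpace ℝ (Fin (2 * n))) M]
  {F : Type*} [NormedAddCommGroup F] [NormedSpace ℂ F] [FiniteDimensional ℂ F]
  {V : M → Type*} [∀ x, AddCommGroup (V x)] [∀ x, Module ℂ (V x)]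
  [TopologicalSpace (TotalSpace F V)] [∀ x, TopologicalSpace (V x)] [FiberBundle F V]
  [VectorBundle ℂ F V] [VectorBundle ℝ F V] [IsManifold (𝓡 (2 * n)) ∞ M]
  [ContMDiffVectorBundle ∞ F V (𝓡 (2 * n))] {I : ComplexStructure n M}
  {D : HolStructure F I V} {Ψ : ∀ x, V x →ₗ[ℂ] V x} {r s : ℕ}

/-- `Ψ` maps holomorphic sections to holomorphic sections. -/
def PreservesHol (D : HolStructure F I V) (Ψ : ∀ x, V x →ₗ[ℂ] V x) : Prop :=
  ∀ s x, HolSecNear D s x → HolSecNear D (fun y => Ψ y (s y)) x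

/-- The image of `Ψ` on holomorphic sections. -/
def imSheaf (hΨ : PreservesHol D Ψ) : CoherentSubsheaf D where
  stalk z := {t | ∃ s, HolSecNear D s z ∧ ∀ᶠ y in 𝓝 z, t y = Ψ y (s y)}
  locally_generated x := by
    obtain ⟨e, he⟩ := exists_isHolBasisNear D x
    refine ⟨_, fun i y => Ψ y (e i y), fun i => hΨ _ _ (he.1 i), ?_⟩
    filter_upwards [he.eventually] with z hz t
    constructor
    · rintro ⟨s, hs, ht⟩
      refine ⟨secCoeff e s, fun i => hz.holFunNear_secCoeff hs i, ?_⟩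
      filter_upwards [ht, hz.2] with y h1 h2
      rw [h1]
      conv_lhs => rw [← h2.sum_secCoeff s]
      simp only [map_sum, map_smul]
    · rintro ⟨f, hf, ht⟩
      refine ⟨_, HolSecNear.sum_smul Finset.univ (fun i _ => hf i) fun i _ => hz.1 i, ?_⟩
      filter_upwards [ht] with y h1
      simp [h1]

theorem IsAdapted.apply_eq_sum {w : Fin r → ∀ y, V y} {k : Fin s → ∀ y, V y} {y : M}
    (ha : IsAdapted D Ψ w k y) (t : ∀ y, V y) : ∀ᶠ z in 𝓝 y,
      Ψ z (t z) = ∑ i, secCoeff (Sum.elim w k) t (Sum.inl i) z • Ψ z (w i z) := by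
  filter_upwards [ha.1.2, ha.2] with z h1 h2
  conv_lhs => rw [← h1.sum_secCoeff t]
  simp [Fintype.sum_sum_type, h2]

theorem IsAnnForm.eventually_linearIndependent {η : ∀ y, V y [⋀^Fin r]→ₗ[ℂ] ℂ} {y : M}
    (h : IsAnnForm D Ψ η y) {w : Fin r → ∀ y, V y} {k : Fin s → ∀ y, V y}
    (ha : IsAdapted D Ψ w k y) : ∃ b, HolFunNear I b y ∧ (∃ᶠ z in 𝓝 y, b z ≠ 0) ∧
      ∀ᶠ z in 𝓝 y, b z ≠ 0 → LinearIndependent ℂ fun i => Ψ z (w i z) := by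
  obtain ⟨b, hb, hb0, hba⟩ := h.ann
  refine ⟨b, hb, hb0, ?_⟩
  filter_upwards [hba, ha.1.2, ha.2] with z h1 h2 h3 hbz
  have := h2.finiteDimensional
  rw [linearIndependent_iff_card_le_finrank_span, Set.finrank]
  have : Submodule.span ℂ (Set.range fun i => Ψ z (w i z)) = LinearMap.range (Ψ z) := by
    refine le_antisymm (Submodule.span_le.2 ?_) ?_
    · rintro _ ⟨i, rfl⟩; exact LinearMap.mem_range_self _ _
    · rintro _ ⟨v, rfl⟩
      rw [← h2.basis.sum_repr v, map_sum, Fintype.sum_sum_type]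
      refine add_mem (Submodule.sum_mem _ fun i _ => ?_) (Submodule.sum_mem _ fun j _ => ?_)
      · rw [map_smul]
        exact Submodule.smul_mem _ _ (Submodule.subset_span ⟨i, by simp⟩)
      · rw [map_smul]
        simp [h3]
  rw [this, (h1 hbz).1, Fintype.card_fin]

/-- The images of the first part of an adapted frame are generically independent. -/
theorem IsAnnForm.eq_zero_of_sum_eq_zero {η : ∀ y, V y [⋀^Fin r]→ₗ[ℂ] ℂ} {y : M}
    (h : IsAnnForm D Ψ η y) {w : Fin r → ∀ y, V y} {k : Fin s → ∀ y, V y}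
    (ha : IsAdapted D Ψ w k y) {f : Fin r → M → ℂ} (hf : ∀ i, SmoothFunNear n (f i) y)
    (h0 : ∀ᶠ z in 𝓝 y, ∑ i, f i z • Ψ z (w i z) = 0) (i : Fin r) : ∀ᶠ z in 𝓝 y, f i z = 0 := by
  obtain ⟨b, hb, hb0, hba⟩ := h.eventually_linearIndependent ha
  have hz0 : ∀ᶠ z in 𝓝 y, b z ≠ 0 → f i z = 0 := by
    filter_upwards [hba, h0] with z h1 h4 hbz
    exact Fintype.linearIndependent_iff.1 (h1 hbz) _ h4 i
  filter_upwards [hz0.eventually_nhds, hb.eventually_frequently_ne_zero hb0, hf i] with z h1 h2 h3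
  exact eq_of_frequently_eq h3.continuousAt continuousAt_const
    ((h2.and_eventually h1).mono fun q hq => hq.2 hq.1)

theorem imSheaf_isFrameNear (hΨ : PreservesHol D Ψ) {η : ∀ y, V y [⋀^Fin r]→ₗ[ℂ] ℂ} {y : M}
    (h : IsAnnForm D Ψ η y) {w : Fin r → ∀ y, V y} {k : Fin s → ∀ y, V y}
    (ha : IsAdapted D Ψ w k y) : (imSheaf hΨ).IsFrameNear (fun i z => Ψ z (w i z)) y := by
  constructor
  · filter_upwards [ha.eventually] with z hz t
    constructor
    · rintro ⟨u, hu, ht⟩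
      refine ⟨fun i => secCoeff (Sum.elim w k) u (Sum.inl i),
        fun i => hz.1.holFunNear_secCoeff hu _, ?_⟩
      filter_upwards [ht, hz.apply_eq_sum u] with q h1 h2
      rw [h1, h2]
    · rintro ⟨f, hf, ht⟩
      refine ⟨_, HolSecNear.sum_smul Finset.univ (fun i _ => hf i) fun i _ => hz.1.1 (Sum.inl i), ?_⟩
      filter_upwards [ht] with q h1
      simp [h1]
  · filter_upwards [h.eventually, ha.eventually] with z h1 h2 f hf h0 i
    exact h1.eq_zero_of_sum_eq_zero h2 (fun i => (hf i).smoothFunNear) h0 i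

/-- The right-hand side does not involve the holomorphic structure, so the image sheaves of two
structures have the same smooth span. -/
theorem imSheaf_inSmoothSpan (hΨ : PreservesHol D Ψ) (x : M) (t : ∀ y, V y) :
    (imSheaf hΨ).InSmoothSpan x t ↔
      ∃ u, SmoothSecNear n F u x ∧ ∀ᶠ y in 𝓝 x, t y = Ψ y (u y) := by
  constructor
  · rintro ⟨m, u, f, hu, ht⟩
    choose σ hσ huσ using fun i => (hu i).1
    refine ⟨_, SmoothSecNear.sum_smul Finset.univ (fun i _ => (hu i).2)
      fun i _ => (hσ i).smoothSecNear, ?_⟩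
    filter_upwards [ht, eventually_all.2 huσ] with y h1 h2
    simp [h1, h2]
  · rintro ⟨u, hu, ht⟩
    obtain ⟨e, he⟩ := exists_isHolBasisNear D x
    refine ⟨_, fun i y => Ψ y (e i y), secCoeff e u,
      fun i => ⟨⟨e i, he.1 i, Eventually.of_forall fun _ => rfl⟩,
        he.smoothFunNear_secCoeff hu i⟩, ?_⟩
    filter_upwards [ht, he.2] with y h1 h2
    rw [h1]
    conv_lhs => rw [← h2.sum_secCoeff u]
    simp only [map_sum, map_smul]

/-- The subsheaf of the kernel of `Ψ` generated by contractions with annihilating forms. -/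
def kerSheaf (hΨ : PreservesHol D Ψ) (r : ℕ) (hn : 0 < n)
    (hη : ∀ x, ∃ η : ∀ y, V y [⋀^Fin r]→ₗ[ℂ] ℂ, IsAnnForm D Ψ η x) : CoherentSubsheaf D where
  stalk z := {t | ∃ η : ∀ y, V y [⋀^Fin r]→ₗ[ℂ] ℂ, IsAnnForm D Ψ η z ∧
    ∃ (m : ℕ) (f : Fin m → M → ℂ) (u : Fin m → Fin (r + 1) → ∀ y, V y),
      (∀ j, HolFunNear I (f j) z) ∧ (∀ j i, HolSecNear D (u j i) z) ∧
      ∀ᶠ y in 𝓝 z, t y = ∑ j, f j y • contraction (η y) fun i => u j i y}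
  locally_generated x := by
    obtain ⟨e, he⟩ := exists_isHolBasisNear D x
    obtain ⟨η, h⟩ := hη x
    let τ := Fintype.equivFin (Fin (r + 1) → Fin (Module.finrank ℂ F))
    refine ⟨_, fun l y => contraction (η y) fun i => e (τ.symm l i) y,
      fun l => (h.contraction_mem_ker hΨ fun i => he.1 _).1, ?_⟩
    filter_upwards [he.eventually, h.eventually] with z hz hηz t
    constructor
    · rintro ⟨η', hη', m, f, u, hf, hu, ht⟩
      -- Another annihilating form differs by a holomorphic unit, which is absorbed in the
      -- coefficients; one form thus generates nearby stalks.
      obtain ⟨κ, hκ, -, hκe⟩ := hηz.exists_unit hn hη'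
      refine ⟨fun l y => ∑ j, f j y * (κ y * ∏ i, secCoeff e (u j i) (τ.symm l i) y), fun l =>
        .sum _ fun j _ => (hf j).mul (hκ.mul (.prod _ fun i _ => hz.holFunNear_secCoeff (hu j i) _)),
        ?_⟩
      filter_upwards [ht, hκe, hz.2] with y h1 h2 h3
      have h4 := fun j => h3.multilinear_expand (contraction (η y)) (u j)
      simp only [h1, h2, contraction_smul, h4, Finset.smul_sum, Finset.sum_smul, smul_smul]
      rw [Finset.sum_comm, ← τ.symm.sum_comp]
    · rintro ⟨f, hf, ht⟩
      exact ⟨η, hηz, _, f, fun l i => e (τ.symm l i), hf, fun l i => hz.1 _, ht⟩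

variable {hn : 0 < n} {hη : ∀ x, ∃ η : ∀ y, V y [⋀^Fin r]→ₗ[ℂ] ℂ, IsAnnForm D Ψ η x}

theorem kerSheaf_stalk_subset {hΨ : PreservesHol D Ψ} {z : M} {t : ∀ y, V y}
    (ht : t ∈ (kerSheaf hΨ r hn hη).stalk z) :
    HolSecNear D t z ∧ ∀ᶠ y in 𝓝 z, Ψ y (t y) = 0 := by
  obtain ⟨η, h, m, f, u, hf, hu, ht⟩ := ht
  have h1 := fun j => h.contraction_mem_ker hΨ (hu j)
  refine ⟨(HolSecNear.sum_smul Finset.univ (fun j _ => hf j) fun j _ => (h1 j).1).congr ht, ?_⟩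
  filter_upwards [ht, eventually_all.2 fun j => (h1 j).2] with y h2 h3
  simp [h2, h3]

/-- Contracting `k j, w` leaves only the term `η(w) k j`, since `η` vanishes as soon as one argument
is `k j`. As `η(w)` is a unit, the kernel part of an adapted frame consists of multiples of
contractions and so lies in the kernel sheaf. -/
theorem IsAnnForm.eq_smul_contraction (hn : 0 < n) {η : ∀ y, V y [⋀^Fin r]→ₗ[ℂ] ℂ} {y : M}
    (h : IsAnnForm D Ψ η y) {w : Fin r → ∀ y, V y} {k : Fin s → ∀ y, V y}
    (ha : IsAdapted D Ψ w k y) (j : Fin s) :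
    (∀ i, HolSecNear D ((Fin.cons (k j) w : Fin (r + 1) → ∀ y, V y) i) y) ∧
    HolFunNear I (fun z => (η z fun i => w i z)⁻¹) y ∧
    ∀ᶠ z in 𝓝 y, k j z = (η z fun i => w i z)⁻¹ • contraction (η z) fun i =>
      (Fin.cons (k j) w : Fin (r + 1) → ∀ y, V y) i z := by
  refine ⟨fun i => ?_, (h.hol.self_of_nhds _ fun i => ha.1.1 (Sum.inl i)).inv (h.ne_zero hn ha), ?_⟩
  · refine Fin.cases ?_ (fun i => ?_) i
    · exact ha.1.1 (Sum.inr j)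
    · exact ha.1.1 (Sum.inl i)
  · filter_upwards [h.eventually, ha.eventually, h.eventually_eq_minorForm ha] with z h1 h2 ⟨h3, h4⟩
    have h5 : (fun i => (Fin.cons (k j) w : Fin (r + 1) → ∀ y, V y) i z) =
        Fin.cons (k j z) fun i => w i z := by
      funext i
      refine Fin.cases ?_ (fun i => ?_) i <;> simp
    rw [h5, contraction_cons_of_mem, smul_smul, inv_mul_cancel₀ (h1.ne_zero hn h2), one_smul]
    intro u i hu
    rw [h4, minorForm_apply, Matrix.det_eq_zero_of_row_eq_zero i, zero_mul]
    intro l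
    have : u i = h3.basis (Sum.inr j) := by rw [h3.basis_apply]; exact hu
    rw [Matrix.of_apply, this, Module.Basis.repr_self]
    simp

theorem IsAdapted.mem_kerSheaf_stalk {hΨ : PreservesHol D Ψ} {w : Fin r → ∀ y, V y}
    {k : Fin s → ∀ y, V y} {y : M} (ha : IsAdapted D Ψ w k y) (j : Fin s) :
    k j ∈ (kerSheaf hΨ r hn hη).stalk y := by
  obtain ⟨η, h⟩ := hη y
  obtain ⟨h1, h2, h3⟩ := h.eq_smul_contraction hn ha j
  exact ⟨η, h, 1, fun _ => _, fun _ => _, fun _ => h2, fun _ => h1, by simpa using h3⟩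

/-- Sections killed by `Ψ` are combinations of the second part of an adapted frame. -/
theorem IsAdapted.eq_sum_of_mem_ker (hη : ∀ x, ∃ η : ∀ y, V y [⋀^Fin r]→ₗ[ℂ] ℂ, IsAnnForm D Ψ η x)
    {w : Fin r → ∀ y, V y} {k : Fin s → ∀ y, V y} {y : M} (ha : IsAdapted D Ψ w k y)
    {t : ∀ y, V y} (ht : SmoothSecNear n F t y) (h0 : ∀ᶠ z in 𝓝 y, Ψ z (t z) = 0) :
    ∀ᶠ z in 𝓝 y, t z = ∑ j, secCoeff (Sum.elim w k) t (Sum.inr j) z • k j z := by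
  obtain ⟨η, h⟩ := hη y
  have h1 := eventually_all.2 (h.eq_zero_of_sum_eq_zero ha
    (f := fun i => secCoeff (Sum.elim w k) t (Sum.inl i))
    (fun i => ha.1.smoothFunNear_secCoeff ht _) (by
      filter_upwards [ha.apply_eq_sum t, h0] with z h1 h2
      rw [← h1, h2]))
  filter_upwards [h1, ha.1.2] with z h2 h3
  conv_lhs => rw [← h3.sum_secCoeff t, Fintype.sum_sum_type]
  simp [h2]

theorem kerSheaf_isFrameNear {hΨ : PreservesHol D Ψ} {y : M}
    {w : Fin r → ∀ y, V y} {k : Fin s → ∀ y, V y} (ha : IsAdapted D Ψ w k y) :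
    (kerSheaf hΨ r hn hη).IsFrameNear k y := by
  constructor
  · filter_upwards [ha.eventually] with z hz t
    constructor
    · intro ht
      obtain ⟨h1, h2⟩ := kerSheaf_stalk_subset ht
      exact ⟨_, fun j => hz.1.holFunNear_secCoeff h1 _,
        hz.eq_sum_of_mem_ker hη h1.smoothSecNear h2⟩
    · rintro ⟨f, hf, ht⟩
      obtain ⟨η, h⟩ := hη z
      have h1 := fun j => h.eq_smul_contraction hn hz j
      refine ⟨η, h, s, _, _, fun j => (hf j).mul (h1 j).2.1, fun j => (h1 j).1, ?_⟩
      filter_upwards [ht, eventually_all.2 fun j => (h1 j).2.2] with q h2 h3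
      rw [h2]
      refine Finset.sum_congr rfl fun j _ => ?_
      conv_lhs => rw [h3 j]
      rw [smul_smul]
  · filter_upwards [ha.eventually] with z hz f hf h0 j
    filter_upwards [h0, hz.1.2] with q h1 h2
    have := Fintype.linearIndependent_iff.1 h2.1 (Sum.elim (fun _ => 0) fun j => f j q)
      (by simpa [Fintype.sum_sum_type] using h1) (Sum.inr j)
    simpa using this

/-- Off the singular set the smooth span is described by `Ψ` alone, so the kernel sheaves of two
holomorphic structures coincide off the union of their singular sets. -/
theorem kerSheaf_inSmoothSpan {hΨ : PreservesHol D Ψ} {y : M} (hy : y ∉ singSet D Ψ r s)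
    (t : ∀ y, V y) : (kerSheaf hΨ r hn hη).InSmoothSpan y t ↔
      SmoothSecNear n F t y ∧ ∀ᶠ z in 𝓝 y, Ψ z (t z) = 0 := by
  obtain ⟨w, k, ha⟩ := not_not.1 hy
  constructor
  · rintro ⟨m, u, f, hu, ht⟩
    have h1 := fun i => kerSheaf_stalk_subset (hu i).1
    refine ⟨(SmoothSecNear.sum_smul Finset.univ (fun i _ => (hu i).2)
      fun i _ => (h1 i).1.smoothSecNear).congr ht, ?_⟩
    filter_upwards [ht, eventually_all.2 fun i => (h1 i).2] with z h2 h3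
    simp [h2, h3]
  · rintro ⟨h1, h2⟩
    exact ⟨s, k, _, fun j => ⟨ha.mem_kerSheaf_stalk j, ha.1.smoothFunNear_secCoeff h1 _⟩,
      ha.eq_sum_of_mem_ker hη h1 h2⟩

end Sheaves

/-! ### Normalized adapted frames -/

/-- The value of an alternating map on linear combinations. -/
theorem alternatingMap_apply_sum {W X ι : Type*} [AddCommGroup W] [Module ℂ W] [AddCommGroup X]
    [Module ℂ X] [Fintype ι] [DecidableEq ι] (g : W [⋀^ι]→ₗ[ℂ] X) (v : ι → W) (b : Matrix ι ι ℂ) :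
    g (fun i => ∑ j, b i j • v j) = b.det • g v := by
  have key : g.compLinearMap (Fintype.linearCombination ℂ v) =
      (LinearMap.toSpanSingleton ℂ X (g v)).compAlternatingMap Matrix.detRowAlternating := by
    refine Module.Basis.ext_alternating (Pi.basisFun ℂ ι) fun C hC => ?_
    let σ : Equiv.Perm ι := Equiv.ofBijective C (Finite.injective_iff_bijective.1 hC)
    have h1 : (fun i => Pi.basisFun ℂ ι (C i)) = (fun i => Pi.basisFun ℂ ι i) ∘ σ := rfl
    have h2 : (Matrix.detRowAlternating fun i => Pi.basisFun ℂ ι i : ℂ) = 1 := by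
      show Matrix.det _ = 1
      rw [← Matrix.det_one (n := ι) (R := ℂ)]
      congr 1
      ext i j
      simp [Matrix.one_apply, Pi.single_apply, eq_comm]
    rw [h1, AlternatingMap.map_perm, AlternatingMap.map_perm]
    congr 1
    rw [LinearMap.compAlternatingMap_apply, h2]
    simp only [AlternatingMap.compLinearMap_apply, LinearMap.toSpanSingleton_apply, one_smul]
    congr 1
    funext i
    simp [Fintype.linearCombination_apply, Pi.single_apply]
  exact DFunLike.congr_fun key b

section Normalized

variable {n : ℕ} {M : Type*} [TopologicalSpace M]
  [ChartedSpace (EuclideanSpace ℝ (Fin (2 * n))) M]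
  {F : Type*} [NormedAddCommGroup F] [NormedSpace ℂ F] [FiniteDimensional ℂ F]
  {V : M → Type*} [∀ x, AddCommGroup (V x)] [∀ x, Module ℂ (V x)]
  [TopologicalSpace (TotalSpace F V)] [∀ x, TopologicalSpace (V x)] [FiberBundle F V]

/-- The determinant with respect to a frame. -/
def frameDet {ι : Type*} [Fintype ι] [DecidableEq ι] (e : ι → ∀ y, V y) (y : M) :
    V y [⋀^ι]→ₗ[ℂ] ℂ :=
  Matrix.detRowAlternating.compLinearMap (LinearMap.pi fun j => frameCoord e j y)

theorem frameDet_apply {ι : Type*} [Fintype ι] [DecidableEq ι] (e : ι → ∀ y, V y) (y : M)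
    (u : ι → V y) : frameDet e y u = (Matrix.of fun i j => frameCoord e j y (u i)).det := rfl

theorem frameDet_apply_sections {ι : Type*} [Fintype ι] [DecidableEq ι] (e : ι → ∀ y, V y) (y : M)
    (u : ι → ∀ y, V y) : frameDet e y (fun i => u i y) =
      (Matrix.of fun i j => secCoeff e (u i) j y).det := by
  rw [frameDet_apply]
  simp only [frameCoord_apply]

theorem IsBasisAt.frameDet_self {ι : Type*} [Fintype ι] [DecidableEq ι] {e : ι → ∀ y, V y} {y : M}
    (h : IsBasisAt e y) : frameDet e y (fun i => e i y) = 1 := by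
  rw [frameDet_apply, ← Matrix.det_one (n := ι) (R := ℂ)]
  congr 1
  ext i j
  simp [h.frameCoord_self, Matrix.one_apply]

/-- Forms of top degree are proportional. With `g` the determinant of a second frame this is the
multiplicativity of changes of frame. -/
theorem IsBasisAt.alternatingMap_apply {ι : Type*} [Fintype ι] [DecidableEq ι] {e : ι → ∀ y, V y}
    {y : M} (h : IsBasisAt e y) {X : Type*} [AddCommGroup X] [Module ℂ X]
    (g : V y [⋀^ι]→ₗ[ℂ] X) (u : ι → V y) :
    g u = frameDet e y u • g fun i => e i y := by
  rw [frameDet_apply, ← alternatingMap_apply_sum]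
  congr 1
  funext i
  simp only [Matrix.of_apply, frameCoord, h, dif_pos, Module.Basis.coord_apply]
  simp_rw [← h.basis_apply]
  exact (h.basis.sum_repr _).symm

theorem IsBasisAt.frameDet_ne_zero {ι : Type*} [Fintype ι] [DecidableEq ι] {e u : ι → ∀ y, V y}
    {y : M} (h : IsBasisAt e y) (hu : IsBasisAt u y) : frameDet e y (fun i => u i y) ≠ 0 := by
  intro h0
  have h1 := h.alternatingMap_apply (frameDet u y) fun i => u i y
  rw [hu.frameDet_self, h0, zero_smul] at h1
  exact one_ne_zero h1

theorem IsBasisAt.smul {ι : Type*} {e : ι → ∀ y, V y} {c : ι → M → ℂ} {y : M} (h : IsBasisAt e y)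
    (hc : ∀ i, c i y ≠ 0) : IsBasisAt (fun i y => c i y • e i y) y := by
  refine ⟨h.1.units_smul fun i => Units.mk0 _ (hc i), ?_⟩
  rw [eq_top_iff, ← h.2, Submodule.span_le]
  rintro _ ⟨i, rfl⟩
  exact (Submodule.smul_mem_iff _ (hc i)).1 (Submodule.subset_span ⟨i, rfl⟩)

variable [VectorBundle ℂ F V] [VectorBundle ℝ F V] [IsManifold (𝓡 (2 * n)) ∞ M]
  [ContMDiffVectorBundle ∞ F V (𝓡 (2 * n))] {I : ComplexStructure n M}
  {D : HolStructure F I V} {Ψ : ∀ x, V x →ₗ[ℂ] V x} {r s : ℕ}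

theorem IsHolBasisNear.holFunNear_frameDet {ι : Type*} [Fintype ι] [DecidableEq ι]
    {e u : ι → ∀ y, V y} {y : M} (he : IsHolBasisNear D e y) (hu : ∀ i, HolSecNear D (u i) y) :
    HolFunNear I (fun z => frameDet e z fun i => u i z) y := by
  simp only [frameDet_apply_sections]
  exact HolFunNear.det fun i j => he.holFunNear_secCoeff (hu i) j

theorem IsHolBasisNear.smul {ι : Type*} [Finite ι] {e : ι → ∀ y, V y} {c : ι → M → ℂ} {y : M}
    (h : IsHolBasisNear D e y) (hc : ∀ i, HolFunNear I (c i) y) (h0 : ∀ i, c i y ≠ 0) :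
    IsHolBasisNear D (fun i y => c i y • e i y) y := by
  refine ⟨fun i => (h.1 i).smul (hc i), ?_⟩
  filter_upwards [h.2, eventually_all.2 fun i => (hc i).continuousAt.eventually_ne (h0 i)]
    with z h1 h2 using h1.smul h2

/-- An adapted frame normalized with respect to an annihilating form and a frame of `V`. -/
def IsNormalized (D : HolStructure F I V) (Ψ : ∀ x, V x →ₗ[ℂ] V x) (η : ∀ y, V y [⋀^Fin r]→ₗ[ℂ] ℂ)
    (e : Fin r ⊕ Fin s → ∀ y, V y) (w : Fin r → ∀ y, V y) (k : Fin s → ∀ y, V y) (y : M) : Prop :=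
  IsAdapted D Ψ w k y ∧ ∀ᶠ z in 𝓝 y, η z (fun i => w i z) = 1 ∧
    frameDet e z (fun i => Sum.elim w k i z) = 1

theorem exists_isNormalized (hn : 0 < n) (hr : 0 < r) (hs : 0 < s)
    {η : ∀ y, V y [⋀^Fin r]→ₗ[ℂ] ℂ} {e : Fin r ⊕ Fin s → ∀ y, V y} {y : M}
    (h : IsAnnForm D Ψ η y) (he : IsHolBasisNear D e y) (hy : y ∉ singSet D Ψ r s) :
    ∃ w k, IsNormalized D Ψ η e w k y := by
  classical
  obtain ⟨w, k, ha⟩ := not_not.1 hy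
  let i₀ : Fin r := ⟨0, hr⟩
  let j₀ : Fin s := ⟨0, hs⟩
  set c : M → ℂ := fun z => η z fun i => w i z with hc
  set d : M → ℂ := fun z => frameDet e z fun i => Sum.elim w k i z with hd
  have hch : HolFunNear I c y := h.hol.self_of_nhds _ fun i => ha.1.1 (Sum.inl i)
  have hc0 : c y ≠ 0 := h.ne_zero hn ha
  have hdh : HolFunNear I d y := he.holFunNear_frameDet ha.1.1
  have hd0 : d y ≠ 0 := he.2.self_of_nhds.frameDet_ne_zero ha.1.2.self_of_nhds
  have hcz := hch.continuousAt.eventually_ne hc0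
  have hdz := hdh.continuousAt.eventually_ne hd0
  -- Only one vector of each part is rescaled, which is why both parts have to be nonempty: the
  -- first `w` by `1 / c` and the first `k` by `c / d`, so that the whole frame is rescaled by `1 /
  -- d`.
  let a : Fin r → M → ℂ := fun i z => if i = i₀ then (c z)⁻¹ else 1
  let b : Fin s → M → ℂ := fun j z => if j = j₀ then c z * (d z)⁻¹ else 1
  have hab : IsHolBasisNear D (fun i y => Sum.elim a b i y • Sum.elim w k i y) y := by
    refine ha.1.smul ?_ ?_
    · rintro (i | j)
      · by_cases hi : i = i₀
        · simpa [a, hi] using hch.inv hc0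
        · simpa [a, hi] using holFunNear_const 1 y
      · by_cases hj : j = j₀
        · simpa [b, hj] using hch.mul (hdh.inv hd0)
        · simpa [b, hj] using holFunNear_const 1 y
    · rintro (i | j)
      · by_cases hi : i = i₀ <;> simp [a, hi, hc0]
      · by_cases hj : j = j₀ <;> simp [b, hj, hc0, hd0]
  have hsum : (fun i y => Sum.elim a b i y • Sum.elim w k i y) =
      Sum.elim (fun i y => a i y • w i y) fun j y => b j y • k j y := by
    funext i
    rcases i with i | j <;> rfl
  refine ⟨fun i y => a i y • w i y, fun j y => b j y • k j y, ⟨hsum ▸ hab, ?_⟩, ?_⟩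
  · filter_upwards [ha.2] with z hz j
    rw [map_smul, hz, smul_zero]
  · filter_upwards [hcz, hdz] with z h1 h2
    constructor
    · have h3 := (η z).toMultilinearMap.map_smul_univ (fun i => a i z) fun i => w i z
      have h4 : ∏ i, a i z = (c z)⁻¹ := by simp [a]
      rw [h4] at h3
      exact h3.trans (inv_mul_cancel₀ h1)
    · rw [← hsum]
      have h3 := (frameDet e z).toMultilinearMap.map_smul_univ
        (fun i => Sum.elim a b i z) fun i => Sum.elim w k i z
      have h4 : ∏ i, Sum.elim a b i z = (d z)⁻¹ := by
        simp [a, b, Fintype.prod_sum_type, inv_mul_cancel_left₀ h1]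
      rw [h4] at h3
      exact h3.trans (inv_mul_cancel₀ h2)

/-- Comparison of normalized frames. -/
theorem IsNormalized.compare {η η' : ∀ y, V y [⋀^Fin r]→ₗ[ℂ] ℂ}
    {e e' : Fin r ⊕ Fin s → ∀ y, V y} {w w' : Fin r → ∀ y, V y} {k k' : Fin s → ∀ y, V y} {y : M}
    (hη : ∀ x, ∃ η : ∀ y, V y [⋀^Fin r]→ₗ[ℂ] ℂ, IsAnnForm D Ψ η x)
    (h : IsNormalized D Ψ η e w k y) (h' : IsNormalized D Ψ η' e' w' k' y)
    (hA : IsAnnForm D Ψ η y)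
    (he : ∀ᶠ z in 𝓝 y, IsBasisAt e z) {κ : M → ℂ} (hκ : ∀ᶠ z in 𝓝 y, η' z = κ z • η z) :
    ∀ᶠ z in 𝓝 y,
      κ z • exteriorPower.ιMulti ℂ r (fun i => Ψ z (w' i z)) =
        exteriorPower.ιMulti ℂ r (fun i => Ψ z (w i z)) ∧
      frameDet e' z (fun i => e i z) • exteriorPower.ιMulti ℂ s (fun j => k' j z) =
        κ z • exteriorPower.ιMulti ℂ s (fun j => k j z) := by
  have hk := eventually_all.2 fun j => h.1.eq_sum_of_mem_ker hη (t := k' j)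
    (h'.1.1.1 (Sum.inr j)).smoothSecNear (h'.1.2.mono fun z hz => hz j)
  filter_upwards [h.1.2, h.2, h'.2, hA.eventually_eq_minorForm h.1, hκ, hk, he, h.1.1.2]
    with z h1 h2 h3 ⟨hz, h4⟩ h5 h6 h7 h8
  -- The minor is `det A`, where `A` expresses `w'` by `w` modulo the kernel; `η'(w') = 1 = η(w)`
  -- and `η' = κ η` give `κ det A = 1`.
  have hdetA : κ z * minorForm hz.basis (fun i => w' i z) = 1 := by
    have := h3.1
    rwa [h5, AlternatingMap.smul_apply, h4, h2.1, mul_one] at this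
  have hg := alternatingMap_eq_minorForm hz.basis
    ((exteriorPower.ιMulti ℂ r (M := V z)).compLinearMap (Ψ z)) (fun C ⟨i, j, hij⟩ => by
      refine MultilinearMap.map_coord_zero
        (AlternatingMap.toMultilinearMap (exteriorPower.ιMulti ℂ r (M := V z))) i ?_
      show Ψ z (hz.basis (C i)) = 0
      rw [hij, hz.basis_apply]
      exact h1 j) fun i => w' i z
  simp only [AlternatingMap.compLinearMap_apply, hz.basis_apply, Sum.elim_inl] at hg
  set A : Matrix (Fin r) (Fin r) ℂ :=
    Matrix.of fun i j => hz.basis.repr (w' i z) (Sum.inl j) with hAdef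
  set Bm : Matrix (Fin s) (Fin s) ℂ :=
    Matrix.of fun i j => secCoeff (Sum.elim w k) (k' i) (Sum.inr j) z with hBdef
  have hkm : (fun j => k' j z) = fun j => ∑ l, Bm j l • k l z := funext fun j => h6 j
  -- The change of frame is block triangular because `k'` lies in the span of `k`.
  have hT : frameDet (Sum.elim w k) z (fun i => Sum.elim w' k' i z) = A.det * Bm.det := by
    rw [frameDet_apply, ← Matrix.det_fromBlocks_zero₂₁ A (Matrix.of fun (i : Fin r) (j : Fin s) =>
      hz.basis.repr (w' i z) (Sum.inr j)) Bm]
    congr 1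
    have hinl : ∀ (i j), frameCoord (Sum.elim w k) (Sum.inl j) z (k' i z) = 0 := by
      intro i j
      rw [h6 i, map_sum]
      refine Finset.sum_eq_zero fun l _ => ?_
      have := hz.frameCoord_self (Sum.inl j) (Sum.inr l)
      simp only [Sum.elim_inr, reduceCtorEq, if_false] at this
      rw [map_smul, this, smul_zero]
    ext i j
    rcases i with i | i <;> rcases j with j | j
    · simp [frameCoord, hz, A]
    · simp [frameCoord, hz]
    · simpa using hinl i j
    · simp [Bm, frameCoord_apply]
  -- The two determinant normalizations give `det A * det B` times the change from `e` to `e'` equal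
  -- to `1`; now use `κ det A = 1`.
  have hdet : frameDet e' z (fun i => e i z) * Bm.det = κ z := by
    have h9 := h8.alternatingMap_apply (frameDet e z) fun i => Sum.elim w' k' i z
    rw [h2.2, hT, smul_eq_mul, mul_one] at h9
    have h10 := h7.alternatingMap_apply (frameDet e' z) fun i => Sum.elim w' k' i z
    rw [h3.2, h9, smul_eq_mul] at h10
    rw [minorForm_apply, ← hAdef] at hdetA
    have hAne : A.det ≠ 0 := right_ne_zero_of_mul (hdetA.symm ▸ one_ne_zero)
    apply mul_left_cancel₀ hAne
    rw [mul_comm A.det (κ z), hdetA, h10]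
    ring
  constructor
  · rw [hg, smul_smul, hdetA, one_smul]
  · rw [hkm, alternatingMap_apply_sum, smul_smul, hdet]

theorem IsNormalized.eventually {η : ∀ y, V y [⋀^Fin r]→ₗ[ℂ] ℂ} {e : Fin r ⊕ Fin s → ∀ y, V y}
    {w : Fin r → ∀ y, V y} {k : Fin s → ∀ y, V y} {y : M} (h : IsNormalized D Ψ η e w k y) :
    ∀ᶠ z in 𝓝 y, IsNormalized D Ψ η e w k z := by
  filter_upwards [h.1.eventually, h.2.eventually_nhds] with z h1 h2 using ⟨h1, h2⟩

end Normalized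

/-! ### Partitions of unity and Hermitian metrics -/

section Metrics

variable {n : ℕ} {M : Type*} [TopologicalSpace M]
  [ChartedSpace (EuclideanSpace ℝ (Fin (2 * n))) M] [IsManifold (𝓡 (2 * n)) ∞ M]

/-- A finite partition of unity. The last clause lets functions that are smooth only on their own `U
j` be summed without regard to their values elsewhere. -/
theorem exists_partition (n : ℕ) {M : Type*} [TopologicalSpace M]
    [ChartedSpace (EuclideanSpace ℝ (Fin (2 * n))) M] [IsManifold (𝓡 (2 * n)) ∞ M]
    [T2Space M] [CompactSpace M] {U : M → Set M} (hU : ∀ x, IsOpen (U x))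
    (hx : ∀ x, x ∈ U x) : ∃ (t : Finset M) (χ : t → M → ℝ), (∀ j y, 0 ≤ χ j y) ∧
      (∀ y, ∑ j, χ j y = 1) ∧ (∀ j y, χ j y ≠ 0 → y ∈ U j) ∧
      ∀ {E : Type} [NormedAddCommGroup E] [NormedSpace ℝ E] (g : t → M → E) (y : M),
        (∀ j : t, y ∈ U j → ContMDiffAt (𝓡 (2 * n)) 𝓘(ℝ, E) ∞ (g j) y) →
        ContMDiffAt (𝓡 (2 * n)) 𝓘(ℝ, E) ∞ (fun z => ∑ j, χ j z • g j z) y := by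
  obtain ⟨t, -, ht⟩ := isCompact_univ.elim_nhds_subcover U fun x _ => (hU x).mem_nhds (hx x)
  obtain ⟨f, hf⟩ := SmoothPartitionOfUnity.exists_isSubordinate (𝓡 (2 * n)) isClosed_univ
    (fun j : t => U j) (fun j => hU j) (by
      intro y hy
      obtain ⟨j, hj, hyj⟩ := Set.mem_iUnion₂.1 (ht hy)
      exact Set.mem_iUnion.2 ⟨⟨j, hj⟩, hyj⟩)
  refine ⟨t, fun j => f j, fun j y => f.nonneg j y, fun y => ?_, fun j y hy => ?_, ?_⟩
  · rw [← finsum_eq_sum_of_fintype]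
    exact f.sum_eq_one (Set.mem_univ y)
  · exact hf j (subset_tsupport _ hy)
  · intro E _ _ g y hg
    have := f.contMDiffAt_finsum (n := ⊤) (x₀ := y) (g := g) fun j hj => hg j (hf j hj)
    simpa only [finsum_eq_sum_of_fintype] using this

variable {F : Type*} [NormedAddCommGroup F] [NormedSpace ℂ F] [FiniteDimensional ℂ F]
  {V : M → Type*} [∀ x, AddCommGroup (V x)] [∀ x, Module ℂ (V x)]
  [TopologicalSpace (TotalSpace F V)] [∀ x, TopologicalSpace (V x)] [FiberBundle F V]

/-- The determinant of the Gram matrix of a frame. -/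
def gramDet {ι : Type*} [Fintype ι] [DecidableEq ι] (h : HermMetric n F V) (e : ι → ∀ y, V y)
    (y : M) : ℂ := (Matrix.of fun a b => h.h y (e a y) (e b y)).det

theorem HermMetric.sum_left (h : HermMetric n F V) {ι : Type*} [Fintype ι] (y : M) (c : ι → ℂ)
    (u : ι → V y) (v : V y) : h.h y (∑ i, c i • u i) v = ∑ i, c i * h.h y (u i) v := by
  let L : V y →ₗ[ℂ] ℂ := ⟨⟨fun u => h.h y u v, fun a b => h.add_left y a b v⟩,
    fun c a => h.smul_left y c a v⟩
  exact (map_sum L _ _).trans (Finset.sum_congr rfl fun i _ => L.map_smul _ _)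

theorem HermMetric.sum_right (h : HermMetric n F V) {ι : Type*} [Fintype ι] (y : M) (c : ι → ℂ)
    (u : ι → V y) (v : V y) :
    h.h y v (∑ i, c i • u i) = ∑ i, starRingEnd ℂ (c i) * h.h y v (u i) := by
  rw [h.conj_symm, h.sum_left, map_sum]
  exact Finset.sum_congr rfl fun i _ => by rw [map_mul, ← h.conj_symm]

open scoped ComplexOrder in
theorem gramDet_pos {ι : Type*} [Fintype ι] [DecidableEq ι] (h : HermMetric n F V)
    {e : ι → ∀ y, V y} {y : M} (he : IsBasisAt e y) :
    0 < (gramDet h e y).re ∧ ((gramDet h e y).re : ℂ) = gramDet h e y := by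
  have hpd : (Matrix.of fun a b => h.h y (e a y) (e b y)).PosDef := by
    refine Matrix.PosDef.of_dotProduct_mulVec_pos ?_ fun x hx => ?_
    · ext a b
      exact (h.conj_symm y _ _).symm
    · have h1 : star x ⬝ᵥ (Matrix.of fun a b => h.h y (e a y) (e b y)).mulVec x =
          h.h y (∑ a, star (x a) • e a y) (∑ a, star (x a) • e a y) := by
        rw [h.sum_left]
        simp only [h.sum_right, dotProduct, Matrix.mulVec, Matrix.of_apply, Pi.star_apply]
        refine Finset.sum_congr rfl fun a _ => ?_
        congr 1
        refine Finset.sum_congr rfl fun b _ => ?_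
        rw [Complex.star_def, Complex.conj_conj, mul_comm]
      rw [h1]
      set u := ∑ a, star (x a) • e a y
      have hu : u ≠ 0 := fun hu => hx (by
        funext a
        have := Fintype.linearIndependent_iff.1 he.1 _ hu a
        simpa using this)
      have h2 := h.conj_symm y u u
      rw [Complex.lt_def]
      exact ⟨h.pos y u hu, (Complex.conj_eq_iff_im.1 h2.symm).symm⟩
  have := Complex.lt_def.1 hpd.det_pos
  exact ⟨this.1, Complex.ext rfl this.2⟩

theorem gramDet_change {ι : Type*} [Fintype ι] [DecidableEq ι] (h : HermMetric n F V)
    {e e' : ι → ∀ y, V y} {y : M} (he' : IsBasisAt e' y) :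
    gramDet h e y = (‖frameDet e' y (fun i => e i y)‖ ^ 2 : ℝ) * gramDet h e' y := by
  set T : Matrix ι ι ℂ := Matrix.of fun i j => secCoeff e' (e i) j y with hT
  -- The Gram matrix transforms by `T G T*`, so its determinant changes by `|det T|²`.
  have h1 : (Matrix.of fun a b => h.h y (e a y) (e b y)) =
      T * (Matrix.of fun a b => h.h y (e' a y) (e' b y)) * T.conjTranspose := by
    ext a b
    have hab : h.h y (e a y) (e b y) = ∑ j, starRingEnd ℂ (secCoeff e' (e b) j y) *
        ∑ i, secCoeff e' (e a) i y * h.h y (e' i y) (e' j y) := by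
      conv_lhs => rw [← he'.sum_secCoeff (e a), ← he'.sum_secCoeff (e b), h.sum_right]
      simp only [h.sum_left]
    rw [Matrix.of_apply, hab]
    simp only [Matrix.mul_apply, Matrix.conjTranspose_apply, Matrix.of_apply, hT]
    exact Finset.sum_congr rfl fun j _ => mul_comm _ _
  rw [gramDet, h1, Matrix.det_mul, Matrix.det_mul, Matrix.det_conjTranspose,
    frameDet_apply_sections, ← hT, gramDet]
  have h2 : ((‖T.det‖ ^ 2 : ℝ) : ℂ) = T.det * star T.det := by
    rw [Complex.star_def, Complex.mul_conj, Complex.normSq_eq_norm_sq]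
  rw [h2]
  ring

variable [VectorBundle ℂ F V] [VectorBundle ℝ F V] [ContMDiffVectorBundle ∞ F V (𝓡 (2 * n))]
  {I : ComplexStructure n M}

theorem contMDiffAt_conj {f : M → ℂ} {x : M} (hf : ContMDiffAt (𝓡 (2 * n)) 𝓘(ℝ, ℂ) ∞ f x) :
    ContMDiffAt (𝓡 (2 * n)) 𝓘(ℝ, ℂ) ∞ (fun y => starRingEnd ℂ (f y)) x :=
  (Complex.conjCLE.contDiff.contDiffAt).comp_contMDiffAt hf

/-- Every complex vector bundle on a compact manifold that has local frames carries a Hermitian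
metric. -/
theorem exists_hermMetric [T2Space M] [CompactSpace M] (D : HolStructure F I V) :
    Nonempty (HermMetric n F V) := by
  choose e he using fun x => exists_isHolBasisNear D x
  have hev := fun x => (he x).eventually
  set U : M → Set M := fun x => interior {y | IsHolBasisNear D (e x) y} with hU
  have hUe : ∀ x, ∀ y ∈ U x, IsHolBasisNear D (e x) y := fun x y hy =>
    interior_subset (s := {y | IsHolBasisNear D (e x) y}) hy
  obtain ⟨t, χ, hχ0, hχ1, hχU, hχs⟩ := exists_partition n (fun x => isOpen_interior (s := {y |
    IsHolBasisNear D (e x) y})) fun x => mem_interior_iff_mem_nhds.2 (hev x)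
  refine ⟨⟨fun y u v => ∑ j, χ j y • ∑ i, frameCoord (e j) i y u *
    starRingEnd ℂ (frameCoord (e j) i y v), ?_, ?_, ?_, ?_, ?_⟩⟩
  · intro x u v w
    simp only [map_add, add_mul, Finset.sum_add_distrib, smul_add]
  · intro x c u w
    simp only [map_smul, smul_eq_mul, Finset.mul_sum, mul_assoc, Complex.real_smul]
    exact Finset.sum_congr rfl fun j _ => Finset.sum_congr rfl fun i _ => by ring
  · intro x u w
    simp only [map_sum, Complex.real_smul, map_mul, Complex.conj_ofReal, Complex.conj_conj]
    exact Finset.sum_congr rfl fun j _ => congrArg _ (Finset.sum_congr rfl fun i _ => mul_comm _ _)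
  · intro x u hu
    have h1 : ∀ j i, frameCoord (e j) i x u * starRingEnd ℂ (frameCoord (e j) i x u) =
        ((‖frameCoord (e j) i x u‖ ^ 2 : ℝ) : ℂ) := fun j i => by
      rw [Complex.mul_conj, Complex.normSq_eq_norm_sq]
    have h2 : (∑ j, χ j x • ∑ i, frameCoord (e j) i x u *
        starRingEnd ℂ (frameCoord (e j) i x u)) =
        ((∑ j, χ j x * ∑ i, ‖frameCoord (e j) i x u‖ ^ 2 : ℝ) : ℂ) := by
      simp only [h1, Complex.real_smul]
      push_cast
      rfl
    rw [h2, Complex.ofReal_re]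
    have h3 : ∀ j, 0 ≤ χ j x * ∑ i, ‖frameCoord (e j) i x u‖ ^ 2 := fun j =>
      mul_nonneg (hχ0 j x) (Finset.sum_nonneg fun i _ => by positivity)
    obtain ⟨j, hj⟩ : ∃ j, χ j x ≠ 0 := by
      by_contra! H
      simpa [H] using hχ1 x
    refine Finset.sum_pos' (fun j _ => h3 j) ⟨j, Finset.mem_univ j,
      mul_pos ((hχ0 j x).lt_of_ne' hj) ?_⟩
    have hb := (hUe _ _ (hχU j x hj)).2.self_of_nhds
    obtain ⟨i, hi⟩ : ∃ i, frameCoord (e j) i x u ≠ 0 := by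
      by_contra! H
      refine hu (hb.basis.repr.map_eq_zero_iff.1 (Finsupp.ext fun i => ?_))
      simpa [frameCoord, hb] using H i
    exact Finset.sum_pos' (fun i _ => by positivity) ⟨i, Finset.mem_univ i, by positivity⟩
  · intro s u x hs hu
    filter_upwards [hs, hu] with y h1 h2
    refine hχs _ y fun j hj => contMDiffAt_finsetSum fun i _ => ?_
    have hb := hUe _ _ hj
    have h3 : ∀ {s : ∀ y, V y}, SmoothSecAt n F s y → ContMDiffAt (𝓡 (2 * n)) 𝓘(ℝ, ℂ) ∞
        (fun y => frameCoord (e j) i y (s y)) y := fun {s} hs => by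
      simp only [frameCoord_apply]
      exact contMDiffAt_secCoeff (fun i => (hb.1 i).self_of_nhds.1) hb.2 hs i
    exact contMDiffAt_mul (h3 h1) (contMDiffAt_conj (h3 h2))

theorem exists_alternatingMap_apply_eq_one {W : Type*} [AddCommGroup W] [Module ℂ W] {m : ℕ}
    {v : Fin m → W} (hv : LinearIndependent ℂ v) : ∃ f : W [⋀^Fin m]→ₗ[ℂ] ℂ, f v = 1 := by
  obtain ⟨g, hg⟩ := LinearMap.exists_leftInverse_of_injective (Fintype.linearCombination ℂ v)
    (LinearMap.ker_eq_bot.2 (hv.fintypeLinearCombination_injective))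
  refine ⟨Matrix.detRowAlternating.compLinearMap g, ?_⟩
  rw [AlternatingMap.compLinearMap_apply]
  show Matrix.det (fun i => g (v i)) = 1
  have h1 : ∀ i, g (v i) = Pi.single i 1 := fun i => by
    have := LinearMap.congr_fun hg (Pi.single i 1)
    simpa [Fintype.linearCombination_apply, Pi.single_apply] using this
  rw [← Matrix.det_one (n := Fin m) (R := ℂ)]
  congr 1
  ext i j
  simp [h1, Matrix.one_apply, Pi.single_apply, eq_comm]

theorem ιMulti_ne_zero {W : Type*} [AddCommGroup W] [Module ℂ W] {m : ℕ}
    {v : Fin m → W} (hv : LinearIndependent ℂ v) : exteriorPower.ιMulti ℂ m v ≠ 0 := by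
  obtain ⟨f, hf⟩ := exists_alternatingMap_apply_eq_one hv
  intro h
  have := exteriorPower.alternatingMapLinearEquiv_apply_ιMulti f v
  rw [h, map_zero, hf] at this
  exact zero_ne_one this

end Metrics

/-! ### Metrics on the determinants of image and kernel -/

section DetMetrics

variable {n : ℕ} {M : Type*} [TopologicalSpace M]
  [ChartedSpace (EuclideanSpace ℝ (Fin (2 * n))) M]
  {F : Type*} [NormedAddCommGroup F] [NormedSpace ℂ F] [FiniteDimensional ℂ F]
  {V : M → Type*} [∀ x, AddCommGroup (V x)] [∀ x, Module ℂ (V x)]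
  [TopologicalSpace (TotalSpace F V)] [∀ x, TopologicalSpace (V x)] [FiberBundle F V]
  [VectorBundle ℂ F V] [VectorBundle ℝ F V] [IsManifold (𝓡 (2 * n)) ∞ M]
  [ContMDiffVectorBundle ∞ F V (𝓡 (2 * n))] {I : ComplexStructure n M}
  {D : HolStructure F I V} {Ψ : ∀ x, V x →ₗ[ℂ] V x} {r s : ℕ}

/-- The germ at `y` of the ratio of two forms, evaluated at `y`. -/
def formRatio (I : ComplexStructure n M) (η η' : ∀ y, V y [⋀^Fin r]→ₗ[ℂ] ℂ) (y : M) : ℂ :=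
  open Classical in
  if h : ∃ k : M → ℂ, HolFunNear I k y ∧ ∀ᶠ z in 𝓝 y, η' z = k z • η z then h.choose y else 0

theorem IsAnnForm.unit_unique (hn : 0 < n) {η : ∀ y, V y [⋀^Fin r]→ₗ[ℂ] ℂ} {y : M}
    (h : IsAnnForm D Ψ η y) {k k' : M → ℂ} (hk : HolFunNear I k y) (hk' : HolFunNear I k' y)
    (hkk : ∀ᶠ z in 𝓝 y, k z • η z = k' z • η z) : k y = k' y := by
  obtain ⟨e, he, hp⟩ := h.prim
  obtain ⟨C, hC⟩ := hp.self_of_nhds.exists_frequently_ne_zero hn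
  refine (eventuallyEq_of_mul_eq_mul (h.hol.self_of_nhds _ fun i => he.1 (C i)) hC hk hk'
    ?_).self_of_nhds
  filter_upwards [hkk] with z hz
  have := congrArg (fun f => f fun i => e (C i) z) hz
  simpa [mul_comm] using this

theorem IsAnnForm.formRatio_eq (hn : 0 < n) {η η' : ∀ y, V y [⋀^Fin r]→ₗ[ℂ] ℂ} {y : M}
    (h : IsAnnForm D Ψ η y) {k : M → ℂ} (hk : HolFunNear I k y)
    (hkη : ∀ᶠ z in 𝓝 y, η' z = k z • η z) : formRatio I η η' y = k y := by
  have hex : ∃ k : M → ℂ, HolFunNear I k y ∧ ∀ᶠ z in 𝓝 y, η' z = k z • η z := ⟨k, hk, hkη⟩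
  rw [formRatio, dif_pos hex]
  refine h.unit_unique hn hex.choose_spec.1 hk ?_
  filter_upwards [hex.choose_spec.2, hkη] with z h1 h2
  rw [← h1, h2]

theorem IsAnnForm.formRatio_eventuallyEq (hn : 0 < n) {η η' : ∀ y, V y [⋀^Fin r]→ₗ[ℂ] ℂ} {y : M}
    (h : IsAnnForm D Ψ η y) {k : M → ℂ} (hk : HolFunNear I k y)
    (hkη : ∀ᶠ z in 𝓝 y, η' z = k z • η z) : formRatio I η η' =ᶠ[𝓝 y] k := by
  filter_upwards [h.eventually, hk.eventually, hkη.eventually_nhds] with z h1 h2 h3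
    using h1.formRatio_eq hn h2 h3

theorem IsAnnForm.formRatio_spec (hn : 0 < n) {η η' : ∀ y, V y [⋀^Fin r]→ₗ[ℂ] ℂ} {y : M}
    (h : IsAnnForm D Ψ η y) (h' : IsAnnForm D Ψ η' y) :
    HolFunNear I (formRatio I η η') y ∧ formRatio I η η' y ≠ 0 ∧
      ∀ᶠ z in 𝓝 y, η' z = formRatio I η η' z • η z := by
  obtain ⟨k, hk, hk0, hkη⟩ := h.exists_unit hn h'
  have := h.formRatio_eventuallyEq hn hk hkη
  refine ⟨hk.congr this, this.self_of_nhds.trans_ne hk0, ?_⟩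
  filter_upwards [this, hkη] with z h1 h2
  rw [h1, h2]

theorem IsAnnForm.formRatio_trans (hn : 0 < n) {η η' η'' : ∀ y, V y [⋀^Fin r]→ₗ[ℂ] ℂ} {y : M}
    (h : IsAnnForm D Ψ η y) (h' : IsAnnForm D Ψ η' y) (h'' : IsAnnForm D Ψ η'' y) :
    formRatio I η η'' y = formRatio I η η' y * formRatio I η' η'' y := by
  obtain ⟨h1, -, h2⟩ := h.formRatio_spec hn h'
  obtain ⟨h3, -, h4⟩ := h'.formRatio_spec hn h''
  refine h.formRatio_eq hn (k := fun z => formRatio I η η' z * formRatio I η' η'' z)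
    (h1.mul h3) ?_
  filter_upwards [h2, h4] with z h5 h6
  rw [h6, h5, smul_smul, mul_comm]

/-- The wedge product of the images of the first part of a normalized frame. -/
def imGen (D : HolStructure F I V) (Ψ : ∀ x, V x →ₗ[ℂ] V x) (η : ∀ y, V y [⋀^Fin r]→ₗ[ℂ] ℂ)
    (e : Fin r ⊕ Fin s → ∀ y, V y) (z : M) : ⋀[ℂ]^r (V z) :=
  open Classical in
  if h : ∃ p : (Fin r → ∀ y, V y) × (Fin s → ∀ y, V y), IsNormalized D Ψ η e p.1 p.2 z then
    exteriorPower.ιMulti ℂ r fun i => Ψ z (h.choose.1 i z) else 0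

/-- The wedge product of the second part of a normalized frame. -/
def kerGen (D : HolStructure F I V) (Ψ : ∀ x, V x →ₗ[ℂ] V x) (η : ∀ y, V y [⋀^Fin r]→ₗ[ℂ] ℂ)
    (e : Fin r ⊕ Fin s → ∀ y, V y) (z : M) : ⋀[ℂ]^s (V z) :=
  open Classical in
  if h : ∃ p : (Fin r → ∀ y, V y) × (Fin s → ∀ y, V y), IsNormalized D Ψ η e p.1 p.2 z then
    exteriorPower.ιMulti ℂ s fun j => h.choose.2 j z else 0

variable (hη : ∀ x, ∃ η : ∀ y, V y [⋀^Fin r]→ₗ[ℂ] ℂ, IsAnnForm D Ψ η x)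

include hη in
-- `imGen` and `kerGen` choose a normalized frame separately at every point. By `compare` with `κ =
-- 1` the wedge products do not depend on the choice, so they agree near `y` with those of one local
-- frame.
theorem IsNormalized.gen_eq {η : ∀ y, V y [⋀^Fin r]→ₗ[ℂ] ℂ} {e : Fin r ⊕ Fin s → ∀ y, V y}
    {w : Fin r → ∀ y, V y} {k : Fin s → ∀ y, V y} {y : M} (hA : IsAnnForm D Ψ η y)
    (he : IsHolBasisNear D e y) (h : IsNormalized D Ψ η e w k y) :
    ∀ᶠ z in 𝓝 y, imGen D Ψ η e z = exteriorPower.ιMulti ℂ r (fun i => Ψ z (w i z)) ∧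
      kerGen D Ψ η e z = exteriorPower.ιMulti ℂ s (fun j => k j z) := by
  filter_upwards [h.eventually, hA.eventually, he.eventually] with z h1 h2 h3
  have hex : ∃ p : (Fin r → ∀ y, V y) × (Fin s → ∀ y, V y), IsNormalized D Ψ η e p.1 p.2 z :=
    ⟨(w, k), h1⟩
  rw [imGen, kerGen, dif_pos hex, dif_pos hex]
  obtain ⟨h4, h5⟩ := (h1.compare hη hex.choose_spec h2 h3.2 (κ := fun _ => 1)
    (Eventually.of_forall fun z => (one_smul _ _).symm)).self_of_nhds
  rw [one_smul] at h4
  rw [h3.2.self_of_nhds.frameDet_self, one_smul, one_smul] at h5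
  exact ⟨h4, h5⟩

include hη in
-- The images `Ψ w'` are independent only generically. The multiplier is therefore determined on a
-- dense set first and at `y` by continuity.
theorem imGen_transition (hn : 0 < n) (hr : 0 < r) (hs : 0 < s)
    {η η' : ∀ y, V y [⋀^Fin r]→ₗ[ℂ] ℂ} {e e' : Fin r ⊕ Fin s → ∀ y, V y} {y : M}
    (hA : IsAnnForm D Ψ η y) (he : IsHolBasisNear D e y) (hA' : IsAnnForm D Ψ η' y)
    (he' : IsHolBasisNear D e' y) (hy : y ∉ singSet D Ψ r s) {f : M → ℂ} (hf : HolFunNear I f y)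
    (hff : ∀ᶠ z in 𝓝 y, imGen D Ψ η e z = f z • imGen D Ψ η' e' z) :
    f y = formRatio I η η' y := by
  obtain ⟨w, k, hN⟩ := exists_isNormalized hn hr hs hA he hy
  obtain ⟨w', k', hN'⟩ := exists_isNormalized hn hr hs hA' he' hy
  obtain ⟨h1, -, h2⟩ := hA.formRatio_spec hn hA'
  obtain ⟨b, -, hb0, hb⟩ := hA'.eventually_linearIndependent hN'.1
  have key : ∀ᶠ z in 𝓝 y, b z ≠ 0 → f z = formRatio I η η' z := ?_
  · exact eq_of_frequently_eq hf.continuousAt h1.continuousAt ((hb0.and_eventually key).mono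
      fun z hz => hz.2 hz.1)
  filter_upwards [hff, hN.gen_eq hη hA he, hN'.gen_eq hη hA' he',
    hN.compare hη hN' hA he.2 h2, hb] with z h3 h4 h5 h6 h7 hbz
  rw [h4.1, h5.1, ← h6.1] at h3
  exact (smul_left_injective ℂ (ιMulti_ne_zero (h7 hbz)) h3).symm

include hη in
-- The vectors `k'` are part of a basis at `y` itself, so their wedge product is nonzero and the
-- multipliers can be compared there directly.
theorem kerGen_transition (hn : 0 < n) (hr : 0 < r) (hs : 0 < s)
    {η η' : ∀ y, V y [⋀^Fin r]→ₗ[ℂ] ℂ} {e e' : Fin r ⊕ Fin s → ∀ y, V y} {y : M}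
    (hA : IsAnnForm D Ψ η y) (he : IsHolBasisNear D e y) (hA' : IsAnnForm D Ψ η' y)
    (he' : IsHolBasisNear D e' y) (hy : y ∉ singSet D Ψ r s) {f : M → ℂ}
    (hff : ∀ᶠ z in 𝓝 y, kerGen D Ψ η e z = f z • kerGen D Ψ η' e' z) :
    frameDet e' y (fun i => e i y) = formRatio I η η' y * f y := by
  obtain ⟨w, k, hN⟩ := exists_isNormalized hn hr hs hA he hy
  obtain ⟨w', k', hN'⟩ := exists_isNormalized hn hr hs hA' he' hy
  obtain ⟨h1, -, h2⟩ := hA.formRatio_spec hn hA'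
  have h3 := hff.self_of_nhds
  have h4 := (hN.compare hη hN' hA he.2 h2).self_of_nhds.2
  rw [(hN.gen_eq hη hA he).self_of_nhds.2, (hN'.gen_eq hη hA' he').self_of_nhds.2] at h3
  rw [h3, smul_smul] at h4
  refine smul_left_injective ℂ (ιMulti_ne_zero (v := fun j => k' j y) ?_) h4
  exact hN'.1.1.2.self_of_nhds.1.comp Sum.inr Sum.inr_injective

theorem HolFunNear.contMDiffAt_norm_sq {k : M → ℂ} {y : M} (hk : HolFunNear I k y) :
    ContMDiffAt (𝓡 (2 * n)) 𝓘(ℝ, ℝ) ∞ (fun z => ‖k z‖ ^ 2) y :=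
  (contDiff_norm_sq ℝ (n := ∞) (E := ℂ)).contDiffAt.comp_contMDiffAt hk.smoothFunNear.self_of_nhds

theorem IsHolBasisNear.reindex {ι κ : Type*} {e : ι → ∀ y, V y} {x : M}
    (he : IsHolBasisNear D e x) (τ : κ ≃ ι) : IsHolBasisNear D (fun i => e (τ i)) x := by
  refine ⟨fun i => he.1 _, ?_⟩
  filter_upwards [he.2] with y hy
  refine ⟨hy.1.comp τ τ.injective, ?_⟩
  rw [← hy.2]
  congr 1
  exact τ.surjective.range_comp (fun i => e i y)

theorem gramDet_reindex {ι κ : Type*} [Fintype ι] [DecidableEq ι] [Fintype κ] [DecidableEq κ]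
    (h : HermMetric n F V) (e : ι → ∀ y, V y) (τ : κ ≃ ι) (y : M) :
    gramDet h (fun i => e (τ i)) y = gramDet h e y :=
  Matrix.det_submatrix_equiv_self τ (Matrix.of fun a b => h.h y (e a y) (e b y))

theorem contDiff_matrix_det {ι : Type*} [Fintype ι] [DecidableEq ι] :
    ContDiff ℝ ∞ fun A : ι → ι → ℂ => (Matrix.of A).det := by
  simp only [Matrix.det_apply, Matrix.of_apply]
  fun_prop

theorem contMDiffAt_gramDet {ι : Type*} [Fintype ι] [DecidableEq ι] (h : HermMetric n F V)
    {e : ι → ∀ y, V y} {y : M} (he : ∀ i, SmoothSecNear n F (e i) y) :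
    ContMDiffAt (𝓡 (2 * n)) 𝓘(ℝ, ℂ) ∞ (gramDet h e) y :=
  contDiff_matrix_det.contDiffAt.comp_contMDiffAt (contMDiffAt_pi_space.2 fun a =>
    contMDiffAt_pi_space.2 fun b => (h.smooth _ _ y (he a) (he b)).self_of_nhds)

/-- The determinants of image and kernel carry metrics whose product is the metric on the
determinant of `V` induced by a Hermitian metric `h`. -/
theorem exists_detMetrics [T2Space M] [CompactSpace M] (hn : 0 < n) (hr : 0 < r) (hs : 0 < s)
    (hrs : r + s = Module.finrank ℂ F) (hΨ : PreservesHol D Ψ) (h : HermMetric n F V) :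
    ∃ (e : M → Fin r ⊕ Fin s → ∀ y, V y) (him : DetMetric (imSheaf hΨ) r (singSet D Ψ r s))
      (hker : DetMetric (kerSheaf hΨ r hn hη) s (singSet D Ψ r s)),
      him.U = hker.U ∧ (∀ x, ∀ y ∈ him.U x, IsHolBasisNear D (e x) y) ∧
      (∀ x y, hker.N x y = (gramDet h (e x) y).re / him.N x y) ∧
      ∀ x x' y, y ∈ him.U x → y ∈ him.U x' → ∃ k, HolFunNear I k y ∧ k y ≠ 0 ∧
        ∀ᶠ z in 𝓝 y, him.N x z = ‖k z‖ ^ 2 * him.N x' z := by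
  have hη' := hη
  choose η hηx using hη'
  let τ : Fin r ⊕ Fin s ≃ Fin (Module.finrank ℂ F) := finSumFinEquiv.trans (finCongr hrs)
  have hex : ∀ x, ∃ e : Fin r ⊕ Fin s → ∀ y, V y, IsHolBasisNear D e x := by
    intro x
    obtain ⟨e, he⟩ := exists_isHolBasisNear D x
    exact ⟨_, he.reindex τ⟩
  choose e he using hex
  set U : M → Set M := fun x => interior {y | IsAnnForm D Ψ (η x) y ∧ IsHolBasisNear D (e x) y}
    with hU
  have hUo : ∀ x, IsOpen (U x) := fun x => isOpen_interior
  have hUm : ∀ x, x ∈ U x := fun x => mem_interior_iff_mem_nhds.2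
    ((hηx x).eventually.and (he x).eventually)
  have hUs : ∀ x, ∀ y ∈ U x, IsAnnForm D Ψ (η x) y ∧ IsHolBasisNear D (e x) y :=
    fun x y hy => interior_subset (s := {y | IsAnnForm D Ψ (η x) y ∧ IsHolBasisNear D (e x) y}) hy
  obtain ⟨t, χ, hχ0, hχ1, hχU, hχs⟩ := exists_partition n hUo hUm
  -- The generators of `det im` transform by the ratios of the forms `η x`, so a sum of squared
  -- ratios weighted by the partition of unity has the transition law of a square norm.
  set N : M → M → ℝ := fun x y => ∑ j, χ j y • ‖formRatio I (η x) (η j) y‖ ^ 2 with hN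
  have hNs : ∀ x, ∀ y ∈ U x, ContMDiffAt (𝓡 (2 * n)) 𝓘(ℝ, ℝ) ∞ (N x) y := fun x y hy =>
    hχs _ y fun j hj =>
      ((hUs x y hy).1.formRatio_spec hn (hUs j y hj).1).1.contMDiffAt_norm_sq
  have hNp : ∀ x, ∀ y ∈ U x, 0 < N x y := by
    intro x y hy
    obtain ⟨j, hj⟩ : ∃ j, χ j y ≠ 0 := by
      by_contra! H
      simpa [H] using hχ1 y
    have h0 := ((hUs x y hy).1.formRatio_spec hn (hUs j y (hχU j y hj)).1).2.1
    exact Finset.sum_pos' (fun j _ => mul_nonneg (hχ0 j y) (by positivity))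
      ⟨j, Finset.mem_univ j, mul_pos ((hχ0 j y).lt_of_ne' hj) (by positivity)⟩
  have hNt : ∀ x x' y, y ∈ U x → y ∈ U x' →
      N x y = ‖formRatio I (η x) (η x') y‖ ^ 2 * N x' y := by
    intro x x' y hy hy'
    rw [hN, Finset.mul_sum]
    refine Finset.sum_congr rfl fun j _ => ?_
    by_cases hj : χ j y = 0
    · simp [hj]
    · rw [(hUs x y hy).1.formRatio_trans hn (hUs x' y hy').1 (hUs j y (hχU j y hj)).1, norm_mul,
        mul_pow, smul_eq_mul, smul_eq_mul]
      ring
  have hg : ∀ x, ∀ y ∈ U x, 0 < (gramDet h (e x) y).re := fun x y hy =>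
    (gramDet_pos h (hUs x y hy).2.2.self_of_nhds).1
  refine ⟨e, ⟨U, hUo, hUm, fun x => imGen D Ψ (η x) (e x), ?_, N, hNs, hNp, ?_⟩,
    ⟨U, hUo, hUm, fun x => kerGen D Ψ (η x) (e x), ?_,
      -- Dividing the metric on `det V` by that on `det im` makes the product of both metrics equal
      -- to the Gram determinant on the nose.
      fun x y => (gramDet h (e x) y).re / N x y, ?_, ?_, ?_⟩, rfl, fun x y hy => (hUs x y hy).2,
    fun x y => rfl, ?_⟩
  · intro x y hy hyS
    obtain ⟨h1, h2⟩ := hUs x y hy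
    obtain ⟨w, k, hw⟩ := exists_isNormalized hn hr hs h1 h2 hyS
    exact ⟨_, imSheaf_isFrameNear hΨ h1 hw.1,
      (hw.gen_eq (fun x => ⟨η x, hηx x⟩) h1 h2).mono fun z hz => hz.1⟩
  · intro x x' y hy hy' hyS f hf hff
    obtain ⟨h1, h2⟩ := hUs x y hy
    obtain ⟨h1', h2'⟩ := hUs x' y hy'
    rw [hNt x x' y hy hy', imGen_transition (fun x => ⟨η x, hηx x⟩) hn hr hs h1 h2 h1' h2' hyS hf
      hff]
  · intro x y hy hyS
    obtain ⟨h1, h2⟩ := hUs x y hy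
    obtain ⟨w, k, hw⟩ := exists_isNormalized hn hr hs h1 h2 hyS
    exact ⟨_, kerSheaf_isFrameNear hw.1,
      (hw.gen_eq (fun x => ⟨η x, hηx x⟩) h1 h2).mono fun z hz => hz.2⟩
  · intro x y hy
    have h1 : ContMDiffAt (𝓡 (2 * n)) 𝓘(ℝ, ℝ) ∞ (fun y => (gramDet h (e x) y).re) y :=
      (Complex.reCLM.contDiff (n := ∞)).contDiffAt.comp_contMDiffAt
        (contMDiffAt_gramDet h fun i => ((hUs x y hy).2.1 i).smoothSecNear)
    exact h1.div₀ (hNs x y hy) (hNp x y hy).ne'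
  · exact fun x y hy => div_pos (hg x y hy) (hNp x y hy)
  · intro x x' y hy hy' hyS f hf hff
    obtain ⟨h1, h2⟩ := hUs x y hy
    obtain ⟨h1', h2'⟩ := hUs x' y hy'
    have h3 := kerGen_transition (fun x => ⟨η x, hηx x⟩) hn hr hs h1 h2 h1' h2' hyS hff
    have h4 := gramDet_change h (e := e x) h2'.2.self_of_nhds
    rw [hNt x x' y hy hy', h4, h3, Complex.re_ofReal_mul, norm_mul]
    have h5 := (h1.formRatio_spec hn h1').2.1
    have h6 := (hNp x' y hy').ne'
    field_simp
  · intro x x' y hy hy'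
    obtain ⟨h1, h2, -⟩ := (hUs x y hy).1.formRatio_spec hn (hUs x' y hy').1
    refine ⟨_, h1, h2, ?_⟩
    filter_upwards [(hUo x).mem_nhds hy, (hUo x').mem_nhds hy'] with z hz hz'
    exact hNt x x' z hz hz'

end DetMetrics

/-! ### Curvature and the Levi form -/

section Levi

variable {E E' : Type*} [NormedAddCommGroup E] [NormedSpace ℂ E] [NormedAddCommGroup E']
  [NormedSpace ℂ E']

/-- The Levi form `√-1 ∂∂̄ g`, up to a constant factor. -/
def levi (g : E → ℝ) (z v w : E) : ℝ :=
  fderiv ℝ (fderiv ℝ g) z (Complex.I • v) w - fderiv ℝ (fderiv ℝ g) z v (Complex.I • w)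

theorem levi_congr {g g' : E → ℝ} {z : E} (h : g =ᶠ[𝓝 z] g') (v w : E) :
    levi g z v w = levi g' z v w := by
  rw [levi, levi, h.fderiv.fderiv_eq]

theorem ContDiffAt.differentiableAt_fderiv {X Y : Type*} [NormedAddCommGroup X] [NormedSpace ℝ X]
    [NormedAddCommGroup Y] [NormedSpace ℝ Y] {f : X → Y} {z : X} (hf : ContDiffAt ℝ 2 f z) :
    DifferentiableAt ℝ (fderiv ℝ f) z :=
  (hf.fderiv_right (m := 1) (by norm_num)).differentiableAt (by simp)

theorem levi_add {g g' : E → ℝ} {z : E} (hg : ContDiffAt ℝ 2 g z) (hg' : ContDiffAt ℝ 2 g' z)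
    (v w : E) : levi (fun u => g u + g' u) z v w = levi g z v w + levi g' z v w := by
  have h1 : fderiv ℝ (fun u => g u + g' u) =ᶠ[𝓝 z] fun u => fderiv ℝ g u + fderiv ℝ g' u := by
    filter_upwards [hg.eventually (by simp), hg'.eventually (by simp)] with u h1 h2
    exact fderiv_add (h1.differentiableAt (by simp)) (h2.differentiableAt (by simp))
  rw [levi, h1.fderiv_eq, fderiv_fun_add (ContDiffAt.differentiableAt_fderiv hg)
    (ContDiffAt.differentiableAt_fderiv hg')]
  simp only [add_apply, levi]
  ring

/-- The Levi form is natural under holomorphic maps. -/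
theorem levi_comp {g : E' → ℝ} {T : E → E'} {z : E} (hg : ContDiffAt ℝ 2 g (T z))
    (hT : ContDiffAt ℝ 2 T z)
    (hI : ∀ᶠ u in 𝓝 z, ∀ w, fderiv ℝ T u (Complex.I • w) = Complex.I • fderiv ℝ T u w) (v w : E) :
    levi (g ∘ T) z v w = levi g (T z) (fderiv ℝ T z v) (fderiv ℝ T z w) := by
  have hT' := ContDiffAt.differentiableAt_fderiv hT
  have h1 : fderiv ℝ (g ∘ T) =ᶠ[𝓝 z] fun u => (fderiv ℝ g (T u)).comp (fderiv ℝ T u) := by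
    filter_upwards [hT.continuousAt.eventually (hg.eventually (by simp)),
      hT.eventually (by simp)] with u h1 h2
    exact fderiv_comp u (h1.differentiableAt (by simp)) (h2.differentiableAt (by simp))
  have h2 : HasFDerivAt (fun u => fderiv ℝ g (T u))
      ((fderiv ℝ (fderiv ℝ g) (T z)).comp (fderiv ℝ T z)) z :=
    (ContDiffAt.differentiableAt_fderiv hg).hasFDerivAt.comp z
      (hT.differentiableAt (by simp)).hasFDerivAt
  have h3 : ∀ a b, fderiv ℝ (fderiv ℝ (g ∘ T)) z a b =
      fderiv ℝ g (T z) (fderiv ℝ (fderiv ℝ T) z a b) +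
        fderiv ℝ (fderiv ℝ g) (T z) (fderiv ℝ T z a) (fderiv ℝ T z b) := by
    intro a b
    rw [h1.fderiv_eq, (h2.clm_comp hT'.hasFDerivAt).fderiv]
    simp
  -- The second derivative of a holomorphic map is complex linear in this slot, and by symmetry in
  -- the other. Therefore its contributions to the two terms of the Levi form cancel.
  have h4 : ∀ a b, fderiv ℝ (fderiv ℝ T) z a (Complex.I • b) =
      Complex.I • fderiv ℝ (fderiv ℝ T) z a b := by
    intro a b
    have h5 : (fun u => fderiv ℝ T u (Complex.I • b)) =ᶠ[𝓝 z]
        fun u => Complex.I • fderiv ℝ T u b := hI.mono fun u hu => hu b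
    have h6 := h5.fderiv_eq (𝕜 := ℝ)
    rw [fderiv_clm_apply hT' (differentiableAt_const _), fderiv_fun_const_smul (hT'.clm_apply
      (differentiableAt_const _)), fderiv_clm_apply hT' (differentiableAt_const _)] at h6
    have := DFunLike.congr_fun h6 a
    simpa using this
  have hsymm : IsSymmSndFDerivAt ℝ T z := hT.isSymmSndFDerivAt (by simp)
  have h7 : ∀ a b, fderiv ℝ (fderiv ℝ T) z (Complex.I • a) b =
      Complex.I • fderiv ℝ (fderiv ℝ T) z a b := by
    intro a b
    rw [hsymm.eq, h4, hsymm.eq]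
  rw [levi, levi, h3, h3, h4, h7, hI.self_of_nhds, hI.self_of_nhds]
  ring

/-- `log |f|²` is pluriharmonic for a holomorphic function `f` without zeros. -/
theorem levi_log_norm_sq {f : E → ℂ} {z : E} (hf : ∀ᶠ u in 𝓝 z, ContDiffAt ℂ 2 f u)
    (h0 : f z ≠ 0) (v w : E) : levi (fun u => Real.log (‖f u‖ ^ 2)) z v w = 0 := by
  -- Scaling `f` to take the value `1` at `z` keeps it in the slit plane nearby. There `log |f|²`
  -- is, up to a constant, twice the real part of a holomorphic logarithm.
  set c := (f z)⁻¹ with hc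
  have hc0 : c ≠ 0 := inv_ne_zero h0
  set T : E → ℂ := fun u => Complex.log (c * f u) with hT
  have hcont : ContinuousAt (fun u => c * f u) z :=
    continuousAt_const.mul hf.self_of_nhds.continuousAt
  have hslit : ∀ᶠ u in 𝓝 z, c * f u ∈ Complex.slitPlane := by
    refine hcont.eventually (Complex.isOpen_slitPlane.mem_nhds ?_)
    show (f z)⁻¹ * f z ∈ _
    rw [inv_mul_cancel₀ h0]
    exact Complex.one_mem_slitPlane
  have hTd : ∀ᶠ u in 𝓝 z, ContDiffAt ℂ 2 T u := by
    filter_upwards [hf, hslit] with u h1 h2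
    exact (Complex.contDiffAt_log h2).comp u (contDiffAt_const.mul h1)
  set g : ℂ → ℝ := fun ζ => 2 * ζ.re + -2 * Real.log ‖c‖ with hg
  have hgd : ∀ ζ, fderiv ℝ g ζ = (2 : ℝ) • Complex.reCLM := by
    intro ζ
    have : HasFDerivAt g ((2 : ℝ) • Complex.reCLM) ζ :=
      (Complex.reCLM.hasFDerivAt.const_mul 2).add_const _
    exact this.fderiv
  have hgT : (fun u => Real.log (‖f u‖ ^ 2)) =ᶠ[𝓝 z] g ∘ T := by
    filter_upwards [hslit] with u hu
    have h1 : f u ≠ 0 := fun h => Complex.slitPlane_ne_zero hu (by rw [h, mul_zero])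
    simp only [hg, hT, Function.comp, Complex.log_re, norm_mul, Real.log_pow]
    rw [Real.log_mul (norm_ne_zero_iff.2 hc0) (norm_ne_zero_iff.2 h1)]
    push_cast
    ring
  have hgs : ContDiffAt ℝ 2 g (T z) := by
    refine ContDiffAt.add (contDiffAt_const.mul Complex.reCLM.contDiff.contDiffAt) contDiffAt_const
  rw [levi_congr hgT, levi_comp hgs (hTd.self_of_nhds.restrict_scalars ℝ), levi]
  · have : fderiv ℝ g = fun _ => (2 : ℝ) • Complex.reCLM := funext hgd
    simp [this]
  · filter_upwards [hTd] with u hu w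
    rw [(hu.differentiableAt (by simp)).fderiv_restrictScalars ℝ,
      ContinuousLinearMap.coe_restrictScalars', map_smul]

end Levi

/-! ### The trace of the Chern curvature -/

section Trace

variable {n r : ℕ}

theorem contDiffAt_matrix_det {ι : Type*} [Fintype ι] [DecidableEq ι] {X : Type*}
    [NormedAddCommGroup X] [NormedSpace ℝ X] {H : X → Matrix ι ι ℂ} {z : X} {m : WithTop ℕ∞}
    (hH : ∀ a b, ContDiffAt ℝ m (fun u => H u a b) z) : ContDiffAt ℝ m (fun u => (H u).det) z := by
  simp only [Matrix.det_apply]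
  fun_prop

/-- Jacobi's formula: differentiate the determinant as a multilinear function of the rows and expand
each term by cofactors. -/
theorem fderiv_det_apply {ι : Type*} [Fintype ι] [DecidableEq ι] {X : Type*}
    [NormedAddCommGroup X] [NormedSpace ℝ X] {H : X → Matrix ι ι ℂ} {z : X}
    (hH : ∀ a b, DifferentiableAt ℝ (fun u => H u a b) z) (v : X) :
    fderiv ℝ (fun u => (H u).det) z v =
      ((Matrix.of fun a b => fderiv ℝ (fun u => H u a b) z v) * (H z).adjugate).trace := by
  let f : ContinuousMultilinearMap ℂ (fun _ : ι => ι → ℂ) ℂ :=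
    ⟨Matrix.detRowAlternating.toMultilinearMap, by
      show Continuous fun A : ι → ι → ℂ => Matrix.det A
      exact Continuous.matrix_det (A := fun A : ι → ι → ℂ => (A : Matrix ι ι ℂ)) continuous_id⟩
  let H' : X → ι → ι → ℂ := H
  have hHd : HasFDerivAt H' (ContinuousLinearMap.pi fun a => ContinuousLinearMap.pi fun b =>
      fderiv ℝ (fun u => H u a b) z) z :=
    hasFDerivAt_pi.2 fun a => hasFDerivAt_pi.2 fun b => (hH a b).hasFDerivAt
  have h1 : HasFDerivAt (fun u => (H u).det) _ z :=
    ((f.hasFDerivAt (x := H' z)).restrictScalars ℝ).comp z hHd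
  rw [h1.fderiv]
  show f.linearDeriv (H' z) _ = _
  rw [ContinuousMultilinearMap.linearDeriv_apply, Matrix.trace]
  refine Finset.sum_congr rfl fun a _ => ?_
  show Matrix.det (Matrix.updateRow (H z) a _) = _
  rw [← Matrix.cramer_transpose_apply, Matrix.cramer_eq_adjugate_mulVec,
    ← Matrix.adjugate_transpose, Matrix.mulVec_transpose, Matrix.diag_apply, Matrix.mul_apply]
  rfl

/-- By Jacobi's formula `tr(∂H · H⁻¹) = ∂ log det H`, so the trace of the curvature depends only on
the determinant of the Gram matrix. -/
theorem trace_chernForm {H : (Fin n → ℂ) → Matrix (Fin r) (Fin r) ℂ} {z : Fin n → ℂ}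
    (hH : ∀ a b, DifferentiableAt ℝ (fun u => H u a b) z) (w : Fin n → ℂ) :
    (chernForm H z w).trace = delC (fun u => (H u).det) z w / (H z).det := by
  rw [chernForm, delC, fderiv_det_apply hH, fderiv_det_apply hH, Matrix.inv_def,
    Matrix.mul_smul, Matrix.trace_smul, Ring.inverse_eq_inv', smul_eq_mul, mul_comm,
    div_eq_mul_inv]
  congr 1
  have : (Matrix.of fun a b => delC (fun w => H w a b) z w) =
      (1 / 2 : ℂ) • ((Matrix.of fun a b => fderiv ℝ (fun u => H u a b) z w) -
        Complex.I • Matrix.of fun a b => fderiv ℝ (fun u => H u a b) z (Complex.I • w)) := by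
    ext a b
    simp [delC]
  rw [this, Matrix.smul_mul, Matrix.trace_smul, Matrix.sub_mul, Matrix.trace_sub, Matrix.smul_mul,
    Matrix.trace_smul]
  simp only [smul_eq_mul]

theorem differentiableAt_delC {f : (Fin n → ℂ) → ℂ} {z : Fin n → ℂ} (hf : ContDiffAt ℝ 2 f z)
    (w : Fin n → ℂ) : DifferentiableAt ℝ (fun u => delC f u w) z := by
  have h := ContDiffAt.differentiableAt_fderiv hf
  simp only [delC]
  exact ((h.clm_apply (differentiableAt_const _)).sub
    ((h.clm_apply (differentiableAt_const _)).const_mul _)).const_mul _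

theorem differentiableAt_chernForm {H : (Fin n → ℂ) → Matrix (Fin r) (Fin r) ℂ} {z : Fin n → ℂ}
    (hH : ∀ a b, ContDiffAt ℝ 2 (fun u => H u a b) z) (h0 : (H z).det ≠ 0) (w : Fin n → ℂ)
    (a b : Fin r) : DifferentiableAt ℝ (fun u => chernForm H u w a b) z := by
  have hinv : ∀ a b, DifferentiableAt ℝ (fun u => (H u)⁻¹ a b) z := by
    intro a b
    simp only [Matrix.inv_def, Ring.inverse_eq_inv', Matrix.smul_apply, smul_eq_mul,
      Matrix.adjugate_apply]
    refine DifferentiableAt.mul (((contDiffAt_matrix_det hH).differentiableAt (by simp)).inv h0) ?_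
    refine (contDiffAt_matrix_det (m := 2) fun i j => ?_).differentiableAt (by simp)
    by_cases hi : i = b
    · subst hi
      simpa using contDiffAt_const
    · simpa [Matrix.updateRow_ne hi] using hH i j
  simp only [chernForm, Matrix.mul_apply, Matrix.of_apply]
  exact DifferentiableAt.fun_sum fun c _ => (differentiableAt_delC (hH a c) w).mul (hinv c b)

theorem delbarC_sum {ι : Type*} {f : ι → (Fin n → ℂ) → ℂ} {z : Fin n → ℂ} {S : Finset ι}
    (hf : ∀ i ∈ S, DifferentiableAt ℝ (f i) z) (v : Fin n → ℂ) :
    delbarC (fun u => ∑ i ∈ S, f i u) z v = ∑ i ∈ S, delbarC (f i) z v := by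
  simp only [delbarC]
  rw [fderiv_fun_sum hf]
  simp only [sum_apply, Finset.mul_sum, ← Finset.sum_add_distrib]

/-- The trace of the Chern curvature is the Levi form of the logarithm of the determinant. -/
theorem trace_chernCurvature {H : (Fin n → ℂ) → Matrix (Fin r) (Fin r) ℂ} {z : Fin n → ℂ}
    (hH : ∀ a b, ContDiffAt ℝ 2 (fun u => H u a b) z) {G : (Fin n → ℂ) → ℝ}
    (hG : ∀ᶠ u in 𝓝 z, 0 < G u ∧ (H u).det = G u) (v w : Fin n → ℂ) :
    (chernCurvature H z v w).trace =
      Complex.I / 2 * levi (fun u => Real.log (G u)) z v w := by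
  have hdet0 : (H z).det ≠ 0 := by
    rw [hG.self_of_nhds.2]
    exact_mod_cast hG.self_of_nhds.1.ne'
  have hGd : ContDiffAt ℝ 2 G z := by
    have h1 : ContDiffAt ℝ 2 (fun u => ((H u).det).re) z :=
      Complex.reCLM.contDiff.contDiffAt.comp z (contDiffAt_matrix_det hH)
    exact h1.congr_of_eventuallyEq (hG.mono fun u hu => by simp [hu.2])
  set g : (Fin n → ℂ) → ℝ := fun u => Real.log (G u) with hg
  have hgd : ContDiffAt ℝ 2 g z := hGd.log hG.self_of_nhds.1.ne'
  have hg2 := ContDiffAt.differentiableAt_fderiv hgd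
  have hlog : ∀ w, ∀ᶠ u in 𝓝 z, (chernForm H u w).trace =
      1 / 2 * ((fderiv ℝ g u w : ℂ) - Complex.I * (fderiv ℝ g u (Complex.I • w) : ℂ)) := by
    intro w
    have hHe : ∀ᶠ u in 𝓝 z, ∀ a b, ContDiffAt ℝ 2 (fun u => H u a b) u :=
      eventually_all.2 fun a => eventually_all.2 fun b => (hH a b).eventually (by simp)
    filter_upwards [hHe, hG.eventually_nhds, hGd.eventually (by simp)] with u h1 h2 h3
    have h4 : (fun u => (H u).det) =ᶠ[𝓝 u] fun u => (G u : ℂ) := h2.mono fun _ h => h.2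
    have h5 : HasFDerivAt (fun u => (G u : ℂ)) (Complex.ofRealCLM.comp (fderiv ℝ G u)) u :=
      Complex.ofRealCLM.hasFDerivAt.comp u (h3.differentiableAt (by simp)).hasFDerivAt
    have h6 : HasFDerivAt g ((G u)⁻¹ • fderiv ℝ G u) u :=
      (h3.differentiableAt (by simp)).hasFDerivAt.log h2.self_of_nhds.1.ne'
    have h7 : (G u : ℂ) ≠ 0 := by exact_mod_cast h2.self_of_nhds.1.ne'
    rw [trace_chernForm fun a b => (h1 a b).differentiableAt (by simp), delC, h4.fderiv_eq,
      h5.fderiv, h6.fderiv, h2.self_of_nhds.2]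
    simp
    field_simp
  have hd : ∀ v w, delbarC (fun u => (chernForm H u w).trace) z v =
      1 / 4 * ((fderiv ℝ (fderiv ℝ g) z v w : ℂ) +
        fderiv ℝ (fderiv ℝ g) z (Complex.I • v) (Complex.I • w) +
        Complex.I * (fderiv ℝ (fderiv ℝ g) z (Complex.I • v) w -
          fderiv ℝ (fderiv ℝ g) z v (Complex.I • w))) := by
    intro v w
    have h1 : ∀ w, HasFDerivAt (fun u => (fderiv ℝ g u w : ℂ))
        (Complex.ofRealCLM.comp ((fderiv ℝ (fderiv ℝ g) z).flip w)) z := by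
      intro w
      refine Complex.ofRealCLM.hasFDerivAt.comp z ?_
      have := hg2.hasFDerivAt.clm_apply (hasFDerivAt_const w z)
      simpa using this
    have h2 := ((h1 w).fun_sub ((h1 (Complex.I • w)).const_mul Complex.I)).const_mul (1 / 2)
    have h3 := EventuallyEq.fderiv_eq (𝕜 := ℝ) (hlog w)
    rw [delbarC, h3, h2.fderiv]
    simp
    linear_combination (-1 / 4 * (fderiv ℝ (fderiv ℝ g) z (Complex.I • v) (Complex.I • w) : ℂ)) *
      Complex.I_mul_I
  have htr : (chernCurvature H z v w).trace =
      delbarC (fun u => (chernForm H u w).trace) z v -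
        delbarC (fun u => (chernForm H u v).trace) z w := by
    simp only [Matrix.trace, Matrix.diag_apply]
    rw [delbarC_sum fun a _ => differentiableAt_chernForm hH hdet0 w a a,
      delbarC_sum fun a _ => differentiableAt_chernForm hH hdet0 v a a, ← Finset.sum_sub_distrib]
    rfl
  -- Antisymmetrizing in `v, w` cancels the symmetric part `g''(v, w) + g''(√-1 v, √-1 w)` and
  -- leaves the Levi form.
  have hsymm : IsSymmSndFDerivAt ℝ g z := hgd.isSymmSndFDerivAt (by simp)
  rw [htr, hd, hd, hsymm.eq w v, hsymm.eq (Complex.I • w) (Complex.I • v),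
    hsymm.eq (Complex.I • w) v, hsymm.eq w (Complex.I • v), levi]
  push_cast
  ring

end Trace

/-! ### The Levi form on a complex manifold -/

section LeviForm

variable {n : ℕ} {M : Type*} [TopologicalSpace M]
  [ChartedSpace (EuclideanSpace ℝ (Fin (2 * n))) M] [IsManifold (𝓡 (2 * n)) ∞ M]
  {I : ComplexStructure n M}

theorem IsHolChart.contDiffAt_transition {φ φ' : OpenPartialHomeomorph M (Fin n → ℂ)}
    (hφ : IsHolChart I.J φ) (hφ' : IsHolChart I.J φ') {y : M} (hy : y ∈ φ.source)
    (hy' : y ∈ φ'.source) : ContDiffAt ℝ ∞ (φ ∘ φ'.symm) (φ' y) :=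
  (hφ'.contMDiffAt_iff hy').1 (hφ.contMDiffAt hy)

theorem IsHolChart.fderiv_transition {φ φ' : OpenPartialHomeomorph M (Fin n → ℂ)}
    (hφ : IsHolChart I.J φ) (hφ' : IsHolChart I.J φ') {y : M} (hy : y ∈ φ.source)
    (hy' : y ∈ φ'.source) (v : Tan n y) :
    fderiv ℝ (φ ∘ φ'.symm) (φ' y) (diffCn φ' y v) = diffCn φ y v :=
  hφ'.fderiv_apply hy' (hφ.mdifferentiableAt hy) v

/-- The Levi form of `G` on tangent vectors, computed in a holomorphic chart. -/
def leviForm (I : ComplexStructure n M) (G : M → ℝ) (y : M) (v w : Tan n y) : ℝ :=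
  levi (G ∘ (I.integrable y).choose.symm) ((I.integrable y).choose y)
    (diffCn (I.integrable y).choose y v) (diffCn (I.integrable y).choose y w)

/-- Transition maps between holomorphic charts are holomorphic and the Levi form is natural under
them, so the chart chosen in the definition does not matter. -/
theorem leviForm_eq {G : M → ℝ} {φ : OpenPartialHomeomorph M (Fin n → ℂ)} {y : M}
    (hφ : IsHolChart I.J φ) (hy : y ∈ φ.source) (hG : ContMDiffAt (𝓡 (2 * n)) 𝓘(ℝ, ℝ) ∞ G y)
    (v w : Tan n y) :
    leviForm I G y v w = levi (G ∘ φ.symm) (φ y) (diffCn φ y v) (diffCn φ y w) := by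
  obtain ⟨hy', hφ'⟩ := (I.integrable y).choose_spec
  rw [leviForm]
  set φ' := (I.integrable y).choose
  have h1 : (G ∘ φ'.symm) =ᶠ[𝓝 (φ' y)] (G ∘ φ.symm) ∘ (φ ∘ φ'.symm) := by
    filter_upwards [(φ'.tendsto_symm hy').eventually (φ.open_source.mem_nhds hy)] with z hz
    simp [φ.left_inv hz]
  have hz : (φ ∘ φ'.symm) (φ' y) = φ y := by simp [φ'.left_inv hy']
  rw [levi_congr h1, levi_comp, hz, hφ.fderiv_transition hφ' hy hy',
    hφ.fderiv_transition hφ' hy hy']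
  · rw [hz]
    exact ((hφ.contMDiffAt_iff hy).1 hG).of_le ENat.LEInfty.out
  · exact (hφ.contDiffAt_transition hφ' hy hy').of_le ENat.LEInfty.out
  · filter_upwards [(φ'.tendsto_symm hy').eventually (φ.open_source.mem_nhds hy),
      (φ'.tendsto_symm hy').eventually (φ'.open_source.mem_nhds hy'),
      φ'.open_target.mem_nhds (φ'.map_source hy')] with z h2 h3 h4 w
    obtain ⟨u, rfl⟩ := hφ'.diffCn_surjective h3 w
    have h5 := hφ.fderiv_transition hφ' h2 h3
    rw [φ'.right_inv h4] at h5
    rw [h5, ← hφ'.holomorphic _ h3, h5, hφ.holomorphic _ h2]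

theorem leviForm_congr {G G' : M → ℝ} {y : M} (h : G =ᶠ[𝓝 y] G') (v w : Tan n y) :
    leviForm I G y v w = leviForm I G' y v w := by
  obtain ⟨hy, -⟩ := (I.integrable y).choose_spec
  exact levi_congr (((I.integrable y).choose.tendsto_symm hy).eventually h) _ _

theorem leviForm_add {G G' : M → ℝ} {y : M} (hG : ContMDiffAt (𝓡 (2 * n)) 𝓘(ℝ, ℝ) ∞ G y)
    (hG' : ContMDiffAt (𝓡 (2 * n)) 𝓘(ℝ, ℝ) ∞ G' y) (v w : Tan n y) :
    leviForm I (fun z => G z + G' z) y v w = leviForm I G y v w + leviForm I G' y v w := by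
  obtain ⟨hy, hφ⟩ := (I.integrable y).choose_spec
  exact levi_add (((hφ.contMDiffAt_iff hy).1 hG).of_le ENat.LEInfty.out)
    (((hφ.contMDiffAt_iff hy).1 hG').of_le ENat.LEInfty.out) _ _

theorem leviForm_log_norm_sq {k : M → ℂ} {y : M} (hk : HolFunNear I k y) (h0 : k y ≠ 0)
    (v w : Tan n y) : leviForm I (fun z => Real.log (‖k z‖ ^ 2)) y v w = 0 := by
  obtain ⟨hy, hφ⟩ := (I.integrable y).choose_spec
  rw [leviForm]
  set φ := (I.integrable y).choose
  obtain ⟨U, hU, hUo, hxU⟩ := eventually_nhds_iff.1 ((holFunNear_iff hφ hy).1 hk)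
  have hcd := contDiffOn_of_differentiableOn hUo
    (fun z hz => (hU z hz).differentiableWithinAt : DifferentiableOn ℂ _ U)
  refine levi_log_norm_sq (f := k ∘ φ.symm) ?_ ?_ _ _
  · filter_upwards [hUo.mem_nhds hxU] with z hz
    exact (hcd.contDiffAt (hUo.mem_nhds hz)).of_le ENat.LEInfty.out
  · simpa [φ.left_inv hy] using h0

/-- Multiplying by the square norm of a holomorphic unit does not change the Levi form of the
logarithm. -/
theorem leviForm_log_of_eq {N N' : M → ℝ} {k : M → ℂ} {y : M} (hk : HolFunNear I k y)
    (h0 : k y ≠ 0) (hN' : ContMDiffAt (𝓡 (2 * n)) 𝓘(ℝ, ℝ) ∞ N' y) (hpos : 0 < N' y)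
    (h : ∀ᶠ z in 𝓝 y, N z = ‖k z‖ ^ 2 * N' z) (v w : Tan n y) :
    leviForm I (fun z => Real.log (N z)) y v w = leviForm I (fun z => Real.log (N' z)) y v w := by
  have h1 : (fun z => Real.log (N z)) =ᶠ[𝓝 y]
      fun z => Real.log (‖k z‖ ^ 2) + Real.log (N' z) := by
    filter_upwards [h, hk.continuousAt.eventually_ne h0, hN'.continuousAt.eventually_ne hpos.ne']
      with z h2 h3 h4
    rw [h2, Real.log_mul (by positivity) h4]
  have h5 : ContMDiffAt (𝓡 (2 * n)) 𝓘(ℝ, ℝ) ∞ (fun z => Real.log (‖k z‖ ^ 2)) y :=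
    ContDiffAt.comp_contMDiffAt (Real.contDiffAt_log.2 (by positivity)) hk.contMDiffAt_norm_sq
  have h6 : ContMDiffAt (𝓡 (2 * n)) 𝓘(ℝ, ℝ) ∞ (fun z => Real.log (N' z)) y :=
    ContDiffAt.comp_contMDiffAt (Real.contDiffAt_log.2 hpos.ne') hN'
  rw [leviForm_congr h1, leviForm_add h5 h6, leviForm_log_norm_sq hk h0, zero_add]

/-- The Levi form of local potentials that differ by the logarithm of the square norm of a
holomorphic unit. -/
structure IsPotential (I : ComplexStructure n M) (U : M → Set M) (N : M → M → ℝ) : Prop where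
  isOpen : ∀ x, IsOpen (U x)
  mem : ∀ x, x ∈ U x
  smooth : ∀ x, ∀ y ∈ U x, ContMDiffAt (𝓡 (2 * n)) 𝓘(ℝ, ℝ) ∞ (N x) y
  pos : ∀ x, ∀ y ∈ U x, 0 < N x y
  transition : ∀ x x' y, y ∈ U x → y ∈ U x' → ∃ k, HolFunNear I k y ∧ k y ≠ 0 ∧
    ∀ᶠ z in 𝓝 y, N x z = ‖k z‖ ^ 2 * N x' z

/-- The two-form with the given local potentials. -/
def potentialForm (I : ComplexStructure n M) (N : M → M → ℝ) (y : M) (v w : Tan n y) : ℝ :=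
  leviForm I (fun z => Real.log (N y z)) y v w

theorem IsPotential.log_smooth {U : M → Set M} {N : M → M → ℝ} (h : IsPotential I U N) {x y : M}
    (hy : y ∈ U x) : ContMDiffAt (𝓡 (2 * n)) 𝓘(ℝ, ℝ) ∞ (fun z => Real.log (N x z)) y :=
  ContDiffAt.comp_contMDiffAt (Real.contDiffAt_log.2 (h.pos x y hy).ne') (h.smooth x y hy)

theorem IsPotential.potentialForm_eq {U : M → Set M} {N : M → M → ℝ} (h : IsPotential I U N)
    {x y : M} (hy : y ∈ U x) (v w : Tan n y) :
    potentialForm I N y v w = leviForm I (fun z => Real.log (N x z)) y v w := by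
  obtain ⟨k, hk, h0, hkN⟩ := h.transition y x y (h.mem y) hy
  exact leviForm_log_of_eq hk h0 (h.smooth x y hy) (h.pos x y hy) hkN v w

/-- The trace of the curvature of a Hermitian matrix whose determinant is a given potential. -/
theorem trace_chernCurvature_comp {r : ℕ} {H : M → Matrix (Fin r) (Fin r) ℂ}
    {φ : OpenPartialHomeomorph M (Fin n → ℂ)} {y : M} (hφ : IsHolChart I.J φ)
    (hy : y ∈ φ.source) (hH : ∀ a b, ContMDiffAt (𝓡 (2 * n)) 𝓘(ℝ, ℂ) ∞ (fun z => H z a b) y)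
    {G : M → ℝ} (hG : ∀ᶠ z in 𝓝 y, 0 < G z ∧ (H z).det = G z) (v w : Tan n y) :
    (chernCurvature (fun z => H (φ.symm z)) (φ y) (diffCn φ y v) (diffCn φ y w)).trace =
      Complex.I / 2 * leviForm I (fun z => Real.log (G z)) y v w := by
  have hGs : ContMDiffAt (𝓡 (2 * n)) 𝓘(ℝ, ℝ) ∞ G y := by
    have h1 : ContMDiffAt (𝓡 (2 * n)) 𝓘(ℝ, ℂ) ∞ (fun z => (H z).det) y :=
      contDiff_matrix_det.contDiffAt.comp_contMDiffAt (contMDiffAt_pi_space.2 fun a =>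
        contMDiffAt_pi_space.2 fun b => hH a b)
    have h2 : ContMDiffAt (𝓡 (2 * n)) 𝓘(ℝ, ℝ) ∞ (fun z => ((H z).det).re) y :=
      (Complex.reCLM.contDiff (n := ∞)).contDiffAt.comp_contMDiffAt h1
    exact h2.congr_of_eventuallyEq (hG.mono fun u hu => by simp [hu.2])
  have hlog : ContMDiffAt (𝓡 (2 * n)) 𝓘(ℝ, ℝ) ∞ (fun z => Real.log (G z)) y :=
    ContDiffAt.comp_contMDiffAt (Real.contDiffAt_log.2 hG.self_of_nhds.1.ne') hGs
  rw [leviForm_eq hφ hy hlog]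
  exact trace_chernCurvature (H := fun z => H (φ.symm z)) (G := G ∘ φ.symm)
    (fun a b => ((hφ.contMDiffAt_iff hy).1 (hH a b)).of_le ENat.LEInfty.out)
    ((φ.tendsto_symm hy).eventually hG) _ _

end LeviForm

/-! ### Wedge products of two-forms -/

section Wedge

variable {T : Type*} [AddCommGroup T] [Module ℝ T] {k : ℕ}

/-- The product of `k` bilinear forms as a multilinear form in `2k` variables. -/
def prodForms (η : Fin k → T →ₗ[ℝ] T →ₗ[ℝ] ℝ) : MultilinearMap ℝ (fun _ : Fin (k * 2) => T) ℝ :=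
  ((MultilinearMap.mkPiAlgebra ℝ (Fin k) ℝ).compMultilinearMap fun j =>
    (⟨fun v : Fin 2 → T => η j (v 0) (v 1), by
        intro _ v i a b
        fin_cases i <;> simp, by
        intro _ v i c a
        fin_cases i <;> simp⟩ :
      MultilinearMap ℝ (fun _ : Fin 2 => T) ℝ)).domDomCongr
    ((Equiv.sigmaEquivProd (Fin k) (Fin 2)).trans finProdFinEquiv)

theorem prodForms_apply (η : Fin k → T →ₗ[ℝ] T →ₗ[ℝ] ℝ) (v : Fin (k * 2) → T) :
    prodForms η v = ∏ j, η j (v (finProdFinEquiv (j, 0))) (v (finProdFinEquiv (j, 1))) := by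
  simp [prodForms, MultilinearMap.mkPiAlgebra_apply, Sigma.curry]

/-- The wedge product of real two-forms. -/
def wedgeAlt (η : Fin k → T →ₗ[ℝ] T →ₗ[ℝ] ℝ) : T [⋀^Fin (k * 2)]→ₗ[ℝ] ℝ :=
  (1 / 2 : ℝ) ^ k • MultilinearMap.alternatization (prodForms η)

theorem wedgeAlt_apply (η : Fin k → T →ₗ[ℝ] T →ₗ[ℝ] ℝ) (v : Fin (k * 2) → T) :
    wedgeAlt η v = (1 / 2 : ℝ) ^ k * ∑ σ : Equiv.Perm (Fin (k * 2)),
      ((Equiv.Perm.sign σ : ℤˣ) : ℤ) *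
        ∏ j : Fin k, η j (v (σ (finProdFinEquiv (j, 0)))) (v (σ (finProdFinEquiv (j, 1)))) := by
  rw [wedgeAlt, AlternatingMap.smul_apply, MultilinearMap.alternatization_apply, smul_eq_mul]
  congr 1
  refine Finset.sum_congr rfl fun σ _ => ?_
  rw [MultilinearMap.domDomCongr_apply, prodForms_apply, Units.smul_def, zsmul_eq_mul]

theorem wedgeTwoForms_eq (η : Fin k → T →ₗ[ℝ] T →ₗ[ℝ] ℝ) (v : Fin (k * 2) → T) :
    wedgeTwoForms (fun j v w => (η j v w : ℂ)) v = (wedgeAlt η v : ℂ) := by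
  rw [wedgeTwoForms, wedgeAlt_apply]
  push_cast
  rfl

theorem alternatingMap_eq_div_mul {m : ℕ} (hm : Module.finrank ℝ T = m) (hm0 : 0 < m)
    (f g : T [⋀^Fin m]→ₗ[ℝ] ℝ) {b : Fin m → T} (hb : g b ≠ 0) (v : Fin m → T) :
    f v = f b / g b * g v := by
  have : FiniteDimensional ℝ T := Module.finite_of_finrank_pos (hm ▸ hm0)
  let e := (Module.finBasisOfFinrankEq ℝ T hm)
  rw [f.eq_smul_basis_det e, g.eq_smul_basis_det e] at *
  simp only [AlternatingMap.smul_apply, smul_eq_mul] at *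
  have h1 := left_ne_zero_of_mul hb
  have h2 := right_ne_zero_of_mul hb
  field_simp

/-- The standard symplectic form in a unitary basis. -/
def stdSymp (p q : Fin k × Fin 2) : ℝ :=
  if p.1 = q.1 then (if p.2 = q.2 then 0 else if p.2 = 0 then 1 else -1) else 0

/-- If the product is nonzero, `τ` permutes the pairs by some `t` and flips inside them by `ε j`.
The permutation of pairs moves both members, hence is even, and each flip contributes its sign once
to `sign τ` and once to the product. The total is a product of squares. -/
theorem sign_mul_prod_stdSymp_nonneg (τ : Equiv.Perm (Fin k × Fin 2)) :
    0 ≤ (((Equiv.Perm.sign τ : ℤˣ) : ℤ) : ℝ) * ∏ j : Fin k, stdSymp (τ (j, 0)) (τ (j, 1)) := by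
  by_cases h0 : ∃ j, stdSymp (τ (j, 0)) (τ (j, 1)) = 0
  · obtain ⟨j, hj⟩ := h0
    rw [Finset.prod_eq_zero (Finset.mem_univ j) hj, mul_zero]
  push Not at h0
  have h1 : ∀ j, (τ (j, 0)).1 = (τ (j, 1)).1 := fun j => by
    by_contra h
    exact h0 j (by simp [stdSymp, h])
  have h2 : ∀ j, (τ (j, 0)).2 ≠ (τ (j, 1)).2 := fun j h => h0 j (by simp [stdSymp, h])
  have htinj : Function.Injective fun j => (τ (j, 0)).1 := by
    intro j j' hjj
    have h3 : (τ (j', 0)).2 = (τ (j, 0)).2 ∨ (τ (j', 0)).2 = (τ (j, 1)).2 := by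
      have := h2 j
      omega
    rcases h3 with h3 | h3
    · have := τ.injective (Prod.ext hjj.symm h3)
      exact (Prod.ext_iff.1 this).1.symm
    · have := τ.injective (Prod.ext (hjj.symm.trans (h1 j)) h3)
      exact (Prod.ext_iff.1 this).1.symm
  let t : Equiv.Perm (Fin k) := Equiv.ofBijective _ (Finite.injective_iff_bijective.1 htinj)
  have hεinj : ∀ j, Function.Injective fun a => (τ (j, a)).2 := by
    intro j a b hab
    have := h2 j
    fin_cases a <;> fin_cases b
    · rfl
    · exact absurd hab this
    · exact absurd hab.symm this
    · rfl
  let ε : Fin k → Equiv.Perm (Fin 2) := fun j =>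
    Equiv.ofBijective _ (Finite.injective_iff_bijective.1 (hεinj j))
  have hτ : τ = (Equiv.prodCongrLeft fun _ => t) * Equiv.prodCongrRight ε := by
    ext1 ⟨j, a⟩
    refine Prod.ext ?_ rfl
    show (τ (j, a)).1 = (τ (j, 0)).1
    fin_cases a
    · rfl
    · exact (h1 j).symm
  have hs : ((Equiv.Perm.sign τ : ℤˣ) : ℤ) = ∏ j, ((Equiv.Perm.sign (ε j) : ℤˣ) : ℤ) := by
    rw [hτ, map_mul, Equiv.Perm.sign_prodCongrLeft, Equiv.Perm.sign_prodCongrRight]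
    simp
  have hεs : ∀ j, stdSymp (τ (j, 0)) (τ (j, 1)) = (((Equiv.Perm.sign (ε j) : ℤˣ) : ℤ) : ℝ) := by
    intro j
    have key : ∀ e : Equiv.Perm (Fin 2), ((Equiv.Perm.sign e : ℤˣ) : ℤ) = if e 0 = 0 then 1 else -1 := by
      decide
    rw [key, stdSymp, if_pos (h1 j), if_neg (h2 j)]
    push_cast
    rfl
  rw [hs]
  push_cast
  rw [← Finset.prod_mul_distrib]
  refine Finset.prod_nonneg fun j _ => ?_
  rw [hεs]
  exact mul_self_nonneg _

/-- All terms of the alternating sum are nonnegative, and the identity permutation contributes a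
positive one. -/
theorem wedgeAlt_pos {η : T →ₗ[ℝ] T →ₗ[ℝ] ℝ} {v : Fin k × Fin 2 → T}
    (hv : ∀ p q, η (v p) (v q) = stdSymp p q) :
    0 < wedgeAlt (fun _ : Fin k => η) (v ∘ finProdFinEquiv.symm) := by
  rw [wedgeAlt_apply]
  refine mul_pos (by positivity) ?_
  have hterm : ∀ σ : Equiv.Perm (Fin (k * 2)),
      (((Equiv.Perm.sign σ : ℤˣ) : ℤ) : ℝ) * ∏ j : Fin k,
        η ((v ∘ finProdFinEquiv.symm) (σ (finProdFinEquiv (j, 0))))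
          ((v ∘ finProdFinEquiv.symm) (σ (finProdFinEquiv (j, 1)))) =
      (((Equiv.Perm.sign (finProdFinEquiv.symm.permCongr σ) : ℤˣ) : ℤ) : ℝ) * ∏ j : Fin k,
        stdSymp (finProdFinEquiv.symm.permCongr σ (j, 0))
          (finProdFinEquiv.symm.permCongr σ (j, 1)) := by
    intro σ
    rw [Equiv.Perm.sign_permCongr]
    simp only [Function.comp, hv, Equiv.permCongr_apply, Equiv.symm_symm]
  refine Finset.sum_pos' (fun σ _ => ?_) ⟨1, Finset.mem_univ _, ?_⟩
  · rw [hterm]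
    exact sign_mul_prod_stdSymp_nonneg _
  · rw [hterm]
    simp [stdSymp, Equiv.permCongr_apply]

/-- Unitary bases of a complex vector space with an invariant real inner product. -/
theorem exists_unitary {W : Type*} [AddCommGroup W] [Module ℂ W] [FiniteDimensional ℂ W]
    (B : W → W → ℝ) (hadd : ∀ u v w, B (u + v) w = B u w + B v w)
    (hsmul : ∀ (c : ℝ) u w, B ((c : ℂ) • u) w = c * B u w)
    (hsymm : ∀ u w, B u w = B w u) (hpos : ∀ u, u ≠ 0 → 0 < B u u)
    (hI : ∀ u w, B (Complex.I • u) (Complex.I • w) = B u w) :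
    ∃ b : Fin (Module.finrank ℂ W) → W, ∀ i j, B (b i) (b j) = (if i = j then 1 else 0) ∧
      B (Complex.I • b i) (b j) = 0 := by
  have hII : ∀ u : W, Complex.I • Complex.I • u = ((-1 : ℝ) : ℂ) • u := fun u => by
    rw [smul_smul, Complex.I_mul_I]
    norm_num
  have hskew : ∀ u w, B u (Complex.I • w) = - B (Complex.I • u) w := fun u w => by
    rw [← hI, hII, hsymm, hsmul, hsymm]
    ring
  have h0 : B 0 0 = 0 := by simpa using hsmul 0 0 0
  -- The Hermitian inner product with real part `B`. An orthonormal basis for it is what is wanted,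
  -- read off in real and imaginary parts.
  let c : InnerProductSpace.Core ℂ W :=
    { inner := fun u w => ⟨B u w, B (Complex.I • u) w⟩
      conj_inner_symm := fun u w => by
        refine Complex.ext (hsymm _ _) ?_
        show -B (Complex.I • w) u = B (Complex.I • u) w
        rw [hsymm, hskew, neg_neg]
      re_inner_nonneg := fun u => by
        show 0 ≤ B u u
        by_cases hu : u = 0
        · rw [hu, h0]
        · exact (hpos u hu).le
      add_left := fun u v w => by
        refine Complex.ext (hadd _ _ _) ?_
        show B (Complex.I • (u + v)) w = B (Complex.I • u) w + B (Complex.I • v) w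
        rw [smul_add, hadd]
      smul_left := fun u w a => by
        have ha : ∀ u, B (a • u) w = a.re * B u w + a.im * B (Complex.I • u) w := by
          intro u
          conv_lhs => rw [← Complex.re_add_im a, add_smul, mul_smul, hadd, hsmul, hsmul]
        refine Complex.ext ?_ ?_
        · show B (a • u) w = a.re * B u w - -a.im * B (Complex.I • u) w
          rw [ha]; ring
        · show B (Complex.I • a • u) w = a.re * B (Complex.I • u) w + -a.im * B u w
          rw [smul_comm, ha, hII, hsmul]; ring
      definite := fun u hu => by
        by_contra h
        exact (hpos u h).ne' (congrArg Complex.re hu) }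
  let _ := c.toNormedAddCommGroup
  let _ : InnerProductSpace ℂ W := InnerProductSpace.ofCore c.toCore
  let b := stdOrthonormalBasis ℂ W
  refine ⟨b, fun i j => ?_⟩
  have := orthonormal_iff_ite.1 b.orthonormal i j
  have h1 : (⟨B (b i) (b j), B (Complex.I • b i) (b j)⟩ : ℂ) = if i = j then 1 else 0 := this
  constructor
  · have := congrArg Complex.re h1
    split_ifs at this ⊢ <;> simpa using this
  · have := congrArg Complex.im h1
    split_ifs at this <;> simpa using this

end Wedge

/-! ### The Riemannian volume of a compact manifold is finite -/

section Volume

variable {n : ℕ} {M : Type*} [TopologicalSpace M]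
  [ChartedSpace (EuclideanSpace ℝ (Fin (2 * n))) M] [IsManifold (𝓡 (2 * n)) ∞ M]

theorem continuousOn_inner_mfderiv (g : RiemMetric n M) {E : Type*} [NormedAddCommGroup E]
    [NormedSpace ℝ E] {s : Set E} (hs : IsOpen s) {f : E → M}
    (hf : ContMDiffOn 𝓘(ℝ, E) (𝓡 (2 * n)) ∞ f s) (u v : E) :
    ContinuousOn (fun z => g.inner (f z) (mfderiv 𝓘(ℝ, E) (𝓡 (2 * n)) f z u)
      (mfderiv 𝓘(ℝ, E) (𝓡 (2 * n)) f z v)) s := by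
  have hT : ∀ u : E, ContMDiffOn 𝓘(ℝ, E) (𝓡 (2 * n)).tangent 0 (fun z =>
      (⟨f z, mfderiv 𝓘(ℝ, E) (𝓡 (2 * n)) f z u⟩ : TangentBundle (𝓡 (2 * n)) M)) s := by
    intro u
    have h1 : ContMDiff 𝓘(ℝ, E) 𝓘(ℝ, E).tangent 0
        (fun z => (⟨z, u⟩ : TangentBundle 𝓘(ℝ, E) E)) := fun z =>
      contMDiffAt_vectorSpace_iff_contDiffAt.2 contDiffAt_const
    have h2 := (hf.contMDiffOn_tangentMapWithin (m := 0) (by simp) hs.uniqueMDiffOn).comp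
      (s := s) h1.contMDiffOn fun z hz => hz
    refine h2.congr fun z hz => ?_
    simp [tangentMapWithin, mfderivWithin_of_isOpen hs hz]
  have h3 : ContMDiffOn 𝓘(ℝ, E) ((𝓡 (2 * n)).prod 𝓘(ℝ)) 0
      (fun z => TotalSpace.mk' ℝ (E := Bundle.Trivial M ℝ) (f z)
        (g.inner (f z) (mfderiv 𝓘(ℝ, E) (𝓡 (2 * n)) f z u)
          (mfderiv 𝓘(ℝ, E) (𝓡 (2 * n)) f z v))) s := by
    intro z hz
    apply ContMDiffWithinAt.clm_bundle_apply₂ (F₁ := EuclideanSpace ℝ (Fin (2 * n)))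
      (F₂ := EuclideanSpace ℝ (Fin (2 * n)))
    · exact ((g.contMDiff.of_le (by simp)).contMDiffAt).comp_contMDiffWithinAt z
        ((hf z hz).of_le (by simp))
    · exact hT u z hz
    · exact hT v z hz
  intro z hz
  have h4 := h3 z hz
  simp only [contMDiffWithinAt_totalSpace] at h4
  exact h4.2.continuousWithinAt

theorem continuousOn_volDensity (g : RiemMetric n M)
    {ψ : OpenPartialHomeomorph M (EuclideanSpace ℝ (Fin (2 * n)))}
    (hψ : ψ ∈ IsManifold.maximalAtlas (𝓡 (2 * n)) ∞ M) :
    ContinuousOn (volDensity g ψ) ψ.target := by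
  refine Real.continuous_sqrt.comp_continuousOn ?_
  have h1 := fun u v => continuousOn_inner_mfderiv g ψ.open_target
    (contMDiffOn_symm_of_mem_maximalAtlas hψ) u v
  refine continuousOn_iff_continuous_domRestrict.2 (Continuous.matrix_det ?_)
  refine continuous_pi fun a => continuous_pi fun b => ?_
  exact continuousOn_iff_continuous_domRestrict.1 (h1 _ _)

/-- Change of charts for the Riemannian density. -/
theorem volDensity_eq (g : RiemMetric n M)
    {ψ ψ' : OpenPartialHomeomorph M (EuclideanSpace ℝ (Fin (2 * n)))}
    (hψ : ψ ∈ IsManifold.maximalAtlas (𝓡 (2 * n)) ∞ M)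
    (hψ' : ψ' ∈ IsManifold.maximalAtlas (𝓡 (2 * n)) ∞ M)
    {z : EuclideanSpace ℝ (Fin (2 * n))} (hz : z ∈ ψ.target) (hz' : ψ.symm z ∈ ψ'.source) :
    DifferentiableAt ℝ (ψ' ∘ ψ.symm) z ∧
      volDensity g ψ z =
        |(fderiv ℝ (ψ' ∘ ψ.symm) z).det| * volDensity g ψ' ((ψ' ∘ ψ.symm) z) := by
  have hs : MDifferentiableAt (𝓡 (2 * n)) (𝓡 (2 * n)) ψ.symm z :=
    ((contMDiffOn_symm_of_mem_maximalAtlas hψ).contMDiffAt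
      (ψ.open_target.mem_nhds hz)).mdifferentiableAt (by simp)
  have hs' : MDifferentiableAt (𝓡 (2 * n)) (𝓡 (2 * n)) ψ'.symm ((ψ' ∘ ψ.symm) z) :=
    ((contMDiffOn_symm_of_mem_maximalAtlas hψ').contMDiffAt
      (ψ'.open_target.mem_nhds (ψ'.map_source hz'))).mdifferentiableAt (by simp)
  have hm : MDifferentiableAt (𝓡 (2 * n)) (𝓡 (2 * n)) ψ' (ψ.symm z) :=
    ((contMDiffOn_of_mem_maximalAtlas hψ').contMDiffAt
      (ψ'.open_source.mem_nhds hz')).mdifferentiableAt (by simp)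
  have hT : MDifferentiableAt (𝓡 (2 * n)) (𝓡 (2 * n)) (ψ' ∘ ψ.symm) z := hm.comp z hs
  have hTd : DifferentiableAt ℝ (ψ' ∘ ψ.symm) z := mdifferentiableAt_iff_differentiableAt.1 hT
  refine ⟨hTd, ?_⟩
  set T := ψ' ∘ ψ.symm with hTdef
  have h1 : ψ.symm =ᶠ[𝓝 z] ψ'.symm ∘ T := by
    filter_upwards [(ψ.continuousAt_symm hz).preimage_mem_nhds (ψ'.open_source.mem_nhds hz')]
      with w hw
    exact (ψ'.left_inv hw).symm
  have hTz : ψ'.symm (T z) = ψ.symm z := ψ'.left_inv hz'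
  have h2 : mfderiv (𝓡 (2 * n)) (𝓡 (2 * n)) ψ.symm z =
      (mfderiv (𝓡 (2 * n)) (𝓡 (2 * n)) ψ'.symm (T z)).comp
        (mfderiv (𝓡 (2 * n)) (𝓡 (2 * n)) T z) := by
    rw [h1.mfderiv_eq]
    exact mfderiv_comp z hs' hT
  rw [mfderiv_eq_fderiv] at h2
  let A : EuclideanSpace ℝ (Fin (2 * n)) →L[ℝ] EuclideanSpace ℝ (Fin (2 * n)) := fderiv ℝ T z
  let X : EuclideanSpace ℝ (Fin (2 * n)) →L[ℝ] EuclideanSpace ℝ (Fin (2 * n)) :=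
    mfderiv (𝓡 (2 * n)) (𝓡 (2 * n)) ψ'.symm (T z)
  let B : EuclideanSpace ℝ (Fin (2 * n)) →L[ℝ] EuclideanSpace ℝ (Fin (2 * n)) →L[ℝ] ℝ :=
    g.inner (ψ.symm z)
  let P : Matrix (Fin (2 * n)) (Fin (2 * n)) ℝ :=
    LinearMap.toMatrix (EuclideanSpace.basisFun _ ℝ).toBasis (EuclideanSpace.basisFun _ ℝ).toBasis
      A.toLinearMap
  have hA : ∀ a, A (EuclideanSpace.single a 1) = ∑ c, P c a • EuclideanSpace.single c (1 : ℝ) := by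
    intro a
    have := (EuclideanSpace.basisFun (Fin (2 * n)) ℝ).toBasis.sum_repr
      (A (EuclideanSpace.single a 1))
    rw [← this]
    refine Finset.sum_congr rfl fun c _ => ?_
    simp [P, LinearMap.toMatrix_apply]
  have hG : (Matrix.of fun a b => B (X (A (EuclideanSpace.single a 1)))
        (X (A (EuclideanSpace.single b 1)))) =
      P.transpose * (Matrix.of fun a b => B (X (EuclideanSpace.single a 1))
        (X (EuclideanSpace.single b 1))) * P := by
    ext a b
    simp only [Matrix.of_apply, hA, map_sum, map_smul, Matrix.mul_apply, Matrix.transpose_apply,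
      Finset.sum_mul, Finset.mul_sum, sum_apply, smul_apply, smul_eq_mul]
    refine Finset.sum_congr rfl fun c _ => Finset.sum_congr rfl fun d _ => ?_
    ring
  have hdet : P.det = A.det := LinearMap.det_toMatrix _ _
  have e1 : volDensity g ψ z = Real.sqrt (Matrix.det (Matrix.of fun a b =>
      B (X (A (EuclideanSpace.single a 1))) (X (A (EuclideanSpace.single b 1))))) := by
    rw [volDensity, h2]
    rfl
  have e2 : volDensity g ψ' (T z) = Real.sqrt (Matrix.det (Matrix.of fun a b =>
      B (X (EuclideanSpace.single a 1)) (X (EuclideanSpace.single b 1)))) := by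
    have hB : ∀ p, p = ψ.symm z → ∀ u v : EuclideanSpace ℝ (Fin (2 * n)),
        g.inner p u v = B u v := by
      rintro p rfl u v
      rfl
    rw [volDensity]
    exact congrArg (fun A => Real.sqrt (Matrix.det A)) (Matrix.ext fun a b => hB _ hTz _ _)
  rw [e1, e2, hG, Matrix.det_mul, Matrix.det_mul, Matrix.det_transpose, hdet,
    mul_right_comm, Real.sqrt_mul (mul_self_nonneg _), Real.sqrt_mul_self_eq_abs]

variable [MeasurableSpace M] [BorelSpace M]

theorem measurableSet_chart (ψ : OpenPartialHomeomorph M (EuclideanSpace ℝ (Fin (2 * n))))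
    {A : Set M} (hA : MeasurableSet A) : MeasurableSet (ψ.target ∩ ψ.symm ⁻¹' A) := by
  have h1 : Measurable (ψ.target.domRestrict ψ.symm) :=
    (continuousOn_iff_continuous_domRestrict.1 ψ.continuousOn_symm).measurable
  have h2 := ψ.open_target.measurableSet.subtype_image (h1 hA)
  convert h2 using 1
  ext z
  simp [and_comm]

theorem map_withDensity_apply (ψ : OpenPartialHomeomorph M (EuclideanSpace ℝ (Fin (2 * n))))
    {K : Set (EuclideanSpace ℝ (Fin (2 * n)))} (hK : MeasurableSet K) (hKψ : K ⊆ ψ.target)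
    (f : EuclideanSpace ℝ (Fin (2 * n)) → ENNReal) {A : Set M} (hA : MeasurableSet A) :
    ((volume.restrict K).withDensity f).map ψ.symm A = ∫⁻ z in K ∩ ψ.symm ⁻¹' A, f z := by
  have h1 : AEMeasurable ψ.symm ((volume.restrict K).withDensity f) :=
    ((ψ.continuousOn_symm.mono hKψ).aemeasurable hK).mono_ac (withDensity_absolutelyContinuous _ _)
  rw [Measure.map_apply_of_aemeasurable h1 hA, withDensity_apply', Measure.restrict_restrict' hK,
    Set.inter_comm]

/-- The measure is a supremum over the whole maximal atlas. By the change of variables formula,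
every chart measure is dominated by the sum of the measures of finitely many compact coordinate
balls that cover `M`, and these are finite because the densities are continuous. -/
theorem riemVolume_lt_top [CompactSpace M] (g : RiemMetric n M) : riemVolume g Set.univ < ⊤ := by
  have hball : ∀ x : M, ∃ ε > 0, Metric.closedBall (chartAt (EuclideanSpace ℝ (Fin (2 * n))) x x) ε
      ⊆ (chartAt (EuclideanSpace ℝ (Fin (2 * n))) x).target := fun x =>
    Metric.nhds_basis_closedBall.mem_iff.1
      ((chartAt _ x).open_target.mem_nhds (mem_chart_target _ x))
  choose ε hε0 hε using hball
  let ψ : M → OpenPartialHomeomorph M (EuclideanSpace ℝ (Fin (2 * n))) := fun x => chartAt _ x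
  have hψ : ∀ x, ψ x ∈ IsManifold.maximalAtlas (𝓡 (2 * n)) ∞ M := fun x =>
    IsManifold.chart_mem_maximalAtlas x
  let K : M → Set (EuclideanSpace ℝ (Fin (2 * n))) := fun x => Metric.closedBall (ψ x x) (ε x)
  let W : M → Set M := fun x => (ψ x).source ∩ ψ x ⁻¹' Metric.ball (ψ x x) (ε x)
  have hWo : ∀ x, IsOpen (W x) := fun x => (ψ x).isOpen_inter_preimage Metric.isOpen_ball
  obtain ⟨t, -, ht⟩ := isCompact_univ.elim_nhds_subcover W fun x _ =>
    (hWo x).mem_nhds ⟨mem_chart_source _ x, Metric.mem_ball_self (hε0 x)⟩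
  let D : M → EuclideanSpace ℝ (Fin (2 * n)) → ENNReal := fun x z =>
    ENNReal.ofReal (volDensity g (ψ x) z)
  let ν : M → Measure M := fun x => ((volume.restrict (K x)).withDensity (D x)).map (ψ x).symm
  have hfin : ∀ x, ν x Set.univ < ⊤ := by
    intro x
    rw [map_withDensity_apply _ Metric.isClosed_closedBall.measurableSet (hε x) _
      MeasurableSet.univ, Set.preimage_univ, Set.inter_univ]
    have : IntegrableOn (volDensity g (ψ x)) (K x) :=
      ((continuousOn_volDensity g (hψ x)).mono (hε x)).integrableOn_compact
        (isCompact_closedBall _ _)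
    exact (lintegral_ofReal_le_lintegral_enorm _).trans_lt this.2
  have hle : riemVolume g ≤ ∑ x ∈ t, ν x := by
    refine iSup₂_le fun χ hχ => Measure.le_iff.2 fun A hA => ?_
    set m := ((volume.restrict χ.target).withDensity fun z =>
        ENNReal.ofReal (volDensity g χ z)).map χ.symm with hm
    have hcov : A = ⋃ x ∈ t, A ∩ W x := by
      rw [← Set.inter_iUnion₂, Set.inter_eq_left.2]
      exact (Set.subset_univ _).trans ht
    calc m A = m (⋃ x ∈ t, A ∩ W x) := by rw [← hcov]
      _ ≤ ∑ x ∈ t, m (A ∩ W x) := measure_biUnion_finset_le _ _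
      _ ≤ ∑ x ∈ t, ν x A := Finset.sum_le_sum fun x _ => ?_
      _ = _ := by rw [Measure.finsetSum_apply]
    have hAW : MeasurableSet (A ∩ W x) := hA.inter (hWo x).measurableSet
    set s := χ.target ∩ χ.symm ⁻¹' (A ∩ W x) with hs
    have hsm : MeasurableSet s := measurableSet_chart χ hAW
    have hT : ∀ z ∈ s, DifferentiableAt ℝ (ψ x ∘ χ.symm) z ∧ volDensity g χ z =
        |(fderiv ℝ (ψ x ∘ χ.symm) z).det| * volDensity g (ψ x) ((ψ x ∘ χ.symm) z) :=
      fun z hz => volDensity_eq g hχ (hψ x) hz.1 hz.2.2.1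
    have e1 : m (A ∩ W x) = ∫⁻ z in s, ENNReal.ofReal (volDensity g χ z) :=
      map_withDensity_apply χ χ.open_target.measurableSet subset_rfl _ hAW
    have e2 : ν x A = ∫⁻ z in K x ∩ (ψ x).symm ⁻¹' A, D x z :=
      map_withDensity_apply _ Metric.isClosed_closedBall.measurableSet (hε x) _ hA
    -- The transition map carries `s` injectively into the compact ball of the chart at `x`, and
    -- `volDensity_eq` supplies exactly the Jacobian factor.
    have hinj : Set.InjOn (ψ x ∘ χ.symm) s := (ψ x).injOn.comp (χ.symm.injOn.mono fun z hz => hz.1)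
      fun z hz => hz.2.2.1
    rw [e1, e2]
    calc ∫⁻ z in s, ENNReal.ofReal (volDensity g χ z)
        = ∫⁻ z in s, ENNReal.ofReal |(fderiv ℝ (ψ x ∘ χ.symm) z).det| *
            D x ((ψ x ∘ χ.symm) z) := by
          refine setLIntegral_congr_fun hsm fun z hz => ?_
          simp only [(hT z hz).2, D]
          rw [ENNReal.ofReal_mul (abs_nonneg _)]
      _ = ∫⁻ z in (ψ x ∘ χ.symm) '' s, D x z :=
          (lintegral_image_eq_lintegral_abs_det_fderiv_mul volume hsm
            (fun z hz => (hT z hz).1.hasFDerivAt.hasFDerivWithinAt) hinj _).symm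
      _ ≤ _ := lintegral_mono_set ?_
    rintro _ ⟨z, hz, rfl⟩
    refine ⟨Metric.ball_subset_closedBall hz.2.2.2, ?_⟩
    show (ψ x).symm (ψ x (χ.symm z)) ∈ A
    rw [(ψ x).left_inv hz.2.2.1]
    exact hz.2.1
  refine (Measure.le_iff.1 hle _ MeasurableSet.univ).trans_lt ?_
  rw [Measure.finsetSum_apply]
  exact ENNReal.sum_lt_top.2 fun x _ => hfin x

end Volume

/-! ### Wedge integrals of Levi forms -/

section WedgeIntegral

variable {n : ℕ} {M : Type*} [TopologicalSpace M]
  [ChartedSpace (EuclideanSpace ℝ (Fin (2 * n))) M]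

theorem IsHolChart.diffCn_mfderiv_symm {J : ∀ x : M, Tan n x →L[ℝ] Tan n x}
    {φ : OpenPartialHomeomorph M (Fin n → ℂ)} (hφ : IsHolChart J φ) {z : Fin n → ℂ}
    (hz : z ∈ φ.target) (u : Fin n → ℂ) :
    diffCn φ (φ.symm z) (mfderiv 𝓘(ℝ, Fin n → ℂ) (𝓡 (2 * n)) φ.symm z u) = u := by
  have h2 : (φ ∘ φ.symm) =ᶠ[𝓝 z] id := by
    filter_upwards [φ.open_target.mem_nhds hz] with z hz
    simp [φ.right_inv hz]
  have h3 := mfderiv_comp (I := 𝓘(ℝ, Fin n → ℂ)) (I'' := 𝓘(ℝ, Fin n → ℂ)) z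
    (hφ.mdifferentiableAt (φ.map_target hz)) (hφ.mdifferentiableAt_symm hz)
  rw [h2.mfderiv_eq, mfderiv_id] at h3
  exact (DFunLike.congr_fun h3 u).symm

theorem IsHolChart.diffCn_injective {J : ∀ x : M, Tan n x →L[ℝ] Tan n x}
    {φ : OpenPartialHomeomorph M (Fin n → ℂ)} (hφ : IsHolChart J φ) {y : M} (hy : y ∈ φ.source) :
    Function.Injective (diffCn φ y) := by
  let L : EuclideanSpace ℝ (Fin (2 * n)) →ₗ[ℝ] Fin n → ℂ :=
    (mfderiv (𝓡 (2 * n)) 𝓘(ℝ, Fin n → ℂ) φ y).toLinearMap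
  have hd : Module.finrank ℝ (EuclideanSpace ℝ (Fin (2 * n))) =
      Module.finrank ℝ (Fin n → ℂ) := by
    rw [finrank_euclideanSpace_fin, finrank_real_of_complex, Module.finrank_fin_fun]
  exact (LinearMap.injective_iff_surjective_of_finrank_eq_finrank (f := L) hd).2
    (hφ.diffCn_surjective hy)

theorem IsHolChart.J_mfderiv_symm {J : ∀ x : M, Tan n x →L[ℝ] Tan n x}
    {φ : OpenPartialHomeomorph M (Fin n → ℂ)} (hφ : IsHolChart J φ) {z : Fin n → ℂ}
    (hz : z ∈ φ.target) (u : Fin n → ℂ) :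
    J (φ.symm z) (mfderiv 𝓘(ℝ, Fin n → ℂ) (𝓡 (2 * n)) φ.symm z u) =
      mfderiv 𝓘(ℝ, Fin n → ℂ) (𝓡 (2 * n)) φ.symm z (Complex.I • u) := by
  apply hφ.diffCn_injective (φ.map_target hz)
  rw [hφ.holomorphic _ (φ.map_target hz), hφ.diffCn_mfderiv_symm hz, hφ.diffCn_mfderiv_symm hz]

/-- The Levi form as a bilinear form. -/
def leviLin {E : Type*} [NormedAddCommGroup E] [NormedSpace ℂ E] (g : E → ℝ) (z : E) :
    E →ₗ[ℝ] E →ₗ[ℝ] ℝ :=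
  LinearMap.mk₂ ℝ (levi g z)
    (fun u v w => by simp only [levi, smul_add, map_add, add_apply]; ring)
    (fun c u w => by
      simp only [levi, smul_comm Complex.I c, map_smul, smul_apply, smul_eq_mul]; ring)
    (fun u v w => by simp only [levi, smul_add, map_add]; ring)
    (fun c u w => by simp only [levi, smul_comm Complex.I c, map_smul, smul_eq_mul]; ring)

theorem continuousAt_levi {E : Type*} [NormedAddCommGroup E] [NormedSpace ℂ E] {g : E → ℝ}
    {z : E} (hg : ContDiffAt ℝ 2 g z) (v w : E) : ContinuousAt (fun u => levi g u v w) z := by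
  have h := ((hg.fderiv_right (m := 1) (by norm_num)).fderiv_right (m := 0)
    (by norm_num)).continuousAt
  exact ((h.clm_apply continuousAt_const).clm_apply continuousAt_const).sub
    ((h.clm_apply continuousAt_const).clm_apply continuousAt_const)

/-- The form `potentialForm` as a bilinear form. -/
def potentialLin (I : ComplexStructure n M) (N : M → M → ℝ) (y : M) :
    Tan n y →ₗ[ℝ] Tan n y →ₗ[ℝ] ℝ :=
  (leviLin ((fun z => Real.log (N y z)) ∘ (I.integrable y).choose.symm)
    ((I.integrable y).choose y)).compl₁₂
    (mfderiv (𝓡 (2 * n)) 𝓘(ℝ, Fin n → ℂ) (I.integrable y).choose y).toLinearMap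
    (mfderiv (𝓡 (2 * n)) 𝓘(ℝ, Fin n → ℂ) (I.integrable y).choose y).toLinearMap

theorem potentialLin_apply (I : ComplexStructure n M) (N : M → M → ℝ) (y : M) (v w : Tan n y) :
    potentialLin I N y v w = potentialForm I N y v w := rfl

variable [IsManifold (𝓡 (2 * n)) ∞ M]

/-- The fundamental form as a bilinear form. -/
def fundLin (g : RiemMetric n M) (I : ComplexStructure n M) (y : M) :
    Tan n y →ₗ[ℝ] Tan n y →ₗ[ℝ] ℝ :=
  LinearMap.mk₂ ℝ (fun v w => g.inner y (I.J y v) w)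
    (fun u v w => by simp only [map_add, add_apply])
    (fun c u w => by simp only [map_smul, smul_apply])
    (fun u v w => by simp only [map_add])
    (fun c u w => by simp only [map_smul])

theorem fundLin_apply (g : RiemMetric n M) (I : ComplexStructure n M) (y : M) (v w : Tan n y) :
    fundLin g I y v w = g.inner y (I.J y v) w := rfl

theorem fundForm_eq (g : RiemMetric n M) (I : ComplexStructure n M) (y : M) :
    fundForm g I y = fun v w => ((fundLin g I y v w : ℝ) : ℂ) := rfl

variable {g : RiemMetric n M} {I : ComplexStructure n M}

/-- The top power of the fundamental form is positive on a unitary basis. -/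
theorem IsHolChart.exists_wedgeAlt_pos (hgI : IsHermitianFor g I) {k : ℕ} (hk : k = n)
    {φ : OpenPartialHomeomorph M (Fin n → ℂ)} (hφ : IsHolChart I.J φ) {z : Fin n → ℂ}
    (hz : z ∈ φ.target) : ∃ u : Fin (k * 2) → Fin n → ℂ,
      0 < wedgeAlt (fun _ : Fin k => fundLin g I (φ.symm z))
        (fun a => mfderiv 𝓘(ℝ, Fin n → ℂ) (𝓡 (2 * n)) φ.symm z (u a)) := by
  subst hk
  set y := φ.symm z with hy
  let A : (Fin k → ℂ) →L[ℝ] Tan k y := mfderiv 𝓘(ℝ, Fin k → ℂ) (𝓡 (2 * k)) φ.symm z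
  have hJ : ∀ u, I.J y (A u) = A (Complex.I • u) := hφ.J_mfderiv_symm hz
  have hA0 : ∀ u, A u = 0 → u = 0 := fun u hu => by
    have h1 : diffCn φ y (A u) = u := hφ.diffCn_mfderiv_symm hz u
    rw [← h1, hu]
    exact map_zero (mfderiv (𝓡 (2 * k)) 𝓘(ℝ, Fin k → ℂ) φ y)
  obtain ⟨b, hb⟩ := exists_unitary (fun u w => g.inner y (A u) (A w))
    (fun u v w => by simp only [map_add, add_apply])
    (fun c u w => by
      rw [Complex.coe_smul, map_smul, map_smul, smul_apply, smul_eq_mul])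
    (fun u w => g.symm y _ _)
    (fun u hu => g.pos y _ fun h => hu (hA0 u h))
    (fun u w => by rw [← hJ, ← hJ, hgI])
  let τ : Fin k ≃ Fin (Module.finrank ℂ (Fin k → ℂ)) := finCongr (Module.finrank_fin_fun ℂ).symm
  let u : Fin k × Fin 2 → Fin k → ℂ := fun p => if p.2 = 0 then b (τ p.1) else Complex.I • b (τ p.1)
  have hII : ∀ u : Fin k → ℂ, A (Complex.I • Complex.I • u) = - A u := fun u => by
    rw [smul_smul, Complex.I_mul_I, neg_one_smul, map_neg]
  have hb1 : ∀ i j, g.inner y (A (b (τ i))) (A (b (τ j))) = if i = j then 1 else 0 := fun i j => by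
    have := (hb (τ i) (τ j)).1
    simpa using this
  have hb2 : ∀ i j, g.inner y (A (Complex.I • b (τ i))) (A (b (τ j))) = 0 := fun i j =>
    (hb (τ i) (τ j)).2
  have hb3 : ∀ i j, g.inner y (A (b (τ i))) (A (Complex.I • b (τ j))) = 0 := fun i j => by
    rw [g.symm]; exact hb2 j i
  have hb4 : ∀ i j, g.inner y (A (Complex.I • b (τ i))) (A (Complex.I • b (τ j))) =
      if i = j then 1 else 0 := fun i j => by
    rw [← hJ, ← hJ, hgI]; exact hb1 i j
  refine ⟨u ∘ finProdFinEquiv.symm, wedgeAlt_pos (v := fun p => A (u p)) ?_⟩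
  rintro ⟨i, a⟩ ⟨j, c⟩
  rw [fundLin_apply, hJ]
  fin_cases a <;> fin_cases c
  · simpa [u, stdSymp] using hb2 i j
  · simpa [u, stdSymp] using hb4 i j
  · simp only [u, stdSymp, Fin.mk_one, Fin.zero_eta, if_true, one_ne_zero, if_false, hII, map_neg,
      neg_apply, hb1]
    split_ifs <;> simp
  · simp only [u, stdSymp, Fin.mk_one, if_true, one_ne_zero, if_false, hII, map_neg, neg_apply,
      hb3]
    simp

theorem continuousAt_wedgeAlt {k : ℕ} {X : Type*} [TopologicalSpace X] {f : X → M} {x : X}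
    {η : ∀ y, Fin k → Tan n y →ₗ[ℝ] Tan n y →ₗ[ℝ] ℝ} {v : ∀ z, Fin (k * 2) → Tan n (f z)}
    (h : ∀ j a b, ContinuousAt (fun z => η (f z) j (v z a) (v z b)) x) :
    ContinuousAt (fun z => wedgeAlt (η (f z)) (v z)) x := by
  simp only [wedgeAlt_apply]
  exact continuousAt_const.mul (tendsto_finsetSum _ fun σ _ => continuousAt_const.mul
    (tendsto_finsetProd _ fun j _ => h j _ _))

variable [CompactSpace M] [MeasurableSpace M] [BorelSpace M]

/-- The density `ρ` is the quotient of two forms of top degree, the second nowhere zero. It is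
continuous on a compact manifold of finite volume, hence integrable. -/
theorem IsPotential.exists_hasWedgeIntegral (hn : 0 < n) (hgI : IsHermitianFor g I)
    {U : M → Set M} {N : M → M → ℝ} (h : IsPotential I U N) :
    ∃ c : ℝ, HasWedgeIntegral g I (fun x v w => (potentialForm I N x v w : ℂ)) c := by
  have hk : n - 1 + 1 = n := Nat.sub_add_cancel hn
  let ηS : ∀ y, Fin (n - 1 + 1) → Tan n y →ₗ[ℝ] Tan n y →ₗ[ℝ] ℝ := fun y =>
    Fin.cons (potentialLin I N y) fun _ => fundLin g I y
  let ηω : ∀ y, Fin (n - 1 + 1) → Tan n y →ₗ[ℝ] Tan n y →ₗ[ℝ] ℝ := fun y _ => fundLin g I y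
  have hb : ∀ y, ∃ b : Fin ((n - 1 + 1) * 2) → Tan n y, wedgeAlt (ηω y) b ≠ 0 := by
    intro y
    obtain ⟨φ, hy, hφ⟩ := I.integrable y
    obtain ⟨u, hu⟩ := hφ.exists_wedgeAlt_pos hgI hk (φ.map_source hy)
    have : ∃ b : Fin ((n - 1 + 1) * 2) → Tan n (φ.symm (φ y)),
      wedgeAlt (ηω (φ.symm (φ y))) b ≠ 0 := ⟨_, hu.ne'⟩
    rwa [φ.left_inv hy] at this
  choose b hb using hb
  let ρ : M → ℝ := fun y => wedgeAlt (ηS y) (b y) / ((n.factorial : ℝ)⁻¹ * wedgeAlt (ηω y) (b y))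
  have hfac : ((n.factorial : ℝ)⁻¹) ≠ 0 := inv_ne_zero (Nat.cast_ne_zero.2 n.factorial_ne_zero)
  have hρ : ∀ y v, wedgeAlt (ηS y) v = ρ y * ((n.factorial : ℝ)⁻¹ * wedgeAlt (ηω y) v) := by
    intro y v
    have hd : Module.finrank ℝ (Tan n y) = (n - 1 + 1) * 2 := by
      have h2 : Module.finrank ℝ (Tan n y) = 2 * n := finrank_euclideanSpace_fin
      omega
    rw [alternatingMap_eq_div_mul hd (by omega) (wedgeAlt (ηS y)) (wedgeAlt (ηω y)) (hb y) v]
    have := hb y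
    simp only [ρ]
    field_simp
  have hcont : Continuous ρ := by
    refine continuous_iff_continuousAt.2 fun y => ?_
    obtain ⟨φ, hy, hφ⟩ := I.integrable y
    have hz := φ.map_source hy
    obtain ⟨u, hu⟩ := hφ.exists_wedgeAlt_pos hgI hk hz
    -- The bases `b y` are chosen pointwise and need not be continuous. Since `ρ` does not depend on
    -- the basis, near `y` it is computed with vectors that are constant in a chart.
    set X : ∀ z, Fin ((n - 1 + 1) * 2) → Tan n (φ.symm z) := fun z a =>
      mfderiv 𝓘(ℝ, Fin n → ℂ) (𝓡 (2 * n)) φ.symm z (u a) with hX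
    have htar := φ.open_target.mem_nhds hz
    have hc1 : ∀ a c, ContinuousAt (fun z => fundLin g I (φ.symm z) (X z a) (X z c)) (φ y) := by
      intro a c
      refine ((continuousOn_inner_mfderiv g φ.open_target hφ.smooth_symm (Complex.I • u a)
        (u c)).continuousAt htar).congr ?_
      filter_upwards [htar] with z hz
      rw [fundLin_apply, hX, hφ.J_mfderiv_symm hz]
    have hc2 : ∀ a c, ContinuousAt (fun z => potentialLin I N (φ.symm z) (X z a) (X z c))
        (φ y) := by
      intro a c
      have hlog := ((hφ.contMDiffAt_iff hy).1 (h.log_smooth (h.mem y))).of_le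
        (ENat.LEInfty.out : (2 : WithTop ℕ∞) ≤ ∞)
      refine (continuousAt_levi hlog (u a) (u c)).congr ?_
      filter_upwards [htar, (φ.tendsto_symm hy).eventually ((h.isOpen y).mem_nhds (h.mem y))]
        with z hz hzU
      rw [potentialLin_apply, h.potentialForm_eq hzU, leviForm_eq hφ (φ.map_target hz)
        (h.log_smooth hzU), φ.right_inv hz, hX, hφ.diffCn_mfderiv_symm hz,
        hφ.diffCn_mfderiv_symm hz]
    have hS : ContinuousAt (fun z => wedgeAlt (ηS (φ.symm z)) (X z)) (φ y) :=
      continuousAt_wedgeAlt fun j a c => by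
        refine Fin.cases ?_ (fun j => ?_) j
        · exact hc2 a c
        · exact hc1 a c
    have hω : ContinuousAt (fun z => wedgeAlt (ηω (φ.symm z)) (X z)) (φ y) :=
      continuousAt_wedgeAlt fun j a c => hc1 a c
    have hq : ContinuousAt (fun z => wedgeAlt (ηS (φ.symm z)) (X z) /
        ((n.factorial : ℝ)⁻¹ * wedgeAlt (ηω (φ.symm z)) (X z))) (φ y) :=
      hS.div (continuousAt_const.mul hω) (mul_ne_zero hfac hu.ne')
    have hρφ : ContinuousAt (ρ ∘ φ.symm) (φ y) := by
      refine hq.congr ?_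
      filter_upwards [hω.eventually_ne hu.ne'] with z hz
      rw [hρ (φ.symm z) (X z)]
      exact mul_div_cancel_right₀ _ (mul_ne_zero hfac hz)
    refine (hρφ.comp (φ.continuousAt hy)).congr ?_
    filter_upwards [φ.open_source.mem_nhds hy] with x hx
    simp [φ.left_inv hx]
  have hfin : IsFiniteMeasure (riemVolume g) := ⟨riemVolume_lt_top g⟩
  have hint : Integrable ρ (riemVolume g) := by
    obtain ⟨C, hC⟩ := isCompact_univ.exists_bound_of_continuousOn hcont.continuousOn
    exact Integrable.of_bound hcont.aestronglyMeasurable C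
      (Eventually.of_forall fun x => hC x (Set.mem_univ x))
  refine ⟨∫ x, ρ x ∂(riemVolume g), fun x => (ρ x : ℂ), ?_, hint.ofReal, integral_ofReal.symm⟩
  intro x v
  have h1 : (Fin.cons (fun v w => (potentialForm I N x v w : ℂ)) fun _ => fundForm g I x :
      Fin (n - 1 + 1) → Tan n x → Tan n x → ℂ) = fun j v w => ((ηS x j v w : ℝ) : ℂ) := by
    funext j
    refine Fin.cases ?_ (fun j => ?_) j <;> rfl
  rw [h1, wedgeTwoForms_eq, hρ, fundFormPow, fundForm_eq, wedgeTwoForms_eq]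
  push_cast
  rfl

theorem HasWedgeIntegral.add {R R' : ∀ x : M, Tan n x → Tan n x → ℂ} {c c' : ℂ}
    (h : HasWedgeIntegral g I R c) (h' : HasWedgeIntegral g I R' c') :
    HasWedgeIntegral g I (fun x v w => R x v w + R' x v w) (c + c') := by
  obtain ⟨ρ, h1, h2, rfl⟩ := h
  obtain ⟨ρ', h1', h2', rfl⟩ := h'
  refine ⟨fun x => ρ x + ρ' x, fun x v => ?_, h2.add h2', (integral_add h2 h2').symm⟩
  rw [add_mul, ← h1, ← h1']
  simp only [wedgeTwoForms, Fin.prod_univ_succ, Fin.cons_zero, Fin.cons_succ, add_mul, mul_add,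
    Finset.sum_add_distrib]

theorem HasWedgeIntegral.const_mul {R : ∀ x : M, Tan n x → Tan n x → ℂ} {c : ℂ}
    (h : HasWedgeIntegral g I R c) (a : ℂ) :
    HasWedgeIntegral g I (fun x v w => a * R x v w) (a * c) := by
  obtain ⟨ρ, h1, h2, rfl⟩ := h
  refine ⟨fun x => a * ρ x, fun x v => ?_, h2.const_mul a, (integral_const_mul _ _).symm⟩
  rw [mul_assoc, ← h1]
  simp only [wedgeTwoForms, Fin.prod_univ_succ, Fin.cons_zero, Fin.cons_succ, Finset.mul_sum]
  refine Finset.sum_congr rfl fun σ _ => ?_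
  ring

end WedgeIntegral

/-! ### Degrees of image and kernel -/

section Degrees

variable {n : ℕ} {M : Type*} [TopologicalSpace M]
  [ChartedSpace (EuclideanSpace ℝ (Fin (2 * n))) M]
  {F : Type*} [NormedAddCommGroup F] [NormedSpace ℂ F] [FiniteDimensional ℂ F]
  {V : M → Type*} [∀ x, AddCommGroup (V x)] [∀ x, Module ℂ (V x)]
  [TopologicalSpace (TotalSpace F V)] [∀ x, TopologicalSpace (V x)] [FiberBundle F V]
  [VectorBundle ℂ F V] [VectorBundle ℝ F V] [IsManifold (𝓡 (2 * n)) ∞ M]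
  [ContMDiffVectorBundle ∞ F V (𝓡 (2 * n))] {I : ComplexStructure n M}
  {D : HolStructure F I V} {Ψ : ∀ x, V x →ₗ[ℂ] V x} {r s : ℕ}

theorem DetMetric.isCurvature_of_isPotential {G : CoherentSubsheaf D} {S : Set M}
    (h : DetMetric G r S) (hP : IsPotential I h.U h.N) :
    h.IsCurvature fun x v w => Complex.I / 2 * potentialForm I h.N x v w := by
  intro φ x y hφ hy hyU v w
  have h1 := trace_chernCurvature_comp (H := fun z => Matrix.of fun _ _ : Fin 1 => (h.N x z : ℂ))
    (G := h.N x) hφ hy (fun a b =>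
      Complex.ofRealCLM.contDiff.contDiffAt.comp_contMDiffAt (h.smooth x y hyU)) ?_ v w
  · rw [h1, ← hP.potentialForm_eq hyU]
  · filter_upwards [(h.isOpen x).mem_nhds hyU] with z hz
    exact ⟨h.pos x z hz, by simp⟩

theorem contMDiffAt_gram {m : ℕ} (h : HermMetric n F V) {e : Fin m → ∀ y, V y} {y : M}
    (he : IsHolBasisNear D e y) (a b : Fin m) :
    ContMDiffAt (𝓡 (2 * n)) 𝓘(ℝ, ℂ) ∞ (fun z => h.h z (e a z) (e b z)) y :=
  (h.smooth _ _ y (he.1 a).smoothSecNear (he.1 b).smoothSecNear).self_of_nhds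

/-- In any holomorphic frame the logarithm of the Gram determinant is `log N + log N'` plus the
logarithm of the square norm of a holomorphic unit, whose Levi form vanishes. -/
theorem isTraceCurvature_of_isPotential (h : HermMetric n F V) {U : M → Set M} {N N' : M → M → ℝ}
    (hP : IsPotential I U N) (hP' : IsPotential I U N') {ι : Type*} [Fintype ι] [DecidableEq ι]
    (τ : Fin (Module.finrank ℂ F) ≃ ι) {e : M → ι → ∀ y, V y}
    (he : ∀ x, ∀ y ∈ U x, IsHolBasisNear D (e x) y)
    (hN : ∀ x, ∀ y ∈ U x, (gramDet h (e x) y).re = N x y * N' x y) :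
    IsTraceCurvature D h fun x v w => Complex.I / 2 * potentialForm I N x v w +
      Complex.I / 2 * potentialForm I N' x v w := by
  intro φ e' y hφ hy he' v w
  have he'' : IsHolBasisNear D e' y := he'
  have hey := (he y y (hP.mem y)).reindex τ
  have h1 := trace_chernCurvature_comp
    (H := fun z => Matrix.of fun a b => h.h z (e' a z) (e' b z))
    (G := fun z => (gramDet h e' z).re) hφ hy (fun a b => contMDiffAt_gram h he'' a b) (by
      filter_upwards [he''.2] with z hz
      exact ⟨(gramDet_pos h hz).1, (gramDet_pos h hz).2.symm⟩) v w
  have h2 : ∀ᶠ z in 𝓝 y, (gramDet h e' z).re =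
      ‖frameDet (fun i => e y (τ i)) z fun i => e' i z‖ ^ 2 * (N y z * N' y z) := by
    filter_upwards [hey.2, (hP.isOpen y).mem_nhds (hP.mem y)] with z h3 h4
    rw [gramDet_change h h3, gramDet_reindex, Complex.re_ofReal_mul, hN y z h4]
  have hym := hP.mem y
  have h3 := leviForm_log_of_eq (I := I) (hey.holFunNear_frameDet he''.1)
    (hey.2.self_of_nhds.frameDet_ne_zero he''.2.self_of_nhds)
    (N' := fun z => N y z * N' y z) ((hP.smooth y y hym).mul (hP'.smooth y y hym))
    (mul_pos (hP.pos y y hym) (hP'.pos y y hym)) h2 v w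
  have h4 : (fun z => Real.log (N y z * N' y z)) =ᶠ[𝓝 y]
      fun z => Real.log (N y z) + Real.log (N' y z) := by
    filter_upwards [(hP.isOpen y).mem_nhds hym] with z hz
    exact Real.log_mul (hP.pos y z hz).ne' (hP'.pos y z hz).ne'
  rw [h1, h3, leviForm_congr h4, leviForm_add (hP.log_smooth hym) (hP'.log_smooth hym),
    Complex.ofReal_add, mul_add]
  rfl

theorem degree_eq (c : ℝ) : ((-c / (4 * Real.pi) : ℝ) : ℂ) =
    Complex.I / (2 * (Real.pi : ℂ)) * (Complex.I / 2 * c) := by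
  have : (Real.pi : ℂ) ≠ 0 := by exact_mod_cast Real.pi_ne_zero
  push_cast
  field_simp
  rw [Complex.I_sq]
  ring

/-- The degree is additive for the kernel and the image of an endomorphism. -/
theorem exists_degrees [T2Space M] [CompactSpace M] [MeasurableSpace M] [BorelSpace M]
    {g : RiemMetric n M} (hgI : IsHermitianFor g I) (hn : 0 < n) (hr : 0 < r) (hs : 0 < s)
    (hrs : r + s = Module.finrank ℂ F) (hΨ : PreservesHol D Ψ)
    (hη : ∀ x, ∃ η : ∀ y, V y [⋀^Fin r]→ₗ[ℂ] ℂ, IsAnnForm D Ψ η x) :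
    ∃ d d' : ℝ, (imSheaf hΨ).IsDegree g r d ∧ (kerSheaf hΨ r hn hη).IsDegree g s d' ∧
      IsBundleDegree g D (d + d') := by
  obtain ⟨h⟩ := exists_hermMetric D
  obtain ⟨e, him, hker, hU, he, hN, ht⟩ := exists_detMetrics hη hn hr hs hrs hΨ h
  have hP : IsPotential I him.U him.N := ⟨him.isOpen, him.mem, him.smooth, him.pos, ht⟩
  have hP' : IsPotential I hker.U hker.N := by
    refine ⟨hker.isOpen, hker.mem, hker.smooth, hker.pos, fun x x' y hy hy' => ?_⟩
    rw [← hU] at hy hy'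
    obtain ⟨k, hk, hk0, hkN⟩ := ht x x' y hy hy'
    have h2 := he x y hy
    have h2' := he x' y hy'
    have hd := h2'.holFunNear_frameDet h2.1
    have hd0 := h2'.2.self_of_nhds.frameDet_ne_zero h2.2.self_of_nhds
    -- The Gram determinants contribute the determinant of the change of frame, and division by the
    -- potentials of the image contributes the inverse of their transition unit.
    refine ⟨fun z => frameDet (e x') z (fun i => e x i z) * (k z)⁻¹, hd.mul (hk.inv hk0),
      mul_ne_zero hd0 (inv_ne_zero hk0), ?_⟩
    filter_upwards [hkN, h2'.2, hk.continuousAt.eventually_ne hk0,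
      (him.isOpen x').mem_nhds hy'] with z h3 h4 h5 h6
    have h7 := (him.pos x' z h6).ne'
    rw [hN, hN, gramDet_change h h4, Complex.re_ofReal_mul, h3, norm_mul, norm_inv]
    field_simp
  obtain ⟨c, hc⟩ := hP.exists_hasWedgeIntegral hn hgI
  obtain ⟨c', hc'⟩ := hP'.exists_hasWedgeIntegral hn hgI
  have hc2 := hc.const_mul (Complex.I / 2)
  have hc2' := hc'.const_mul (Complex.I / 2)
  obtain ⟨hSa, hSc⟩ := isAnalyticSubset_singSet hn hrs hΨ hη
  refine ⟨-c / (4 * Real.pi), -c' / (4 * Real.pi),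
    ⟨_, him, _, _, hSa, hSc, fun y hy => ?_, him.isCurvature_of_isPotential hP, hc2, degree_eq c⟩,
    ⟨_, hker, _, _, hSa, hSc, fun y hy => ?_, hker.isCurvature_of_isPotential hP', hc2',
      degree_eq c'⟩, h, _, _,
      isTraceCurvature_of_isPotential h hP (hU ▸ hP') ((finCongr hrs.symm).trans finSumFinEquiv.symm)
        he (fun x y hy => ?_), hc2.add hc2', ?_⟩
  · obtain ⟨w, k, ha⟩ := not_not.1 hy
    obtain ⟨η, hηy⟩ := hη y
    exact ⟨_, imSheaf_isFrameNear hΨ hηy ha⟩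
  · obtain ⟨w, k, ha⟩ := not_not.1 hy
    exact ⟨_, kerSheaf_isFrameNear ha⟩
  · have h7 := (him.pos x y hy).ne'
    rw [hN]
    field_simp
  · rw [Complex.ofReal_add, degree_eq, degree_eq, mul_add]

end Degrees

/-! ### Endomorphisms of stable bundles -/

section Endomorphisms

variable {n : ℕ} {M : Type*} [TopologicalSpace M]
  [ChartedSpace (EuclideanSpace ℝ (Fin (2 * n))) M]
  {F : Type*} [NormedAddCommGroup F] [NormedSpace ℂ F] [FiniteDimensional ℂ F]
  {V : M → Type*} [∀ x, AddCommGroup (V x)] [∀ x, Module ℂ (V x)]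
  [TopologicalSpace (TotalSpace F V)] [∀ x, TopologicalSpace (V x)] [FiberBundle F V]
  [VectorBundle ℂ F V] [VectorBundle ℝ F V] [IsManifold (𝓡 (2 * n)) ∞ M]
  [ContMDiffVectorBundle ∞ F V (𝓡 (2 * n))] {I : ComplexStructure n M}
  {D : HolStructure F I V}

theorem IsHolEnd.preservesHol {Φ : ∀ x, V x →ₗ[ℂ] V x} (hs : IsSmoothEnd n F Φ)
    (hΦ : IsHolEnd D Φ) : PreservesHol D Φ := by
  intro s x h
  filter_upwards [h.eventually] with y hy
  refine ⟨(hs s y hy.smoothSecNear).self_of_nhds, LinearMap.ext fun v => ?_⟩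
  rw [sub_eq_zero.1 (hΦ s y hy.smoothSecNear v), hy.self_of_nhds.2]
  exact map_zero _

theorem PreservesHol.sub_smul {Φ : ∀ x, V x →ₗ[ℂ] V x} (hΦ : PreservesHol D Φ) (c : ℂ) :
    PreservesHol D fun x => Φ x - c • LinearMap.id := by
  intro s x h
  refine (HolSecNear.sum_smul (Finset.univ : Finset (Fin 2)) (f := ![fun _ => 1, fun _ => -c])
    (s := ![fun y => Φ y (s y), s]) (x := x) (fun i _ => ?_) fun i _ => ?_).congr
    (Eventually.of_forall fun y => ?_)
  · fin_cases i <;> exact holFunNear_const _ x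
  · fin_cases i
    · exact hΦ s x h
    · exact h
  · simp [Fin.sum_univ_two, sub_eq_add_neg]

theorem exists_isBasisAt (D : HolStructure F I V) (y : M) :
    ∃ e : Fin (Module.finrank ℂ F) → ∀ y, V y, IsBasisAt e y := by
  obtain ⟨e, he⟩ := exists_isHolBasisNear D y
  exact ⟨e, he.2.self_of_nhds⟩

theorem IsBasisAt.finrank_eq {ι : Type*} [Fintype ι] {e : ι → ∀ y, V y} {y : M}
    (h : IsBasisAt e y) : Module.finrank ℂ (V y) = Fintype.card ι :=
  Module.finrank_eq_card_basis h.basis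

theorem IsBasisAt.det_eq_frameDet {ι : Type*} [Fintype ι] [DecidableEq ι] {e : ι → ∀ y, V y}
    {y : M} (h : IsBasisAt e y) (A : V y →ₗ[ℂ] V y) :
    LinearMap.det A = frameDet e y fun i => A (e i y) := by
  rw [frameDet_apply, ← LinearMap.det_toMatrix h.basis, ← Matrix.det_transpose]
  congr 1
  ext i j
  simp [LinearMap.toMatrix_apply, frameCoord, h]

theorem PreservesHol.holFunNear_det {Ψ : ∀ x, V x →ₗ[ℂ] V x} (hΨ : PreservesHol D Ψ) (x : M) :
    HolFunNear I (fun y => LinearMap.det (Ψ y)) x := by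
  obtain ⟨e, he⟩ := exists_isHolBasisNear D x
  refine (he.holFunNear_frameDet fun i => hΨ _ _ (he.1 i)).congr ?_
  filter_upwards [he.2] with y hy using hy.det_eq_frameDet _

/-- A holomorphic endomorphism attains its maximal rank on a dense set. -/
theorem PreservesHol.frequently_finrank_range [ConnectedSpace M] {Ψ : ∀ x, V x →ₗ[ℂ] V x}
    (hΨ : PreservesHol D Ψ) {r : ℕ} (hle : ∀ y, Module.finrank ℂ (LinearMap.range (Ψ y)) ≤ r)
    {p : M} (hp : Module.finrank ℂ (LinearMap.range (Ψ p)) = r) (x : M) :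
    ∃ᶠ y in 𝓝 x, Module.finrank ℂ (LinearMap.range (Ψ y)) = r := by
  have key := frequently_not_of_exists_not
    (Q := fun y => Module.finrank ℂ (LinearMap.range (Ψ y)) ≠ r) (p := p) ?_ (not_not.2 hp) x
  · exact key.mono fun y hy => not_not.1 hy
  intro x hx
  obtain ⟨e, he⟩ := exists_isHolBasisNear D x
  -- On open sets where the rank is less than `r` all minors of size `r` vanish. If such sets
  -- accumulate at `x`, the identity theorem makes the minors vanish near `x`.
  have hmin : ∀ R C : Fin r → Fin (Module.finrank ℂ F),
      ∀ᶠ y in 𝓝 x, frameMinor e R y (fun i => Ψ y (e (C i) y)) = 0 := by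
    intro R C
    refine HolFunNear.eventually_eq_zero_of_frequently (I := I) ?_ ?_
    · simp only [frameMinor_apply]
      refine HolFunNear.det fun i j => ?_
      refine (he.holFunNear_secCoeff (hΨ _ x (he.1 (C i))) (R j)).congr ?_
      exact Eventually.of_forall fun y =>
        frameCoord_apply e (fun y => Ψ y (e (C i) y)) (R j) y
    · refine (hx.and_eventually he.2.eventually_nhds).mono fun y hy => ?_
      filter_upwards [hy.1, hy.2] with z h1 h2
      refine (frameMinor e R z).map_linearDependent _ fun hli => ?_
      have := h2.finiteDimensional
      have h3 := linearIndependent_iff_card_le_finrank_span.1 hli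
      have h4 : Submodule.span ℂ (Set.range fun i => Ψ z (e (C i) z)) ≤ LinearMap.range (Ψ z) :=
        Submodule.span_le.2 (by rintro _ ⟨i, rfl⟩; exact LinearMap.mem_range_self _ _)
      rw [Fintype.card_fin] at h3
      exact h1 ((hle z).antisymm (h3.trans (Submodule.finrank_mono h4)))
  filter_upwards [eventually_all.2 fun R => eventually_all.2 (hmin R), he.2] with y h1 h2 h3
  obtain ⟨R, C, h4⟩ := exists_minor_ne_zero h2 Ψ h3
  exact h4 (h1 R C)

variable {I₁ I₂ : ComplexStructure n M} {D₁ : HolStructure F I₁ V} {D₂ : HolStructure F I₂ V}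

/-- A bundle with an endomorphism of generic rank strictly between zero and the rank of the bundle
is not stable. -/
theorem not_isAlphaStable [T2Space M] [CompactSpace M] [ConnectedSpace M] [MeasurableSpace M]
    [BorelSpace M] (hn : 0 < n) {g : RiemMetric n M} (hg₁ : IsHermitianFor g I₁)
    (hg₂ : IsHermitianFor g I₂) {α : ℝ} {Ψ : ∀ x, V x →ₗ[ℂ] V x} (h₁ : PreservesHol D₁ Ψ)
    (h₂ : PreservesHol D₂ Ψ) {r : ℕ} (hr : 0 < r) (hrF : r < Module.finrank ℂ F)
    (hle : ∀ y, Module.finrank ℂ (LinearMap.range (Ψ y)) ≤ r)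
    {p : M} (hp : Module.finrank ℂ (LinearMap.range (Ψ p)) = r) :
    ¬ IsAlphaStable g α D₁ D₂ := by
  intro hst
  obtain ⟨s, hrs⟩ := Nat.exists_eq_add_of_lt hrF
  replace hrs : r + (s + 1) = Module.finrank ℂ F := by omega
  have hs : 0 < s + 1 := Nat.succ_pos s
  generalize s + 1 = s at hrs hs
  have hη₁ := fun x => exists_isAnnForm hn h₁ hle (h₁.frequently_finrank_range hle hp x)
  have hη₂ := fun x => exists_isAnnForm hn h₂ hle (h₂.frequently_finrank_range hle hp x)
  obtain ⟨d₁, d₁', hi₁, hk₁, hV₁⟩ := exists_degrees hg₁ hn hr hs hrs h₁ hη₁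
  obtain ⟨d₂, d₂', hi₂, hk₂, hV₂⟩ := exists_degrees hg₂ hn hr hs hrs h₂ hη₂
  obtain ⟨ha₁, hc₁⟩ := isAnalyticSubset_singSet hn hrs h₁ hη₁
  obtain ⟨ha₂, hc₂⟩ := isAnalyticSubset_singSet hn hrs h₂ hη₂
  have him : IsCoherentPair (imSheaf h₁) (imSheaf h₂) r := by
    refine ⟨_, _, ha₁, ha₂, hc₁, hc₂, fun y hy => ?_, fun y hy => ?_, fun x _ t => ?_⟩
    · obtain ⟨w, k, ha⟩ := not_not.1 hy
      exact ⟨_, imSheaf_isFrameNear h₁ (hη₁ y).choose_spec ha⟩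
    · obtain ⟨w, k, ha⟩ := not_not.1 hy
      exact ⟨_, imSheaf_isFrameNear h₂ (hη₂ y).choose_spec ha⟩
    · rw [imSheaf_inSmoothSpan, imSheaf_inSmoothSpan]
  have hker : IsCoherentPair (kerSheaf h₁ r hn hη₁) (kerSheaf h₂ r hn hη₂) s := by
    refine ⟨_, _, ha₁, ha₂, hc₁, hc₂, fun y hy => ?_, fun y hy => ?_, fun x hx t => ?_⟩
    · obtain ⟨w, k, ha⟩ := not_not.1 hy
      exact ⟨_, kerSheaf_isFrameNear ha⟩
    · obtain ⟨w, k, ha⟩ := not_not.1 hy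
      exact ⟨_, kerSheaf_isFrameNear ha⟩
    · rw [Set.mem_union, not_or] at hx
      rw [kerSheaf_inSmoothSpan hx.1, kerSheaf_inSmoothSpan hx.2]
  -- The degree of `V` used here is, for each structure, the sum of the degrees of image and kernel.
  -- Multiplied by the ranks and added, the two inequalities therefore have equal sides.
  have e₁ := hst _ _ r him hr (by omega) _ _ _ _ hi₁ hi₂ hV₁ hV₂
  have e₂ := hst _ _ s hker hs (by omega) _ _ _ _ hk₁ hk₂ hV₁ hV₂
  rw [← hrs] at e₁ e₂
  have hr' : (0 : ℝ) < r := by exact_mod_cast hr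
  have hs' : (0 : ℝ) < s := by exact_mod_cast hs
  have f₁ := mul_lt_mul_of_pos_left e₁ hr'
  have f₂ := mul_lt_mul_of_pos_left e₂ hs'
  refine lt_irrefl _ ((add_lt_add f₁ f₂).trans_eq ?_)
  have hrs' : (r : ℝ) + s ≠ 0 := (add_pos hr' hs').ne'
  push_cast
  field_simp
  ring

end Endomorphisms

end BiHermitian

end

/-! ### The eigenvalue argument -/

theorem lemma3p7
    {n : ℕ} (hn : 0 < n)
    -- a compact connected smooth manifold of real dimension `2n`
    {M : Type*} [TopologicalSpace M] [T2Space M] [CompactSpace M] [ConnectedSpace M]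
    [ChartedSpace (EuclideanSpace ℝ (Fin (2 * n))) M] [IsManifold (𝓡 (2 * n)) ∞ M]
    [MeasurableSpace M] [BorelSpace M]
    -- a bi-Hermitian structure
    (g : RiemMetric n M) (Ip Im : ComplexStructure n M)
    (hgp : IsHermitianFor g Ip) (hgm : IsHermitianFor g Im)
    -- `g` is Gauduchon for both complex structures
    (hGp : IsGauduchon g Ip) (hGm : IsGauduchon g Im)
    -- both complex structures induce the same volume form
    (hvol : ∀ (x : M) (v : Fin (n * 2) → Tan n x), fundFormPow g Ip n x v = fundFormPow g Im n x v)
    -- a smooth complex vector bundle of finite rank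
    {F : Type*} [NormedAddCommGroup F] [NormedSpace ℂ F] [FiniteDimensional ℂ F]
    {V : M → Type*} [∀ x, AddCommGroup (V x)] [∀ x, Module ℂ (V x)]
    [TopologicalSpace (TotalSpace F V)] [∀ x, TopologicalSpace (V x)]
    [FiberBundle F V] [VectorBundle ℂ F V] [VectorBundle ℝ F V]
    [ContMDiffVectorBundle ∞ F V (𝓡 (2 * n))]
    -- a pair of holomorphic structures on it
    (Dp : HolStructure F Ip V) (Dm : HolStructure F Im V)
    (α : ℝ) (hα : α ∈ Set.Ioo (0 : ℝ) 1)
    (hstable : IsAlphaStable g α Dp Dm) :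
    IsSimple Dp Dm := by
  intro Φ hΦ hp hm
  have h₁ := hp.preservesHol hΦ
  have h₂ := hm.preservesHol hΦ
  have hrk : ∀ y, FiniteDimensional ℂ (V y) ∧ Module.finrank ℂ (V y) = Module.finrank ℂ F := by
    intro y
    obtain ⟨e, he⟩ := exists_isBasisAt Dp y
    exact ⟨he.finiteDimensional, he.finrank_eq.trans (Fintype.card_fin _)⟩
  have hfd := fun y => (hrk y).1
  rcases Nat.eq_zero_or_pos (Module.finrank ℂ F) with hF | hF
  · refine ⟨0, fun x => LinearMap.ext fun v => ?_⟩
    have : Subsingleton (V x) := Module.finrank_zero_iff.1 ((hrk x).2.trans hF)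
    exact Subsingleton.elim _ _
  obtain ⟨x₀⟩ := (inferInstance : Nonempty M)
  have : Nontrivial (V x₀) := Module.nontrivial_of_finrank_pos (R := ℂ) ((hrk x₀).2 ▸ hF)
  obtain ⟨c, hc⟩ := Module.End.exists_eigenvalue (Φ x₀)
  refine ⟨c, ?_⟩
  set Ψ : ∀ x, V x →ₗ[ℂ] V x := fun x => Φ x - c • LinearMap.id with hΨ
  -- The eigenvalue at `x₀` makes the determinant vanish there, and the maximum principle carries
  -- this to all of `M`.
  have hdet : ∀ x, LinearMap.det (Ψ x) = 0 := by
    intro x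
    rw [eq_of_forall_holFunNear (h₁.sub_smul c).holFunNear_det x x₀]
    obtain ⟨v, hv⟩ := hc.exists_hasEigenvector
    by_contra h0
    refine h0 (LinearMap.det_eq_zero_iff_ker_ne_bot.2 fun h => hv.2 ?_)
    have h3 : Φ x₀ v = c • v := hv.apply_eq_smul
    have h4 : v ∈ LinearMap.ker (Ψ x₀) := by simp [hΨ, h3]
    rwa [h, Submodule.mem_bot] at h4
  obtain ⟨p, hp⟩ : ∃ p, ∀ y, Module.finrank ℂ (LinearMap.range (Ψ y)) ≤
      Module.finrank ℂ (LinearMap.range (Ψ p)) := by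
    have hfin : (Set.range fun y => Module.finrank ℂ (LinearMap.range (Ψ y))).Finite :=
      (Set.finite_Iic (Module.finrank ℂ F)).subset (by
        rintro _ ⟨y, rfl⟩
        exact (LinearMap.range (Ψ y)).finrank_le.trans (hrk y).2.le)
    obtain ⟨_, ⟨p, rfl⟩, hp⟩ := Set.exists_max_image _ id hfin (Set.range_nonempty _)
    exact ⟨p, fun y => hp _ ⟨y, rfl⟩⟩
  -- Maximal rank zero means `Φ = c`. Otherwise the maximal rank lies strictly between `0` and `rk
  -- V`, since `Ψ` is nowhere invertible, and this contradicts stability.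
  rcases Nat.eq_zero_or_pos (Module.finrank ℂ (LinearMap.range (Ψ p))) with h0 | h0
  · intro x
    have h3 : Module.finrank ℂ (LinearMap.range (Ψ x)) = 0 := Nat.le_zero.1 ((hp x).trans h0.le)
    exact sub_eq_zero.1 (LinearMap.range_eq_bot.1 (Submodule.finrank_eq_zero.1 h3))
  · refine absurd hstable (not_isAlphaStable hn hgp hgm (h₁.sub_smul c) (h₂.sub_smul c) h0 ?_ hp rfl)
    rw [← (hrk p).2]
    exact Submodule.finrank_lt (LinearMap.range_lt_top_of_det_eq_zero (hdet p)).ne
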